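/- **Setting.** Let $\mathtt O$ be a strict operadic category in the sense of Batanin and Markl: a category with a cardinality functor $|-|$ to finite ordinals and all maps, a chosen local terminal object $U_c$ with $|U_c|=1$ in each component $c$ (an object is *local terminal* if it is terminal in its component), and strictly functorial fibers $f^{-1}(i)$ of a morphism $f:T\to S$, $i\in|S|$. A *trivial* object is one of the $U_c$; a *quasibijection* is a morphism all of whose fibers are trivial; $f$ is *order preserving* if $|f|$ is. For $f:T\to S$ and $g:S\to R$ write $f_i:(gf)^{-1}(i)\to g^{-1}(i)$ for the induced map of fibers. Assume that * $\mathtt O$ is graded: there are $e(T)\in\mathbb N$ with $e(T)=e(S)+\sum_i e(f^{-1}(i))$ for every $f:T\to S$; and $f$ is invertible whenever $e(T)=e(S)$; * $\mathtt O$ is constant-free: every $|f|$ is surjective; every morphism is a quasibijection followed by an order preserving morphism; every quasibijection is invertible; * (strong blow up) for an order preserving $f':S'\to T'$, a quasibijection $s:T'\to T''$, objects $F_j$ ($j\in|T''|$) and morphisms $q_i:f'^{-1}(i)\to F_{|s|(i)}$, there is exactly one commutative square $f''p=sf'$ with $f''$ order preserving, $f''^{-1}(j)=F_j$, and induced maps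 of fibers $q_i$; * (unique fiber) if $t$ is local terminal and the fiber of some $T\to t$ equals $T$, then $t$ is trivial. Let $\mathtt V$ be a cocomplete symmetric monoidal category with unit $\Bbbk$ whose tensor product preserves colimits in each variable. A morphism $\phi:T\to S$ is *elementary* if it is order preserving and has exactly one nontrivial fiber $G$, with $e(G)\ge1$; we write $G\triangleright T\xrightarrow{\phi}S$. If $t$ is local terminal, $T\to t$, and $F$ is its fiber, the pair is called a *virtual morphism* between $F$ and $T$. Let $\mathtt{QVrt}(e)$ be the groupoid whose objects are the classes $[T]$ of objects of grade $\ge1$ modulo virtual morphisms, generated by the isomorphisms of $\mathtt O$ subject to composition in $\mathtt O$ and to the identification of an isomorphism over a local terminal object with the induced isomorphism of fibers. A *$1$-connected collection* $E$ is a presheaf $E:\mathtt{QVrt}(e)^{op}\to\mathtt V$, considered as vanishing in grade $0$. **Operads.** A *Markl operad* $M$ in $\mathtt V$ is a presheaf on the groupoid of isomorphisms of $\mathtt O$ with operations $\circ_\phi:M(S)\otimes M(G)\to M(T)$ for all elementary $G\triangleright T\xrightarrow{\phi}S$ such that * (associativity) if $\phi:T\to S$, $\psi:S\to P$ are elementary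 and the nontrivial fiber of $\phi$ lies over that of $\psi$, at $i$, then $\circ_\phi(\circ_\psi\otimes 1)=\circ_{\psi\phi}(1\otimes\circ_{\phi_i})$; * (commutativity) for a commutative square $\psi'\phi'=\psi''\phi''$ of elementary morphisms whose fibers $F',G',F'',G''$ (of $\phi',\psi',\phi'',\psi''$) are disjoint, $F'$ lying over $G''$ and $F''$ over $G'$ over two different elements of the cardinality of the common target, the two iterated circle products agree up to the symmetry of $\mathtt V$ and the actions of the canonical quasibijections $F'\cong G''$, $F''\cong G'$; * (equivariance) for a commutative square with isomorphisms $\omega:T'\to T''$, $\sigma:S'\to S''$, where $\sigma$ is a quasibijection, and elementary $\phi',\phi''$ with fibers $G',G''$, one has $\omega^*\circ_{\phi''}=\circ_{\phi'}(\sigma^*\otimes\bar\omega^*)$, with $\bar\omega:G'\to G''$ induced by $\omega$. It is *strictly extended unital* if there are maps $\eta_t:\Bbbk\to M(t)$ for all local terminal $t$, natural for isomorphisms, such that, for each map $T\to t$ with $e(T)\ge 1$ and fiber $F$, the composite $\vartheta(T,t):M(F)\cong\Bbbk\otimes M(F)\xrightarrow{\eta_t\otimes1}M(t)\otimes M(F)\xrightarrow{\circ}M(T)$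 is an identity (in particular $M(F)=M(T)$), and such that equivariance also holds when $\sigma$ is an arbitrary isomorphism, in the form $\omega^*\circ_{\phi''}\bigl(1\otimes((\omega_j)^{*})^{-1}\vartheta\bigr)=\circ_{\phi'}(\sigma^*\otimes1)$ on $M(S'')\otimes M(G')$, where $j$ is the position of $G''$, $\omega_j:(\sigma\phi')^{-1}(j)\to G''$ is induced by $\omega$, and $\vartheta:M(G')\to M((\sigma\phi')^{-1}(j))$ comes from $(\sigma\phi')^{-1}(j)\to\sigma^{-1}(j)$. It is *$1$-connected* if all $\eta_t$ are isomorphisms. Morphisms of such operads are families of maps $M(T)\to N(T)$ commuting with the actions of isomorphisms, with all $\circ_\phi$ and with all $\eta_t$. The forgetful functor $\Box$ sends $M$ to the $1$-connected collection $[T]\mapsto M(T)$, $e(T)\ge1$. **Towers.** Let $e(X)\ge1$. A *labelled tower* $(\ell,\mathcal T)$ under $X$ consists of elementary morphisms $\mathcal T: T\xrightarrow{\tau_1}T_1\to\cdots\xrightarrow{\tau_{k-1}}T_{k-1}\xrightarrow{\tau_k}U_c$, $k\ge1$, with nontrivial fibers $t_1,\dots,t_k$ (so $t_k=T_{k-1}$),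 and an isomorphism $\ell:X\to T$. The groupoid $\mathtt{lTw}(X)$ of labelled towers is generated by two types of morphisms. Those of the first type, $(\ell,\mathcal T')\to(\sigma_1\ell,\mathcal T'')$, are given by sequences of isomorphisms $\sigma_1:T'\to T''$, $\sigma_{s+1}:T'_s\to T''_s$ ($1\le s<k$) commuting with the $\tau$'s. Those of the second type, $(\ell,\mathcal T')\to(\ell,\mathcal T'')$, replace two consecutive morphisms $\tau'_u,\tau'_{u+1}$ ($u+1<k$) by $\tau''_u,\tau''_{u+1}$ forming with them a commutative square with disjoint fibers as in the commutativity axiom. The relations are: first type morphisms compose as sequences of isomorphisms; interchanging back is inverse to interchanging; interchanges are natural with respect to first type morphisms; interchanges at disjoint places commute; and the two ways of reversing three consecutive morphisms with pairwise disjoint fibers agree. For a $1$-connected collection $E$ put $E(\ell,\mathcal T)=E[t_1]\otimes\cdots\otimes E[t_k]$. This is a functor on $\mathtt{lTw}(X)$, contravariant as written: a morphism of the first type acts by the tensor product of the maps $E[t''_s]\to E[t'_s]$ induced by the $\sigma$'s, and one of the second type by the symmetry of $\mathtt V$, using $[t'_u]\cong[t''_{u+1}]$ and $[t''_u]\cong[t'_{u+1}]$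 via the canonical quasibijections. As $\mathtt{lTw}(X)$ is a groupoid, its variance does not affect the colimit. **Theorem 9.8.** There is a left adjoint $\mathbb F$ of the forgetful functor $\Box$ from $1$-connected strictly extended unital Markl operads in $\mathtt V$ to $1$-connected collections in $\mathtt V$, given by $$\mathbb F(E)(X)=\begin{cases}\operatorname*{colim}_{(\ell,\mathcal T)\in\mathtt{lTw}(X)}E(\ell,\mathcal T)& e(X)\ge1,\\ \Bbbk & e(X)=0.\end{cases}$$ Here, for $\iota:E\to\Box\mathbb F(E)$ the unit of the adjunction, the map $E(\ell,\mathcal T)\to\mathbb F(E)(X)$ of the colimit cocone is $$e_1\otimes\cdots\otimes e_k\longmapsto \ell^*\bigl(\iota(e_1)\circ_{\tau_1}(\iota(e_2)\circ_{\tau_2}\cdots(\iota(e_{k-1})\circ_{\tau_{k-1}}\iota(e_k))\cdots)\bigr),$$ where $x\circ_\tau z$ denotes $\circ_\tau$ applied to the symmetry image $z\otimes x$ of $x\otimes z$, and in grade $0$ the units $\eta$ of $\mathbb F(E)$ are the identity of $\Bbbk$. Consequently $\mathbb F(E)$ is the free $1$-connected strictly extended unital Markl operad generated by $E$: for each $1$-connected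 strictly extended unital Markl operad $M$ and each map of collections $y:E\to\Box M$ there is exactly one morphism $\hat y:\mathbb F(E)\to M$ with $\Box(\hat y)\,\iota=y$. -/

import Mathlib

open CategoryTheory MonoidalCategory Opposite

universe v u v' u'

namespace OpCat

/-! ## Strict operadic categories -/

/-- An object `t` is local terminal if it is a terminal object of its connected component. -/
def IsLocalTerminal {O : Type u} [Category.{v} O] (t : O) : Prop :=
  ∀ T : O, Zigzag T t → Nonempty (Unique (T ⟶ t))

/-- The data of a strict operadic category: the cardinality functor to the skeletal category of
finite sets (objects `n`, morphisms all maps `Fin n → Fin m`), the chosen local terminal objects,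
the fibers `f⁻¹(i)`, with `|f⁻¹(i)| = |f|⁻¹(i)` in the skeletal category, and the induced maps
`f_i : h⁻¹(i) ⟶ g⁻¹(i)` for each commutative triangle `h = f ≫ g`. -/
class OperadicData (O : Type u) [Category.{v} O] where
  card : O → ℕ
  cardMap : ∀ {T S : O}, (T ⟶ S) → Fin (card T) → Fin (card S)
  U : ConnectedComponents O → O
  fiber : ∀ {T S : O}, (T ⟶ S) → Fin (card S) → O
  card_fiber : ∀ {T S : O} (f : T ⟶ S) (i : Fin (card S)),
    (Finset.univ.filter fun x => cardMap f x = i).card = card (fiber f i)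
  fiberMap : ∀ {T S R : O} (f : T ⟶ S) (g : S ⟶ R) (h : T ⟶ R), f ≫ g = h →
    ∀ i : Fin (card R), fiber h i ⟶ fiber g i

open OperadicData

section Data

variable {O : Type u} [Category.{v} O] [OperadicData O]

/-- The order preserving identification of `|f⁻¹(i)|` with the preimage `|f|⁻¹(i) ⊆ |T|`. -/
def incl {T S : O} (f : T ⟶ S) (i : Fin (card S)) : Fin (card (fiber f i)) ↪o Fin (card T) :=
  (Finset.univ.filter fun x => cardMap f x = i).orderEmbOfFin (card_fiber f i)

/-- A trivial object is a chosen local terminal one. -/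
def IsTrivial (T : O) : Prop := ∃ c : ConnectedComponents O, T = U c

/-- A quasibijection is a morphism all of whose fibers are trivial. -/
def IsQuasibijection {T S : O} (f : T ⟶ S) : Prop := ∀ i, IsTrivial (fiber f i)

/-- The morphisms `f` for which `|f|` is order preserving. -/
def IsOrderPreserving {T S : O} (f : T ⟶ S) : Prop := Monotone (cardMap f)

lemma cardMap_incl {T S : O} (f : T ⟶ S) (i : Fin (card S)) (k : Fin (card (fiber f i))) :
    cardMap f (incl f i k) = i := by
  have h := Finset.orderEmbOfFin_mem (Finset.univ.filter fun x => cardMap f x = i)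
    (card_fiber f i) k
  exact (Finset.mem_filter.mp h).2

lemma exists_incl {T S : O} (f : T ⟶ S) (x : Fin (card T)) {i : Fin (card S)}
    (hx : cardMap f x = i) : ∃ k, incl f i k = x := by
  subst hx
  have h : x ∈ Set.range ((Finset.univ.filter fun y => cardMap f y = cardMap f x).orderEmbOfFin
      (card_fiber f (cardMap f x))) := by
    rw [Finset.range_orderEmbOfFin]; simp
  exact h

end Data

/-- A strict operadic category. -/
class OperadicCategory (O : Type u) [Category.{v} O] extends OperadicData O where
  cardMap_id : ∀ T : O, cardMap (𝟙 T) = id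
  cardMap_comp : ∀ {T S R : O} (f : T ⟶ S) (g : S ⟶ R),
    cardMap (f ≫ g) = cardMap g ∘ cardMap f
  /-- `U c` lies in the component `c`. -/
  mk_U : ∀ c : ConnectedComponents O, (Quotient.mk _ (U c) : ConnectedComponents O) = c
  U_localTerminal : ∀ c : ConnectedComponents O, IsLocalTerminal (U c)
  card_U : ∀ c : ConnectedComponents O, card (U c) = 1
  /-- Identities have trivial fibers. -/
  id_quasibijection : ∀ T : O, IsQuasibijection (𝟙 T)
  /-- `|f_i|` is the map of preimages induced by `|f|`. -/
  incl_fiberMap : ∀ {T S R : O} (f : T ⟶ S) (g : S ⟶ R) (h : T ⟶ R) (w : f ≫ g = h)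
    (i : Fin (card R)) (x : Fin (card (fiber h i))),
    incl g i (cardMap (fiberMap f g h w i) x) = cardMap f (incl h i x)
  /-- Taking the `i`th fiber is a functor on the slice category over `R`. -/
  fiberMap_id : ∀ {T R : O} (h : T ⟶ R) (w : 𝟙 T ≫ h = h) (i : Fin (card R)),
    fiberMap (𝟙 T) h h w i = 𝟙 _
  fiberMap_comp : ∀ {T S Q R : O} (f : T ⟶ S) (g : S ⟶ Q) (a : T ⟶ R) (b : S ⟶ R) (c : Q ⟶ R)
    (w₁ : f ≫ b = a) (w₂ : g ≫ c = b) (w₃ : (f ≫ g) ≫ c = a) (i : Fin (card R)),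
    fiberMap (f ≫ g) c a w₃ i = fiberMap f b a w₁ i ≫ fiberMap g c b w₂ i
  /-- Over a chosen local terminal object, the fiber functor is the domain functor. -/
  fiber_U : ∀ {T : O} {c : ConnectedComponents O} (f : T ⟶ U c) (i : Fin (card (U c))),
    fiber f i = T
  fiberMap_U : ∀ {T S : O} {c : ConnectedComponents O} (f : T ⟶ S) (g : S ⟶ U c) (h : T ⟶ U c)
    (w : f ≫ g = h) (i : Fin (card (U c))),
    fiberMap f g h w i = eqToHom (fiber_U h i) ≫ f ≫ eqToHom (fiber_U g i).symm
  /-- `f⁻¹(j) = f_i⁻¹(j)` for `i = |g|(j)`. -/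
  fiber_fiberMap : ∀ {T S R : O} (f : T ⟶ S) (g : S ⟶ R) (h : T ⟶ R) (w : f ≫ g = h)
    (i : Fin (card R)) (k : Fin (card (fiber g i))),
    fiber (fiberMap f g h w i) k = fiber f (incl g i k)
  /-- `(f_i)_j = f_j` for `f : T ⟶ S`, `a : S ⟶ Q`, `c : Q ⟶ R` and `i = |c|(j)`. -/
  fiberMap_fiberMap : ∀ {T S Q R : O} (f : T ⟶ S) (a : S ⟶ Q) (b : T ⟶ Q) (c : Q ⟶ R)
    (g : S ⟶ R) (h : T ⟶ R) (w : f ≫ a = b) (wg : a ≫ c = g) (wh : b ≫ c = h) (w' : f ≫ g = h)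
    (i : Fin (card R)) (k : Fin (card (fiber c i)))
    (w'' : fiberMap f g h w' i ≫ fiberMap a c g wg i = fiberMap b c h wh i),
    fiberMap (fiberMap f g h w' i) (fiberMap a c g wg i) (fiberMap b c h wh i) w'' k =
      eqToHom (fiber_fiberMap b c h wh i k) ≫ fiberMap f a b w (incl c i k) ≫
        eqToHom (fiber_fiberMap a c g wg i k).symm

/-- A grading of an operadic category: `e(T) + e(F₁) + ⋯ + e(F_k) = e(S)` for each `f : S ⟶ T`
with fibers `F₁, …, F_k`. -/
class GradedOperadicCategory (O : Type u) [Category.{v} O] extends OperadicCategory O where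
  grade : O → ℕ
  grade_eq : ∀ {S T : O} (f : S ⟶ T), grade T + ∑ i, grade (fiber f i) = grade S

open GradedOperadicCategory (grade grade_eq)

section Basic

variable {O : Type u} [Category.{v} O]

lemma IsLocalTerminal.of_iso {s t : O} (ht : IsLocalTerminal t) (i : s ≅ t) :
    IsLocalTerminal s := by
  intro T hT
  obtain ⟨h⟩ := ht T (hT.trans (Zigzag.of_hom i.hom))
  exact ⟨⟨⟨h.default ≫ i.inv⟩, fun f => by
    have : f ≫ i.hom = h.default := h.uniq _
    rw [← this]; simp⟩⟩

lemma IsLocalTerminal.hom_ext {T t : O} (ht : IsLocalTerminal t) (f g : T ⟶ t) : f = g := by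
  obtain ⟨h⟩ := ht T (Zigzag.of_hom f)
  exact (h.uniq f).trans (h.uniq g).symm

variable [OperadicCategory O]

lemma IsTrivial.isLocalTerminal {T : O} (h : IsTrivial T) : IsLocalTerminal T := by
  obtain ⟨c, rfl⟩ := h
  exact OperadicCategory.U_localTerminal c

lemma IsTrivial.card_eq {T : O} (h : IsTrivial T) : card T = 1 := by
  obtain ⟨c, rfl⟩ := h
  exact OperadicCategory.card_U c

lemma fiber_of_isTrivial {T S : O} (f : T ⟶ S) (h : IsTrivial S) (i : Fin (card S)) :
    fiber f i = T := by
  obtain ⟨c, rfl⟩ := h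
  exact OperadicCategory.fiber_U f i

lemma cardMap_comp_apply {T S R : O} (f : T ⟶ S) (g : S ⟶ R) (x : Fin (card T)) :
    cardMap (f ≫ g) x = cardMap g (cardMap f x) := by
  rw [OperadicCategory.cardMap_comp]; rfl

/-- The isomorphism of fibers induced by an isomorphism of objects over `R`. -/
@[simps] def fiberIso {T S R : O} (f : T ≅ S) (g : S ⟶ R) (h : T ⟶ R) (w : f.hom ≫ g = h)
    (i : Fin (card R)) : fiber h i ≅ fiber g i where
  hom := fiberMap f.hom g h w i
  inv := fiberMap f.inv h g (by rw [← w]; simp) i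
  hom_inv_id := by
    rw [← OperadicCategory.fiberMap_comp f.hom f.inv h g h w (by rw [← w]; simp) (by simp)]
    have : ∀ (k : T ⟶ T) (hk : k ≫ h = h), k = 𝟙 T → fiberMap k h h hk i = 𝟙 _ := by
      rintro k hk rfl
      exact OperadicCategory.fiberMap_id _ _ _
    exact this _ _ f.hom_inv_id
  inv_hom_id := by
    rw [← OperadicCategory.fiberMap_comp f.inv f.hom g h g (by rw [← w]; simp) w (by simp)]
    have : ∀ (k : S ⟶ S) (hk : k ≫ g = g), k = 𝟙 S → fiberMap k g g hk i = 𝟙 _ := by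
      rintro k hk rfl
      exact OperadicCategory.fiberMap_id _ _ _
    exact this _ _ f.inv_hom_id

/-- The fibers of an isomorphism are local terminal. -/
lemma isLocalTerminal_fiber_iso {T S : O} (f : T ≅ S) (i : Fin (card S)) :
    IsLocalTerminal (fiber f.hom i) :=
  (OperadicCategory.id_quasibijection S i).isLocalTerminal.of_iso
    (fiberIso f (𝟙 S) f.hom (by simp) i)

/-- If `g⁻¹(i)` is trivial for `i = |g|(k)`, then `f⁻¹(k) = (f ≫ g)⁻¹(i)`. -/
lemma fiber_eq_of_trivial {T S R : O} (f : T ⟶ S) (g : S ⟶ R) (h : T ⟶ R) (w : f ≫ g = h)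
    (k : Fin (card S)) (i : Fin (card R)) (hk : cardMap g k = i)
    (hi : IsTrivial (fiber g i)) : fiber f k = fiber h i := by
  subst hk
  obtain ⟨l, hl⟩ := exists_incl g k rfl
  rw [← fiber_of_isTrivial (fiberMap f g h w _) hi l, OperadicCategory.fiber_fiberMap, hl]

lemma card_of_iso {T S : O} (f : T ≅ S) : card T = card S := by
  have h1 : Function.LeftInverse (cardMap f.inv) (cardMap f.hom) := fun x => by
    rw [← cardMap_comp_apply, f.hom_inv_id, OperadicCategory.cardMap_id]; rfl
  have h2 : Function.RightInverse (cardMap f.inv) (cardMap f.hom) := fun x => by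
    rw [← cardMap_comp_apply, f.inv_hom_id, OperadicCategory.cardMap_id]; rfl
  exact Fin.equiv_iff_eq.mp ⟨⟨cardMap f.hom, cardMap f.inv, h1, h2⟩⟩

lemma IsLocalTerminal.card_eq {t : O} (ht : IsLocalTerminal t) : card t = 1 := by
  let c : ConnectedComponents O := Quotient.mk _ t
  have hz : Zigzag (OperadicData.U c) t := Quotient.exact (OperadicCategory.mk_U c)
  have hU := OperadicCategory.U_localTerminal c
  obtain ⟨a⟩ := ht _ hz
  obtain ⟨b⟩ := hU _ hz.symm
  have e : t ≅ OperadicData.U c :=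
    ⟨b.default, a.default, ht.hom_ext _ _, hU.hom_ext _ _⟩
  rw [card_of_iso e, OperadicCategory.card_U]

/-- The derived map of a commutative square `f' ≫ s = p ≫ f''` with `s` a quasibijection, from
`f'⁻¹(i)` to `f''⁻¹(j)` for `j = |s|(i)`. -/
def derivedMap {S' S'' T' T'' : O} (f' : S' ⟶ T') (s : T' ⟶ T'') (hs : IsQuasibijection s)
    (p : S' ⟶ S'') (f'' : S'' ⟶ T'') (w : p ≫ f'' = f' ≫ s) (i : Fin (card T')) :
    fiber f' i ⟶ fiber f'' (cardMap s i) :=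
  eqToHom (fiber_eq_of_trivial f' s (f' ≫ s) rfl i _ rfl (hs _)) ≫ fiberMap p f'' (f' ≫ s) w _

end Basic

/-- A completion of the corner `S' ⟶ T' ⟶ T''` formed by `f'` and the quasibijection `s` to a
commutative square whose right vertical map is order preserving, with prescribed fibers `F j` and
prescribed derived sequence `q`. -/
structure BlowUp {O : Type u} [Category.{v} O] [OperadicCategory O] {S' T' T'' : O}
    (f' : S' ⟶ T') (s : T' ⟶ T'') (hs : IsQuasibijection s) (F : Fin (card T'') → O)
    (q : ∀ i, fiber f' i ⟶ F (cardMap s i)) where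
  obj : O
  top : S' ⟶ obj
  right : obj ⟶ T''
  w : top ≫ right = f' ≫ s
  orderPreserving : IsOrderPreserving right
  fiber_eq : ∀ j, fiber right j = F j
  derived_eq : ∀ i, derivedMap f' s hs top right w i ≫ eqToHom (fiber_eq _) = q i

/-- The standing assumptions on a graded operadic category: it is constant-free and factorizable,
quasibijections are invertible, the blow up and the unique fiber axioms hold, and morphisms of
grade `0` are invertible. -/
class StandingAssumptions (O : Type u) [Category.{v} O] [GradedOperadicCategory O] : Prop where
  constant_free : ∀ {T S : O} (f : T ⟶ S), Function.Surjective (cardMap f)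
  factorizable : ∀ {T S : O} (f : T ⟶ S), ∃ (R : O) (s : T ⟶ R) (g : R ⟶ S),
    IsQuasibijection s ∧ IsOrderPreserving g ∧ s ≫ g = f
  isIso_of_quasibijection : ∀ {T S : O} (s : T ⟶ S), IsQuasibijection s → IsIso s
  blow_up : ∀ {S' T' T'' : O} (f' : S' ⟶ T') (s : T' ⟶ T'') (hs : IsQuasibijection s)
    (F : Fin (card T'') → O) (q : ∀ i, fiber f' i ⟶ F (cardMap s i)),
    IsOrderPreserving f' → Nonempty (Unique (BlowUp f' s hs F q))
  unique_fiber : ∀ {T t : O} (f : T ⟶ t) (i : Fin (card t)), IsLocalTerminal t →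
    fiber f i = T → IsTrivial t
  isIso_of_grade : ∀ {S T : O} (f : S ⟶ T), grade S = grade T → IsIso f

/-! ## Elementary morphisms -/

section Elem

variable {O : Type u} [Category.{v} O] [GradedOperadicCategory O]

lemma grade_of_isTrivial {T : O} (h : IsTrivial T) : grade T = 0 := by
  have h1 := grade_eq (𝟙 T)
  have h2 : ∀ i, grade (fiber (𝟙 T) i) = grade T := fun i => by rw [fiber_of_isTrivial _ h]
  simp only [h2, Finset.sum_const, Finset.card_univ, Fintype.card_fin, h.card_eq] at h1
  simpa using h1

lemma grade_le_of_hom {S T : O} (f : S ⟶ T) : grade T ≤ grade S := by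
  rw [← grade_eq f]; exact Nat.le_add_right _ _

lemma grade_of_iso {S T : O} (f : S ≅ T) : grade S = grade T :=
  le_antisymm (grade_le_of_hom f.inv) (grade_le_of_hom f.hom)

lemma grade_of_isLocalTerminal {t : O} (ht : IsLocalTerminal t) : grade t = 0 := by
  let c : ConnectedComponents O := Quotient.mk _ t
  have hz : Zigzag (OperadicData.U c) t := Quotient.exact (OperadicCategory.mk_U c)
  obtain ⟨a⟩ := ht _ hz
  exact Nat.le_zero.mp (grade_of_isTrivial (O := O) ⟨c, rfl⟩ ▸ grade_le_of_hom a.default)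

lemma grade_fiber_le {S T : O} (f : S ⟶ T) (i : Fin (card T)) : grade (fiber f i) ≤ grade S := by
  rw [← grade_eq f]
  exact (Finset.single_le_sum (f := fun i => grade (fiber f i)) (fun _ _ => Nat.zero_le _)
    (Finset.mem_univ i)).trans (Nat.le_add_left _ _)

/-- For a map to a local terminal object, the source and the fiber have the same grade. -/
lemma grade_fiber_localTerminal {T t : O} (f : T ⟶ t) (ht : IsLocalTerminal t)
    (i : Fin (card t)) : grade (fiber f i) = grade T := by
  have h := grade_eq f
  have : Subsingleton (Fin (card t)) := by rw [ht.card_eq]; infer_instance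
  rw [grade_of_isLocalTerminal ht, Fintype.sum_subsingleton _ i] at h
  simpa using h

/-- An elementary morphism: an order preserving morphism with precisely one nontrivial fiber, over
`idx`, whose grade is at least `1`. -/
structure Elementary (T S : O) where
  hom : T ⟶ S
  orderPreserving : IsOrderPreserving hom
  idx : Fin (card S)
  trivial : ∀ i, i ≠ idx → IsTrivial (OperadicData.fiber hom i)
  grade_pos : 1 ≤ grade (OperadicData.fiber hom idx)

namespace Elementary

/-- The unique nontrivial fiber. -/
def fiber {T S : O} (φ : Elementary T S) : O := OperadicData.fiber φ.hom φ.idx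

lemma fiber_pos {T S : O} (φ : Elementary T S) : 1 ≤ grade φ.fiber := φ.grade_pos

lemma one_le_grade {T S : O} (φ : Elementary T S) : 1 ≤ grade T :=
  φ.grade_pos.trans (grade_fiber_le φ.hom φ.idx)

/-- The map from an object of positive grade to a local terminal object is elementary. -/
def toLocalTerminal {T t : O} (f : T ⟶ t) (ht : IsLocalTerminal t) (hT : 1 ≤ grade T) :
    Elementary T t where
  hom := f
  orderPreserving := fun x y _ => by
    have : Subsingleton (Fin (card t)) := by rw [ht.card_eq]; infer_instance
    exact (Subsingleton.elim _ _).le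
  idx := ⟨0, by rw [ht.card_eq]; exact Nat.one_pos⟩
  trivial := fun i hi => by
    have : Subsingleton (Fin (card t)) := by rw [ht.card_eq]; infer_instance
    exact absurd (Subsingleton.elim _ _) hi
  grade_pos := by rw [grade_fiber_localTerminal f ht]; exact hT

/-- The composite of elementary morphisms with joint fibers is elementary. -/
def comp {T S P : O} (φ : Elementary T S) (ψ : Elementary S P)
    (h : cardMap ψ.hom φ.idx = ψ.idx) : Elementary T P where
  hom := φ.hom ≫ ψ.hom
  orderPreserving := by
    unfold IsOrderPreserving
    rw [OperadicCategory.cardMap_comp]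
    exact ψ.orderPreserving.comp φ.orderPreserving
  idx := ψ.idx
  trivial := fun i hi => by
    have ht := ψ.trivial i hi
    have hc := ht.card_eq
    let k : Fin (card (OperadicData.fiber ψ.hom i)) := ⟨0, by rw [hc]; exact Nat.one_pos⟩
    have hk := cardMap_incl ψ.hom i k
    rw [← fiber_eq_of_trivial φ.hom ψ.hom _ rfl (incl ψ.hom i k) i hk ht]
    refine φ.trivial _ fun e => hi ?_
    rw [← hk, e, h]
  grade_pos := by
    obtain ⟨k, hk⟩ := exists_incl ψ.hom φ.idx h
    refine le_trans ?_ (grade_fiber_le (fiberMap φ.hom ψ.hom _ rfl ψ.idx) k)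
    rw [OperadicCategory.fiber_fiberMap, hk]
    exact φ.grade_pos

end Elementary
end Elem

section Squares

variable {O : Type u} [Category.{v} O] [GradedOperadicCategory O]

/-- A commutative square with horizontal isomorphisms and elementary vertical morphisms. -/
structure ElementarySquare {T' S' T'' S'' : O} (φ' : Elementary T' S') (φ'' : Elementary T'' S'')
    where
  top : T' ≅ T''
  bot : S' ≅ S''
  w : φ'.hom ≫ bot.hom = top.hom ≫ φ''.hom

namespace ElementarySquare

variable {T' S' T'' S'' : O} {φ' : Elementary T' S'} {φ'' : Elementary T'' S''}
  (q : ElementarySquare φ' φ'')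

/-- The nontrivial fiber of the diagonal of the square. -/
def mid : O := OperadicData.fiber (φ'.hom ≫ q.bot.hom) φ''.idx

/-- The isomorphism between the nontrivial fibers of the diagonal and of the right vertical
morphism, induced by the top isomorphism. -/
def right : q.mid ≅ φ''.fiber := fiberIso q.top φ''.hom (φ'.hom ≫ q.bot.hom) q.w.symm φ''.idx

lemma cardMap_idx : cardMap q.bot.hom φ'.idx = φ''.idx := by
  by_contra hne
  have h0 := grade_of_isTrivial (φ''.trivial _ hne)
  rw [← grade_of_iso (fiberIso q.top φ''.hom (φ'.hom ≫ q.bot.hom) q.w.symm _)] at h0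
  obtain ⟨k, hk⟩ := exists_incl q.bot.hom φ'.idx rfl
  have h1 := grade_fiber_le (fiberMap φ'.hom q.bot.hom _ rfl _) k
  rw [OperadicCategory.fiber_fiberMap, hk, h0] at h1
  have := φ'.grade_pos
  omega

lemma one_le_grade_mid : 1 ≤ grade q.mid := by
  rw [grade_of_iso q.right]; exact φ''.grade_pos

/-- The map from the fiber of the diagonal to the (local terminal) fiber of the bottom isomorphism,
induced by the left vertical morphism. -/
def left : Elementary q.mid (OperadicData.fiber q.bot.hom φ''.idx) :=
  Elementary.toLocalTerminal (fiberMap φ'.hom q.bot.hom _ rfl φ''.idx)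
    (isLocalTerminal_fiber_iso q.bot _) q.one_le_grade_mid

lemma left_fiber : q.left.fiber = φ'.fiber := by
  have h : q.left.fiber = OperadicData.fiber φ'.hom (incl q.bot.hom φ''.idx q.left.idx) :=
    OperadicCategory.fiber_fiberMap _ _ _ _ _ _
  obtain ⟨k, hk⟩ := exists_incl q.bot.hom φ'.idx q.cardMap_idx
  have : Subsingleton (Fin (card (OperadicData.fiber q.bot.hom φ''.idx))) := by
    rw [(isLocalTerminal_fiber_iso q.bot _).card_eq]; infer_instance
  rw [h, Subsingleton.elim q.left.idx k, hk]
  rfl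

lemma mid_eq (hq : IsQuasibijection q.bot.hom) : φ'.fiber = q.mid :=
  fiber_eq_of_trivial φ'.hom q.bot.hom _ rfl φ'.idx φ''.idx q.cardMap_idx (hq _)

/-- If the bottom isomorphism is a quasibijection, the isomorphism between the nontrivial fibers of
the vertical morphisms induced by the top isomorphism. -/
def fiberIsoOfQuasibijection (hq : IsQuasibijection q.bot.hom) : φ'.fiber ≅ φ''.fiber :=
  eqToIso (q.mid_eq hq) ≪≫ q.right

end ElementarySquare

lemma IsOrderPreserving.fiberMap {T S R : O} {f : T ⟶ S} (hf : IsOrderPreserving f) (g : S ⟶ R)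
    (h : T ⟶ R) (w : f ≫ g = h) (i : Fin (card R)) :
    IsOrderPreserving (OperadicData.fiberMap f g h w i) := fun x y hxy => by
  refine (incl g i).le_iff_le.mp ?_
  rw [OperadicCategory.incl_fiberMap, OperadicCategory.incl_fiberMap]
  exact hf ((incl _ _).monotone hxy)

/-- For elementary `φ : T ⟶ S` and `ψ : S ⟶ P` with joint fibers and composite `ξ`, the induced
elementary morphism `φ_i : ξ⁻¹(i) ⟶ ψ⁻¹(i)` between the nontrivial fibers. -/
noncomputable def Elementary.induced {T S P : O} (φ : Elementary T S) (ψ : Elementary S P)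
    (h : cardMap ψ.hom φ.idx = ψ.idx) : Elementary (φ.comp ψ h).fiber ψ.fiber where
  hom := fiberMap φ.hom ψ.hom _ rfl ψ.idx
  orderPreserving := φ.orderPreserving.fiberMap ψ.hom _ rfl ψ.idx
  idx := (exists_incl ψ.hom φ.idx h).choose
  trivial := fun i hi => by
    have h2 := OperadicCategory.fiber_fiberMap φ.hom ψ.hom _ rfl ψ.idx i
    refine h2 ▸ φ.trivial _ fun e => hi ((incl ψ.hom ψ.idx).injective ?_)
    exact e.trans (exists_incl ψ.hom φ.idx h).choose_spec.symm
  grade_pos := by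
    have h2 := OperadicCategory.fiber_fiberMap φ.hom ψ.hom _ rfl ψ.idx
      (exists_incl ψ.hom φ.idx h).choose
    rw [(exists_incl ψ.hom φ.idx h).choose_spec] at h2
    exact h2 ▸ φ.grade_pos

lemma Elementary.induced_fiber {T S P : O} (φ : Elementary T S) (ψ : Elementary S P)
    (h : cardMap ψ.hom φ.idx = ψ.idx) : φ.fiber = (φ.induced ψ h).fiber := by
  have h1 := (exists_incl ψ.hom φ.idx h).choose_spec
  have h2 : (φ.induced ψ h).fiber = OperadicData.fiber φ.hom (incl ψ.hom ψ.idx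
    (exists_incl ψ.hom φ.idx h).choose) := OperadicCategory.fiber_fiberMap _ _ _ _ _ _
  rw [h2, h1]; rfl

/-- A commutative square `φ' ≫ ψ' = φ'' ≫ ψ''` of elementary morphisms with disjoint fibers such
that the nontrivial fiber of `φ'` lies over that of `ψ''`, and that of `φ''` over that of `ψ'`. -/
structure DisjointSquare {T P' P'' S : O} (φ' : Elementary T P') (ψ' : Elementary P' S)
    (φ'' : Elementary T P'') (ψ'' : Elementary P'' S) : Prop where
  w : φ'.hom ≫ ψ'.hom = φ''.hom ≫ ψ''.hom
  over' : cardMap ψ'.hom φ'.idx = ψ''.idx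
  over'' : cardMap ψ''.hom φ''.idx = ψ'.idx
  disjoint : ψ'.idx ≠ ψ''.idx

namespace DisjointSquare

variable {T P' P'' S : O} {φ' : Elementary T P'} {ψ' : Elementary P' S}
  {φ'' : Elementary T P''} {ψ'' : Elementary P'' S}

lemma symm (q : DisjointSquare φ' ψ' φ'' ψ'') :
    DisjointSquare φ'' ψ'' φ' ψ' := ⟨q.w.symm, q.over'', q.over', q.disjoint.symm⟩

lemma fiber_eq (q : DisjointSquare φ' ψ' φ'' ψ'') :
    φ'.fiber = OperadicData.fiber (φ'.hom ≫ ψ'.hom) ψ''.idx :=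
  fiber_eq_of_trivial φ'.hom ψ'.hom _ rfl φ'.idx _ q.over' (ψ'.trivial _ q.disjoint.symm)

lemma quasibijection (q : DisjointSquare φ' ψ' φ'' ψ'') :
    IsQuasibijection (fiberMap φ''.hom ψ''.hom (φ'.hom ≫ ψ'.hom) q.w.symm ψ''.idx) := by
  intro k
  rw [OperadicCategory.fiber_fiberMap]
  refine φ''.trivial _ fun e => q.disjoint ?_
  rw [← q.over'', ← e, cardMap_incl]

/-- The canonical quasibijection between the nontrivial fibers of `φ'` and `ψ''`. -/
noncomputable def fiberIso [StandingAssumptions O] (q : DisjointSquare φ' ψ' φ'' ψ'') :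
    φ'.fiber ≅ ψ''.fiber :=
  eqToIso q.fiber_eq ≪≫
    @asIso _ _ _ _ (fiberMap φ''.hom ψ''.hom (φ'.hom ≫ ψ'.hom) q.w.symm ψ''.idx)
      (StandingAssumptions.isIso_of_quasibijection _ q.quasibijection)

end DisjointSquare

end Squares

/-! ## Markl operads -/

/-- A presheaf on the groupoid of isomorphisms of `O`. -/
abbrev IsoPresheaf (O : Type u) [Category.{v} O] (V : Type u') [Category.{v'} V] :=
  (Core O)ᵒᵖ ⥤ V

namespace IsoPresheaf

variable {O : Type u} [Category.{v} O] {V : Type u'} [Category.{v'} V] (P : IsoPresheaf O V)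

/-- The value of a presheaf. -/
def val (T : O) : V := P.obj (op ⟨T⟩)

/-- The contravariant action of an isomorphism. -/
def pull {T S : O} (f : T ≅ S) : P.val S ⟶ P.val T :=
  P.map (Quiver.Hom.op (X := (⟨T⟩ : Core O)) (Y := ⟨S⟩) ⟨f⟩)

/-- The identification of the values at equal objects. -/
def cast {T S : O} (h : T = S) : P.val T ⟶ P.val S := eqToHom (congrArg P.val h)

lemma pull_refl (T : O) : P.pull (Iso.refl T) = 𝟙 _ := P.map_id _

lemma pull_trans {T S R : O} (f : T ≅ S) (g : S ≅ R) :
    P.pull (f ≪≫ g) = P.pull g ≫ P.pull f :=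
  P.map_comp (Quiver.Hom.op (X := (⟨S⟩ : Core O)) (Y := ⟨R⟩) ⟨g⟩)
    (Quiver.Hom.op (X := (⟨T⟩ : Core O)) (Y := ⟨S⟩) ⟨f⟩)

end IsoPresheaf

/-- A Markl `O`-operad in `V`. -/
structure MarklOperad (O : Type u) [Category.{v} O] [GradedOperadicCategory O]
    [StandingAssumptions O] (V : Type u') [Category.{v'} V] [MonoidalCategory V]
    [SymmetricCategory V] where
  presheaf : IsoPresheaf O V
  /-- The circle product of an elementary morphism. -/
  circ : ∀ {T S : O} (φ : Elementary T S),
    presheaf.val S ⊗ presheaf.val φ.fiber ⟶ presheaf.val T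
  /-- Associativity for elementary morphisms with joint fibers. -/
  assoc : ∀ {T S P : O} (φ : Elementary T S) (ψ : Elementary S P)
    (h : cardMap ψ.hom φ.idx = ψ.idx),
    (circ ψ ▷ presheaf.val φ.fiber) ≫ circ φ =
      (α_ _ _ _).hom ≫
        (presheaf.val P ◁
          ((presheaf.val ψ.fiber ◁ presheaf.cast (φ.induced_fiber ψ h)) ≫
            circ (φ.induced ψ h))) ≫
        circ (φ.comp ψ h)
  /-- Commutativity for elementary morphisms with disjoint fibers. -/
  comm : ∀ {T P' P'' S : O} (φ' : Elementary T P') (ψ' : Elementary P' S)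
    (φ'' : Elementary T P'') (ψ'' : Elementary P'' S) (q : DisjointSquare φ' ψ' φ'' ψ''),
    (α_ _ _ _).inv ≫ (circ ψ'' ▷ presheaf.val φ''.fiber) ≫ circ φ'' =
      (presheaf.val S ◁
        ((β_ (presheaf.val ψ''.fiber) (presheaf.val φ''.fiber)).hom ≫
          (presheaf.pull q.symm.fiberIso.symm ⊗ₘ presheaf.pull q.fiberIso))) ≫
        (α_ _ _ _).inv ≫ (circ ψ' ▷ presheaf.val φ'.fiber) ≫ circ φ'
  /-- Equivariance with respect to squares over a quasibijection. -/
  equivariant : ∀ {T' S' T'' S'' : O} (φ' : Elementary T' S') (φ'' : Elementary T'' S'')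
    (q : ElementarySquare φ' φ'') (hq : IsQuasibijection q.bot.hom),
    circ φ'' ≫ presheaf.pull q.top =
      (presheaf.pull q.bot ⊗ₘ presheaf.pull (q.fiberIsoOfQuasibijection hq)) ≫ circ φ'

section Markl

variable {O : Type u} [Category.{v} O] [GradedOperadicCategory O] [StandingAssumptions O]
  {V : Type u'} [Category.{v'} V] [MonoidalCategory V] [SymmetricCategory V]

namespace MarklOperad

/-- The value of a Markl operad. -/
abbrev val (M : MarklOperad O V) (T : O) : V := M.presheaf.val T

/-- The contravariant action of an isomorphism on a Markl operad. -/
abbrev pull (M : MarklOperad O V) {T S : O} (f : T ≅ S) : M.val S ⟶ M.val T := M.presheaf.pull f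

/-- The map `ϑ(T, t)`, multiplication by the unit `eta` at a local terminal object `t`. -/
def theta (M : MarklOperad O V) {T t : O} (eta : 𝟙_ V ⟶ M.val t) (f : T ⟶ t)
    (ht : IsLocalTerminal t) (hT : 1 ≤ grade T) :
    M.val (Elementary.toLocalTerminal f ht hT).fiber ⟶ M.val T :=
  (λ_ _).inv ≫ (eta ▷ _) ≫ M.circ (Elementary.toLocalTerminal f ht hT)

end MarklOperad

end Markl

/-- A `1`-connected strictly extended unital Markl operad. -/
structure ConnectedMarklOperad (O : Type u) [Category.{v} O] [GradedOperadicCategory O]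
    [StandingAssumptions O] (V : Type u') [Category.{v'} V] [MonoidalCategory V]
    [SymmetricCategory V] extends MarklOperad O V where
  eta : ∀ {t : O}, IsLocalTerminal t → (𝟙_ V ⟶ toMarklOperad.val t)
  eta_natural : ∀ {s t : O} (hs : IsLocalTerminal s) (ht : IsLocalTerminal t) (f : s ≅ t),
    eta ht ≫ toMarklOperad.pull f = eta hs
  /-- Unitality with respect to the chosen local terminal objects. -/
  unital : ∀ {T : O} (c : ConnectedComponents O) (f : T ⟶ OperadicData.U c) (hT : 1 ≤ grade T),
    toMarklOperad.theta (eta (OperadicCategory.U_localTerminal c)) f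
      (OperadicCategory.U_localTerminal c) hT =
        presheaf.cast (OperadicCategory.fiber_U f _)
  /-- Equivariance with respect to squares over an arbitrary isomorphism. -/
  equivariant_iso : ∀ {T' S' T'' S'' : O} (φ' : Elementary T' S') (φ'' : Elementary T'' S'')
    (q : ElementarySquare φ' φ''),
    (toMarklOperad.val S'' ◁
      (presheaf.cast q.left_fiber.symm ≫
        toMarklOperad.theta (eta (isLocalTerminal_fiber_iso q.bot φ''.idx)) q.left.hom
          (isLocalTerminal_fiber_iso q.bot φ''.idx) q.one_le_grade_mid ≫
        toMarklOperad.pull q.right.symm)) ≫ circ φ'' ≫ toMarklOperad.pull q.top =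
      (toMarklOperad.pull q.bot ▷ toMarklOperad.val φ'.fiber) ≫ circ φ'
  /-- Strictness: all the maps `ϑ(T, t)` are identities. -/
  strict : ∀ {T t : O} (f : T ⟶ t) (ht : IsLocalTerminal t) (hT : 1 ≤ grade T),
    ∃ h : toMarklOperad.val (Elementary.toLocalTerminal f ht hT).fiber = toMarklOperad.val T,
      toMarklOperad.theta (eta ht) f ht hT = eqToHom h
  /-- `1`-connectedness: the extended unit is an isomorphism. -/
  isIso_eta : ∀ {t : O} (ht : IsLocalTerminal t), IsIso (eta ht)

namespace ConnectedMarklOperad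

variable {O : Type u} [Category.{v} O] [GradedOperadicCategory O] [StandingAssumptions O]
  {V : Type u'} [Category.{v'} V] [MonoidalCategory V] [SymmetricCategory V]

/-- A morphism of strictly extended unital Markl operads. -/
@[ext] structure Hom (M N : ConnectedMarklOperad O V) where
  hom : ∀ T : O, M.val T ⟶ N.val T
  pull_hom : ∀ {T S : O} (f : T ≅ S), M.pull f ≫ hom T = hom S ≫ N.pull f
  circ_hom : ∀ {T S : O} (φ : Elementary T S),
    M.circ φ ≫ hom T = (hom S ⊗ₘ hom φ.fiber) ≫ N.circ φ
  eta_hom : ∀ {t : O} (ht : IsLocalTerminal t), M.eta ht ≫ hom t = N.eta ht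

instance : Category (ConnectedMarklOperad O V) where
  Hom := Hom
  id M := ⟨fun _ => 𝟙 _, by simp, by simp, by simp⟩
  comp F G := ⟨fun T => F.hom T ≫ G.hom T,
    fun f => by rw [← Category.assoc, F.pull_hom, Category.assoc, G.pull_hom, Category.assoc],
    fun φ => by
      rw [← Category.assoc, F.circ_hom, Category.assoc, G.circ_hom, ← Category.assoc,
        ← MonoidalCategory.tensorHom_comp_tensorHom],
    fun ht => by rw [← Category.assoc, F.eta_hom, G.eta_hom]⟩

end ConnectedMarklOperad

/-! ## Categories given by generators and relations -/

/-- Formal composites of generating arrows. -/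
inductive Word {A : Type u} (G : A → A → Type v) : A → A → Type (max u v)
  | gen {a b : A} (g : G a b) : Word G a b
  | id (a : A) : Word G a a
  | comp {a b c : A} (p : Word G a b) (q : Word G b c) : Word G a c

/-- The congruence generated by the relation `R` and the axioms of a category. -/
inductive WordRel {A : Type u} {G : A → A → Type v}
    (R : ∀ a b : A, Word G a b → Word G a b → Prop) : ∀ a b : A, Word G a b → Word G a b → Prop
  | of {a b : A} {p q : Word G a b} (h : R a b p q) : WordRel R a b p q
  | refl {a b : A} (p : Word G a b) : WordRel R a b p p
  | symm {a b : A} {p q : Word G a b} (h : WordRel R a b p q) : WordRel R a b q p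
  | trans {a b : A} {p q r : Word G a b} (h : WordRel R a b p q) (h' : WordRel R a b q r) :
      WordRel R a b p r
  | congr {a b c : A} {p p' : Word G a b} {q q' : Word G b c} (h : WordRel R a b p p')
      (h' : WordRel R b c q q') : WordRel R a c (p.comp q) (p'.comp q')
  | id_comp {a b : A} (p : Word G a b) : WordRel R a b ((Word.id a).comp p) p
  | comp_id {a b : A} (p : Word G a b) : WordRel R a b (p.comp (Word.id b)) p
  | assoc {a b c d : A} (p : Word G a b) (q : Word G b c) (r : Word G c d) :
      WordRel R a d ((p.comp q).comp r) (p.comp (q.comp r))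

/-- The category with objects `A`, generating arrows `G`, and relations `R`. -/
structure Presented {A : Type u} {G : A → A → Type v}
    (R : ∀ a b : A, Word G a b → Word G a b → Prop) where
  as : A

namespace Presented

variable {A : Type u} {G : A → A → Type v} (R : ∀ a b : A, Word G a b → Word G a b → Prop)

instance : Category (Presented R) where
  Hom a b := Quot (WordRel R a.as b.as)
  id a := Quot.mk _ (Word.id a.as)
  comp {a b c} p q := Quot.map₂ (r := WordRel R a.as b.as) (s := WordRel R b.as c.as)
    (t := WordRel R a.as c.as) Word.comp (fun p _ _ h => .congr (.refl p) h)
    (fun _ _ q h => .congr h (.refl q)) p q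
  id_comp := by rintro ⟨a⟩ ⟨b⟩ ⟨p⟩; exact Quot.sound (.id_comp p)
  comp_id := by rintro ⟨a⟩ ⟨b⟩ ⟨p⟩; exact Quot.sound (.comp_id p)
  assoc := by rintro ⟨a⟩ ⟨b⟩ ⟨c⟩ ⟨d⟩ ⟨p⟩ ⟨q⟩ ⟨r⟩; exact Quot.sound (.assoc p q r)

/-- The arrow of the presented category represented by a formal composite. -/
def homMk {a b : A} (p : Word G a b) : (⟨a⟩ : Presented R) ⟶ ⟨b⟩ := Quot.mk _ p

lemma homMk_id (a : A) : homMk R (Word.id (G := G) a) = 𝟙 _ := rfl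

lemma homMk_comp {a b c : A} (p : Word G a b) (q : Word G b c) :
    homMk R (p.comp q) = homMk R p ≫ homMk R q := rfl

variable {R}

lemma homMk_eq {a b : A} {p q : Word G a b} (h : R a b p q) : homMk R p = homMk R q :=
  Quot.sound (.of h)

end Presented

/-- The value of a formal composite under an assignment on generators. -/
def Word.eval {A : Type u} {G : A → A → Type v} {C : Type u'} [Category.{v'} C] (obj : A → C)
    (map : ∀ {a b : A}, G a b → (obj a ⟶ obj b)) : ∀ {a b : A}, Word G a b → (obj a ⟶ obj b)
  | _, _, .gen g => map g
  | _, _, .id a => 𝟙 (obj a)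
  | _, _, .comp p q => p.eval obj map ≫ q.eval obj map

lemma WordRel.eval_eq {A : Type u} {G : A → A → Type v}
    {R : ∀ a b : A, Word G a b → Word G a b → Prop} {C : Type u'} [Category.{v'} C] (obj : A → C)
    (map : ∀ {a b : A}, G a b → (obj a ⟶ obj b))
    (h : ∀ (a b : A) (p q : Word G a b), R a b p q → p.eval obj map = q.eval obj map)
    {a b : A} {p q : Word G a b} (hpq : WordRel R a b p q) :
    p.eval obj map = q.eval obj map := by
  induction hpq with
  | of hr => exact h _ _ _ _ hr
  | refl => rfl
  | symm _ ih => exact ih.symm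
  | trans _ _ ih ih' => exact ih.trans ih'
  | congr _ _ ih ih' => simp only [Word.eval, ih, ih']
  | id_comp => simp [Word.eval]
  | comp_id => simp [Word.eval]
  | assoc => simp [Word.eval]

/-- The functor out of a presented category defined by its values on generators. -/
def Presented.lift {A : Type u} {G : A → A → Type v}
    {R : ∀ a b : A, Word G a b → Word G a b → Prop} {C : Type u'} [Category.{v'} C] (obj : A → C)
    (map : ∀ {a b : A}, G a b → (obj a ⟶ obj b))
    (h : ∀ (a b : A) (p q : Word G a b), R a b p q → p.eval obj map = q.eval obj map) :
    Presented R ⥤ C where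
  obj a := obj a.as
  map {a b} := Quot.lift (fun p : Word G a.as b.as => p.eval obj map) fun _ _ hpq =>
    WordRel.eval_eq obj map h hpq
  map_id _ := rfl
  map_comp := by rintro ⟨a⟩ ⟨b⟩ ⟨c⟩ ⟨p⟩ ⟨q⟩; rfl

/-! ## Virtual isomorphisms and collections -/

section Virtual

variable (O : Type u) [Category.{v} O] [GradedOperadicCategory O]

/-- There is a virtual morphism from `F` to `T` if `F` is the fiber of the map from `T` to a local
terminal object. -/
def Virtual {O : Type u} [Category.{v} O] [GradedOperadicCategory O] (F T : O) : Prop :=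
  ∃ (t : O) (_ : IsLocalTerminal t) (f : T ⟶ t) (i : Fin (card t)), F = fiber f i

/-- The objects of positive grade modulo virtual isomorphisms. -/
def VirtualClass : Type u := Quot fun F T : {T : O // 1 ≤ grade T} => Virtual F.1 T.1

variable {O}

/-- The class of an object of positive grade. -/
def VirtualClass.mk (T : O) (hT : 1 ≤ grade T) : VirtualClass O := Quot.mk _ ⟨T, hT⟩

lemma VirtualClass.sound {F T : O} (hF : 1 ≤ grade F) (hT : 1 ≤ grade T) (h : Virtual F T) :
    VirtualClass.mk F hF = VirtualClass.mk T hT := Quot.sound h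

/-- A generating arrow between classes: an isomorphism between representatives. -/
structure VirtualGen (A B : VirtualClass O) where
  src : O
  tgt : O
  src_pos : 1 ≤ grade src
  tgt_pos : 1 ≤ grade tgt
  iso : src ≅ tgt
  src_eq : VirtualClass.mk src src_pos = A
  tgt_eq : VirtualClass.mk tgt tgt_pos = B

/-- The relations: composition of isomorphisms of `O`, and the identification of an isomorphism
over a local terminal object with the induced isomorphism of fibers. -/
inductive VirtualRel : ∀ A B : VirtualClass O, Word VirtualGen A B → Word VirtualGen A B → Prop
  | refl (T : O) (hT : 1 ≤ grade T) :
      VirtualRel _ _ (.gen ⟨T, T, hT, hT, Iso.refl T, rfl, rfl⟩) (.id (VirtualClass.mk T hT))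
  | trans {T S R : O} (hT : 1 ≤ grade T) (hS : 1 ≤ grade S) (hR : 1 ≤ grade R) (f : T ≅ S)
      (g : S ≅ R) :
      VirtualRel _ _
        (.comp (.gen ⟨T, S, hT, hS, f, rfl, rfl⟩) (.gen ⟨S, R, hS, hR, g, rfl, rfl⟩))
        (.gen ⟨T, R, hT, hR, f ≪≫ g, rfl, rfl⟩)
  | fiber {T S t : O} (hT : 1 ≤ grade T) (hS : 1 ≤ grade S) (ht : IsLocalTerminal t) (f : T ≅ S)
      (g : S ⟶ t) (h : T ⟶ t) (w : f.hom ≫ g = h) (i : Fin (card t))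
      (hT' : 1 ≤ grade (fiber h i)) (hS' : 1 ≤ grade (fiber g i)) :
      VirtualRel _ _ (.gen ⟨T, S, hT, hS, f, rfl, rfl⟩)
        (.gen ⟨fiber h i, fiber g i, hT', hS', fiberIso f g h w i,
          VirtualClass.sound _ _ ⟨t, ht, h, i, rfl⟩, VirtualClass.sound _ _ ⟨t, ht, g, i, rfl⟩⟩)

variable (O)

/-- The category `QVrt(e)`: the groupoid generated by virtual morphisms and isomorphisms between
objects of positive grade, modulo virtual morphisms. -/
abbrev QVrt : Type u := Presented (VirtualRel (O := O))

/-- A `1`-connected `O`-collection in `V` is a presheaf on `QVrt(e)`; it is understood to vanish in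
grade `0`, so that the classes of objects of grade `0` carry no data. -/
abbrev Collection (V : Type u') [Category.{v'} V] := (QVrt O)ᵒᵖ ⥤ V

variable {O}

/-- The class `[T]` as an object of `QVrt(e)`. -/
abbrev QVrt.mk (T : O) (hT : 1 ≤ grade T) : QVrt O := ⟨VirtualClass.mk T hT⟩

/-- The arrow of `QVrt(e)` represented by an isomorphism of `O`. -/
def QVrt.hom {A B : VirtualClass O} {T S : O} {hT : 1 ≤ grade T} {hS : 1 ≤ grade S} (f : T ≅ S)
    (hA : VirtualClass.mk T hT = A) (hB : VirtualClass.mk S hS = B) :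
    (⟨A⟩ : QVrt O) ⟶ ⟨B⟩ := Presented.homMk _ (.gen ⟨T, S, hT, hS, f, hA, hB⟩)

end Virtual

/-! ## The forgetful functor -/

lemma fiber_eq_toLocalTerminal {O : Type u} [Category.{v} O] [GradedOperadicCategory O] {T t : O}
    (ht : IsLocalTerminal t) (f : T ⟶ t) (i : Fin (card t)) (hT : 1 ≤ grade T) :
    fiber f i = (Elementary.toLocalTerminal f ht hT).fiber := by
  have : Subsingleton (Fin (card t)) := by rw [ht.card_eq]; infer_instance
  rw [Subsingleton.elim i (Elementary.toLocalTerminal f ht hT).idx]; rfl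

lemma IsoPresheaf.pull_eqToIso {O : Type u} [Category.{v} O] {V : Type u'} [Category.{v'} V]
    (P : IsoPresheaf O V) {T S : O} (h : T = S) :
    P.pull (eqToIso h) = eqToHom (congrArg P.val h.symm) := by
  subst h; exact P.pull_refl T

section Forget

variable {O : Type u} [Category.{v} O] [GradedOperadicCategory O] [StandingAssumptions O]
  {V : Type u'} [Category.{v'} V] [MonoidalCategory V] [SymmetricCategory V]

namespace ConnectedMarklOperad

variable (M : ConnectedMarklOperad O V)

lemma val_eq_of_virtual {F T : O} (hT : 1 ≤ grade T) (h : Virtual F T) : M.val F = M.val T := by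
  obtain ⟨t, ht, f, i, rfl⟩ := h
  obtain ⟨h, -⟩ := M.strict f ht hT
  rw [← h, fiber_eq_toLocalTerminal ht f i hT]

/-- The value of a strictly extended unital Markl operad on a virtual isomorphism class. -/
def classVal : VirtualClass O → V :=
  Quot.lift (fun T => M.val T.1) fun _ T h => M.val_eq_of_virtual T.2 h

/-- The value on a generating arrow. -/
def genMap {A B : VirtualClass O} (g : VirtualGen A B) : M.classVal B ⟶ M.classVal A :=
  eqToHom (congrArg M.classVal g.tgt_eq.symm) ≫ M.pull g.iso ≫
    eqToHom (congrArg M.classVal g.src_eq)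

lemma theta_pull {T S t : O} (hT : 1 ≤ grade T) (hS : 1 ≤ grade S) (ht : IsLocalTerminal t)
    (f : T ≅ S) (g : S ⟶ t) (h : T ⟶ t)
    (q : ElementarySquare (.toLocalTerminal h ht hT) (.toLocalTerminal g ht hS))
    (hf : q.top = f) (hb : q.bot = Iso.refl t) (hq : IsQuasibijection q.bot.hom) :
    M.theta (M.eta ht) g ht hS ≫ M.pull f =
      M.pull (q.fiberIsoOfQuasibijection hq) ≫ M.theta (M.eta ht) h ht hT := by
  have h1 := M.equivariant _ _ q hq
  subst hf
  simp only [MarklOperad.theta, Category.assoc, MarklOperad.pull] at h1 ⊢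
  rw [h1, hb, IsoPresheaf.pull_refl, MonoidalCategory.id_tensorHom, leftUnitor_inv_naturality_assoc,
    whisker_exchange_assoc]

lemma genMap_fiber {T S t : O} (hT : 1 ≤ grade T) (hS : 1 ≤ grade S) (ht : IsLocalTerminal t)
    (f : T ≅ S) (g : S ⟶ t) (h : T ⟶ t) (w : f.hom ≫ g = h) (i : Fin (card t))
    (e₁ : M.val S = M.val (fiber g i)) (e₂ : M.val (fiber h i) = M.val T) :
    M.pull f = eqToHom e₁ ≫ M.pull (fiberIso f g h w i) ≫ eqToHom e₂ := by
  let q : ElementarySquare (.toLocalTerminal h ht hT) (.toLocalTerminal g ht hS) :=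
    ⟨f, Iso.refl t, ht.hom_ext _ _⟩
  have hq : IsQuasibijection q.bot.hom := OperadicCategory.id_quasibijection t
  have h1 := M.theta_pull hT hS ht f g h q rfl rfl hq
  obtain ⟨a, ha⟩ := M.strict g ht hS
  obtain ⟨b, hb⟩ := M.strict h ht hT
  rw [ha, hb] at h1
  have : Subsingleton (Fin (card t)) := by rw [ht.card_eq]; infer_instance
  have hi : i = (Elementary.toLocalTerminal g ht hS).idx := Subsingleton.elim _ _
  subst hi
  have h2 : ∀ (h' : T ⟶ t) (w' : f.hom ≫ g = h') (hh : h' = h) (j : Fin (card t)),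
      M.pull (fiberIso f g h' w' j) =
        M.pull (fiberIso f g h w j) ≫ eqToHom (by rw [hh]) := by
    rintro _ w' rfl j; simp
  have h3 : M.pull (q.fiberIsoOfQuasibijection hq) =
      M.pull (fiberIso f g h w (Elementary.toLocalTerminal g ht hS).idx) := by
    have h4 := h2 _ q.w.symm (Category.comp_id h) (Elementary.toLocalTerminal g ht hS).idx
    refine (M.presheaf.pull_trans _ _).trans ?_
    rw [IsoPresheaf.pull_eqToIso]
    refine (congrArg (· ≫ eqToHom _) h4).trans ?_
    exact ((Category.assoc _ _ _).trans (congrArg _ (eqToHom_trans _ _))).trans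
      (Category.comp_id _)
  rw [h3] at h1
  have h5 : M.pull f = eqToHom a.symm ≫
      M.pull (fiberIso f g h w (Elementary.toLocalTerminal g ht hS).idx) ≫ eqToHom b := by
    rw [← cancel_epi (eqToHom a), h1]
    exact ((eqToHom_trans_assoc _ _ _).trans (Category.id_comp _)).symm
  exact h5

lemma genMap_mk {T S : O} (hT : 1 ≤ grade T) (hS : 1 ≤ grade S) (f : T ≅ S) :
    M.genMap ⟨T, S, hT, hS, f, rfl, rfl⟩ = M.pull f :=
  (Category.id_comp _).trans (Category.comp_id _)

/-- The underlying collection of a `1`-connected strictly extended unital Markl operad: the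
presheaf `[T] ↦ M(T)` on `QVrt(e)`. -/
def toCollection : Collection O V :=
  (Presented.lift (C := Vᵒᵖ) (fun A => op (M.classVal A)) (fun g => (M.genMap g).op) (by
    intro A B p q hr
    apply Quiver.Hom.unop_inj
    cases hr with
    | refl T hT => exact (M.genMap_mk hT hT _).trans (M.presheaf.pull_refl T)
    | @trans T S R hT hS hR f g =>
      refine Eq.trans ?_ ((M.presheaf.pull_trans f g).symm.trans (M.genMap_mk hT hR _).symm)
      exact congr (congrArg _ (M.genMap_mk hS hR g)) (M.genMap_mk hT hS f)
    | @fiber T S t hT hS ht f g h w i hT' hS' =>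
      refine (M.genMap_mk hT hS f).trans ?_
      exact M.genMap_fiber hT hS ht f g h w i
        (M.val_eq_of_virtual hS ⟨t, ht, g, i, rfl⟩).symm
        (M.val_eq_of_virtual hT ⟨t, ht, h, i, rfl⟩))).leftOp

end ConnectedMarklOperad

end Forget

section ForgetFunctor

variable {O : Type u} [Category.{v} O] [GradedOperadicCategory O] [StandingAssumptions O]
  {V : Type u'} [Category.{v'} V] [MonoidalCategory V] [SymmetricCategory V]

namespace ConnectedMarklOperad

lemma heq_hom_of_virtual {M N : ConnectedMarklOperad O V} (F : M ⟶ N) {X T : O}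
    (hT : 1 ≤ grade T) (h : Virtual X T) : HEq (Hom.hom F X) (Hom.hom F T) := by
  obtain ⟨t, ht, f, i, rfl⟩ := h
  obtain ⟨a, ha⟩ := M.strict f ht hT
  obtain ⟨b, hb⟩ := N.strict f ht hT
  have h1 : M.theta (M.eta ht) f ht hT ≫ Hom.hom F T =
      Hom.hom F _ ≫ N.theta (N.eta ht) f ht hT := by
    have h2 := Hom.circ_hom F (Elementary.toLocalTerminal f ht hT)
    have h3 := Hom.eta_hom F ht
    simp only [MarklOperad.theta, Category.assoc]
    rw [h2, ← h3, leftUnitor_inv_naturality_assoc, whisker_exchange_assoc]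
    simp [MonoidalCategory.tensorHom_def]
  rw [ha, hb] at h1
  rw [fiber_eq_toLocalTerminal ht f i hT]
  have h4 : Hom.hom F T = eqToHom a.symm ≫ Hom.hom F _ ≫ eqToHom b := by
    rw [← h1]; simp
  rw [h4]
  simp

/-- The component of a morphism of operads on a virtual isomorphism class. -/
def classHom {M N : ConnectedMarklOperad O V} (F : M ⟶ N) (A : VirtualClass O) :
    M.classVal A ⟶ N.classVal A :=
  Quot.hrecOn (motive := fun A => M.classVal A ⟶ N.classVal A) A (fun T => Hom.hom F T.1) fun _ T h => heq_hom_of_virtual F T.2 h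

lemma genMap_classHom {M N : ConnectedMarklOperad O V} (F : M ⟶ N) {A B : VirtualClass O}
    (g : VirtualGen A B) : M.genMap g ≫ classHom F A = classHom F B ≫ N.genMap g := by
  obtain ⟨T, S, hT, hS, f, rfl, rfl⟩ := g
  rw [genMap_mk, genMap_mk]
  exact Hom.pull_hom F f

lemma eval_classHom {M N : ConnectedMarklOperad O V} (F : M ⟶ N) {A B : VirtualClass O}
    (p : Word VirtualGen A B) :
    (p.eval (C := Vᵒᵖ) (fun A => op (M.classVal A)) (fun g => (M.genMap g).op)).unop ≫
        classHom F A =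
      classHom F B ≫
        (p.eval (C := Vᵒᵖ) (fun A => op (N.classVal A)) (fun g => (N.genMap g).op)).unop := by
  induction p with
  | gen g => exact genMap_classHom F g
  | id A => exact (Category.id_comp _).trans (Category.comp_id _).symm
  | comp p q hp hq => simp only [Word.eval, unop_comp, Category.assoc, hp, reassoc_of% hq]

variable (O V)

/-- The forgetful functor `□` from `1`-connected strictly extended unital Markl operads to
`1`-connected collections. -/
def forget : ConnectedMarklOperad O V ⥤ Collection O V where
  obj M := M.toCollection
  map F :=
    { app := fun A => classHom F A.unop.as
      naturality := by
        rintro ⟨B⟩ ⟨A⟩ ⟨⟨p⟩⟩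
        exact eval_classHom F p }
  map_id M := by
    ext ⟨⟨⟨T⟩⟩⟩; rfl
  map_comp F G := by
    ext ⟨⟨⟨T⟩⟩⟩; rfl

end ConnectedMarklOperad

end ForgetFunctor

/-! ## Arrows of `QVrt(e)` -/

section QVrtHom

variable {O : Type u} [Category.{v} O] [GradedOperadicCategory O]

namespace QVrt

lemma hom_refl {A : VirtualClass O} {T : O} {hT : 1 ≤ grade T} (h : VirtualClass.mk T hT = A) :
    QVrt.hom (Iso.refl T) h h = 𝟙 _ := by
  subst h; exact Presented.homMk_eq (.refl T hT)

lemma hom_trans {A B C : VirtualClass O} {T S R : O} {hT : 1 ≤ grade T} {hS : 1 ≤ grade S}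
    {hR : 1 ≤ grade R} (f : T ≅ S) (g : S ≅ R) (hA : VirtualClass.mk T hT = A)
    (hB : VirtualClass.mk S hS = B) (hC : VirtualClass.mk R hR = C) :
    QVrt.hom f hA hB ≫ QVrt.hom g hB hC = QVrt.hom (f ≪≫ g) hA hC := by
  subst hA hB hC; exact Presented.homMk_eq (.trans hT hS hR f g)

/-- An isomorphism of `O` as an isomorphism of `QVrt(e)`. -/
@[simps] def iso {A B : VirtualClass O} {T S : O} {hT : 1 ≤ grade T} {hS : 1 ≤ grade S}
    (f : T ≅ S) (hA : VirtualClass.mk T hT = A) (hB : VirtualClass.mk S hS = B) :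
    (⟨A⟩ : QVrt O) ≅ ⟨B⟩ where
  hom := QVrt.hom f hA hB
  inv := QVrt.hom f.symm hB hA
  hom_inv_id := by rw [hom_trans, Iso.self_symm_id, hom_refl]
  inv_hom_id := by rw [hom_trans, Iso.symm_self_id, hom_refl]

lemma hom_congr {A B : VirtualClass O} {T S T' S' : O} {hT : 1 ≤ grade T} {hS : 1 ≤ grade S}
    {hT' : 1 ≤ grade T'} {hS' : 1 ≤ grade S'} (f : T ≅ S) (f' : T' ≅ S') (e₁ : T = T') (e₂ : S = S')
    (h : f.hom = eqToHom e₁ ≫ f'.hom ≫ eqToHom e₂.symm)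
    (hA : VirtualClass.mk T hT = A) (hB : VirtualClass.mk S hS = B)
    (hA' : VirtualClass.mk T' hT' = A) (hB' : VirtualClass.mk S' hS' = B) :
    QVrt.hom f hA hB = QVrt.hom f' hA' hB' := by
  subst e₁ e₂
  have : f = f' := by ext; simpa using h
  subst this
  rfl

/-- An induced map of fibers over `i`, and the induced map of fibers over a preimage `j` of `i`
under a map `c` whose fiber over `i` is local terminal, represent the same arrow. -/
lemma hom_fiberMap {T S Q R : O} (f : T ⟶ S) (a : S ⟶ Q) (b : T ⟶ Q) (c : Q ⟶ R) (g : S ⟶ R)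
    (h : T ⟶ R) (w : f ≫ a = b) (wg : a ≫ c = g) (w' : f ≫ g = h) (i : Fin (card R))
    (j : Fin (card Q)) (hj : cardMap c j = i) (hc : IsLocalTerminal (fiber c i))
    (e : fiber h i ≅ fiber g i) (he : e.hom = fiberMap f g h w' i)
    (e' : fiber b j ≅ fiber a j) (he' : e'.hom = fiberMap f a b w j)
    {A B : VirtualClass O} {h₁ : 1 ≤ grade (fiber h i)} {h₂ : 1 ≤ grade (fiber g i)}
    {h₃ : 1 ≤ grade (fiber b j)} {h₄ : 1 ≤ grade (fiber a j)}
    (k₁ : VirtualClass.mk _ h₁ = A) (k₂ : VirtualClass.mk _ h₂ = B)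
    (k₃ : VirtualClass.mk _ h₃ = A) (k₄ : VirtualClass.mk _ h₄ = B) :
    QVrt.hom e k₁ k₂ = QVrt.hom e' k₃ k₄ := by
  subst k₁ k₂
  have wh : b ≫ c = h := by rw [← w, Category.assoc, wg, w']
  obtain ⟨k, rfl⟩ := exists_incl c j hj
  have w'' : e.hom ≫ fiberMap a c g wg i = fiberMap b c h wh i := by
    rw [he, ← OperadicCategory.fiberMap_comp f a h g c w' wg (by rw [w, wh])]
    subst w; rfl
  have e₁ := OperadicCategory.fiber_fiberMap b c h wh i k
  have e₂ := OperadicCategory.fiber_fiberMap a c g wg i k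
  have h5 : 1 ≤ grade (fiber (fiberMap b c h wh i) k) := e₁ ▸ h₃
  have h6 : 1 ≤ grade (fiber (fiberMap a c g wg i) k) := e₂ ▸ h₄
  refine (Presented.homMk_eq (.fiber h₁ h₂ hc e (fiberMap a c g wg i) (fiberMap b c h wh i)
    w'' k h5 h6)).trans ?_
  refine hom_congr (fiberIso e _ _ w'' k) e' e₁ e₂ ?_ _ _ _ _
  rw [he']
  have := OperadicCategory.fiberMap_fiberMap f a b c g h w wg wh w' i k (by rw [← he, w''])
  rw [← this]
  have : ∀ (x : fiber h i ⟶ fiber g i) (hx : x = e.hom)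
      (y : x ≫ fiberMap a c g wg i = fiberMap b c h wh i),
      fiberMap e.hom _ _ w'' k = fiberMap x _ _ y k := by rintro _ rfl _; rfl
  exact this _ he.symm _

end QVrt

namespace ElementarySquare

variable {T' S' T'' S'' : O} {φ' : Elementary T' S'} {φ'' : Elementary T'' S''}

lemma virtual_mid (q : ElementarySquare φ' φ'') : Virtual φ'.fiber q.mid :=
  ⟨_, isLocalTerminal_fiber_iso q.bot φ''.idx, _, q.left.idx, q.left_fiber.symm⟩

/-- The arrow between the classes of the nontrivial fibers induced by the top isomorphism. -/
def fiberClass (q : ElementarySquare φ' φ'') :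
    QVrt.mk φ'.fiber φ'.fiber_pos ⟶ QVrt.mk φ''.fiber φ''.fiber_pos :=
  QVrt.hom q.right (VirtualClass.sound φ'.fiber_pos q.one_le_grade_mid q.virtual_mid).symm rfl

end ElementarySquare

end QVrtHom

/-! ## Towers -/

section Towers

variable {O : Type u} [Category.{v} O] [GradedOperadicCategory O]

/-- The identity square. -/
@[simps] def ElementarySquare.refl {T S : O} (φ : Elementary T S) : ElementarySquare φ φ :=
  ⟨Iso.refl T, Iso.refl S, by simp⟩

/-- The horizontal composite of squares. -/
@[simps] def ElementarySquare.trans {T T' T'' S S' S'' : O} {φ : Elementary T S}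
    {φ' : Elementary T' S'} {φ'' : Elementary T'' S''} (q : ElementarySquare φ φ')
    (q' : ElementarySquare φ' φ'') : ElementarySquare φ φ'' :=
  ⟨q.top ≪≫ q'.top, q.bot ≪≫ q'.bot, by
    rw [Iso.trans_hom, ← Category.assoc, q.w, Category.assoc, q'.w]; simp⟩

lemma ElementarySquare.fiberClass_refl {T S : O} (φ : Elementary T S) :
    (ElementarySquare.refl φ).fiberClass = 𝟙 _ := by
  refine (QVrt.hom_congr _ (Iso.refl φ.fiber) (by simp [mid]; rfl) rfl ?_ _ _ rfl rfl).trans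
    (QVrt.hom_refl _)
  have : ∀ (h : T ⟶ S) (hh : h = φ.hom) (w : 𝟙 T ≫ φ.hom = h),
      fiberMap (𝟙 T) φ.hom h w φ.idx = eqToHom (by rw [hh]) := by
    rintro _ rfl w; exact OperadicCategory.fiberMap_id _ _ _
  have h1 := this (φ.hom ≫ 𝟙 S) (by simp) (by simp)
  refine h1.trans ?_
  simp
  rfl

lemma ElementarySquare.fiberClass_trans {T T' T'' S S' S'' : O} {φ : Elementary T S}
    {φ' : Elementary T' S'} {φ'' : Elementary T'' S''} (q : ElementarySquare φ φ')
    (q' : ElementarySquare φ' φ'') :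
    (q.trans q').fiberClass = q.fiberClass ≫ q'.fiberClass := by
  have w₁ : q.top.hom ≫ (φ'.hom ≫ q'.bot.hom) = φ.hom ≫ (q.trans q').bot.hom := by
    rw [← Category.assoc, ← q.w]; simp
  let e : (q.trans q').mid ≅ q'.mid := fiberIso q.top (φ'.hom ≫ q'.bot.hom) _ w₁ φ''.idx
  have h := QVrt.hom_fiberMap q.top.hom φ'.hom (φ.hom ≫ q.bot.hom) q'.bot.hom
    (φ'.hom ≫ q'.bot.hom) _ q.w.symm rfl w₁ φ''.idx φ'.idx q'.cardMap_idx
    (isLocalTerminal_fiber_iso _ _) e rfl q.right rfl (h₁ := (q.trans q').one_le_grade_mid)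
    (h₂ := q'.one_le_grade_mid) (h₃ := q.one_le_grade_mid)
    (VirtualClass.sound φ.fiber_pos (q.trans q').one_le_grade_mid (q.trans q').virtual_mid).symm
    (VirtualClass.sound φ'.fiber_pos q'.one_le_grade_mid q'.virtual_mid).symm
    (VirtualClass.sound φ.fiber_pos q.one_le_grade_mid q.virtual_mid).symm rfl
  have h' : (q.trans q').right = e ≪≫ q'.right := by
    ext
    exact OperadicCategory.fiberMap_comp _ _ _ _ _ _ _ _ _
  refine Eq.trans ?_ (congrArg (fun x => x ≫ q'.fiberClass) h)
  refine Eq.trans ?_ (QVrt.hom_trans e q'.right _ _ rfl).symm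
  exact congrArg (fun x => QVrt.hom x _ rfl) h'

/-- The towers `T ⟶ T₁ ⟶ ⋯ ⟶ T_{k-1} ⟶ U_c` of elementary morphisms with initial term `T`. The
last morphism, from an object of positive grade to the chosen local terminal object of its
component, is unique, and is not recorded. -/
inductive Tower : O → Type (max u v)
  | last (T : O) (hT : 1 ≤ grade T) : Tower T
  | cons {T S : O} (φ : Elementary T S) (r : Tower S) : Tower T

namespace Tower

/-- The morphisms of towers with a given first isomorphism. -/
inductive Hom : ∀ {T' T'' : O}, Tower T' → Tower T'' → (T' ≅ T'') → Type (max u v)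
  | last {T' T'' : O} (h' : 1 ≤ grade T') (h'' : 1 ≤ grade T'') (σ : T' ≅ T'') :
      Hom (.last T' h') (.last T'' h'') σ
  | cons {T' S' T'' S'' : O} {φ' : Elementary T' S'} {φ'' : Elementary T'' S''} {r' : Tower S'}
      {r'' : Tower S''} {σ : T' ≅ T''} {ρ : S' ≅ S''} (w : φ'.hom ≫ ρ.hom = σ.hom ≫ φ''.hom)
      (f : Hom r' r'' ρ) : Hom (.cons φ' r') (.cons φ'' r'') σ

/-- The identity morphism of a tower. -/
def Hom.id : ∀ {T : O} (A : Tower T), Hom A A (Iso.refl T)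
  | _, .last _ h => .last h h _
  | _, .cons φ r => .cons (ElementarySquare.refl φ).w (Hom.id r)

/-- The composite of morphisms of towers. -/
def Hom.comp : ∀ {T T' T'' : O} {A : Tower T} {B : Tower T'} {C : Tower T''} {σ : T ≅ T'}
    {ρ : T' ≅ T''}, Hom A B σ → Hom B C ρ → Hom A C (σ ≪≫ ρ)
  | _, _, _, _, _, _, _, _, .last h _ _, .last _ h' _ => .last h h' _
  | _, _, _, _, _, _, _, _, .cons w f, .cons w' f' =>
      .cons (ElementarySquare.trans ⟨_, _, w⟩ ⟨_, _, w'⟩).w (f.comp f')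

/-- The moves replacing two consecutive morphisms `φ', ψ'` of a tower with disjoint fibers by the
other two morphisms `φ'', ψ''` of a commutative square. -/
inductive Swap : ∀ {T : O}, Tower T → Tower T → Type (max u v)
  | here {T P' P'' S : O} {φ' : Elementary T P'} {ψ' : Elementary P' S} {φ'' : Elementary T P''}
      {ψ'' : Elementary P'' S} (q : DisjointSquare φ' ψ' φ'' ψ'') (r : Tower S) :
      Swap (.cons φ' (.cons ψ' r)) (.cons φ'' (.cons ψ'' r))
  | there {T S : O} (φ : Elementary T S) {A B : Tower S} (s : Swap A B) :
      Swap (.cons φ A) (.cons φ B)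

/-- The reverse move. -/
def Swap.symm : ∀ {T : O} {A B : Tower T}, Swap A B → Swap B A
  | _, _, _, .here q r => .here q.symm r
  | _, _, _, .there φ s => .there φ s.symm

/-- Compatibility of two moves with morphisms of towers between their sources and targets. -/
inductive Swap.Natural : ∀ {T T' : O} {A B : Tower T} {A' B' : Tower T'} {σ : T ≅ T'},
    Swap A B → Swap A' B' → Hom A A' σ → Hom B B' σ → Prop
  | here {T P₁ P₂ S T' P₁' P₂' S' : O} {φ₁ : Elementary T P₁} {ψ₁ : Elementary P₁ S}
      {φ₂ : Elementary T P₂} {ψ₂ : Elementary P₂ S} {φ₁' : Elementary T' P₁'}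
      {ψ₁' : Elementary P₁' S'} {φ₂' : Elementary T' P₂'} {ψ₂' : Elementary P₂' S'}
      (q : DisjointSquare φ₁ ψ₁ φ₂ ψ₂) (q' : DisjointSquare φ₁' ψ₁' φ₂' ψ₂') {r : Tower S}
      {r' : Tower S'} {σ : T ≅ T'} {ρ₁ : P₁ ≅ P₁'} {ρ₂ : P₂ ≅ P₂'} {ρ : S ≅ S'} (f : Hom r r' ρ)
      (w₁ : φ₁.hom ≫ ρ₁.hom = σ.hom ≫ φ₁'.hom) (w₁' : ψ₁.hom ≫ ρ.hom = ρ₁.hom ≫ ψ₁'.hom)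
      (w₂ : φ₂.hom ≫ ρ₂.hom = σ.hom ≫ φ₂'.hom) (w₂' : ψ₂.hom ≫ ρ.hom = ρ₂.hom ≫ ψ₂'.hom) :
      Swap.Natural (.here q r) (.here q' r') (.cons w₁ (.cons w₁' f)) (.cons w₂ (.cons w₂' f))
  | there {T S T' S' : O} {φ : Elementary T S} {φ' : Elementary T' S'} {A B : Tower S}
      {A' B' : Tower S'} {s : Swap A B} {s' : Swap A' B'} {σ : T ≅ T'} {ρ : S ≅ S'}
      {f : Hom A A' ρ} {g : Hom B B' ρ} (w : φ.hom ≫ ρ.hom = σ.hom ≫ φ'.hom)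
      (h : Swap.Natural s s' f g) :
      Swap.Natural (.there φ s) (.there φ' s') (.cons w f) (.cons w g)

/-- Two moves at disjoint places of a tower, performed in both orders. -/
inductive Swap.Distant : ∀ {T : O} {A B C D : Tower T}, Swap A B → Swap B D → Swap A C →
    Swap C D → Prop
  | here {T P' P'' S : O} {φ' : Elementary T P'} {ψ' : Elementary P' S} {φ'' : Elementary T P''}
      {ψ'' : Elementary P'' S} (q : DisjointSquare φ' ψ' φ'' ψ'') {r r' : Tower S}
      (s : Swap r r') :
      Swap.Distant (.here q r) (.there φ'' (.there ψ'' s)) (.there φ' (.there ψ' s)) (.here q r')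
  | there {T S : O} (φ : Elementary T S) {A B C D : Tower S} {s₁ : Swap A B} {s₂ : Swap B D}
      {s₃ : Swap A C} {s₄ : Swap C D} (h : Swap.Distant s₁ s₂ s₃ s₄) :
      Swap.Distant (.there φ s₁) (.there φ s₂) (.there φ s₃) (.there φ s₄)

/-- The two ways to reverse the order of three consecutive morphisms of a tower with pairwise
disjoint fibers. -/
inductive Swap.Hexagon : ∀ {T : O} {A B C A' B' D : Tower T}, Swap A B → Swap B C → Swap C D →
    Swap A A' → Swap A' B' → Swap B' D → Prop
  | here {T P P' P'' Q Q' Q'' S : O}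
      {a₁ : Elementary T P} {a₂ : Elementary P Q} {a₃ : Elementary Q S}
      {b₁ : Elementary T P'} {b₂ : Elementary P' Q} {b₃ : Elementary P' Q'}
      {c₁ : Elementary Q' S} {c₂ : Elementary T P''} {c₃ : Elementary P'' Q'}
      {d₁ : Elementary P Q''} {d₂ : Elementary Q'' S} {d₃ : Elementary P'' Q''}
      (q₁ : DisjointSquare a₁ a₂ b₁ b₂) (q₂ : DisjointSquare b₂ a₃ b₃ c₁)
      (q₃ : DisjointSquare b₁ b₃ c₂ c₃) (q₄ : DisjointSquare a₂ a₃ d₁ d₂)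
      (q₅ : DisjointSquare a₁ d₁ c₂ d₃) (q₆ : DisjointSquare d₃ d₂ c₃ c₁) (r : Tower S) :
      Swap.Hexagon (.here q₁ (.cons a₃ r)) (.there b₁ (.here q₂ r)) (.here q₃ (.cons c₁ r))
        (.there a₁ (.here q₄ r)) (.here q₅ (.cons d₂ r)) (.there c₂ (.here q₆ r))
  | there {T S : O} (φ : Elementary T S) {A B C A' B' D : Tower S} {s₁ : Swap A B}
      {s₂ : Swap B C} {s₃ : Swap C D} {s₄ : Swap A A'} {s₅ : Swap A' B'} {s₆ : Swap B' D}
      (h : Swap.Hexagon s₁ s₂ s₃ s₄ s₅ s₆) :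
      Swap.Hexagon (.there φ s₁) (.there φ s₂) (.there φ s₃) (.there φ s₄) (.there φ s₅)
        (.there φ s₆)

end Tower

end Towers

section Cross

variable {O : Type u} [Category.{v} O] [GradedOperadicCategory O]

lemma QVrt.hom_of_eq {A B : VirtualClass O} {T F G : O} {hT : 1 ≤ grade T} {hF : 1 ≤ grade F}
    {hG : 1 ≤ grade G} (h : F = T) (f : F ≅ G) (hA : VirtualClass.mk F hF = A)
    (hA' : VirtualClass.mk T hT = A) (hB : VirtualClass.mk G hG = B) :
    QVrt.hom (eqToIso h.symm ≪≫ f) hA' hB = QVrt.hom f hA hB := by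
  subst h; congr 1; simp

namespace DisjointSquare

variable [StandingAssumptions O]

/-- The isomorphism between the classes of the nontrivial fibers of `φ'` and `ψ''`. -/
noncomputable def cross {T P' P'' S : O} {φ' : Elementary T P'} {ψ' : Elementary P' S}
    {φ'' : Elementary T P''} {ψ'' : Elementary P'' S} (q : DisjointSquare φ' ψ' φ'' ψ'') :
    QVrt.mk φ'.fiber φ'.fiber_pos ≅ QVrt.mk ψ''.fiber ψ''.fiber_pos :=
  QVrt.iso q.fiberIso rfl rfl

lemma cross_hom_eq {T P' P'' S : O} {φ' : Elementary T P'} {ψ' : Elementary P' S}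
    {φ'' : Elementary T P''} {ψ'' : Elementary P'' S} (q : DisjointSquare φ' ψ' φ'' ψ'')
    (h : T ⟶ S) (w : φ''.hom ≫ ψ''.hom = h) (e : fiber h ψ''.idx ≅ ψ''.fiber)
    (he : e.hom = fiberMap φ''.hom ψ''.hom h w ψ''.idx) {h₁ : 1 ≤ grade (fiber h ψ''.idx)}
    (hA : VirtualClass.mk _ h₁ = VirtualClass.mk φ'.fiber φ'.fiber_pos) :
    q.cross.hom = QVrt.hom e hA rfl := by
  have hh : h = φ'.hom ≫ ψ'.hom := by rw [← w, q.w]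
  subst hh
  refine Eq.trans ?_ (QVrt.hom_of_eq q.fiber_eq.symm e hA rfl rfl)
  refine congrArg (fun x => QVrt.hom x rfl rfl) ?_
  refine congrArg (fun x => eqToIso q.fiber_eq ≪≫ x) ?_
  ext
  exact he.symm

lemma isIso_fiberMap {T P' P'' S : O} {φ' : Elementary T P'} {ψ' : Elementary P' S}
    {φ'' : Elementary T P''} {ψ'' : Elementary P'' S} (q : DisjointSquare φ' ψ' φ'' ψ'')
    {R : O} (c : S ⟶ R) (g : P'' ⟶ R) (h : T ⟶ R) (wg : ψ''.hom ≫ c = g)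
    (w : φ''.hom ≫ g = h) (i : Fin (card R)) (hi : cardMap c ψ'.idx ≠ i) :
    IsIso (fiberMap φ''.hom g h w i) := by
  apply StandingAssumptions.isIso_of_quasibijection
  intro k
  rw [OperadicCategory.fiber_fiberMap]
  refine φ''.trivial _ fun e => hi ?_
  have h1 := cardMap_incl g i k
  rw [e, ← wg, cardMap_comp_apply, q.over''] at h1
  exact h1

lemma cross_cross_aux {T P P₁ S Q R : O} {φ : Elementary T P} {ψ : Elementary P S}
    {φ₁ : Elementary T P₁} {ψ₁ : Elementary P₁ S} (q : DisjointSquare φ ψ φ₁ ψ₁)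
    {χ : Elementary S R} {μ : Elementary P₁ Q} {ν : Elementary Q R}
    (q' : DisjointSquare ψ₁ χ μ ν) (hne : cardMap χ.hom ψ.idx ≠ ν.idx) (p : T ⟶ Q)
    (hp : φ₁.hom ≫ μ.hom = p) (h : T ⟶ R) (hh : p ≫ ν.hom = h) :
    ∃ (e : fiber h ν.idx ≅ ν.fiber) (_ : e.hom = fiberMap p ν.hom h hh ν.idx)
      (h₁ : 1 ≤ grade (fiber h ν.idx))
      (hA : VirtualClass.mk _ h₁ = VirtualClass.mk φ.fiber φ.fiber_pos),
      q.cross.hom ≫ q'.cross.hom = QVrt.hom e hA rfl := by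
  subst hp hh
  have wg : φ₁.hom ≫ (ψ₁.hom ≫ χ.hom) = (φ₁.hom ≫ μ.hom) ≫ ν.hom := by
    rw [q'.w, Category.assoc]
  have := q.isIso_fiberMap χ.hom (ψ₁.hom ≫ χ.hom) _ rfl wg ν.idx hne
  let e₁ := asIso (fiberMap φ₁.hom (ψ₁.hom ≫ χ.hom) _ wg ν.idx)
  have h0 := q.isIso_fiberMap (𝟙 S) ψ₁.hom (φ₁.hom ≫ ψ₁.hom) (by simp) rfl ψ₁.idx
    (by rw [OperadicCategory.cardMap_id]; exact q.disjoint)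
  let e₀ := asIso (fiberMap φ₁.hom ψ₁.hom _ rfl ψ₁.idx)
  have h2 := q'.isIso_fiberMap (𝟙 R) ν.hom (ψ₁.hom ≫ χ.hom) (by simp) q'.w.symm ν.idx
    (by rw [OperadicCategory.cardMap_id]; exact q'.disjoint)
  let e₂ : _ ≅ ν.fiber := @asIso _ _ _ _ _ h2
  have g₂ : 1 ≤ grade (fiber (ψ₁.hom ≫ χ.hom) ν.idx) := by
    rw [grade_of_iso e₂]; exact ν.fiber_pos
  have g₁ : 1 ≤ grade (fiber ((φ₁.hom ≫ μ.hom) ≫ ν.hom) ν.idx) := by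
    rw [grade_of_iso e₁]; exact g₂
  have g₀ : 1 ≤ grade (fiber (φ₁.hom ≫ ψ₁.hom) ψ₁.idx) := by
    rw [grade_of_iso e₀]; exact ψ₁.fiber_pos
  have k₂ : VirtualClass.mk _ g₂ = VirtualClass.mk ψ₁.fiber ψ₁.fiber_pos := by
    congr 1; exact q'.fiber_eq.symm
  have k₀ : VirtualClass.mk _ g₀ = VirtualClass.mk φ.fiber φ.fiber_pos := by
    congr 1; rw [q.fiber_eq]; congr 1; exact q.w.symm
  have k₁ : VirtualClass.mk _ g₁ = VirtualClass.mk φ.fiber φ.fiber_pos := by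
    rw [← k₀]; congr 1
    have := fiber_eq_of_trivial (φ₁.hom ≫ ψ₁.hom) χ.hom ((φ₁.hom ≫ μ.hom) ≫ ν.hom)
      (by rw [Category.assoc, wg]) ψ₁.idx ν.idx q'.over' (χ.trivial _ q'.disjoint.symm)
    exact this.symm
  have hc₁ : q.cross.hom = QVrt.hom e₁ k₁ k₂ := by
    rw [q.cross_hom_eq (φ₁.hom ≫ ψ₁.hom) rfl e₀ rfl k₀]
    exact (QVrt.hom_fiberMap φ₁.hom ψ₁.hom _ χ.hom _ _ rfl rfl wg ν.idx ψ₁.idx q'.over'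
      (χ.trivial _ q'.disjoint.symm).isLocalTerminal e₁ rfl e₀ rfl k₁ k₂ k₀ rfl).symm
  have hc₂ : q'.cross.hom = QVrt.hom e₂ k₂ rfl :=
    q'.cross_hom_eq (ψ₁.hom ≫ χ.hom) q'.w.symm e₂ rfl k₂
  refine ⟨e₁ ≪≫ e₂, ?_, g₁, k₁, ?_⟩
  · exact (OperadicCategory.fiberMap_comp _ _ _ _ _ _ _ _ _).symm
  · rw [hc₁, hc₂]; exact QVrt.hom_trans _ _ _ _ _

/-- Two ways to move a nontrivial fiber along two consecutive squares agree. -/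
lemma cross_cross {T P P₁ S Q R P₂ S' : O} {φ : Elementary T P} {ψ : Elementary P S}
    {φ₁ : Elementary T P₁} {ψ₁ : Elementary P₁ S} (q : DisjointSquare φ ψ φ₁ ψ₁)
    {χ : Elementary S R} {μ : Elementary P₁ Q} {ν : Elementary Q R}
    (q' : DisjointSquare ψ₁ χ μ ν) (hne : cardMap χ.hom ψ.idx ≠ ν.idx)
    {ψ' : Elementary P S'} {φ₂ : Elementary T P₂} {ψ₂ : Elementary P₂ S'}
    (r : DisjointSquare φ ψ' φ₂ ψ₂) {χ' : Elementary S' R} {μ₂ : Elementary P₂ Q}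
    (r' : DisjointSquare ψ₂ χ' μ₂ ν) (hne' : cardMap χ'.hom ψ'.idx ≠ ν.idx)
    (hp : φ₁.hom ≫ μ.hom = φ₂.hom ≫ μ₂.hom) :
    q.cross.hom ≫ q'.cross.hom = r.cross.hom ≫ r'.cross.hom := by
  obtain ⟨e, he, h₁, hA, h⟩ := cross_cross_aux q q' hne _ hp _ rfl
  obtain ⟨e', he', h₁', hA', h'⟩ := cross_cross_aux r r' hne' _ rfl _ rfl
  have : e = e' := by ext; rw [he, he']
  subst this
  rw [h, h']

/-- The isomorphisms `cross` are natural with respect to morphisms of towers. -/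
lemma cross_natural {T P₁ P₂ S T' P₁' P₂' S' : O} {φ₁ : Elementary T P₁}
    {ψ₁ : Elementary P₁ S} {φ₂ : Elementary T P₂} {ψ₂ : Elementary P₂ S} {φ₁' : Elementary T' P₁'}
    {ψ₁' : Elementary P₁' S'} {φ₂' : Elementary T' P₂'} {ψ₂' : Elementary P₂' S'}
    (q : DisjointSquare φ₁ ψ₁ φ₂ ψ₂) (q' : DisjointSquare φ₁' ψ₁' φ₂' ψ₂')
    (s₁ : ElementarySquare φ₁ φ₁') (t₁ : ElementarySquare ψ₁ ψ₁') (s₂ : ElementarySquare φ₂ φ₂')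
    (t₂ : ElementarySquare ψ₂ ψ₂') (hs : s₁.top = s₂.top)
    (h₂ : s₂.bot = t₂.top) (ht : t₁.bot = t₂.bot) :
    q.cross.hom ≫ t₂.fiberClass = s₁.fiberClass ≫ q'.cross.hom := by
  have w₀ : φ₂.hom ≫ s₂.bot.hom = s₁.top.hom ≫ φ₂'.hom := by rw [hs, s₂.w]
  have wh₂ : φ₂.hom ≫ (ψ₂.hom ≫ t₂.bot.hom) = s₁.top.hom ≫ (φ₂'.hom ≫ ψ₂'.hom) := by
    rw [t₂.w, ← h₂, ← Category.assoc, w₀, Category.assoc]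
  have wh₁ : φ₁.hom ≫ (ψ₁.hom ≫ t₂.bot.hom) = s₁.top.hom ≫ (φ₂'.hom ≫ ψ₂'.hom) := by
    rw [← wh₂, ← Category.assoc, q.w, Category.assoc]
  have wh₃ : (φ₁.hom ≫ s₁.bot.hom) ≫ ψ₁'.hom = s₁.top.hom ≫ (φ₂'.hom ≫ ψ₂'.hom) := by
    rw [s₁.w, Category.assoc, q'.w]
  have hne : cardMap t₂.bot.hom ψ₁.idx ≠ ψ₂'.idx := by
    rw [← ht, t₁.cardMap_idx]; exact q'.disjoint
  -- the four isomorphisms of fibers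
  have := q.isIso_fiberMap t₂.bot.hom (ψ₂.hom ≫ t₂.bot.hom) _ rfl wh₂ ψ₂'.idx hne
  let e₁ : _ ≅ t₂.mid := @asIso _ _ _ _ _ this
  have h0 := q.isIso_fiberMap (𝟙 S) ψ₂.hom (φ₂.hom ≫ ψ₂.hom) (by simp) rfl ψ₂.idx
    (by rw [OperadicCategory.cardMap_id]; exact q.disjoint)
  let e₀ := asIso (fiberMap φ₂.hom ψ₂.hom _ rfl ψ₂.idx)
  have h2 := q'.isIso_fiberMap (𝟙 S') ψ₂'.hom (φ₂'.hom ≫ ψ₂'.hom) (by simp) rfl ψ₂'.idx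
    (by rw [OperadicCategory.cardMap_id]; exact q'.disjoint)
  let e₂ : _ ≅ ψ₂'.fiber := @asIso _ _ _ _ _ h2
  let e₃ := OpCat.fiberIso s₁.top (φ₂'.hom ≫ ψ₂'.hom) _ rfl ψ₂'.idx
  have g₁ : 1 ≤ grade (fiber (s₁.top.hom ≫ (φ₂'.hom ≫ ψ₂'.hom)) ψ₂'.idx) := by
    rw [grade_of_iso e₁]; exact t₂.one_le_grade_mid
  have g₀ : 1 ≤ grade (fiber (φ₂.hom ≫ ψ₂.hom) ψ₂.idx) := by
    rw [grade_of_iso e₀]; exact ψ₂.fiber_pos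
  have g₂ : 1 ≤ grade (fiber (φ₂'.hom ≫ ψ₂'.hom) ψ₂'.idx) := by
    rw [grade_of_iso e₂]; exact ψ₂'.fiber_pos
  have k₀ : VirtualClass.mk _ g₀ = VirtualClass.mk φ₁.fiber φ₁.fiber_pos := by
    congr 1; rw [q.fiber_eq]; congr 1; exact q.w.symm
  have k₂ : VirtualClass.mk _ g₂ = VirtualClass.mk φ₁'.fiber φ₁'.fiber_pos := by
    congr 1; rw [q'.fiber_eq]; congr 1; exact q'.w.symm
  have m₁ := (VirtualClass.sound φ₁.fiber_pos s₁.one_le_grade_mid s₁.virtual_mid).symm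
  have m₂ := (VirtualClass.sound ψ₂.fiber_pos t₂.one_le_grade_mid t₂.virtual_mid).symm
  have k₁ : VirtualClass.mk _ g₁ = VirtualClass.mk φ₁.fiber φ₁.fiber_pos := by
    rw [← m₁]; congr 1
    exact (fiber_eq_of_trivial _ ψ₁'.hom _ wh₃ φ₁'.idx ψ₂'.idx q'.over'
      (ψ₁'.trivial _ q'.disjoint.symm)).symm
  have c₁ : q.cross.hom = QVrt.hom e₁ k₁ m₂ := by
    rw [q.cross_hom_eq (φ₂.hom ≫ ψ₂.hom) rfl e₀ rfl k₀]
    exact (QVrt.hom_fiberMap φ₂.hom ψ₂.hom _ t₂.bot.hom _ _ rfl rfl wh₂ ψ₂'.idx ψ₂.idx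
      t₂.cardMap_idx (isLocalTerminal_fiber_iso _ _) e₁ rfl e₀ rfl k₁ m₂ k₀ rfl).symm
  have c₂ : q'.cross.hom = QVrt.hom e₂ k₂ rfl :=
    q'.cross_hom_eq (φ₂'.hom ≫ ψ₂'.hom) rfl e₂ rfl k₂
  have c₃ : s₁.fiberClass = QVrt.hom e₃ k₁ k₂ :=
    (QVrt.hom_fiberMap s₁.top.hom φ₁'.hom _ ψ₁'.hom _ _ s₁.w.symm q'.w rfl ψ₂'.idx φ₁'.idx
      q'.over' (ψ₁'.trivial _ q'.disjoint.symm).isLocalTerminal e₃ rfl s₁.right rfl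
      (h₃ := s₁.one_le_grade_mid) (h₄ := φ₁'.fiber_pos) k₁ k₂ m₁ rfl).symm
  rw [c₁, c₂, c₃]
  refine (QVrt.hom_trans e₁ t₂.right k₁ m₂ rfl).trans (Eq.trans ?_ (QVrt.hom_trans e₃ e₂ _ _ _).symm)
  refine congrArg (fun x => QVrt.hom x k₁ rfl) ?_
  ext
  have f₁ := OperadicCategory.fiberMap_comp φ₂.hom t₂.top.hom _ _ ψ₂'.hom wh₂ t₂.w.symm
    (by rw [Category.assoc, ← t₂.w, wh₂]) ψ₂'.idx
  have f₂ := OperadicCategory.fiberMap_comp s₁.top.hom φ₂'.hom _ _ ψ₂'.hom rfl rfl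
    (by rw [Category.assoc]) ψ₂'.idx
  refine f₁.symm.trans (Eq.trans ?_ f₂)
  congr 1
  rw [← h₂, w₀]

end DisjointSquare
end Cross

/-! ## The functor of labelled towers -/

section SwapMap

variable {V : Type u'} [Category.{v'} V] [MonoidalCategory V] [SymmetricCategory V]

/-- Exchange of the first two factors of a tensor product, by the symmetry and two given maps. -/
def swapMap {A B C D : V} (x : B ⟶ C) (y : A ⟶ D) (R : V) : A ⊗ (B ⊗ R) ⟶ C ⊗ (D ⊗ R) :=
  (α_ A B R).inv ≫ (((β_ A B).hom ≫ (x ⊗ₘ y)) ▷ R) ≫ (α_ C D R).hom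

lemma swapMap_natural {A B C D A' B' C' D' R R' : V} (x : B ⟶ C) (y : A ⟶ D) (x' : B' ⟶ C')
    (y' : A' ⟶ D') (a : A ⟶ A') (b : B ⟶ B') (c : C ⟶ C') (d : D ⟶ D') (r : R ⟶ R')
    (h : b ≫ x' = x ≫ c) (k : a ≫ y' = y ≫ d) :
    (a ⊗ₘ (b ⊗ₘ r)) ≫ swapMap x' y' R' = swapMap x y R ≫ (c ⊗ₘ (d ⊗ₘ r)) := by
  have h1 : (a ⊗ₘ b) ≫ (β_ A' B').hom ≫ (x' ⊗ₘ y') =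
      ((β_ A B).hom ≫ (x ⊗ₘ y)) ≫ (c ⊗ₘ d) := by
    rw [BraidedCategory.braiding_naturality_assoc, tensorHom_comp_tensorHom, h, k,
      ← tensorHom_comp_tensorHom, Category.assoc]
  simp only [swapMap, Category.assoc]
  rw [associator_inv_naturality_assoc, ← associator_naturality]
  simp only [← Category.assoc]
  congr 1
  simp only [Category.assoc]
  congr 1
  rw [← tensorHom_id, ← tensorHom_id, tensorHom_comp_tensorHom, tensorHom_comp_tensorHom, h1]
  simp

lemma swapMap_swapMap {A B C D : V} (x : B ≅ C) (y : A ≅ D) (R : V) :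
    swapMap x.hom y.hom R ≫ swapMap y.inv x.inv R = 𝟙 _ := by
  have h1 : ((β_ A B).hom ≫ (x.hom ⊗ₘ y.hom)) ≫ (β_ C D).hom ≫ (y.inv ⊗ₘ x.inv) = 𝟙 _ := by
    rw [Category.assoc, BraidedCategory.braiding_naturality_assoc, tensorHom_comp_tensorHom]
    simp
  simp only [swapMap, Category.assoc, Iso.hom_inv_id_assoc]
  rw [← comp_whiskerRight_assoc, h1]
  simp

lemma swapMap_hexagon (A B C R : V) :
    swapMap (𝟙 B) (𝟙 A) (C ⊗ R) ≫ (B ◁ swapMap (𝟙 C) (𝟙 A) R) ≫ swapMap (𝟙 C) (𝟙 B) (A ⊗ R) =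
      (A ◁ swapMap (𝟙 C) (𝟙 B) R) ≫ swapMap (𝟙 C) (𝟙 A) (B ⊗ R) ≫
        (C ◁ swapMap (𝟙 B) (𝟙 A) R) := by
  have h := BraidedCategory.yang_baxter A B C
  have h1 := congrArg (fun f => (α_ A (B ⊗ C) R).inv ≫ (f ▷ R)) h
  have : ∀ {X Y Z : V}, swapMap (𝟙 Y) (𝟙 X) Z = (α_ X Y Z).inv ≫ (β_ X Y).hom ▷ Z ≫ (α_ Y X Z).hom := by
    intros; simp [swapMap]
  simp only [this]
  have e1 : (α_ A B (C ⊗ R)).inv ≫ (β_ A B).hom ▷ (C ⊗ R) ≫ (α_ B A (C ⊗ R)).hom ≫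
     B ◁ ((α_ A C R).inv ≫ (β_ A C).hom ▷ R ≫ (α_ C A R).hom) ≫
     (α_ B C (A ⊗ R)).inv ≫ (β_ B C).hom ▷ (A ⊗ R) ≫ (α_ C B (A ⊗ R)).hom = 
     A ◁ (α_ B C R).inv ≫ (α_ A (B ⊗ C) R).inv ≫ (((α_ A B C).inv ≫ (β_ A B).hom ▷ C ≫ (α_ B A C).hom ≫ B ◁ (β_ A C).hom ≫ (α_ B C A).inv ≫ (β_ B C).hom ▷ A ≫ (α_ C B A).hom) ▷ R) ≫ (α_ C (B ⊗ A) R).hom ≫ C ◁ (α_ B A R).hom := by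
    monoidal
  have e2 : A ◁ ((α_ B C R).inv ≫ (β_ B C).hom ▷ R ≫ (α_ C B R).hom) ≫ (α_ A C (B ⊗ R)).inv ≫ (β_ A C).hom ▷ (B ⊗ R) ≫ (α_ C A (B ⊗ R)).hom ≫
     C ◁ ((α_ A B R).inv ≫ (β_ A B).hom ▷ R ≫ (α_ B A R).hom) =
     A ◁ (α_ B C R).inv ≫ (α_ A (B ⊗ C) R).inv ≫ ((A ◁ (β_ B C).hom ≫ (α_ A C B).inv ≫ (β_ A C).hom ▷ B ≫ (α_ C A B).hom ≫ C ◁ (β_ A B).hom) ▷ R) ≫ (α_ C (B ⊗ A) R).hom ≫ C ◁ (α_ B A R).hom := by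
    monoidal
  simp only [Category.assoc] at e1 e2 ⊢
  rw [e1, e2, h]

lemma swapMap_left {A B C B₁ A₁ C₁ A₂ C₂ B₂ R : V} (x₁ : B ⟶ B₁) (y₁ : A ⟶ A₁) (x₂ : C ⟶ C₁)
    (y₂ : A₁ ⟶ A₂) (x₃ : C₁ ⟶ C₂) (y₃ : B₁ ⟶ B₂) :
    swapMap x₁ y₁ (C ⊗ R) ≫ (B₁ ◁ swapMap x₂ y₂ R) ≫ swapMap x₃ y₃ (A₂ ⊗ R) =
      (swapMap (𝟙 B) (𝟙 A) (C ⊗ R) ≫ (B ◁ swapMap (𝟙 C) (𝟙 A) R) ≫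
        swapMap (𝟙 C) (𝟙 B) (A ⊗ R)) ≫ ((x₂ ≫ x₃) ⊗ₘ ((x₁ ≫ y₃) ⊗ₘ ((y₁ ≫ y₂) ⊗ₘ 𝟙 R))) := by
  have h1 := swapMap_natural (𝟙 B) (𝟙 A) x₁ y₁ (𝟙 A) (𝟙 B) x₁ y₁ (𝟙 (C ⊗ R)) rfl rfl
  have h2 := swapMap_natural (𝟙 C) (𝟙 A) x₂ y₂ y₁ (𝟙 C) x₂ (y₁ ≫ y₂) (𝟙 R) rfl (by simp)
  have h3 := swapMap_natural (𝟙 C) (𝟙 B) x₃ y₃ x₁ x₂ (x₂ ≫ x₃) (x₁ ≫ y₃)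
    ((y₁ ≫ y₂) ⊗ₘ 𝟙 R) (by simp) (by simp)
  have h4 : (x₁ ⊗ₘ (y₁ ⊗ₘ 𝟙 (C ⊗ R))) ≫ (B₁ ◁ swapMap x₂ y₂ R) =
      (B ◁ swapMap (𝟙 C) (𝟙 A) R) ≫ (x₁ ⊗ₘ (x₂ ⊗ₘ ((y₁ ≫ y₂) ⊗ₘ 𝟙 R))) := by
    rw [← id_tensorHom, ← id_tensorHom, tensorHom_comp_tensorHom, tensorHom_comp_tensorHom, ← h2]
    simp
  have h1' : swapMap x₁ y₁ (C ⊗ R) =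
      swapMap (𝟙 B) (𝟙 A) (C ⊗ R) ≫ (x₁ ⊗ₘ (y₁ ⊗ₘ 𝟙 (C ⊗ R))) := by
    rw [← h1]; simp
  rw [h1', Category.assoc, reassoc_of% h4, h3]
  simp only [Category.assoc]

lemma swapMap_right {A B C B₁ A₁ C₁ A₂ C₂ B₂ R : V} (x₁ : C ⟶ C₁) (y₁ : B ⟶ B₁) (x₂ : C₁ ⟶ C₂)
    (y₂ : A ⟶ A₁) (x₃ : B₁ ⟶ B₂) (y₃ : A₁ ⟶ A₂) :
    (A ◁ swapMap x₁ y₁ R) ≫ swapMap x₂ y₂ (B₁ ⊗ R) ≫ (C₂ ◁ swapMap x₃ y₃ R) =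
      ((A ◁ swapMap (𝟙 C) (𝟙 B) R) ≫ swapMap (𝟙 C) (𝟙 A) (B ⊗ R) ≫
        (C ◁ swapMap (𝟙 B) (𝟙 A) R)) ≫
          ((x₁ ≫ x₂) ⊗ₘ ((y₁ ≫ x₃) ⊗ₘ ((y₂ ≫ y₃) ⊗ₘ 𝟙 R))) := by
  have h1 := swapMap_natural (𝟙 C) (𝟙 B) x₁ y₁ (𝟙 B) (𝟙 C) x₁ y₁ (𝟙 R) rfl rfl
  have h2 := swapMap_natural (𝟙 C) (𝟙 A) x₂ y₂ (𝟙 A) x₁ (x₁ ≫ x₂) y₂ (y₁ ⊗ₘ 𝟙 R)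
    (by simp) (by simp)
  have h3 := swapMap_natural (𝟙 B) (𝟙 A) x₃ y₃ y₂ y₁ (y₁ ≫ x₃) (y₂ ≫ y₃) (𝟙 R)
    (by simp) (by simp)
  have h1' : A ◁ swapMap x₁ y₁ R =
      (A ◁ swapMap (𝟙 C) (𝟙 B) R) ≫ (𝟙 A ⊗ₘ (x₁ ⊗ₘ (y₁ ⊗ₘ 𝟙 R))) := by
    rw [id_tensorHom, ← whiskerLeft_comp, ← h1]; simp
  have h4 : ((x₁ ≫ x₂) ⊗ₘ (y₂ ⊗ₘ (y₁ ⊗ₘ 𝟙 R))) ≫ (C₂ ◁ swapMap x₃ y₃ R) =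
      (C ◁ swapMap (𝟙 B) (𝟙 A) R) ≫
        ((x₁ ≫ x₂) ⊗ₘ ((y₁ ≫ x₃) ⊗ₘ ((y₂ ≫ y₃) ⊗ₘ 𝟙 R))) := by
    rw [← id_tensorHom, ← id_tensorHom, tensorHom_comp_tensorHom, tensorHom_comp_tensorHom, ← h3]
    simp
  rw [h1', Category.assoc, reassoc_of% h2, h4]
  simp only [Category.assoc]

lemma swapMap_hexagon' {A B C B₁ A₁ C₁ A₂ C₂ B₂ A₃ B₃ C₃ R : V} (x₁ : B ⟶ B₁) (y₁ : A ⟶ A₁)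
    (x₂ : C ⟶ C₁) (y₂ : A₁ ⟶ A₂) (x₃ : C₁ ⟶ C₂) (y₃ : B₁ ⟶ B₂) (x₁' : C ⟶ C₃) (y₁' : B ⟶ B₃)
    (x₂' : C₃ ⟶ C₂) (y₂' : A ⟶ A₃) (x₃' : B₃ ⟶ B₂) (y₃' : A₃ ⟶ A₂) (h₁ : x₂ ≫ x₃ = x₁' ≫ x₂')
    (h₂ : x₁ ≫ y₃ = y₁' ≫ x₃') (h₃ : y₁ ≫ y₂ = y₂' ≫ y₃') :
    swapMap x₁ y₁ (C ⊗ R) ≫ (B₁ ◁ swapMap x₂ y₂ R) ≫ swapMap x₃ y₃ (A₂ ⊗ R) =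
      (A ◁ swapMap x₁' y₁' R) ≫ swapMap x₂' y₂' (B₃ ⊗ R) ≫ (C₂ ◁ swapMap x₃' y₃' R) := by
  rw [swapMap_left, swapMap_right, swapMap_hexagon, h₁, h₂, h₃]

end SwapMap

section Whisker

variable {V : Type u'} [Category.{v'} V] [MonoidalCategory V]

lemma whisker_square (X : V) {A B B' C : V} {f : A ⟶ B} {g : B ⟶ C} {f' : A ⟶ B'} {g' : B' ⟶ C}
    (h : f ≫ g = f' ≫ g') : (X ◁ f) ≫ (X ◁ g) = (X ◁ f') ≫ (X ◁ g') := by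
  rw [← whiskerLeft_comp, ← whiskerLeft_comp, h]

lemma whisker_hexagon (X : V) {A B C B' C' D : V} {f : A ⟶ B} {g : B ⟶ C} {k : C ⟶ D}
    {f' : A ⟶ B'} {g' : B' ⟶ C'} {k' : C' ⟶ D} (h : f ≫ g ≫ k = f' ≫ g' ≫ k') :
    (X ◁ f) ≫ (X ◁ g) ≫ (X ◁ k) = (X ◁ f') ≫ (X ◁ g') ≫ (X ◁ k') := by
  rw [← whiskerLeft_comp, ← whiskerLeft_comp, ← whiskerLeft_comp, ← whiskerLeft_comp, h]

lemma tensor_square {X Y : V} (x : X ⟶ Y) {A B B' C : V} {f : A ⟶ B} {g : B ⟶ C} {f' : A ⟶ B'}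
    {g' : B' ⟶ C} (h : f ≫ g = f' ≫ g') : (x ⊗ₘ f) ≫ (Y ◁ g) = (X ◁ f') ≫ (x ⊗ₘ g') := by
  rw [← id_tensorHom, ← id_tensorHom, tensorHom_comp_tensorHom, tensorHom_comp_tensorHom, h,
    Category.id_comp, Category.comp_id]

end Whisker

section TowerFunctor

variable {O : Type u} [Category.{v} O] [GradedOperadicCategory O]

namespace Tower

/-- `E(𝒯) = E[t₁] ⊗ ⋯ ⊗ E[t_k]` for a tower `𝒯` with fiber sequence `t₁, …, t_k`. -/
def tensor {V : Type u'} [Category.{v'} V] [MonoidalCategory V] (E : Collection O V) :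
    ∀ {T : O}, Tower T → V
  | T, .last _ h => E.obj (op (QVrt.mk T h))
  | _, .cons φ r => E.obj (op (QVrt.mk φ.fiber φ.fiber_pos)) ⊗ r.tensor E

/-- The contravariant action of a morphism of towers on `E(𝒯)`. -/
def Hom.map {V : Type u'} [Category.{v'} V] [MonoidalCategory V] (E : Collection O V) :
    ∀ {T' T'' : O} {A : Tower T'} {B : Tower T''} {σ : T' ≅ T''}, Hom A B σ →
      (B.tensor E ⟶ A.tensor E)
  | _, _, _, _, _, .last h' h'' σ =>
      E.map (QVrt.hom (hT := h') (hS := h'') σ rfl rfl).op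
  | _, _, _, _, _, .cons w f =>
      E.map (ElementarySquare.fiberClass ⟨_, _, w⟩).op ⊗ₘ f.map E

lemma Hom.map_id {V : Type u'} [Category.{v'} V] [MonoidalCategory V] (E : Collection O V) :
    ∀ {T : O} (A : Tower T), (Hom.id A).map E = 𝟙 _
  | _, .last T h => (congrArg (fun x => E.map (Quiver.Hom.op x)) (QVrt.hom_refl rfl)).trans
      (E.map_id _)
  | _, .cons φ r => by
      refine Eq.trans (congrArg₂ (fun x y => x ⊗ₘ y) (congrArg (fun x => E.map (Quiver.Hom.op x))
        (ElementarySquare.fiberClass_refl φ)) (Hom.map_id E r)) ?_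
      exact (congrArg (fun x => x ⊗ₘ 𝟙 _) (E.map_id _)).trans (id_tensorHom_id _ _)

lemma Hom.map_comp {V : Type u'} [Category.{v'} V] [MonoidalCategory V] (E : Collection O V) :
    ∀ {T T' T'' : O} {A : Tower T} {B : Tower T'} {C : Tower T''} {σ : T ≅ T'}
      {ρ : T' ≅ T''} (f : Hom A B σ) (g : Hom B C ρ), (f.comp g).map E = g.map E ≫ f.map E
  | _, _, _, _, _, _, _, _, .last h _ σ, .last _ h' ρ =>
      (congrArg (fun x => E.map (Quiver.Hom.op x)) (QVrt.hom_trans σ ρ rfl rfl rfl).symm).trans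
        (E.map_comp _ _)
  | _, _, _, _, _, _, _, _, .cons w f, .cons w' f' => by
      refine Eq.trans (congrArg₂ (fun x y => x ⊗ₘ y) (congrArg (fun x => E.map (Quiver.Hom.op x))
        (ElementarySquare.fiberClass_trans ⟨_, _, w⟩ ⟨_, _, w'⟩)) (Hom.map_comp E f f')) ?_
      exact (congrArg (fun x => x ⊗ₘ _) (E.map_comp _ _)).trans
        (MonoidalCategory.tensorHom_comp_tensorHom _ _ _ _).symm

variable [StandingAssumptions O] {V : Type u'} [Category.{v'} V] [MonoidalCategory V]
  [SymmetricCategory V]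

/-- The action of a move on `E(𝒯)`: the symmetry of `V` exchanges the two factors, after the
identification of the fibers. -/
noncomputable def Swap.map (E : Collection O V) : ∀ {T : O} {A B : Tower T}, Swap A B →
    (B.tensor E ⟶ A.tensor E)
  | _, _, _, .here q r => swapMap (E.map q.cross.hom.op) (E.map q.symm.cross.inv.op) (r.tensor E)
  | _, _, _, .there φ s => E.obj (op (QVrt.mk φ.fiber φ.fiber_pos)) ◁ s.map E

lemma Swap.map_symm (E : Collection O V) : ∀ {T : O} {A B : Tower T} (s : Swap A B),
    s.symm.map E ≫ s.map E = 𝟙 _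
  | _, _, _, .here q r =>
      swapMap_swapMap (E.mapIso q.symm.cross.op) (E.mapIso q.cross.symm.op) (r.tensor E)
  | _, _, _, .there φ s =>
      (whiskerLeft_comp _ _ _).symm.trans
        ((congrArg (fun x => _ ◁ x) (Swap.map_symm E s)).trans (whiskerLeft_id _ _))

lemma Swap.Natural.map_eq (E : Collection O V) {T T' : O} {A B : Tower T} {A' B' : Tower T'}
    {σ : T ≅ T'} {s : Swap A B} {s' : Swap A' B'} {f : Hom A A' σ} {g : Hom B B' σ}
    (h : Swap.Natural s s' f g) : g.map E ≫ s.map E = s'.map E ≫ f.map E := by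
  induction h with
  | here q q' f w₁ w₁' w₂ w₂' =>
    simp only [Hom.map, Swap.map]
    refine swapMap_natural _ _ _ _ _ _ _ _ _ ?_ ?_
    · rw [← E.map_comp, ← E.map_comp, ← op_comp, ← op_comp]
      exact congrArg (fun x => E.map (Quiver.Hom.op x))
        (DisjointSquare.cross_natural q q' ⟨_, _, w₁⟩ ⟨_, _, w₁'⟩ ⟨_, _, w₂⟩ ⟨_, _, w₂'⟩
          rfl rfl rfl)
    · rw [← E.map_comp, ← E.map_comp, ← op_comp, ← op_comp]
      refine congrArg (fun x => E.map (Quiver.Hom.op x)) ?_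
      have h1 := DisjointSquare.cross_natural q.symm q'.symm ⟨_, _, w₂⟩ ⟨_, _, w₂'⟩ ⟨_, _, w₁⟩
        ⟨_, _, w₁'⟩ rfl rfl rfl
      rw [Iso.inv_comp_eq, ← Category.assoc, h1, Category.assoc, Iso.hom_inv_id]
      exact (Category.comp_id _).symm
  | there w h ih =>
    exact tensor_square _ ih

lemma Swap.Distant.map_eq (E : Collection O V) {T : O} {A B C D : Tower T} {s₁ : Swap A B}
    {s₂ : Swap B D} {s₃ : Swap A C} {s₄ : Swap C D} (h : Swap.Distant s₁ s₂ s₃ s₄) :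
    s₂.map E ≫ s₁.map E = s₄.map E ≫ s₃.map E := by
  induction h with
  | here q s =>
    simp only [Swap.map]
    have := swapMap_natural (E.map q.cross.hom.op) (E.map q.symm.cross.inv.op)
      (E.map q.cross.hom.op) (E.map q.symm.cross.inv.op) (𝟙 _) (𝟙 _) (𝟙 _) (𝟙 _) (s.map E)
      (by simp) (by simp)
    simp only [id_tensorHom] at this
    exact this
  | there φ h ih => exact whisker_square _ ih

lemma Swap.Hexagon.map_eq (E : Collection O V) {T : O} {A B C A' B' D : Tower T}
    {s₁ : Swap A B} {s₂ : Swap B C} {s₃ : Swap C D} {s₄ : Swap A A'} {s₅ : Swap A' B'}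
    {s₆ : Swap B' D} (h : Swap.Hexagon s₁ s₂ s₃ s₄ s₅ s₆) :
    s₃.map E ≫ s₂.map E ≫ s₁.map E = s₆.map E ≫ s₅.map E ≫ s₄.map E := by
  induction h with
  | @here T P P' P'' Q Q' Q'' S a₁ a₂ a₃ b₁ b₂ b₃ c₁ c₂ c₃ d₁ d₂ d₃ q₁ q₂ q₃ q₄ q₅ q₆ r =>
    have e₁ : q₁.cross.hom ≫ q₂.cross.hom = q₅.cross.hom ≫ q₆.cross.hom :=
      DisjointSquare.cross_cross q₁ q₂ (q₄.over'.trans_ne q₆.disjoint) q₅ q₆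
        (q₄.over''.trans_ne q₂.disjoint) q₃.w
    have e₂ : q₃.cross.hom ≫ q₆.symm.cross.hom = q₁.symm.cross.hom ≫ q₄.cross.hom :=
      DisjointSquare.cross_cross q₃ q₆.symm (q₂.over''.trans_ne q₄.disjoint) q₁.symm q₄
        (q₂.over'.trans_ne q₆.disjoint.symm) q₅.w.symm
    have e₃ : q₃.symm.cross.hom ≫ q₂.symm.cross.hom = q₅.symm.cross.hom ≫ q₄.symm.cross.hom :=
      DisjointSquare.cross_cross q₃.symm q₂.symm (q₆.over''.trans_ne q₄.disjoint.symm) q₅.symm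
        q₄.symm (q₆.over'.trans_ne q₂.disjoint.symm) q₁.w.symm
    refine swapMap_hexagon' _ _ _ _ _ _ _ _ _ _ _ _ ?_ ?_ ?_
    · rw [← E.map_comp, ← E.map_comp, ← op_comp, ← op_comp, e₁]
    · rw [← E.map_comp, ← E.map_comp, ← op_comp, ← op_comp]
      refine congrArg (fun x => E.map (Quiver.Hom.op x)) ?_
      rw [Iso.inv_comp_eq, ← Category.assoc, ← e₂, Category.assoc, Iso.hom_inv_id]
      exact (Category.comp_id _).symm
    · rw [← E.map_comp, ← E.map_comp, ← op_comp, ← op_comp]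
      refine congrArg (fun x => E.map (Quiver.Hom.op x)) ?_
      have e₄ : q₃.symm.cross ≪≫ q₂.symm.cross = q₅.symm.cross ≪≫ q₄.symm.cross := Iso.ext e₃
      exact congrArg Iso.inv e₄
  | there φ h ih => exact whisker_hexagon _ ih

end Tower

end TowerFunctor

/-! ## Labelled towers -/

section LabelledTowers

variable {O : Type u} [Category.{v} O] [GradedOperadicCategory O]

/-- A labelled tower: a tower with an isomorphism from `X` to its initial term. -/
structure LabelledTower (X : O) where
  base : O
  label : X ≅ base
  tower : Tower base

/-- The generating morphisms of labelled towers: those of the first type, given by morphisms of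
towers, and those of the second type, given by moves. -/
inductive LabelledTower.Gen {X : O} : LabelledTower X → LabelledTower X → Type (max u v)
  | first {a b : LabelledTower X} (σ : a.base ≅ b.base) (w : a.label ≪≫ σ = b.label)
      (f : Tower.Hom a.tower b.tower σ) : Gen a b
  | second {T : O} (ℓ : X ≅ T) {A B : Tower T} (s : Tower.Swap A B) : Gen ⟨T, ℓ, A⟩ ⟨T, ℓ, B⟩

/-- The commutativity relations between the generating morphisms. -/
inductive LabelledTower.Rel {X : O} : ∀ a b : LabelledTower X, Word Gen a b → Word Gen a b → Prop
  | id (a : LabelledTower X) :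
      Rel a a (.gen (.first (Iso.refl _) (Iso.trans_refl _) (Tower.Hom.id a.tower))) (.id a)
  | comp {a b c : LabelledTower X} (σ : a.base ≅ b.base) (w : a.label ≪≫ σ = b.label)
      (f : Tower.Hom a.tower b.tower σ) (ρ : b.base ≅ c.base) (w' : b.label ≪≫ ρ = c.label)
      (g : Tower.Hom b.tower c.tower ρ) :
      Rel a c (.comp (.gen (.first σ w f)) (.gen (.first ρ w' g)))
        (.gen (.first (σ ≪≫ ρ) (by rw [← w', ← w, Iso.trans_assoc]) (f.comp g)))
  | symm {T : O} (ℓ : X ≅ T) {A B : Tower T} (s : Tower.Swap A B) :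
      Rel ⟨T, ℓ, A⟩ ⟨T, ℓ, A⟩ (.comp (.gen (.second ℓ s)) (.gen (.second ℓ s.symm))) (.id _)
  | natural {T T' : O} (ℓ : X ≅ T) {σ : T ≅ T'} {A B : Tower T} {A' B' : Tower T'}
      {s : Tower.Swap A B} {s' : Tower.Swap A' B'} {f : Tower.Hom A A' σ} {g : Tower.Hom B B' σ}
      (h : Tower.Swap.Natural s s' f g) :
      Rel ⟨T, ℓ, A⟩ ⟨T', ℓ ≪≫ σ, B'⟩ (.comp (.gen (.second ℓ s)) (.gen (.first σ rfl g)))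
        (.comp (.gen (.first σ rfl f)) (.gen (.second (ℓ ≪≫ σ) s')))
  | distant {T : O} (ℓ : X ≅ T) {A B C D : Tower T} {s₁ : Tower.Swap A B} {s₂ : Tower.Swap B D}
      {s₃ : Tower.Swap A C} {s₄ : Tower.Swap C D} (h : Tower.Swap.Distant s₁ s₂ s₃ s₄) :
      Rel ⟨T, ℓ, A⟩ ⟨T, ℓ, D⟩ (.comp (.gen (.second ℓ s₁)) (.gen (.second ℓ s₂)))
        (.comp (.gen (.second ℓ s₃)) (.gen (.second ℓ s₄)))
  | hexagon {T : O} (ℓ : X ≅ T) {A B C A' B' D : Tower T} {s₁ : Tower.Swap A B}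
      {s₂ : Tower.Swap B C} {s₃ : Tower.Swap C D} {s₄ : Tower.Swap A A'} {s₅ : Tower.Swap A' B'}
      {s₆ : Tower.Swap B' D} (h : Tower.Swap.Hexagon s₁ s₂ s₃ s₄ s₅ s₆) :
      Rel ⟨T, ℓ, A⟩ ⟨T, ℓ, D⟩
        (.comp (.comp (.gen (.second ℓ s₁)) (.gen (.second ℓ s₂))) (.gen (.second ℓ s₃)))
        (.comp (.comp (.gen (.second ℓ s₄)) (.gen (.second ℓ s₅))) (.gen (.second ℓ s₆)))

/-- The groupoid of labelled towers under `X`. -/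
abbrev LTw (X : O) := Presented (LabelledTower.Rel (X := X))

variable [StandingAssumptions O] {V : Type u'} [Category.{v'} V] [MonoidalCategory V]
  [SymmetricCategory V]

/-- The contravariant action of a generating morphism on `E(ℓ, 𝒯) = E(𝒯)`. -/
noncomputable def LabelledTower.Gen.map {X : O} (E : Collection O V) {a b : LabelledTower X} :
    Gen a b → (b.tower.tensor E ⟶ a.tower.tensor E)
  | .first _ _ f => f.map E
  | .second _ s => s.map E

/-- The functor `E` on the groupoid of labelled towers under `X`. -/
noncomputable def towerDiagram (E : Collection O V) (X : O) : (LTw X)ᵒᵖ ⥤ V :=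
  (Presented.lift (C := Vᵒᵖ) (fun a : LabelledTower X => op (a.tower.tensor E))
    (fun g => (g.map E).op) (by
      intro a b p q hr
      apply Quiver.Hom.unop_inj
      cases hr with
      | id a => exact Tower.Hom.map_id E a.tower
      | comp σ w f ρ w' g => exact (Tower.Hom.map_comp E f g).symm
      | symm ℓ s => exact Tower.Swap.map_symm E s
      | natural ℓ h => exact h.map_eq E
      | distant ℓ h => exact h.map_eq E
      | hexagon ℓ h => exact h.map_eq E)).leftOp

namespace Tower

/-- The composite `e₁ ⊗ ⋯ ⊗ e_k ↦ y(e₁) ∘_{τ₁} (y(e₂) ∘_{τ₂} ⋯ (y(e_{k-1}) ∘_{τ_{k-1}} y(e_k)))` in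
an operad `M`, where `x ∘_τ z` is the circle product of `z ⊗ x`, for a map of collections
`y : E ⟶ □ M`. -/
noncomputable def eval {E : Collection O V} {M : ConnectedMarklOperad O V}
    (y : E ⟶ (ConnectedMarklOperad.forget O V).obj M) :
    ∀ {T : O} (A : Tower T), A.tensor E ⟶ M.val T
  | T, .last _ h => y.app (op (QVrt.mk T h))
  | _, .cons (S := S) φ r =>
      (y.app (op (QVrt.mk φ.fiber φ.fiber_pos)) ⊗ₘ r.eval y) ≫
        (β_ (M.val φ.fiber) (M.val S)).hom ≫ M.circ φ

end Tower

/-- The map `E(ℓ, 𝒯) ⟶ M(X)` given by the composite in `M` and the action of the labeling. -/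
noncomputable def LabelledTower.eval {E : Collection O V} {M : ConnectedMarklOperad O V}
    (y : E ⟶ (ConnectedMarklOperad.forget O V).obj M) {X : O} (a : LabelledTower X) :
    a.tower.tensor E ⟶ M.val X :=
  a.tower.eval y ≫ M.pull a.label

end LabelledTowers

end OpCat

open OpCat CategoryTheory.Limits

namespace OpCat

open OperadicData
open OpCat.GradedOperadicCategory (grade grade_eq)

set_option linter.unusedSectionVars false

/-! ## Lifting along fibers -/

section Lifting

variable {O : Type u} [Category.{v} O]

/-! The free operad is obtained from a weaker free object. A `TowerModule` over `E` is a presheaf on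
the isomorphisms of `O` on which only the generators `E` act, along elementary morphisms, subject to
equivariance and commutativity and with units in grade 0. Acting successively along the morphisms of
a tower, starting from a unit, gives a cocone on the labelled towers under each object, and a module
is free (`TowerModule.IsFree`) if these cocones are colimits and its units are invertible. The
colimits do form a free module (`freeModule`): an elementary morphism acts by being put in front of
a tower, after it has been transported along the label.

The main point is that a free module carries circle products `P(F) ⊗ P(S) ⟶ P(T)` for every
elementary `T ⟶ S` with fiber `F`. The blow up axiom says that a map over `S` can be built,
uniquely, from prescribed maps of fibers (`lift_exists`, `lift_unique`, `lift_hom`). Hence an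
elementary morphism out of `F` is realized by a factorization of `T ⟶ S`, unique up to isomorphism
(`exists_refinement`, `Refinement.exists_square`). Repeating this inserts a whole tower under `F`
into the fiber (`Tower.insert`). The insertion respects both types of morphisms of towers, so it
descends to the colimit as `TowerModule.IsFree.circ`.

The product is governed by two rules: on generators it is the action (`gen_circ`), and on an element
decomposed by an elementary `γ` it is computed from a refinement realizing `γ` (`act_circ`). Since
an elementary morphism strictly lowers the grade, the axioms follow by induction on the grade of the
fiber: `circ_assoc`, `circ_equivariant`, and `circ_comm`, the last by running one induction twice,
first against the action and then against the product itself.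

Multiplication by a unit at a local terminal object is so far only a map `theta`, not an identity.
It is invertible (`isIso_theta`) and compatible with composition. By the unique fiber axiom, a map
from a given object to a local terminal object is determined by its fiber, so the values can be
moved coherently to one representative in each virtual class. After this transport all `theta` are
identities (`strictOperad`).

For the universal property, a `1`-connected operad is a module over its own collection, hence over
`E` by restriction along `y`. There is one module map from the free module to it, and `circ_comp`,
again by induction on the grade, shows that this map preserves circle products. -/

lemma fiberMap_congr [OperadicData O] {T S R : O} {f f' : T ⟶ S} {g : S ⟶ R} {h h' : T ⟶ R}
    (hf : f = f') (hh : h = h') {i i' : Fin (card R)} (hi : i = i') (w : f ≫ g = h)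
    (w' : f' ≫ g = h') :
    fiberMap f g h w i = eqToHom (by rw [hh, hi]) ≫ fiberMap f' g h' w' i' ≫
      eqToHom (by rw [hi]) := by
  subst hf hh hi; simp

variable [GradedOperadicCategory O]

lemma isOrderPreserving_of_card_target {X Y : O} (f : X ⟶ Y) (h : card Y = 1) :
    IsOrderPreserving f := fun x y _ => by
  have : Subsingleton (Fin (card Y)) := by rw [h]; infer_instance
  exact (Subsingleton.elim _ _).le

lemma isOrderPreserving_eqToHom {X Y : O} (h : X = Y) : IsOrderPreserving (eqToHom h) := by
  subst h
  unfold IsOrderPreserving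
  rw [eqToHom_refl, OperadicCategory.cardMap_id]
  exact monotone_id

lemma isQuasibijection_eqToHom {X Y : O} (h : X = Y) : IsQuasibijection (eqToHom h) := by
  subst h; exact OperadicCategory.id_quasibijection X

lemma zigzag_of_hom_hom {X Y Z : O} (f : X ⟶ Y) (g : X ⟶ Z) : Zigzag Y Z :=
  (Zigzag.of_hom f).symm.trans (Zigzag.of_hom g)

/-- Each component has only one chosen local terminal object. Equalities of fibers, as opposed to
isomorphisms, originate here. -/
lemma IsTrivial.eq_of_zigzag {X Y : O} (hX : IsTrivial X) (hY : IsTrivial Y) (h : Zigzag X Y) :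
    X = Y := by
  obtain ⟨c, rfl⟩ := hX
  obtain ⟨d, rfl⟩ := hY
  congr 1
  rw [← OperadicCategory.mk_U c, ← OperadicCategory.mk_U d]
  exact Quotient.sound h

/-- The chosen local terminal object of the component of `T`. -/
def terminalOf (T : O) : O := OperadicData.U (Quotient.mk _ T : ConnectedComponents O)

lemma isTrivial_terminalOf (T : O) : IsTrivial (terminalOf T) := ⟨_, rfl⟩

lemma zigzag_terminalOf (T : O) : Zigzag T (terminalOf T) :=
  Quotient.exact (OperadicCategory.mk_U (Quotient.mk _ T : ConnectedComponents O)).symm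

/-- The map to a local terminal object of the same component. -/
noncomputable def IsLocalTerminal.from {T t : O} (ht : IsLocalTerminal t) (h : Zigzag T t) :
    T ⟶ t := (ht T h).some.default

noncomputable def toTerminal (T : O) : T ⟶ terminalOf T :=
  (isTrivial_terminalOf T).isLocalTerminal.from (zigzag_terminalOf T)

variable [StandingAssumptions O]

/-- The map to the chosen local terminal object of the component is between objects of grade 0,
hence invertible. This justifies the recurring case distinction between positive grade, where values
are colimits, and grade 0, where they are controlled by the units. -/
lemma isLocalTerminal_of_grade_eq_zero {T : O} (h : grade T = 0) : IsLocalTerminal T := by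
  have := StandingAssumptions.isIso_of_grade (toTerminal T)
    (by rw [h, grade_of_isTrivial (isTrivial_terminalOf T)])
  exact (isTrivial_terminalOf T).isLocalTerminal.of_iso (asIso (toTerminal T))

/-- The axiom gives uniqueness as an equality of structures. What is used later is an equality of
the middle objects along which the two factorizations correspond. -/
lemma BlowUp.eq_data {S' T' T'' : O} {f' : S' ⟶ T'} {s : T' ⟶ T''} {hs : IsQuasibijection s}
    {F : Fin (card T'') → O} {q : ∀ i, fiber f' i ⟶ F (cardMap s i)} {b b' : BlowUp f' s hs F q}
    (h : b = b') : ∃ e : b.obj = b'.obj, b.top ≫ eqToHom e = b'.top ∧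
      b.right = eqToHom e ≫ b'.right := by
  subst h; exact ⟨rfl, by simp⟩

lemma derivedMap_id {T S T₀ : O} (h : T ⟶ S) (p : T ⟶ T₀) (f : T₀ ⟶ S) (w : p ≫ f = h)
    (w' : p ≫ f = h ≫ 𝟙 S) (i : Fin (card S)) (hi : cardMap (𝟙 S) i = i) :
    derivedMap h (𝟙 S) (OperadicCategory.id_quasibijection S) p f w' i =
      fiberMap p f h w i ≫ eqToHom (by rw [hi]) := by
  unfold derivedMap
  rw [fiberMap_congr (f := p) rfl (Category.comp_id h) hi w' w]
  simp

lemma cardMap_id_apply (S : O) (i : Fin (card S)) : cardMap (𝟙 S) i = i := by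
  rw [OperadicCategory.cardMap_id]; rfl

/-- This is the blow up axiom with an identity as quasibijection. The identity moves no index, so
the derived sequence is simply the family of induced maps of fibers. -/
lemma lift_exists_of_orderPreserving {T S : O} (h : T ⟶ S) (hh : IsOrderPreserving h)
    (F : Fin (card S) → O) (q : ∀ i, fiber h i ⟶ F i) :
    ∃ (T₀ : O) (p : T ⟶ T₀) (f : T₀ ⟶ S) (w : p ≫ f = h) (e : ∀ i, fiber f i = F i),
      IsOrderPreserving f ∧ ∀ i, fiberMap p f h w i = q i ≫ eqToHom (e i).symm := by
  have hi := cardMap_id_apply S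
  obtain ⟨b, -⟩ := StandingAssumptions.blow_up h (𝟙 S) (OperadicCategory.id_quasibijection S) F
    (fun i => q i ≫ eqToHom (by rw [hi])) hh
  obtain ⟨T₀, p, f, w, hf, e, d⟩ := b.default
  have w₁ : p ≫ f = h := by rw [w, Category.comp_id]
  refine ⟨T₀, p, f, w₁, e, hf, fun i => ?_⟩
  have := d i
  rw [derivedMap_id h p f w₁ w i (hi i), Category.assoc, eqToHom_trans] at this
  rw [← cancel_mono (eqToHom ((congrArg (fiber f) (hi i).symm).trans (e _))), this]
  simp

lemma lift_unique_of_orderPreserving {T S T₀ T₁ : O} (h : T ⟶ S) (hh : IsOrderPreserving h)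
    (p : T ⟶ T₀) (f : T₀ ⟶ S) (w : p ≫ f = h) (hf : IsOrderPreserving f)
    (p' : T ⟶ T₁) (f' : T₁ ⟶ S) (w' : p' ≫ f' = h) (hf' : IsOrderPreserving f')
    (e : ∀ i, fiber f i = fiber f' i)
    (he : ∀ i, fiberMap p f h w i ≫ eqToHom (e i) = fiberMap p' f' h w' i) :
    ∃ e : T₀ = T₁, p ≫ eqToHom e = p' ∧ f = eqToHom e ≫ f' := by
  have hi := cardMap_id_apply S
  obtain ⟨b⟩ := StandingAssumptions.blow_up h (𝟙 S) (OperadicCategory.id_quasibijection S)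
    (fun i => fiber f' i) (fun i => fiberMap p' f' h w' i ≫ eqToHom (by rw [hi])) hh
  have w₁ : p ≫ f = h ≫ 𝟙 S := by rw [w, Category.comp_id]
  have w₂ : p' ≫ f' = h ≫ 𝟙 S := by rw [w', Category.comp_id]
  let b₁ : BlowUp h (𝟙 S) (OperadicCategory.id_quasibijection S)
      (fun i => fiber f' i) (fun i => fiberMap p' f' h w' i ≫ eqToHom (by rw [hi])) :=
    ⟨T₀, p, f, w₁, hf, e, fun i => by
      rw [derivedMap_id h p f w w₁ i (hi i), ← he i]; simp⟩
  let b₂ : BlowUp h (𝟙 S) (OperadicCategory.id_quasibijection S)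
      (fun i => fiber f' i) (fun i => fiberMap p' f' h w' i ≫ eqToHom (by rw [hi])) :=
    ⟨T₁, p', f', w₂, hf', fun i => rfl, fun i => by
      rw [derivedMap_id h p' f' w' w₂ i (hi i)]; simp⟩
  exact BlowUp.eq_data ((b.uniq b₁).trans (b.uniq b₂).symm)

/-- A map can be factored through an order preserving map with prescribed fibers and prescribed
induced maps of fibers. -/
lemma lift_exists {T S : O} (h : T ⟶ S) (F : Fin (card S) → O) (q : ∀ i, fiber h i ⟶ F i) :
    ∃ (T₀ : O) (p : T ⟶ T₀) (f : T₀ ⟶ S) (w : p ≫ f = h) (e : ∀ i, fiber f i = F i),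
      IsOrderPreserving f ∧ ∀ i, fiberMap p f h w i = q i ≫ eqToHom (e i).symm := by
  -- Quasibijections are invertible, so it suffices to treat the order preserving factor `g` and to
  -- move the fibers along `s`.
  obtain ⟨R, s, g, hs, hg, rfl⟩ := StandingAssumptions.factorizable h
  have := StandingAssumptions.isIso_of_quasibijection s hs
  let σ := fiberIso (asIso s) g (s ≫ g) rfl
  obtain ⟨T₀, p, f, w, e, hf, he⟩ := lift_exists_of_orderPreserving g hg F
    (fun i => (σ i).inv ≫ q i)
  refine ⟨T₀, s ≫ p, f, by rw [Category.assoc, w], e, hf, fun i => ?_⟩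
  rw [OperadicCategory.fiberMap_comp s p _ g f rfl w, he i]
  rw [Category.assoc]
  exact (σ i).hom_inv_id_assoc _

/-- The factorization of `lift_exists` is unique. -/
lemma lift_unique {T S T₀ T₁ : O} (h : T ⟶ S)
    (p : T ⟶ T₀) (f : T₀ ⟶ S) (w : p ≫ f = h) (hf : IsOrderPreserving f)
    (p' : T ⟶ T₁) (f' : T₁ ⟶ S) (w' : p' ≫ f' = h) (hf' : IsOrderPreserving f')
    (e : ∀ i, fiber f i = fiber f' i)
    (he : ∀ i, fiberMap p f h w i ≫ eqToHom (e i) = fiberMap p' f' h w' i) :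
    ∃ e : T₀ = T₁, p ≫ eqToHom e = p' ∧ f = eqToHom e ≫ f' := by
  obtain ⟨R, s, g, hs, hg, rfl⟩ := StandingAssumptions.factorizable h
  have := StandingAssumptions.isIso_of_quasibijection s hs
  let σ := fiberIso (asIso s) g (s ≫ g) rfl
  have w₁ : (inv s ≫ p) ≫ f = g := by rw [Category.assoc, w]; simp
  have w₁' : (inv s ≫ p') ≫ f' = g := by rw [Category.assoc, w']; simp
  have hσ : ∀ i, (σ i).inv = fiberMap (inv s) (s ≫ g) g (by simp) i := fun i => rfl
  obtain ⟨e₁, h₁, h₂⟩ := lift_unique_of_orderPreserving g hg (inv s ≫ p) f w₁ hf (inv s ≫ p') f'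
    w₁' hf' e (fun i => by
      rw [OperadicCategory.fiberMap_comp (inv s) p g (s ≫ g) f (by simp) w,
        OperadicCategory.fiberMap_comp (inv s) p' g (s ≫ g) f' (by simp) w', Category.assoc, he i])
  refine ⟨e₁, ?_, h₂⟩
  rw [← cancel_epi (inv s), ← h₁, Category.assoc]

/-- Maps over `S` from a factorization of a map to `S` are determined by the fibers. -/
lemma lift_hom {T S T₀ T₁ : O} (h : T ⟶ S)
    (p : T ⟶ T₀) (f : T₀ ⟶ S) (w : p ≫ f = h)
    (p' : T ⟶ T₁) (f' : T₁ ⟶ S) (w' : p' ≫ f' = h) (hf' : IsOrderPreserving f')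
    (q : ∀ i, fiber f i ⟶ fiber f' i)
    (hq : ∀ i, fiberMap p f h w i ≫ q i = fiberMap p' f' h w' i) :
    ∃ (θ : T₀ ⟶ T₁) (wθ : θ ≫ f' = f), p ≫ θ = p' ∧ ∀ i, fiberMap θ f' f wθ i = q i := by
  -- Changing the fibers of `f` by `q` gives a map `r`. Then `p ≫ r` and `p'` factor `h` with the
  -- same fibers and the same induced maps, so uniqueness identifies the target of `r` with `T₁`.
  obtain ⟨T₂, r, f₂, w₂, e, hf₂, he⟩ := lift_exists f _ q
  have w₃ : (p ≫ r) ≫ f₂ = h := by rw [Category.assoc, w₂, w]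
  obtain ⟨rfl, h₁, h₂⟩ := lift_unique h (p ≫ r) f₂ w₃ hf₂ p' f' w' hf' e (fun i => by
    rw [OperadicCategory.fiberMap_comp p r h f f₂ w w₂, he i, ← hq i]; simp)
  obtain rfl : f₂ = f' := by simpa using h₂
  exact ⟨r, w₂, by simpa using h₁, fun i => by rw [he i]; simp⟩

/-- An order preserving quasibijection is an identity. -/
lemma eq_of_quasibijection {X Y : O} (g : X ⟶ Y) (hg : IsOrderPreserving g)
    (hq : IsQuasibijection g) : ∃ e : X = Y, g = eqToHom e := by
  have hid := OperadicCategory.id_quasibijection Y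
  have e : ∀ i, fiber g i = fiber (𝟙 Y) i := fun i => (hq i).eq_of_zigzag (hid i)
    (Zigzag.of_hom (fiberMap g (𝟙 Y) g (Category.comp_id g) i))
  -- The factorizations `𝟙 X ≫ g` and `g ≫ 𝟙 Y` of `g` have equal trivial fibers, hence they
  -- coincide.
  obtain ⟨e, h₁, h₂⟩ := lift_unique g (𝟙 X) g (Category.id_comp g) hg g (𝟙 Y) (Category.comp_id g)
    (isOrderPreserving_eqToHom rfl) e (fun i => (hid i).isLocalTerminal.hom_ext _ _)
  exact ⟨e, by rw [← h₁, Category.id_comp]⟩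

/-- The grade of the source is the grade of `S` plus those of the fibers, so `p` preserves the grade
and is therefore invertible. This is how lifts that change fibers only up to isomorphism are
recognized as isomorphisms. -/
lemma isIso_of_grade_fiber_eq {T S T₀ : O} (h : T ⟶ S) (p : T ⟶ T₀) (f : T₀ ⟶ S)
    (hq : ∀ i, grade (fiber h i) = grade (fiber f i)) : IsIso p := by
  apply StandingAssumptions.isIso_of_grade
  rw [← grade_eq h, ← grade_eq f]
  simp only [hq]

/-- Every map to `S` becomes order preserving after an isomorphism which preserves the fibers of
positive grade and makes the fibers of grade `0` trivial. -/
lemma exists_normalization {T S : O} (h : T ⟶ S) :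
    ∃ (T₀ : O) (τ : T ≅ T₀) (f : T₀ ⟶ S) (w : τ.hom ≫ f = h), IsOrderPreserving f ∧
      ∀ i, (grade (fiber h i) = 0 → IsTrivial (fiber f i)) ∧
        (1 ≤ grade (fiber h i) → ∃ e, fiberMap τ.hom f h w i = eqToHom e) := by
  classical
  -- A fiber of grade 0 is replaced by the chosen local terminal object of its component and all
  -- others are kept. No grade changes, so the resulting lift is invertible.
  let F : Fin (card S) → O := fun i =>
    if grade (fiber h i) = 0 then terminalOf (fiber h i) else fiber h i
  have hF : ∀ i, grade (fiber h i) = 0 → F i = terminalOf (fiber h i) := fun i hi => if_pos hi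
  have hF' : ∀ i, grade (fiber h i) ≠ 0 → F i = fiber h i := fun i hi => if_neg hi
  let q : ∀ i, fiber h i ⟶ F i := fun i =>
    if hi : grade (fiber h i) = 0 then toTerminal _ ≫ eqToHom (hF i hi).symm
    else eqToHom (hF' i hi).symm
  obtain ⟨T₀, p, f, w, e, hf, he⟩ := lift_exists h F q
  have : IsIso p := isIso_of_grade_fiber_eq h p f fun i => by
    rw [e i]
    by_cases hi : grade (fiber h i) = 0
    · rw [hF i hi, grade_of_isTrivial (isTrivial_terminalOf _), hi]
    · rw [hF' i hi]
  refine ⟨T₀, asIso p, f, w, hf, fun i => ⟨fun hi => ?_, fun hi => ?_⟩⟩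
  · rw [e i, hF i hi]; exact isTrivial_terminalOf _
  · have hi' : grade (fiber h i) ≠ 0 := by omega
    refine ⟨(hF' i hi').symm.trans (e i).symm, (he i).trans ?_⟩
    simp only [q, dif_neg hi']
    simp

/-- Change of one fiber of an order preserving map. -/
lemma exists_lift_at {T S : O} (h : T ⟶ S) (j : Fin (card S)) {G : O} (q : fiber h j ⟶ G) :
    ∃ (T₀ : O) (p : T ⟶ T₀) (f : T₀ ⟶ S) (w : p ≫ f = h) (e : G = fiber f j),
      IsOrderPreserving f ∧ fiberMap p f h w j = q ≫ eqToHom e ∧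
        ∀ i, i ≠ j → ∃ e, fiberMap p f h w i = eqToHom e := by
  classical
  let F : Fin (card S) → O := fun i => if i = j then G else fiber h i
  have hF : ∀ i, i = j → F i = G := fun i hi => if_pos hi
  have hF' : ∀ i, i ≠ j → F i = fiber h i := fun i hi => if_neg hi
  let q' : ∀ i, fiber h i ⟶ F i := fun i =>
    if hi : i = j then eqToHom (by rw [hi]) ≫ q ≫ eqToHom (hF i hi).symm
    else eqToHom (hF' i hi).symm
  obtain ⟨T₀, p, f, w, e, hf, he⟩ := lift_exists h F q'
  refine ⟨T₀, p, f, w, (hF j rfl).symm.trans (e j).symm, hf, ?_, fun i hi =>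
    ⟨(hF' i hi).symm.trans (e i).symm, (he i).trans ?_⟩⟩
  · rw [he j]; simp [q']
  · simp only [q', dif_neg hi]; simp

end Lifting

/-! ## Elementary morphisms over a fixed target -/

section ElementaryOver

variable {O : Type u} [Category.{v} O] [GradedOperadicCategory O]

lemma isTrivial_grade_ne {X : O} (h : IsTrivial X) : ¬ 1 ≤ grade X := by
  rw [grade_of_isTrivial h]; omega

/-- The position is no extra datum: only the fiber over it has positive grade. -/
lemma Elementary.ext_hom {T S : O} {φ ψ : Elementary T S} (h : φ.hom = ψ.hom) : φ = ψ := by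
  obtain ⟨f, hf, i, ht, hp⟩ := φ
  obtain ⟨g, hg, j, ht', hp'⟩ := ψ
  obtain rfl : f = g := h
  obtain rfl : i = j := by
    by_contra hne
    exact isTrivial_grade_ne (ht' i hne) hp
  rfl

/-- The fiber of `φ` over the position of `ψ` maps to an object of positive grade. Morphisms do not
raise the grade, so this fiber cannot be trivial. -/
lemma Elementary.idx_eq {T T' S : O} (φ : Elementary T S) (ψ : Elementary T' S) (p : T ⟶ T')
    (w : p ≫ ψ.hom = φ.hom) : φ.idx = ψ.idx := by
  by_contra hne
  have h1 := grade_of_isTrivial (φ.trivial ψ.idx (Ne.symm hne))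
  have h2 := grade_le_of_hom (fiberMap p ψ.hom φ.hom w ψ.idx)
  have := ψ.grade_pos
  omega

lemma Elementary.fiber_def {T S : O} (φ : Elementary T S) :
    OperadicData.fiber φ.hom φ.idx = φ.fiber := rfl

lemma Elementary.fiber_eq_of_idx {T S : O} (φ : Elementary T S) {i : Fin (card S)}
    (h : φ.idx = i) : φ.fiber = OperadicData.fiber φ.hom i := by
  subst h; rfl

/-- The map of nontrivial fibers induced by a map over the common target. -/
def Elementary.fiberHom {T T' S : O} (φ : Elementary T S) (ψ : Elementary T' S) (p : T ⟶ T')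
    (w : p ≫ ψ.hom = φ.hom) : φ.fiber ⟶ ψ.fiber :=
  eqToHom (φ.fiber_eq_of_idx (φ.idx_eq ψ p w)) ≫
    fiberMap p ψ.hom φ.hom w ψ.idx ≫ eqToHom ψ.fiber_def

lemma Elementary.fiberHom_congr {T T' S : O} (φ : Elementary T S) (ψ : Elementary T' S)
    {p p' : T ⟶ T'} (h : p = p') (w : p ≫ ψ.hom = φ.hom) (w' : p' ≫ ψ.hom = φ.hom) :
    φ.fiberHom ψ p w = φ.fiberHom ψ p' w' := by
  subst h; rfl

lemma Elementary.fiberHom_id {T S : O} (φ : Elementary T S) (w : 𝟙 T ≫ φ.hom = φ.hom) :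
    φ.fiberHom φ (𝟙 T) w = 𝟙 _ := by
  unfold Elementary.fiberHom
  rw [OperadicCategory.fiberMap_id]
  simp

lemma fiberMap_eq_idx {T S R : O} (f : T ⟶ S) (g : S ⟶ R) (h : T ⟶ R) (w : f ≫ g = h)
    {i i' : Fin (card R)} (hi : i = i') :
    fiberMap f g h w i = eqToHom (by rw [hi]) ≫ fiberMap f g h w i' ≫ eqToHom (by rw [hi]) := by
  subst hi; simp

lemma Elementary.fiberHom_comp {T T' T'' S : O} (φ : Elementary T S) (ψ : Elementary T' S)
    (χ : Elementary T'' S) (p : T ⟶ T') (p' : T' ⟶ T'') (w : p ≫ ψ.hom = φ.hom)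
    (w' : p' ≫ χ.hom = ψ.hom) (w'' : (p ≫ p') ≫ χ.hom = φ.hom) :
    φ.fiberHom χ (p ≫ p') w'' = φ.fiberHom ψ p w ≫ ψ.fiberHom χ p' w' := by
  have h := ψ.idx_eq χ p' w'
  unfold Elementary.fiberHom
  rw [OperadicCategory.fiberMap_comp p p' φ.hom ψ.hom χ.hom w w' w'' χ.idx]
  simp only [Category.assoc]
  rw [fiberMap_eq_idx p ψ.hom φ.hom w h]
  simp

/-- The isomorphism of nontrivial fibers induced by an isomorphism over the common target. -/
@[simps] def Elementary.fiberHomIso {T T' S : O} (φ : Elementary T S) (ψ : Elementary T' S)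
    (σ : T ≅ T') (w : σ.hom ≫ ψ.hom = φ.hom) : φ.fiber ≅ ψ.fiber where
  hom := φ.fiberHom ψ σ.hom w
  inv := ψ.fiberHom φ σ.inv (by rw [← w]; simp)
  hom_inv_id := by
    rw [← φ.fiberHom_comp ψ φ σ.hom σ.inv w (by rw [← w]; simp) (by simp)]
    exact (φ.fiberHom_congr φ σ.hom_inv_id _ (by simp)).trans (φ.fiberHom_id _)
  inv_hom_id := by
    rw [← ψ.fiberHom_comp φ ψ σ.inv σ.hom (by rw [← w]; simp) w (by simp)]
    exact (ψ.fiberHom_congr ψ σ.inv_hom_id _ (by simp)).trans (ψ.fiberHom_id _)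

lemma fiber_fiberMap_incl {T S R : O} (p : T ⟶ S) (f : S ⟶ R) (h : T ⟶ R) (w : p ≫ f = h)
    {l : Fin (card S)} {i : Fin (card R)} {k : Fin (card (fiber f i))} (hk : incl f i k = l) :
    fiber (fiberMap p f h w i) k = fiber p l := by
  rw [OperadicCategory.fiber_fiberMap, hk]

/-- If `p` inverted the order of two elements, monotonicity of `f` and `h` would force both into one
fiber over `R`, where `p` restricts to a monotone map. -/
lemma isOrderPreserving_of_fiberMap {T S R : O} (p : T ⟶ S) (f : S ⟶ R) (h : T ⟶ R)
    (w : p ≫ f = h) (hf : IsOrderPreserving f) (hh : IsOrderPreserving h)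
    (hp : ∀ i, IsOrderPreserving (fiberMap p f h w i)) : IsOrderPreserving p := by
  intro x y hxy
  by_contra hlt
  rw [not_le] at hlt
  have hx : cardMap f (cardMap p x) = cardMap h x := by rw [← w, cardMap_comp_apply]
  have hy : cardMap f (cardMap p y) = cardMap h y := by rw [← w, cardMap_comp_apply]
  have e : cardMap h y = cardMap h x := by
    refine le_antisymm ?_ (hh hxy)
    rw [← hx, ← hy]; exact hf hlt.le
  generalize hi : cardMap h x = i at e
  obtain ⟨a, rfl⟩ := exists_incl h x hi
  obtain ⟨b, rfl⟩ := exists_incl h y e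
  have h1 : a ≤ b := (incl h _).le_iff_le.mp hxy
  have h2 := (incl f _).monotone (hp _ h1)
  rw [OperadicCategory.incl_fiberMap, OperadicCategory.incl_fiberMap] at h2
  exact absurd hlt (not_lt.mpr h2)

/-- A map over `S` which is elementary on the fiber over `j` and an order preserving quasibijection
on the other fibers is elementary. -/
lemma exists_elementary_of_fiberMap {T S R : O} (p : T ⟶ S) (f : S ⟶ R) (h : T ⟶ R)
    (w : p ≫ f = h) (hf : IsOrderPreserving f) (hh : IsOrderPreserving h) (j : Fin (card R))
    (γ : Elementary (fiber h j) (fiber f j)) (hγ : γ.hom = fiberMap p f h w j)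
    (hp : ∀ i, i ≠ j → IsOrderPreserving (fiberMap p f h w i) ∧
      IsQuasibijection (fiberMap p f h w i)) :
    ∃ φ : Elementary T S, φ.hom = p ∧ φ.idx = incl f j γ.idx ∧ φ.fiber = γ.fiber := by
  have e : OperadicData.fiber γ.hom γ.idx = fiber p (incl f j γ.idx) := by
    rw [hγ]; exact fiber_fiberMap_incl p f h w rfl
  refine ⟨⟨p, isOrderPreserving_of_fiberMap p f h w hf hh fun i => ?_, incl f j γ.idx,
    fun l hl => ?_, e ▸ γ.grade_pos⟩, rfl, rfl, e.symm⟩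
  · by_cases hi : i = j
    · subst hi; rw [← hγ]; exact γ.orderPreserving
    · exact (hp i hi).1
  · obtain ⟨k, hk⟩ := exists_incl f l rfl
    rw [← fiber_fiberMap_incl p f h w hk]
    generalize hi : cardMap f l = i at k hk
    by_cases hij : i = j
    · subst hij
      rw [← hγ]
      refine γ.trivial k fun h => hl ?_
      rw [← hk, h]
    · exact (hp i hij).2 k

lemma Elementary.exists_conj {X Y G₀ G₁ : O} (γ : Elementary G₀ G₁) (e₀ : X = G₀) (e₁ : G₁ = Y) :
    ∃ γ' : Elementary X Y, γ'.hom = eqToHom e₀ ≫ γ.hom ≫ eqToHom e₁ ∧ γ'.fiber = γ.fiber := by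
  subst e₀ e₁; exact ⟨γ, by simp, rfl⟩

/-- The restriction of an elementary morphism to the fiber containing its nontrivial fiber. -/
noncomputable def Elementary.atFiber {T S R : O} (φ : Elementary T S) (f : S ⟶ R) (h : T ⟶ R)
    (w : φ.hom ≫ f = h) (j : Fin (card R)) (hj : cardMap f φ.idx = j) :
    Elementary (OperadicData.fiber h j) (OperadicData.fiber f j) where
  hom := fiberMap φ.hom f h w j
  orderPreserving := φ.orderPreserving.fiberMap f h w j
  idx := (exists_incl f φ.idx hj).choose
  trivial := fun i hi => by
    rw [OperadicCategory.fiber_fiberMap]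
    refine φ.trivial _ fun e => hi ((incl f j).injective ?_)
    exact e.trans (exists_incl f φ.idx hj).choose_spec.symm
  grade_pos := by
    rw [fiber_fiberMap_incl φ.hom f h w (exists_incl f φ.idx hj).choose_spec]
    exact φ.grade_pos

lemma Elementary.incl_atFiber_idx {T S R : O} (φ : Elementary T S) (f : S ⟶ R) (h : T ⟶ R)
    (w : φ.hom ≫ f = h) (j : Fin (card R)) (hj : cardMap f φ.idx = j) :
    incl f j (φ.atFiber f h w j hj).idx = φ.idx := (exists_incl f φ.idx hj).choose_spec

lemma Elementary.atFiber_fiber {T S R : O} (φ : Elementary T S) (f : S ⟶ R) (h : T ⟶ R)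
    (w : φ.hom ≫ f = h) (j : Fin (card R)) (hj : cardMap f φ.idx = j) :
    (φ.atFiber f h w j hj).fiber = φ.fiber :=
  fiber_fiberMap_incl φ.hom f h w (φ.incl_atFiber_idx f h w j hj)

lemma QVrt.mk_congr {X Y : O} (h : X = Y) (hX : 1 ≤ grade X) (hY : 1 ≤ grade Y) :
    QVrt.mk X hX = QVrt.mk Y hY := by
  subst h; rfl

lemma QVrt.eqToHom_comp_hom {A A' B : VirtualClass O} {T S : O} {hT : 1 ≤ grade T}
    {hS : 1 ≤ grade S} (f : T ≅ S) (e : (⟨A⟩ : QVrt O) = ⟨A'⟩) (hA : VirtualClass.mk T hT = A')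
    (hA' : VirtualClass.mk T hT = A) (hB : VirtualClass.mk S hS = B) :
    eqToHom e ≫ QVrt.hom f hA hB = QVrt.hom f hA' hB := by
  subst hA hA'; simp

lemma QVrt.hom_comp_eqToHom {A B B' : VirtualClass O} {T S : O} {hT : 1 ≤ grade T}
    {hS : 1 ≤ grade S} (f : T ≅ S) (hA : VirtualClass.mk T hT = A)
    (hB : VirtualClass.mk S hS = B) (e : (⟨B⟩ : QVrt O) = ⟨B'⟩)
    (hB' : VirtualClass.mk S hS = B') :
    QVrt.hom f hA hB ≫ eqToHom e = QVrt.hom f hA hB' := by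
  subst hB hB'; simp

/-- An isomorphism over a local terminal object and the induced isomorphism of fibers represent
the same arrow. -/
lemma QVrt.hom_fiberIso {T S t : O} (ht : IsLocalTerminal t) (f : T ≅ S) (g : S ⟶ t) (h : T ⟶ t)
    (w : f.hom ≫ g = h) (i : Fin (card t)) {A B : VirtualClass O} {hT : 1 ≤ grade T}
    {hS : 1 ≤ grade S} {hT' : 1 ≤ grade (fiber h i)} {hS' : 1 ≤ grade (fiber g i)}
    (hA : VirtualClass.mk T hT = A) (hB : VirtualClass.mk S hS = B)
    (hA' : VirtualClass.mk _ hT' = A) (hB' : VirtualClass.mk _ hS' = B) :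
    QVrt.hom f hA hB = QVrt.hom (fiberIso f g h w i) hA' hB' := by
  subst hA hB
  exact Presented.homMk_eq (.fiber hT hS ht f g h w i hT' hS')

lemma eqToHom_comp_conj {C : Type*} [Category C] {X₀ X₁ X₂ X Y Y₁ Y₂ : C} (e₀ : X₀ = X₁)
    (e₁ : X₁ = X₂) (e₂ : X₂ = X) (f : X ⟶ Y) (k₁ : Y = Y₁) (k₂ : Y₁ = Y₂) :
    eqToHom e₀ ≫ eqToHom e₁ ≫ (eqToHom e₂ ≫ f ≫ eqToHom k₁) ≫ eqToHom k₂ =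
      eqToHom (e₀.trans (e₁.trans e₂)) ≫ f ≫ eqToHom (k₁.trans k₂) := by
  subst e₀ e₁ e₂ k₁ k₂; simp

namespace ElementarySquare

/-- The square induced on the fibers over a common target. -/
noncomputable def atFiber {T S T' S' R : O} {φ : Elementary T S} {φ' : Elementary T' S'}
    (q : ElementarySquare φ φ') (f : S ⟶ R) (h : T ⟶ R) (w : φ.hom ≫ f = h) (f' : S' ⟶ R)
    (h' : T' ⟶ R) (w' : φ'.hom ≫ f' = h') (wb : q.bot.hom ≫ f' = f) (j : Fin (card R))
    (hj : cardMap f φ.idx = j) (hj' : cardMap f' φ'.idx = j) :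
    ElementarySquare (φ.atFiber f h w j hj) (φ'.atFiber f' h' w' j hj') where
  top := fiberIso q.top h' h (by rw [← w', ← Category.assoc, ← q.w, Category.assoc, wb, w]) j
  bot := fiberIso q.bot f' f wb j
  w := by
    have wt : q.top.hom ≫ h' = h := by
      rw [← w', ← Category.assoc, ← q.w, Category.assoc, wb, w]
    refine (OperadicCategory.fiberMap_comp φ.hom q.bot.hom h f f' w wb
      (by rw [Category.assoc, wb, w]) j).symm.trans (Eq.trans ?_
      (OperadicCategory.fiberMap_comp q.top.hom φ'.hom h h' f' wt w'
        (by rw [Category.assoc, w', wt]) j))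
    congr 1
    exact q.w

/-- By the axiom `(f_i)_j = f_j`, the map of nontrivial fibers of the restricted square is that of
`q` up to equalities of objects. Passing to fibers therefore leaves the represented arrow of
`QVrt(e)` unchanged. -/
lemma atFiber_fiberClass {T S T' S' R : O} {φ : Elementary T S} {φ' : Elementary T' S'}
    (q : ElementarySquare φ φ') (f : S ⟶ R) (h : T ⟶ R) (w : φ.hom ≫ f = h) (f' : S' ⟶ R)
    (h' : T' ⟶ R) (w' : φ'.hom ≫ f' = h') (wb : q.bot.hom ≫ f' = f) (j : Fin (card R))
    (hj : cardMap f φ.idx = j) (hj' : cardMap f' φ'.idx = j) :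
    (q.atFiber f h w f' h' w' wb j hj hj').fiberClass =
      eqToHom (QVrt.mk_congr (φ.atFiber_fiber f h w j hj) _ _) ≫ q.fiberClass ≫
        eqToHom (QVrt.mk_congr (φ'.atFiber_fiber f' h' w' j hj').symm _ _) := by
  have wt : q.top.hom ≫ h' = h := by
    rw [← w', ← Category.assoc, ← q.w, Category.assoc, wb, w]
  have wd : (φ.hom ≫ q.bot.hom) ≫ f' = h := by rw [Category.assoc, wb, w]
  have hk := φ'.incl_atFiber_idx f' h' w' j hj'
  set Q := q.atFiber f h w f' h' w' wb j hj hj' with hQ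
  set k := (φ'.atFiber f' h' w' j hj').idx with hkdef
  have hd : (φ.atFiber f h w j hj).hom ≫ Q.bot.hom = fiberMap (φ.hom ≫ q.bot.hom) f' h wd j :=
    (OperadicCategory.fiberMap_comp φ.hom q.bot.hom h f f' w wb wd j).symm
  have w'' : fiberMap q.top.hom h' h wt j ≫ fiberMap φ'.hom f' h' w' j =
      fiberMap (φ.hom ≫ q.bot.hom) f' h wd j := by
    rw [← hd]; exact Q.w.symm
  have key := OperadicCategory.fiberMap_fiberMap q.top.hom φ'.hom (φ.hom ≫ q.bot.hom) f' h' h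
    q.w.symm w' wd wt j k w''
  unfold fiberClass
  rw [QVrt.hom_comp_eqToHom _ _ _ _ (by
      rw [VirtualClass.mk, VirtualClass.mk]; congr 2
      exact (φ'.atFiber_fiber f' h' w' j hj').symm),
    QVrt.eqToHom_comp_hom _ _ _ ((VirtualClass.sound φ.fiber_pos q.one_le_grade_mid
      q.virtual_mid).symm.trans (by
      rw [VirtualClass.mk, VirtualClass.mk]; congr 2
      exact (φ.atFiber_fiber f h w j hj).symm))]
  have e₁ : Q.mid = q.mid := by
    unfold mid
    rw [hd, fiber_fiberMap_incl _ _ _ _ hk]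
  refine QVrt.hom_congr _ _ e₁ (φ'.atFiber_fiber f' h' w' j hj') ?_ _ _ _ _
  have k1 : Q.right.hom = eqToHom (by unfold mid; rw [hd]) ≫
      fiberMap (fiberMap q.top.hom h' h wt j) (fiberMap φ'.hom f' h' w' j)
        (fiberMap (φ.hom ≫ q.bot.hom) f' h wd j) w'' k := by
    have := fiberMap_congr (f := fiberMap q.top.hom h' h wt j) (g := fiberMap φ'.hom f' h' w' j)
      rfl hd (rfl : k = k) Q.w.symm w''
    refine this.trans ?_
    simp
    rfl
  have k2 : fiberMap q.top.hom φ'.hom (φ.hom ≫ q.bot.hom) q.w.symm (incl f' j k) =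
      eqToHom (by rw [hk]; rfl) ≫ q.right.hom ≫ eqToHom (by rw [hk]; rfl) := by
    have := fiberMap_congr (f := q.top.hom) (g := φ'.hom) rfl rfl hk q.w.symm q.w.symm
    exact this
  rw [k1, key, k2]
  refine (eqToHom_comp_conj _ _ _ _ _ _).trans ?_
  rfl

/-- The vertically unchanged square with inverted isomorphisms. -/
@[simps] def inverse {T S T' S' : O} {φ : Elementary T S} {φ' : Elementary T' S'}
    (q : ElementarySquare φ φ') : ElementarySquare φ' φ :=
  ⟨q.top.symm, q.bot.symm, by
    rw [Iso.symm_hom, Iso.symm_hom, Iso.eq_inv_comp, ← Category.assoc, ← q.w]; simp⟩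

lemma ext {T S T' S' : O} {φ : Elementary T S} {φ' : Elementary T' S'}
    {q q' : ElementarySquare φ φ'} (h : q.top = q'.top) (h' : q.bot = q'.bot) : q = q' := by
  obtain ⟨a, b, w⟩ := q
  obtain ⟨a', b', w'⟩ := q'
  obtain rfl : a = a' := h
  obtain rfl : b = b' := h'
  rfl

@[simp] lemma fiberClass_inverse_comp {T S T' S' : O} {φ : Elementary T S} {φ' : Elementary T' S'}
    (q : ElementarySquare φ φ') : q.inverse.fiberClass ≫ q.fiberClass = 𝟙 _ := by
  rw [← fiberClass_trans, ← fiberClass_refl]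
  congr 1
  exact ext (by simp) (by simp)

@[simp] lemma fiberClass_comp_inverse {T S T' S' : O} {φ : Elementary T S} {φ' : Elementary T' S'}
    (q : ElementarySquare φ φ') : q.fiberClass ≫ q.inverse.fiberClass = 𝟙 _ := by
  rw [← fiberClass_trans, ← fiberClass_refl]
  congr 1
  exact ext (by simp) (by simp)

end ElementarySquare

end ElementaryOver

/-! ## Refinements of elementary morphisms -/

section Refinements

variable {O : Type u} [Category.{v} O] [GradedOperadicCategory O] [StandingAssumptions O]

/-- Maps over `S` out of a factorization can be prescribed on fibers. Here `m` is prescribed on the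
nontrivial one, and into the trivial ones there is no choice. The resulting map preserves the grades
of all fibers, so it is invertible. This is the source of the uniqueness of refinements. -/
lemma Elementary.exists_lift_iso {T T₁ T₁' S : O} (φ : Elementary T S) (φ₂ : Elementary T₁ S)
    (φ₂' : Elementary T₁' S) (p : T ⟶ T₁) (w : p ≫ φ₂.hom = φ.hom) (p' : T ⟶ T₁')
    (w' : p' ≫ φ₂'.hom = φ.hom) (m : φ₂.fiber ≅ φ₂'.fiber)
    (hm : φ.fiberHom φ₂ p w ≫ m.hom = φ.fiberHom φ₂' p' w') :
    ∃ (θ : T₁ ≅ T₁') (wθ : θ.hom ≫ φ₂'.hom = φ₂.hom), p ≫ θ.hom = p' ∧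
      φ₂.fiberHom φ₂' θ.hom wθ = m.hom := by
  have h₂ := φ.idx_eq φ₂ p w
  have h₂' := φ.idx_eq φ₂' p' w'
  have hi := h₂.symm.trans h₂'
  let q : ∀ i, OperadicData.fiber φ₂.hom i ⟶ OperadicData.fiber φ₂'.hom i := fun i =>
    if h : i = φ₂.idx then eqToHom (φ₂.fiber_eq_of_idx h.symm).symm ≫ m.hom ≫
      eqToHom (φ₂'.fiber_eq_of_idx (h.trans hi).symm)
    else (φ₂'.trivial i (fun e => h (e.trans hi.symm))).isLocalTerminal.from
      (zigzag_of_hom_hom (fiberMap p φ₂.hom φ.hom w i) (fiberMap p' φ₂'.hom φ.hom w' i))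
  have hq : ∀ i (h : φ₂.idx = i), q i = eqToHom (φ₂.fiber_eq_of_idx h).symm ≫ m.hom ≫
      eqToHom (φ₂'.fiber_eq_of_idx (hi.symm.trans h)) := fun i h => dif_pos h.symm
  obtain ⟨θ, wθ, h₁, h₃⟩ := lift_hom φ.hom p φ₂.hom w p' φ₂'.hom w' φ₂'.orderPreserving q (by
    intro i
    by_cases h : i = φ.idx
    · subst h
      rw [hq _ h₂.symm]
      unfold Elementary.fiberHom at hm
      rw [fiberMap_eq_idx p φ₂.hom φ.hom w h₂, fiberMap_eq_idx p' φ₂'.hom φ.hom w' h₂']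
      rw [← cancel_epi (eqToHom φ.fiber_def.symm), ← cancel_mono (eqToHom
        (φ₂'.fiber_eq_of_idx h₂'.symm).symm)]
      simpa using hm
    · exact (φ₂'.trivial i fun e => h (e.trans h₂'.symm)).isLocalTerminal.hom_ext _ _)
  have : IsIso θ := isIso_of_grade_fiber_eq φ₂.hom θ φ₂'.hom fun i => by
    by_cases h : i = φ₂.idx
    · rw [← φ₂.fiber_eq_of_idx h.symm, ← φ₂'.fiber_eq_of_idx (h.trans hi).symm, grade_of_iso m]
    · rw [grade_of_isTrivial (φ₂.trivial i h),
        grade_of_isTrivial (φ₂'.trivial i fun e => h (e.trans hi.symm))]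
  refine ⟨asIso θ, wθ, h₁, ?_⟩
  unfold Elementary.fiberHom
  simp only [asIso_hom]
  rw [h₃, hq _ hi]
  simp

lemma Elementary.comp_hom {T S P : O} (φ : Elementary T S) (ψ : Elementary S P)
    (h : cardMap ψ.hom φ.idx = ψ.idx) : φ.hom ≫ ψ.hom = (φ.comp ψ h).hom := rfl

lemma Elementary.induced_hom {T S P : O} (φ : Elementary T S) (ψ : Elementary S P)
    (h : cardMap ψ.hom φ.idx = ψ.idx) :
    (φ.induced ψ h).hom = (φ.comp ψ h).fiberHom ψ φ.hom (φ.comp_hom ψ h) :=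
  ((Category.id_comp _).trans (Category.comp_id _)).symm

lemma ElementarySquare.comp_w {T T₁ T' T₁' S : O} {φ₁ : Elementary T T₁}
    {φ₁' : Elementary T' T₁'} (s : ElementarySquare φ₁ φ₁') {φ₂ : Elementary T₁ S}
    {φ₂' : Elementary T₁' S} (h : cardMap φ₂.hom φ₁.idx = φ₂.idx)
    (h' : cardMap φ₂'.hom φ₁'.idx = φ₂'.idx) (w : s.bot.hom ≫ φ₂'.hom = φ₂.hom) :
    s.top.hom ≫ (φ₁'.comp φ₂' h').hom = (φ₁.comp φ₂ h).hom := by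
  rw [← Elementary.comp_hom, ← Elementary.comp_hom, ← Category.assoc, ← s.w, Category.assoc, w]

/-- A square of elementary morphisms over `S` restricts to the nontrivial fibers over `S`. -/
lemma ElementarySquare.exists_induced {T T₁ T' T₁' S : O} {φ₁ : Elementary T T₁}
    {φ₁' : Elementary T' T₁'} (s : ElementarySquare φ₁ φ₁') {φ₂ : Elementary T₁ S}
    {φ₂' : Elementary T₁' S} (h : cardMap φ₂.hom φ₁.idx = φ₂.idx)
    (h' : cardMap φ₂'.hom φ₁'.idx = φ₂'.idx) (w : s.bot.hom ≫ φ₂'.hom = φ₂.hom) :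
    ∃ r : ElementarySquare (φ₁.induced φ₂ h) (φ₁'.induced φ₂' h'),
      r.top.hom = (φ₁.comp φ₂ h).fiberHom (φ₁'.comp φ₂' h') s.top.hom (s.comp_w h h' w) ∧
      r.bot.hom = φ₂.fiberHom φ₂' s.bot.hom w ∧
      r.fiberClass = eqToHom (QVrt.mk_congr (φ₁.induced_fiber φ₂ h).symm _ _) ≫ s.fiberClass ≫
        eqToHom (QVrt.mk_congr (φ₁'.induced_fiber φ₂' h') _ _) := by
  have hidx := φ₂.idx_eq φ₂' s.bot.hom w
  -- Unpacking `φ₂'` allows its position to be replaced by that of `φ₂`, so that the square can be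
  -- restricted over literally one index.
  obtain ⟨f', hf', j', ht', hp'⟩ := φ₂'
  obtain rfl : φ₂.idx = j' := hidx
  refine ⟨s.atFiber φ₂.hom (φ₁.hom ≫ φ₂.hom) rfl f' (φ₁'.hom ≫ f') rfl w φ₂.idx h h', ?_, ?_,
    s.atFiber_fiberClass _ _ _ _ _ _ _ _ _ _⟩
  · exact ((Category.id_comp _).trans (Category.comp_id _)).symm
  · exact ((Category.id_comp _).trans (Category.comp_id _)).symm

/-- A factorization, up to an isomorphism, of an elementary morphism which realizes a given
elementary morphism from its fiber. -/
structure Refinement {T S G₀ G₁ : O} (φ : Elementary T S) (m : φ.fiber ≅ G₀)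
    (γ : Elementary G₀ G₁) where
  obj₀ : O
  obj₁ : O
  iso : T ≅ obj₀
  first : Elementary obj₀ obj₁
  second : Elementary obj₁ S
  joint : cardMap second.hom first.idx = second.idx
  w : (iso.hom ≫ first.hom) ≫ second.hom = φ.hom
  label : second.fiber ≅ G₁
  comm : m.hom ≫ γ.hom = φ.fiberHom second (iso.hom ≫ first.hom) w ≫ label.hom

/-- Two lifts over `S` do this. The first replaces the nontrivial fiber by `G₀` through the
isomorphism `m`, and so is an isomorphism. The second replaces `G₀` by `G₁` through `γ`, and is
elementary because it restricts to `γ` over one index and to identities over the others. Positivity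
of the grade of `G₁` is needed for the remaining map to `S` to be elementary. -/
lemma exists_refinement {T S G₀ G₁ : O} (φ : Elementary T S) (m : φ.fiber ≅ G₀)
    (γ : Elementary G₀ G₁) (hG : 1 ≤ grade G₁) : Nonempty (Refinement φ m γ) := by
  obtain ⟨T₀, p, f₀, w, e, hf₀, hj, hi⟩ := exists_lift_at φ.hom φ.idx (eqToHom φ.fiber_def ≫ m.hom)
  have hg : ∀ i, grade (fiber φ.hom i) = grade (fiber f₀ i) := fun i => by
    by_cases h : i = φ.idx
    · subst h; rw [← e, φ.fiber_def, grade_of_iso m]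
    · obtain ⟨e, -⟩ := hi i h; rw [e]
  have := isIso_of_grade_fiber_eq φ.hom p f₀ hg
  obtain ⟨T₁, p₁, f₁, w₁, e₁, hf₁, hj₁, hi₁⟩ := exists_lift_at f₀ φ.idx (eqToHom e.symm ≫ γ.hom)
  obtain ⟨γ', hγ', hγ''⟩ := γ.exists_conj e.symm e₁
  have ht₀ : ∀ i, i ≠ φ.idx → IsTrivial (fiber f₀ i) := fun i h => by
    obtain ⟨e, -⟩ := hi i h; rw [← e]; exact φ.trivial i h
  have ht₁ : ∀ i, i ≠ φ.idx → IsTrivial (fiber f₁ i) := fun i h => by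
    obtain ⟨e, -⟩ := hi₁ i h; rw [← e]; exact ht₀ i h
  obtain ⟨φ₁, rfl, hφ₁, -⟩ := exists_elementary_of_fiberMap p₁ f₁ f₀ w₁ hf₁ hf₀ φ.idx γ'
    (by rw [hγ', hj₁, Category.assoc]) (fun i h => by
      obtain ⟨e, he⟩ := hi₁ i h
      rw [he]
      exact ⟨isOrderPreserving_eqToHom e, isQuasibijection_eqToHom e⟩)
  have w₂ : (p ≫ φ₁.hom) ≫ f₁ = φ.hom := by rw [Category.assoc, w₁, w]
  let φ₂ : Elementary T₁ S := ⟨f₁, hf₁, φ.idx, ht₁, by rw [← e₁]; exact hG⟩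
  have e₂ : G₁ = φ₂.fiber := e₁
  have h₂ : fiberMap (p ≫ φ₁.hom) φ₂.hom φ.hom w₂ φ₂.idx =
      (eqToHom φ.fiber_def ≫ m.hom ≫ γ.hom) ≫ eqToHom e₁ := by
    refine (OperadicCategory.fiberMap_comp p φ₁.hom φ.hom f₀ f₁ w w₁ w₂ φ.idx).trans ?_
    rw [hj, hj₁]
    simp
  refine ⟨⟨T₀, T₁, asIso p, φ₁, φ₂, ?_, w₂, eqToIso e₂.symm, ?_⟩⟩
  · rw [hφ₁]; exact cardMap_incl _ _ _
  · unfold Elementary.fiberHom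
    simp only [asIso_hom]
    rw [h₂]
    simp

namespace Refinement

variable {T S G₀ G₁ : O} {φ : Elementary T S} {m : φ.fiber ≅ G₀} {γ : Elementary G₀ G₁}

/-- The composite of the two elementary morphisms of a refinement. -/
abbrev composite (ρ : Refinement φ m γ) : Elementary ρ.obj₀ S := ρ.first.comp ρ.second ρ.joint

lemma iso_composite (ρ : Refinement φ m γ) : ρ.iso.hom ≫ ρ.composite.hom = φ.hom := by
  rw [← ρ.w, Category.assoc]; rfl

/-- The square comparing the restriction to the fibers with the realized morphism. -/
noncomputable def square (ρ : Refinement φ m γ) :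
    ElementarySquare (ρ.first.induced ρ.second ρ.joint) γ where
  top := (φ.fiberHomIso ρ.composite ρ.iso ρ.iso_composite).symm ≪≫ m
  bot := ρ.label
  w := by
    rw [Iso.trans_hom, Category.assoc, ρ.comm, Iso.symm_hom, Iso.eq_inv_comp,
      Elementary.induced_hom, Elementary.fiberHomIso_hom, ← Category.assoc]
    congr 1
    exact (φ.fiberHom_comp ρ.composite ρ.second ρ.iso.hom ρ.first.hom _ _ _).symm

/-- The induced arrow between the classes of the nontrivial fibers. -/
noncomputable def arrow (ρ : Refinement φ m γ) :
    QVrt.mk ρ.first.fiber ρ.first.fiber_pos ⟶ QVrt.mk γ.fiber γ.fiber_pos :=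
  eqToHom (QVrt.mk_congr (ρ.first.induced_fiber ρ.second ρ.joint) _ _) ≫ ρ.square.fiberClass

/-- Two refinements of isomorphic data are isomorphic. -/
lemma exists_square {T' G₀' G₁' : O} {φ' : Elementary T' S} {m' : φ'.fiber ≅ G₀'}
    {γ' : Elementary G₀' G₁'} (ρ : Refinement φ m γ) (ρ' : Refinement φ' m' γ') (σ : T ≅ T')
    (w : σ.hom ≫ φ'.hom = φ.hom) (q : ElementarySquare γ γ')
    (hm : m.hom ≫ q.top.hom = φ.fiberHom φ' σ.hom w ≫ m'.hom) :
    ∃ (s : ElementarySquare ρ.first ρ'.first) (ws : s.bot.hom ≫ ρ'.second.hom = ρ.second.hom),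
      s.top = ρ.iso.symm ≪≫ σ ≪≫ ρ'.iso ∧
      ρ.label.hom ≫ q.bot.hom = ρ.second.fiberHom ρ'.second s.bot.hom ws ≫ ρ'.label.hom ∧
      ρ.arrow ≫ q.fiberClass = s.fiberClass ≫ ρ'.arrow := by
  have w₁ : (σ.hom ≫ ρ'.iso.hom ≫ ρ'.first.hom) ≫ ρ'.second.hom = φ.hom := by
    rw [Category.assoc, ρ'.w, w]
  -- Both refinements factor `φ` through maps to `S` whose nontrivial fibers are identified by the
  -- labels and `q.bot`. This yields the isomorphism of middle objects.
  obtain ⟨θ, wθ, h₁, h₂⟩ := φ.exists_lift_iso ρ.second ρ'.second (ρ.iso.hom ≫ ρ.first.hom) ρ.w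
    (σ.hom ≫ ρ'.iso.hom ≫ ρ'.first.hom) w₁ (ρ.label ≪≫ q.bot ≪≫ ρ'.label.symm) (by
      simp only [Iso.trans_hom, Iso.symm_hom]
      rw [← Category.assoc, ← Category.assoc, Iso.comp_inv_eq, ← ρ.comm, Category.assoc, q.w,
        φ.fiberHom_comp φ' ρ'.second σ.hom _ w ρ'.w w₁, Category.assoc (φ.fiberHom φ' σ.hom w),
        ← ρ'.comm, ← Category.assoc, hm, Category.assoc])
  let s : ElementarySquare ρ.first ρ'.first := ⟨ρ.iso.symm ≪≫ σ ≪≫ ρ'.iso, θ, by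
    rw [Iso.trans_hom, Iso.trans_hom, Iso.symm_hom, Category.assoc, Category.assoc,
      ← h₁, Category.assoc, Iso.inv_hom_id_assoc]⟩
  refine ⟨s, wθ, rfl, by rw [h₂]; simp, ?_⟩
  obtain ⟨r, h₃, h₄, h₅⟩ := s.exists_induced ρ.joint ρ'.joint wθ
  have w₂ := s.comp_w ρ.joint ρ'.joint wθ
  -- The two ways of comparing the restriction of `ρ.first` with `γ'` are the same square, so the
  -- arrows they represent agree.
  have e : ρ.square.trans q = r.trans ρ'.square := by
    refine ElementarySquare.ext ?_ ?_
    · ext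
      have w₃ : (ρ.iso.hom ≫ s.top.hom) ≫ ρ'.composite.hom = φ.hom := by
        rw [Category.assoc, w₂, ρ.iso_composite]
      have w₄ : (σ.hom ≫ ρ'.iso.hom) ≫ ρ'.composite.hom = φ.hom := by
        rw [Category.assoc, ρ'.iso_composite, w]
      have h₆ : φ.fiberHom ρ.composite ρ.iso.hom ρ.iso_composite ≫ r.top.hom =
          φ.fiberHom φ' σ.hom w ≫ φ'.fiberHom ρ'.composite ρ'.iso.hom ρ'.iso_composite := by
        rw [h₃, ← φ.fiberHom_comp ρ.composite ρ'.composite ρ.iso.hom _ ρ.iso_composite w₂ w₃,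
          ← φ.fiberHom_comp φ' ρ'.composite σ.hom ρ'.iso.hom w ρ'.iso_composite w₄]
        exact φ.fiberHom_congr ρ'.composite (by simp [s]) _ _
      simp only [ElementarySquare.trans_top, square, Iso.trans_hom, Iso.symm_hom, Category.assoc]
      rw [Iso.inv_comp_eq, Elementary.fiberHomIso_hom, hm, ← Category.assoc, h₆, Category.assoc]
      congr 1
      rw [← Elementary.fiberHomIso_hom, Iso.hom_inv_id_assoc]
    · ext
      simp only [ElementarySquare.trans_bot, Iso.trans_hom]
      rw [h₄]
      change ρ.label.hom ≫ _ = _ ≫ ρ'.label.hom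
      rw [h₂]; simp
  unfold arrow
  rw [Category.assoc, ← ElementarySquare.fiberClass_trans, e, ElementarySquare.fiberClass_trans, h₅]
  simp

end Refinement

end Refinements

/-! ## Constructions of squares -/

section Squares

variable {O : Type u} [Category.{v} O] [GradedOperadicCategory O] [StandingAssumptions O]

lemma QVrt.hom_eqToIso {X Y : O} (h : X = Y) (hX : 1 ≤ grade X) (hY : 1 ≤ grade Y)
    {A B : VirtualClass O} (hA : VirtualClass.mk X hX = A) (hB : VirtualClass.mk Y hY = B)
    (e : (⟨A⟩ : QVrt O) = ⟨B⟩) :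
    QVrt.hom (eqToIso h) hA hB = eqToHom e := by
  subst h hA hB; exact QVrt.hom_refl _

namespace DisjointSquare

variable {T P' P'' S : O} {φ' : Elementary T P'} {ψ' : Elementary P' S}
  {φ'' : Elementary T P''} {ψ'' : Elementary P'' S}

/-- The canonical quasibijection is induced by an order preserving morphism, hence is order
preserving, and order preserving quasibijections are identities. So the fibers exchanged by a square
are equal, not merely isomorphic. -/
lemma fiberMap_eq_eqToHom (q : DisjointSquare φ' ψ' φ'' ψ'') (h : T ⟶ S)
    (w : φ''.hom ≫ ψ''.hom = h) :
    ∃ e, fiberMap φ''.hom ψ''.hom h w ψ''.idx = eqToHom e := by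
  obtain rfl : h = φ'.hom ≫ ψ'.hom := by rw [q.w, w]
  exact eq_of_quasibijection _ (φ''.orderPreserving.fiberMap _ _ _ _) q.quasibijection

lemma fiber_eq_fiber (q : DisjointSquare φ' ψ' φ'' ψ'') : φ'.fiber = ψ''.fiber := by
  obtain ⟨e, -⟩ := q.fiberMap_eq_eqToHom (φ'.hom ≫ ψ'.hom) q.w.symm
  exact q.fiber_eq.trans e

/-- The canonical quasibijection of fibers is an identity. -/
lemma fiberIso_eq (q : DisjointSquare φ' ψ' φ'' ψ'') :
    q.fiberIso = eqToIso q.fiber_eq_fiber := by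
  obtain ⟨e, he⟩ := q.fiberMap_eq_eqToHom (φ'.hom ≫ ψ'.hom) q.w.symm
  ext
  change eqToHom q.fiber_eq ≫ fiberMap φ''.hom ψ''.hom (φ'.hom ≫ ψ'.hom) q.w.symm ψ''.idx = _
  rw [he]
  exact eqToHom_trans q.fiber_eq e

lemma cross_hom_eq_eqToHom (q : DisjointSquare φ' ψ' φ'' ψ'') :
    q.cross.hom = eqToHom (QVrt.mk_congr q.fiber_eq_fiber _ _) := by
  change QVrt.hom q.fiberIso rfl rfl = _
  rw [q.fiberIso_eq]
  exact QVrt.hom_eqToIso _ _ _ _ _ _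

lemma cross_inv_eq_eqToHom (q : DisjointSquare φ' ψ' φ'' ψ'') :
    q.cross.inv = eqToHom (QVrt.mk_congr q.fiber_eq_fiber _ _).symm := by
  rw [← cancel_epi q.cross.hom, Iso.hom_inv_id, q.cross_hom_eq_eqToHom, eqToHom_trans,
    eqToHom_refl]

/-- Over an index where `ψ'` has a trivial fiber, the fiber of the composite is a fiber of `φ'`. It
is the nontrivial one only over the position of `ψ''`. -/
lemma isTrivial_fiber (q : DisjointSquare φ' ψ' φ'' ψ'') (h : T ⟶ S)
    (w : φ'.hom ≫ ψ'.hom = h) {i : Fin (card S)} (h' : i ≠ ψ'.idx) (h'' : i ≠ ψ''.idx) :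
    IsTrivial (fiber h i) := by
  have ht := ψ'.trivial i h'
  let k : Fin (card (fiber ψ'.hom i)) := ⟨0, by rw [ht.card_eq]; exact Nat.one_pos⟩
  have hk := cardMap_incl ψ'.hom i k
  rw [← fiber_eq_of_trivial φ'.hom ψ'.hom h w (incl ψ'.hom i k) i hk ht]
  refine φ'.trivial _ fun e => h'' ?_
  rw [← hk, e, q.over']

end DisjointSquare

/-- Identity horizontals force the vertical morphisms to coincide, and the square is then the
identity square. -/
lemma ElementarySquare.fiberClass_eq_eqToHom {T S T' S' : O} {φ : Elementary T S}
    {φ' : Elementary T' S'} (q : ElementarySquare φ φ') (e₀ : T = T') (e₁ : S = S')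
    (h₀ : q.top.hom = eqToHom e₀) (h₁ : q.bot.hom = eqToHom e₁) :
    ∃ e : φ.fiber = φ'.fiber, q.fiberClass = eqToHom (QVrt.mk_congr e _ _) := by
  subst e₀ e₁
  obtain rfl : φ = φ' := by
    apply Elementary.ext_hom
    have := q.w
    rw [h₀, h₁] at this
    simpa using this
  obtain rfl : q = ElementarySquare.refl φ := ElementarySquare.ext (Iso.ext h₀) (Iso.ext h₁)
  exact ⟨rfl, fiberClass_refl φ⟩

/-- A refinement is strict if the restriction of its first morphism to the fibers is the realized
morphism. -/
structure Refinement.IsStrict {T S G₀ G₁ : O} {φ : Elementary T S} {m : φ.fiber ≅ G₀}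
    {γ : Elementary G₀ G₁} (ρ : Refinement φ m γ) : Prop where
  top : ∃ e, ρ.square.top.hom = eqToHom e
  label : ∃ e, ρ.label.hom = eqToHom e

lemma Refinement.IsStrict.fiber_eq {T S G₀ G₁ : O} {φ : Elementary T S} {m : φ.fiber ≅ G₀}
    {γ : Elementary G₀ G₁} {ρ : Refinement φ m γ} (h : ρ.IsStrict) : ρ.first.fiber = γ.fiber := by
  obtain ⟨⟨e₀, h₀⟩, ⟨e₁, h₁⟩⟩ := h
  exact (ρ.first.induced_fiber ρ.second ρ.joint).trans
    (ρ.square.fiberClass_eq_eqToHom e₀ e₁ h₀ h₁).choose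

lemma Refinement.IsStrict.arrow_eq {T S G₀ G₁ : O} {φ : Elementary T S} {m : φ.fiber ≅ G₀}
    {γ : Elementary G₀ G₁} {ρ : Refinement φ m γ} (h : ρ.IsStrict) :
    ρ.arrow = eqToHom (QVrt.mk_congr h.fiber_eq _ _) := by
  obtain ⟨⟨e₀, h₀⟩, ⟨e₁, h₁⟩⟩ := h
  unfold arrow
  rw [(ρ.square.fiberClass_eq_eqToHom e₀ e₁ h₀ h₁).choose_spec, eqToHom_trans]

/-- The fiber of the composite maps to a fiber of `ρ`, which is local terminal, and the fiber of
that map is the fiber of `f` over `l`. Such a map and its fiber have the same grade. -/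
lemma grade_fiber_comp_iso {T S R : O} (f : T ⟶ S) (ρ : S ≅ R) (l : Fin (card S)) :
    grade (fiber (f ≫ ρ.hom) (cardMap ρ.hom l)) = grade (fiber f l) := by
  obtain ⟨k, hk⟩ := exists_incl ρ.hom l rfl
  rw [← fiber_fiberMap_incl f ρ.hom (f ≫ ρ.hom) rfl hk]
  exact (grade_fiber_localTerminal _ (isLocalTerminal_fiber_iso ρ _) k).symm

lemma Elementary.grade_fiber_comp_iso {T S R : O} (φ : Elementary T S) (ρ : S ≅ R)
    {i : Fin (card R)} (hi : i ≠ cardMap ρ.hom φ.idx) :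
    grade (OperadicData.fiber (φ.hom ≫ ρ.hom) i) = 0 := by
  obtain ⟨l, rfl⟩ := StandingAssumptions.constant_free ρ.hom i
  rw [OpCat.grade_fiber_comp_iso]
  exact grade_of_isTrivial (φ.trivial l fun e => hi (by rw [e]))

/-- An elementary morphism can be transported along an isomorphism of its target, with control of
the top isomorphism. -/
lemma Elementary.exists_of_normalization {T S R T₀ : O} (φ : Elementary T S) (ρ : S ≅ R)
    (f : T₀ ⟶ R) (hf : IsOrderPreserving f) (τ : T ≅ T₀) (w : τ.hom ≫ f = φ.hom ≫ ρ.hom)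
    (hf₀ : ∀ i, grade (OperadicData.fiber (φ.hom ≫ ρ.hom) i) = 0 →
      IsTrivial (OperadicData.fiber f i)) :
    ∃ φ₀ : Elementary T₀ R, φ₀.hom = f := by
  refine ⟨⟨f, hf, cardMap ρ.hom φ.idx, fun i hi => hf₀ i (φ.grade_fiber_comp_iso ρ hi), ?_⟩, rfl⟩
  rw [← grade_of_iso (fiberIso τ f _ w _), OpCat.grade_fiber_comp_iso]
  exact φ.grade_pos

/-- Composing with `ρ` may destroy the order and make trivial fibers merely local terminal.
Normalization repairs both at the cost of an isomorphism of the source. Every labelled tower under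
the target can thereby be extended by `φ`. -/
lemma Elementary.exists_square {T S R : O} (φ : Elementary T S) (ρ : S ≅ R) :
    ∃ (T₀ : O) (φ₀ : Elementary T₀ R) (q : ElementarySquare φ φ₀), q.bot = ρ := by
  obtain ⟨T₀, τ, f, w, hf, hi⟩ := exists_normalization (φ.hom ≫ ρ.hom)
  obtain ⟨φ₀, rfl⟩ := φ.exists_of_normalization ρ f hf τ w fun i h => (hi i).1 h
  exact ⟨T₀, φ₀, ⟨τ, ρ, w.symm⟩, rfl⟩

lemma isQuasibijection_of_isTrivial {X Y : O} (f : X ⟶ Y) (hX : IsTrivial X) (hY : IsTrivial Y) :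
    IsQuasibijection f := fun i => by rwa [fiber_of_isTrivial f hY i]

lemma isQuasibijection_conj {X X' Y Y' : O} {f : X ⟶ Y} (hf : IsQuasibijection f) (e : X' = X)
    (e' : Y = Y') : IsQuasibijection (eqToHom e ≫ f ≫ eqToHom e') := by
  subst e e'; simpa using hf

lemma isOrderPreserving_conj {X X' Y Y' : O} {f : X ⟶ Y} (hf : IsOrderPreserving f) (e : X' = X)
    (e' : Y = Y') : IsOrderPreserving (eqToHom e ≫ f ≫ eqToHom e') := by
  subst e e'; simpa using hf

/-- An elementary morphism over `R` induces one between normalizations. -/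
lemma Elementary.exists_normalized {T S R T₀ S₀ : O} (φ : Elementary T S) (a : S ⟶ R) (b : T ⟶ R)
    (wb : φ.hom ≫ a = b) (τ : T ≅ T₀) (f : T₀ ⟶ R) (w : τ.hom ≫ f = b) (hf : IsOrderPreserving f)
    (hi : ∀ i, (grade (OperadicData.fiber b i) = 0 → IsTrivial (OperadicData.fiber f i)) ∧
      (1 ≤ grade (OperadicData.fiber b i) → ∃ e, fiberMap τ.hom f b w i = eqToHom e))
    (σ : S ≅ S₀) (g : S₀ ⟶ R) (w' : σ.hom ≫ g = a) (hg : IsOrderPreserving g)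
    (hi' : ∀ i, (grade (OperadicData.fiber a i) = 0 → IsTrivial (OperadicData.fiber g i)) ∧
      (1 ≤ grade (OperadicData.fiber a i) → ∃ e, fiberMap σ.hom g a w' i = eqToHom e)) :
    ∃ φ₀ : Elementary T₀ S₀, φ.hom ≫ σ.hom = τ.hom ≫ φ₀.hom := by
  let p : T₀ ⟶ S₀ := τ.inv ≫ φ.hom ≫ σ.hom
  have wp : p ≫ g = f := by
    simp only [p, Category.assoc]; rw [w', wb, Iso.inv_comp_eq, w]
  have wt : τ.inv ≫ b = f := by rw [Iso.inv_comp_eq, w]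
  have wi : (φ.hom ≫ σ.hom) ≫ g = b := by rw [Category.assoc, w', wb]
  have hinv : ∀ i, 1 ≤ grade (OperadicData.fiber b i) →
      ∃ e, fiberMap τ.inv b f wt i = eqToHom e := fun i h => by
    obtain ⟨e, he⟩ := (hi i).2 h
    refine ⟨e.symm, ?_⟩
    have h1 := (fiberIso τ f b w i).hom_inv_id
    rw [fiberIso_hom, he, fiberIso_inv] at h1
    rw [← cancel_epi (eqToHom e), h1]; simp
  have hmap : ∀ i, fiberMap p g f wp i =
      fiberMap τ.inv b f wt i ≫ fiberMap φ.hom a b wb i ≫ fiberMap σ.hom g a w' i := fun i => by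
    rw [OperadicCategory.fiberMap_comp τ.inv (φ.hom ≫ σ.hom) f b g wt wi,
      OperadicCategory.fiberMap_comp φ.hom σ.hom b a g wb w']
  have hgr : ∀ i, grade (OperadicData.fiber b i) = grade (OperadicData.fiber f i) := fun i =>
    grade_of_iso (fiberIso τ f b w i)
  have hgr' : ∀ i, grade (OperadicData.fiber a i) = grade (OperadicData.fiber g i) := fun i =>
    grade_of_iso (fiberIso σ g a w' i)
  obtain ⟨φ₀, h₀⟩ : ∃ φ₀ : Elementary T₀ S₀, φ₀.hom = p := by
    let i₀ := cardMap a φ.idx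
    have hpos : 1 ≤ grade (OperadicData.fiber b i₀) :=
      (φ.atFiber a b wb i₀ rfl).one_le_grade
    have hγ : ∃ γ : Elementary (OperadicData.fiber f i₀) (OperadicData.fiber g i₀),
        γ.hom = fiberMap p g f wp i₀ := by
      -- If the fiber of `a` has grade 0, normalization has made it trivial and the restricted map
      -- is elementary as a map to a local terminal object. Otherwise normalization has changed
      -- neither fiber, and the restriction of `φ` serves.
      rcases Nat.eq_zero_or_pos (grade (OperadicData.fiber a i₀)) with h | h
      · exact ⟨.toLocalTerminal _ ((hi' i₀).1 h).isLocalTerminal (by rw [← hgr]; exact hpos), rfl⟩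
      · obtain ⟨e, he⟩ := hinv i₀ hpos
        obtain ⟨e', he'⟩ := (hi' i₀).2 h
        obtain ⟨γ, hγ, -⟩ := (φ.atFiber a b wb i₀ rfl).exists_conj e e'
        exact ⟨γ, by rw [hγ, hmap, he, he']; rfl⟩
    obtain ⟨γ, hγ⟩ := hγ
    obtain ⟨φ₀, h, -, -⟩ := exists_elementary_of_fiberMap p g f wp hg hf i₀ γ hγ fun i hne => by
      rcases Nat.eq_zero_or_pos (grade (OperadicData.fiber b i)) with h | h
      · have ht := (hi i).1 h
        have ht' := (hi' i).1 (Nat.le_zero.mp (h ▸ grade_le_of_hom (fiberMap φ.hom a b wb i)))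
        exact ⟨isOrderPreserving_of_card_target _ ht'.card_eq,
          isQuasibijection_of_isTrivial _ ht ht'⟩
      · have hq : IsQuasibijection (fiberMap φ.hom a b wb i) := fun k => by
          rw [OperadicCategory.fiber_fiberMap]
          refine φ.trivial _ fun e => hne ?_
          rw [← cardMap_incl a i k, e]
        have := StandingAssumptions.isIso_of_quasibijection _ hq
        obtain ⟨e, he⟩ := hinv i h
        obtain ⟨e', he'⟩ := (hi' i).2 (by
          rw [← grade_of_iso (asIso (fiberMap φ.hom a b wb i))]; exact h)
        rw [hmap, he, he']
        exact ⟨isOrderPreserving_conj (φ.orderPreserving.fiberMap _ _ _ _) _ _,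
          isQuasibijection_conj hq _ _⟩
    exact ⟨φ₀, h⟩
  exact ⟨φ₀, by rw [h₀]; simp [p]⟩

/-- A square of elementary morphisms with disjoint fibers can be transported along an isomorphism
of its final object. -/
lemma DisjointSquare.exists_transport {T P' P'' S R : O} {φ' : Elementary T P'}
    {ψ' : Elementary P' S} {φ'' : Elementary T P''} {ψ'' : Elementary P'' S}
    (q : DisjointSquare φ' ψ' φ'' ψ'') (ρ : S ≅ R) :
    ∃ (T₀ P₀' P₀'' : O) (φ₀' : Elementary T₀ P₀') (ψ₀' : Elementary P₀' R)
      (φ₀'' : Elementary T₀ P₀'') (ψ₀'' : Elementary P₀'' R) (τ : T ≅ T₀) (σ' : P' ≅ P₀')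
      (σ'' : P'' ≅ P₀''), DisjointSquare φ₀' ψ₀' φ₀'' ψ₀'' ∧
      φ'.hom ≫ σ'.hom = τ.hom ≫ φ₀'.hom ∧ ψ'.hom ≫ ρ.hom = σ'.hom ≫ ψ₀'.hom ∧
      φ''.hom ≫ σ''.hom = τ.hom ≫ φ₀''.hom ∧ ψ''.hom ≫ ρ.hom = σ''.hom ≫ ψ₀''.hom := by
  obtain ⟨T₀, τ, f, w, hf, hi⟩ := exists_normalization (φ'.hom ≫ ψ'.hom ≫ ρ.hom)
  obtain ⟨P₀', σ', g', w', hg', hi'⟩ := exists_normalization (ψ'.hom ≫ ρ.hom)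
  obtain ⟨P₀'', σ'', g'', w'', hg'', hi''⟩ := exists_normalization (ψ''.hom ≫ ρ.hom)
  obtain ⟨ψ₀', rfl⟩ := ψ'.exists_of_normalization ρ g' hg' σ' w' fun i h => (hi' i).1 h
  obtain ⟨ψ₀'', rfl⟩ := ψ''.exists_of_normalization ρ g'' hg'' σ'' w'' fun i h => (hi'' i).1 h
  obtain ⟨φ₀', h'⟩ := φ'.exists_normalized (ψ'.hom ≫ ρ.hom) _ rfl τ f w hf hi σ' _ w' hg' hi'
  obtain ⟨φ₀'', h''⟩ := φ''.exists_normalized (ψ''.hom ≫ ρ.hom) (φ'.hom ≫ ψ'.hom ≫ ρ.hom)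
    (by rw [← Category.assoc, ← q.w, Category.assoc]) τ f w hf hi σ'' _ w'' hg'' hi''
  let s' : ElementarySquare φ' φ₀' := ⟨τ, σ', h'⟩
  let t' : ElementarySquare ψ' ψ₀' := ⟨σ', ρ, w'.symm⟩
  let s'' : ElementarySquare φ'' φ₀'' := ⟨τ, σ'', h''⟩
  let t'' : ElementarySquare ψ'' ψ₀'' := ⟨σ'', ρ, w''.symm⟩
  have aux : ∀ {P P₀ : O} {φ : Elementary T P} {φ₀ : Elementary T₀ P₀} {ψ : Elementary P S}
      {ψ₀ : Elementary P₀ R} (s : ElementarySquare φ φ₀) (t : ElementarySquare ψ ψ₀),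
      s.bot = t.top → cardMap ψ₀.hom φ₀.idx = cardMap t.bot.hom (cardMap ψ.hom φ.idx) := by
    intro P P₀ φ φ₀ ψ ψ₀ s t h
    rw [← s.cardMap_idx, ← cardMap_comp_apply, ← cardMap_comp_apply, h, ← t.w]
  refine ⟨T₀, P₀', P₀'', φ₀', ψ₀', φ₀'', ψ₀'', τ, σ', σ'', ⟨?_, ?_, ?_, ?_⟩, h', w'.symm, h'',
    w''.symm⟩
  · rw [← cancel_epi τ.hom, ← Category.assoc, ← Category.assoc, ← h', ← h'', Category.assoc,
      Category.assoc, w', w'', ← Category.assoc, q.w, Category.assoc]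
  · rw [aux s' t' rfl, ← t''.cardMap_idx, q.over']
  · rw [aux s'' t'' rfl, ← t'.cardMap_idx, q.over'']
  · rw [← t'.cardMap_idx, ← t''.cardMap_idx]
    intro h
    refine q.disjoint ?_
    have := congrArg (cardMap ρ.inv) h
    rw [← cardMap_comp_apply, ← cardMap_comp_apply] at this
    simpa [t', t'', OperadicCategory.cardMap_id] using this

end Squares

/-! ## Strict refinements -/

section Strict

variable {O : Type u} [Category.{v} O] [GradedOperadicCategory O] [StandingAssumptions O]

lemma cardMap_incl_eq {T S R : O} (p : T ⟶ S) (f : S ⟶ R) (h : T ⟶ R) (w : p ≫ f = h)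
    (j : Fin (card R)) (g : fiber h j ⟶ fiber f j) (hg : fiberMap p f h w j = g)
    (x : Fin (card (fiber h j))) :
    cardMap p (incl h j x) = incl f j (cardMap g x) := by
  subst hg
  exact (OperadicCategory.incl_fiberMap p f h w j x).symm

lemma eqToHom_conj_self {C : Type*} [Category C] {X Y : C} (f : X ⟶ Y) (e : X = X) (e' : Y = Y) :
    eqToHom e ≫ f ≫ eqToHom e' = f := by simp

lemma eqToHom_conj_comp {C : Type*} [Category C] {X X' Y Z : C} (f : X ⟶ Y) (g : Y ⟶ Z)
    (e : X = X') (e' : X' = X) (e'' : Z = Z) :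
    eqToHom e ≫ ((eqToHom e' ≫ f) ≫ g) ≫ eqToHom e'' = f ≫ g := by subst e'; simp

lemma Refinement.isStrict_of {T S G₀ G₁ : O} {φ : Elementary T S} {m : φ.fiber ≅ G₀}
    {γ : Elementary G₀ G₁} (ρ : Refinement φ m γ) (e : G₀ = ρ.composite.fiber)
    (h : φ.fiberHom ρ.composite ρ.iso.hom ρ.iso_composite = m.hom ≫ eqToHom e)
    (hl : ∃ e, ρ.label.hom = eqToHom e) : ρ.IsStrict := by
  refine ⟨⟨e.symm, ?_⟩, hl⟩
  change (φ.fiberHomIso ρ.composite ρ.iso ρ.iso_composite).inv ≫ m.hom = _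
  rw [Iso.inv_comp_eq, Elementary.fiberHomIso_hom, h]
  simp

/-- Both orders of a pair of elementary morphisms with disjoint fibers can be realized
simultaneously by refinements of an elementary morphism. -/
lemma exists_disjoint_refinements {T S G₀ G₁' G₁'' G₂ : O} (φ : Elementary T S) (m : φ.fiber ≅ G₀)
    {α' : Elementary G₀ G₁'} {β' : Elementary G₁' G₂} {α'' : Elementary G₀ G₁''}
    {β'' : Elementary G₁'' G₂} (q : DisjointSquare α' β' α'' β'') (hG : 1 ≤ grade G₂) :
    ∃ (T₀ T₁' T₁'' T₂ : O) (τ : T ≅ T₀) (φ' : Elementary T₀ T₁') (ψ' : Elementary T₁' T₂)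
      (φ'' : Elementary T₀ T₁'') (ψ'' : Elementary T₁'' T₂) (ξ' : Elementary T₁' S)
      (ξ'' : Elementary T₁'' S) (χ : Elementary T₂ S) (l' : ξ'.fiber ≅ G₁') (l'' : ξ''.fiber ≅ G₁'')
      (l : χ.fiber ≅ G₂) (h₁ : _) (h₂ : _) (h₃ : _) (h₄ : _) (h₅ : _) (h₆ : _) (h₇ : _) (h₈ : _)
      (h₉ : _) (h₁₀ : _) (h₁₁ : _) (h₁₂ : _),
      (⟨T₀, T₁', τ, φ', ξ', h₁, h₂, l', h₃⟩ : Refinement φ m α').IsStrict ∧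
      (⟨T₀, T₁'', τ, φ'', ξ'', h₄, h₅, l'', h₆⟩ : Refinement φ m α'').IsStrict ∧
      (⟨T₁', T₂, Iso.refl _, ψ', χ, h₇, h₈, l, h₉⟩ : Refinement ξ' l' β').IsStrict ∧
      (⟨T₁'', T₂, Iso.refl _, ψ'', χ, h₁₀, h₁₁, l, h₁₂⟩ : Refinement ξ'' l'' β'').IsStrict ∧
      DisjointSquare φ' ψ' φ'' ψ'' := by
  -- All objects are built over `S` by prescribing the fiber at `φ.idx`, namely `G₀`, `G₁'`, `G₁''`
  -- and `G₂`. The other fibers stay trivial.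
  obtain ⟨T₀, p, f₀, w₀, rfl, hf₀, hj₀, hi₀⟩ :=
    exists_lift_at φ.hom φ.idx (eqToHom φ.fiber_def ≫ m.hom)
  have hg : ∀ i, grade (fiber φ.hom i) = grade (fiber f₀ i) := fun i => by
    by_cases h : i = φ.idx
    · subst h; rw [φ.fiber_def, grade_of_iso m]
    · obtain ⟨e, -⟩ := hi₀ i h; rw [e]
  have := isIso_of_grade_fiber_eq φ.hom p f₀ hg
  obtain ⟨T₁', p₁', f₁', w₁', rfl, hf₁', hj₁', hi₁'⟩ := exists_lift_at f₀ φ.idx α'.hom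
  obtain ⟨T₁'', p₁'', f₁'', w₁'', rfl, hf₁'', hj₁'', hi₁''⟩ := exists_lift_at f₀ φ.idx α''.hom
  obtain ⟨T₂, p₂, f₂, w₂, rfl, hf₂, hj₂, hi₂⟩ := exists_lift_at f₁' φ.idx β'.hom
  simp only [eqToHom_refl, Category.comp_id] at hj₀ hj₁' hj₁'' hj₂
  have ht₀ : ∀ i, i ≠ φ.idx → IsTrivial (fiber f₀ i) := fun i h => by
    obtain ⟨e, -⟩ := hi₀ i h; rw [← e]; exact φ.trivial i h
  have ht₁' : ∀ i, i ≠ φ.idx → IsTrivial (fiber f₁' i) := fun i h => by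
    obtain ⟨e, -⟩ := hi₁' i h; rw [← e]; exact ht₀ i h
  have ht₁'' : ∀ i, i ≠ φ.idx → IsTrivial (fiber f₁'' i) := fun i h => by
    obtain ⟨e, -⟩ := hi₁'' i h; rw [← e]; exact ht₀ i h
  have ht₂ : ∀ i, i ≠ φ.idx → IsTrivial (fiber f₂ i) := fun i h => by
    obtain ⟨e, -⟩ := hi₂ i h; rw [← e]; exact ht₁' i h
  have w₁₂ : (p₁' ≫ p₂) ≫ f₂ = f₀ := by rw [Category.assoc, w₂, w₁']
  have hj₁₂ : fiberMap (p₁' ≫ p₂) f₂ f₀ w₁₂ φ.idx = α''.hom ≫ β''.hom := by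
    rw [OperadicCategory.fiberMap_comp p₁' p₂ f₀ f₁' f₂ w₁' w₂, hj₁', hj₂, q.w]
  -- The object `T₂` was obtained from `T₁'` only. The map from `T₁''` is prescribed on fibers,
  -- where commutativity of the original square `q` is exactly the compatibility required, so the
  -- new square commutes as well.
  obtain ⟨p₂', wp, hp, hj₂'⟩ : ∃ (θ : T₁'' ⟶ T₂) (wθ : θ ≫ f₂ = f₁''), p₁'' ≫ θ = p₁' ≫ p₂ ∧
      fiberMap θ f₂ f₁'' wθ φ.idx = β''.hom := by
    classical
    let r : ∀ i, fiber f₁'' i ⟶ fiber f₂ i := fun i =>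
      if h : i = φ.idx then eqToHom (by rw [h]) ≫ β''.hom ≫ eqToHom (by rw [h])
      else eqToHom ((hi₁'' i h).choose.symm.trans ((hi₁' i h).choose.trans (hi₂ i h).choose))
    obtain ⟨θ, wθ, h, h'⟩ := lift_hom f₀ p₁'' f₁'' w₁'' (p₁' ≫ p₂) f₂ w₁₂ hf₂ r (fun i => by
      by_cases h : i = φ.idx
      · subst h
        rw [hj₁₂, hj₁'']; simp [r]
      · rw [OperadicCategory.fiberMap_comp p₁' p₂ f₀ f₁' f₂ w₁' w₂, (hi₁' i h).choose_spec,
          (hi₂ i h).choose_spec, (hi₁'' i h).choose_spec]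
        simp [r, h])
    exact ⟨θ, wθ, h, by rw [h']; simp [r]⟩
  have eqf : ∀ {X Y : O} {f : X ⟶ Y}, (∃ e : X = Y, f = eqToHom e) →
      IsOrderPreserving f ∧ IsQuasibijection f := fun h => by
    obtain ⟨e, rfl⟩ := h
    exact ⟨isOrderPreserving_eqToHom e, isQuasibijection_eqToHom e⟩
  obtain ⟨φ', rfl, hφ', -⟩ := exists_elementary_of_fiberMap p₁' f₁' f₀ w₁' hf₁' hf₀ φ.idx α'
    hj₁'.symm fun i h => eqf (hi₁' i h)
  obtain ⟨φ'', rfl, hφ'', -⟩ := exists_elementary_of_fiberMap p₁'' f₁'' f₀ w₁'' hf₁'' hf₀ φ.idx α''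
    hj₁''.symm fun i h => eqf (hi₁'' i h)
  obtain ⟨ψ', rfl, hψ', -⟩ := exists_elementary_of_fiberMap p₂ f₂ f₁' w₂ hf₂ hf₁' φ.idx β'
    hj₂.symm fun i h => eqf (hi₂ i h)
  obtain ⟨ψ'', rfl, hψ'', -⟩ := exists_elementary_of_fiberMap p₂' f₂ f₁'' wp hf₂ hf₁'' φ.idx β''
    hj₂'.symm fun i h => ⟨isOrderPreserving_of_card_target _ (ht₂ i h).card_eq,
      isQuasibijection_of_isTrivial _ (ht₁'' i h) (ht₂ i h)⟩
  let ξ' : Elementary T₁' S := ⟨f₁', hf₁', φ.idx, ht₁', β'.one_le_grade⟩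
  let ξ'' : Elementary T₁'' S := ⟨f₁'', hf₁'', φ.idx, ht₁'', β''.one_le_grade⟩
  let χ : Elementary T₂ S := ⟨f₂, hf₂, φ.idx, ht₂, hG⟩
  have aux : ∀ (c : Elementary T₀ S) (hc : c.hom = f₀) (hi : c.idx = φ.idx) (w : _)
      (e : fiber f₀ φ.idx = c.fiber), φ.fiberHom c p w = m.hom ≫ eqToHom e := by
    rintro ⟨_, _, _, _, _⟩ rfl rfl w e
    unfold Elementary.fiberHom
    simp only
    rw [hj₀]
    simp
  have aux' : ∀ {T₁ : O} (c : Elementary T₁ S) (d : Elementary T₁ S) (w : _) (hc : c.hom = d.hom)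
      (e : c.fiber = d.fiber), c.fiberHom d (𝟙 _) w = eqToHom e := by
    intro T₁ c d w h e
    obtain rfl := Elementary.ext_hom h
    exact c.fiberHom_id w
  have W' : (p ≫ φ'.hom) ≫ f₁' = φ.hom := by rw [Category.assoc, w₁', w₀]
  have W'' : (p ≫ φ''.hom) ≫ f₁'' = φ.hom := by rw [Category.assoc, w₁'', w₀]
  have J' : cardMap f₁' φ'.idx = φ.idx := by rw [hφ']; exact cardMap_incl _ _ _
  have J'' : cardMap f₁'' φ''.idx = φ.idx := by rw [hφ'']; exact cardMap_incl _ _ _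
  have K' : cardMap f₂ ψ'.idx = φ.idx := by rw [hψ']; exact cardMap_incl _ _ _
  have K'' : cardMap f₂ ψ''.idx = φ.idx := by rw [hψ'']; exact cardMap_incl _ _ _
  have C' : φ.fiberHom ξ' (p ≫ φ'.hom) W' = m.hom ≫ α'.hom := by
    unfold Elementary.fiberHom
    have := OperadicCategory.fiberMap_comp p φ'.hom φ.hom f₀ f₁' w₀ w₁' W' φ.idx
    rw [hj₀, hj₁'] at this
    exact (congrArg (fun x => eqToHom rfl ≫ x ≫ eqToHom rfl) this).trans
      (eqToHom_conj_comp _ _ _ _ _)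
  have C'' : φ.fiberHom ξ'' (p ≫ φ''.hom) W'' = m.hom ≫ α''.hom := by
    unfold Elementary.fiberHom
    have := OperadicCategory.fiberMap_comp p φ''.hom φ.hom f₀ f₁'' w₀ w₁'' W'' φ.idx
    rw [hj₀, hj₁''] at this
    exact (congrArg (fun x => eqToHom rfl ≫ x ≫ eqToHom rfl) this).trans
      (eqToHom_conj_comp _ _ _ _ _)
  have D' : ∀ (g : T₁' ⟶ T₂) (w : g ≫ f₂ = f₁'), g = ψ'.hom → ξ'.fiberHom χ g w = β'.hom := by
    rintro _ w rfl
    unfold Elementary.fiberHom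
    exact (congrArg (fun x => eqToHom rfl ≫ x ≫ eqToHom rfl) hj₂).trans
      (eqToHom_conj_self _ _ _)
  have D'' : ∀ (g : T₁'' ⟶ T₂) (w : g ≫ f₂ = f₁''), g = ψ''.hom →
      ξ''.fiberHom χ g w = β''.hom := by
    rintro _ w rfl
    unfold Elementary.fiberHom
    exact (congrArg (fun x => eqToHom rfl ≫ x ≫ eqToHom rfl) hj₂').trans
      (eqToHom_conj_self _ _ _)
  have hid : ∀ {X Y Z : O} (f : X ⟶ Y) (g : Y ⟶ Z) {h : X ⟶ Z}, f ≫ g = h →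
      ((Iso.refl X).hom ≫ f) ≫ g = h := by
    intro X Y Z f g h w; simpa using w
  refine ⟨T₀, T₁', T₁'', T₂, asIso p, φ', ψ', φ'', ψ'', ξ', ξ'', χ, Iso.refl _, Iso.refl _,
    Iso.refl _, J', W', ?_, J'', W'', ?_, K', hid _ _ w₂, ?_, K'', hid _ _ wp, ?_, ?_, ?_, ?_, ?_,
    ?_⟩
  · exact (C'.symm).trans (Category.comp_id _).symm
  · exact (C''.symm).trans (Category.comp_id _).symm
  · refine (Category.id_comp _).trans (Eq.trans ?_ (Category.comp_id _).symm)
    exact (D' _ _ (Category.id_comp _)).symm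
  · refine (Category.id_comp _).trans (Eq.trans ?_ (Category.comp_id _).symm)
    exact (D'' _ _ (Category.id_comp _)).symm
  · exact Refinement.isStrict_of _ (by congr 1; exact w₁'.symm) (aux _ w₁' rfl _ _) ⟨rfl, rfl⟩
  · exact Refinement.isStrict_of _ (by congr 1; exact w₁''.symm) (aux _ w₁'' rfl _ _) ⟨rfl, rfl⟩
  · refine Refinement.isStrict_of _ (congrArg (fun x => fiber x φ.idx) w₂.symm) ?_ ⟨rfl, rfl⟩
    refine (aux' ξ' (ψ'.comp χ K') ((Category.id_comp _).trans w₂) w₂.symm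
      (congrArg (fun x => fiber x φ.idx) w₂.symm)).trans ?_
    exact (Category.id_comp _).symm
  · refine Refinement.isStrict_of _ (congrArg (fun x => fiber x φ.idx) wp.symm) ?_ ⟨rfl, rfl⟩
    refine (aux' ξ'' (ψ''.comp χ K'') ((Category.id_comp _).trans wp) wp.symm
      (congrArg (fun x => fiber x φ.idx) wp.symm)).trans ?_
    exact (Category.id_comp _).symm
  · have joint : ∀ {X Y : O} (g : X ⟶ Y) (f : Y ⟶ S) (h : X ⟶ S) (w : g ≫ f = h)
        (γ : fiber h φ.idx ⟶ fiber f φ.idx), fiberMap g f h w φ.idx = γ → ∀ x,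
        cardMap g (incl h φ.idx x) = incl f φ.idx (cardMap γ x) := by
      intro X Y g f h w γ hγ x
      exact cardMap_incl_eq g f h w φ.idx γ hγ x
    refine ⟨hp.symm, ?_, ?_, ?_⟩
    · rw [hφ', hψ'', joint _ _ _ _ _ hj₂, q.over']
    · rw [hφ'', hψ', joint _ _ _ _ _ hj₂', q.over'']
    · rw [hψ', hψ'']
      exact fun h => q.disjoint ((incl f₂ φ.idx).injective h)

end Strict

/-! ## Restriction of refinements to fibers -/

section Restriction

variable {O : Type u} [Category.{v} O] [GradedOperadicCategory O] [StandingAssumptions O]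

lemma Elementary.fiber_eq_of_hom_eq_fiberMap {T S R : O} (φ : Elementary T S) (c : S ⟶ R)
    (h : T ⟶ R)
    (w : φ.hom ≫ c = h) (j : Fin (card R)) (hj : cardMap c φ.idx = j)
    (Φ : Elementary (OperadicData.fiber h j) (OperadicData.fiber c j))
    (hΦ : Φ.hom = fiberMap φ.hom c h w j) : Φ.fiber = φ.fiber := by
  obtain rfl : Φ = φ.atFiber c h w j hj := ext_hom hΦ
  exact φ.atFiber_fiber c h w j hj

lemma fiberMap_fiberMap_incl {T S Q R : O} (f : T ⟶ S) (a : S ⟶ Q) (b : T ⟶ Q) (c : Q ⟶ R)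
    (g : S ⟶ R) (h : T ⟶ R) (w : f ≫ a = b) (wg : a ≫ c = g) (wh : b ≫ c = h) (w' : f ≫ g = h)
    (i : Fin (card R)) (k : Fin (card (fiber c i))) (l : Fin (card Q)) (hk : incl c i k = l)
    (w'' : fiberMap f g h w' i ≫ fiberMap a c g wg i = fiberMap b c h wh i) :
    fiberMap (fiberMap f g h w' i) (fiberMap a c g wg i) (fiberMap b c h wh i) w'' k =
      eqToHom (fiber_fiberMap_incl b c h wh hk) ≫ fiberMap f a b w l ≫
        eqToHom (fiber_fiberMap_incl a c g wg hk).symm := by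
  subst hk
  exact OperadicCategory.fiberMap_fiberMap f a b c g h w wg wh w' i k w''

/-- This is the axiom `(f_i)_j = f_j` for maps between nontrivial fibers. The restricted morphisms
`Φ`, `Ψ` and the map `P` are arguments with equations so that the lemma also applies when they arise
by other constructions. -/
lemma Elementary.fiberHom_of_fiberMap {T T' S R : O} (φ : Elementary T S) (ψ : Elementary T' S)
    (p : T ⟶ T') (w : p ≫ ψ.hom = φ.hom) (c : S ⟶ R) (h : T ⟶ R) (h' : T' ⟶ R)
    (wφ : φ.hom ≫ c = h) (wψ : ψ.hom ≫ c = h') (wp : p ≫ h' = h) (j : Fin (card R))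
    (hj : cardMap c ψ.idx = j)
    (Φ : Elementary (OperadicData.fiber h j) (OperadicData.fiber c j))
    (Ψ : Elementary (OperadicData.fiber h' j) (OperadicData.fiber c j))
    (hΦ : Φ.hom = fiberMap φ.hom c h wφ j) (hΨ : Ψ.hom = fiberMap ψ.hom c h' wψ j)
    (P : OperadicData.fiber h j ⟶ OperadicData.fiber h' j) (hP : P = fiberMap p h' h wp j)
    (W : P ≫ Ψ.hom = Φ.hom) (e : Φ.fiber = φ.fiber) (e' : ψ.fiber = Ψ.fiber) :
    Φ.fiberHom Ψ P W = eqToHom e ≫ φ.fiberHom ψ p w ≫ eqToHom e' := by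
  subst hP
  obtain rfl : Φ = φ.atFiber c h wφ j (by rw [φ.idx_eq ψ p w, hj]) := ext_hom hΦ
  obtain rfl : Ψ = ψ.atFiber c h' wψ j hj := ext_hom hΨ
  have hk := ψ.incl_atFiber_idx c h' wψ j hj
  have key := fiberMap_fiberMap_incl p ψ.hom φ.hom c h' h w wψ wφ wp j
    (ψ.atFiber c h' wψ j hj).idx ψ.idx hk W
  unfold Elementary.fiberHom
  refine (congrArg (fun x => eqToHom _ ≫ x ≫ eqToHom _) key).trans ?_
  have aux : ∀ {A B C D E F G H : O} (e₁ : A = B) (e₂ : B = C) (f : C ⟶ D) (e₃ : D = E) (e₄ : E = F)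
      (k₁ : A = G) (k₂ : G = C) (k₃ : D = H) (k₄ : H = F),
      eqToHom e₁ ≫ (eqToHom e₂ ≫ f ≫ eqToHom e₃) ≫ eqToHom e₄ =
        eqToHom k₁ ≫ (eqToHom k₂ ≫ f ≫ eqToHom k₃) ≫ eqToHom k₄ := by
    intros; subst_vars; rfl
  exact aux _ _ _ _ _ _ _ _ _

namespace Refinement

variable {T S G₀ G₁ : O} {φ : Elementary T S} {m : φ.fiber ≅ G₀} {γ : Elementary G₀ G₁}

lemma second_idx (ρ : Refinement φ m γ) : φ.idx = ρ.second.idx := φ.idx_eq ρ.second _ ρ.w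

/-- The restriction of a refinement to the fibers of a morphism out of the target. -/
noncomputable def atFiber (ρ : Refinement φ m γ) {R : O} (c : S ⟶ R) (h : T ⟶ R)
    (w : φ.hom ≫ c = h) (j : Fin (card R)) (hj : cardMap c φ.idx = j)
    (Φ : Elementary (fiber h j) (fiber c j)) (hΦ : Φ.hom = fiberMap φ.hom c h w j)
    (M : Φ.fiber ≅ G₀)
    (hM : M = eqToIso (φ.fiber_eq_of_hom_eq_fiberMap c h w j hj Φ hΦ) ≪≫ m) :
    Refinement Φ M γ where
  obj₀ := fiber (ρ.first.hom ≫ ρ.second.hom ≫ c) j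
  obj₁ := fiber (ρ.second.hom ≫ c) j
  iso := fiberIso ρ.iso _ h (by rw [← w, ← ρ.w]; simp) j
  first := ρ.first.atFiber (ρ.second.hom ≫ c) _ rfl j (by
    rw [cardMap_comp_apply, ρ.joint, ← ρ.second_idx, hj])
  second := ρ.second.atFiber c _ rfl j (by rw [← ρ.second_idx, hj])
  joint := by
    apply (incl c j).injective
    rw [Elementary.incl_atFiber_idx]
    refine (OperadicCategory.incl_fiberMap _ _ _ _ _ _).trans ?_
    rw [Elementary.incl_atFiber_idx, ρ.joint]
  w := by
    rw [hΦ]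
    change (fiberMap _ _ _ _ _ ≫ fiberMap _ _ _ _ _) ≫ fiberMap _ _ _ _ _ = _
    have h₁ : (ρ.iso.hom ≫ ρ.first.hom) ≫ ρ.second.hom ≫ c = h := by
      rw [← w, ← ρ.w]; simp
    rw [← OperadicCategory.fiberMap_comp ρ.iso.hom ρ.first.hom h _ _ _ rfl h₁,
      ← OperadicCategory.fiberMap_comp _ ρ.second.hom h _ c h₁ rfl (by rw [ρ.w, w])]
    exact (fiberMap_congr ρ.w rfl rfl _ _).trans (eqToHom_conj_self _ _ _)
  label := eqToIso (ρ.second.atFiber_fiber c _ rfl j (by rw [← ρ.second_idx, hj])) ≪≫ ρ.label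
  comm := by
    subst hM
    have h₁ : (ρ.iso.hom ≫ ρ.first.hom) ≫ ρ.second.hom ≫ c = h := by
      rw [← w, ← ρ.w]; simp
    have hj' : cardMap c ρ.second.idx = j := by rw [← ρ.second_idx, hj]
    have key : ∀ P (hP : P = fiberMap (ρ.iso.hom ≫ ρ.first.hom) _ h h₁ j) (W : _),
        Φ.fiberHom (ρ.second.atFiber c _ rfl j hj') P W = _ := fun P hP W =>
      φ.fiberHom_of_fiberMap ρ.second (ρ.iso.hom ≫ ρ.first.hom) ρ.w c h _ w rfl h₁ j hj' Φ
        (ρ.second.atFiber c _ rfl j hj') hΦ rfl P hP W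
        (φ.fiber_eq_of_hom_eq_fiberMap c h w j hj Φ hΦ)
        (ρ.second.atFiber_fiber c _ rfl j hj').symm
    have h₂ := key _ (OperadicCategory.fiberMap_comp ρ.iso.hom ρ.first.hom h
      (ρ.first.hom ≫ ρ.second.hom ≫ c) (ρ.second.hom ≫ c) (by rw [← w, ← ρ.w]; simp) rfl h₁ j).symm
    have e₁ := ρ.second.atFiber_fiber c _ rfl j hj'
    refine Eq.trans ?_ (congrArg (fun x => x ≫ (eqToHom e₁ ≫ ρ.label.hom)) (h₂ _)).symm
    simp only [Iso.trans_hom, eqToIso.hom, Category.assoc, eqToHom_trans_assoc, eqToHom_refl,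
      Category.id_comp]
    rw [ρ.comm]

/-- The fibers of the restricted morphisms are fibers of the original ones, and so are the maps
between them. The squares defining the two arrows hence differ by a square of equalities. -/
lemma arrow_atFiber (ρ : Refinement φ m γ) {R : O} (c : S ⟶ R) (h : T ⟶ R)
    (w : φ.hom ≫ c = h) (j : Fin (card R)) (hj : cardMap c φ.idx = j)
    (Φ : Elementary (fiber h j) (fiber c j)) (hΦ : Φ.hom = fiberMap φ.hom c h w j)
    (M : Φ.fiber ≅ G₀)
    (hM : M = eqToIso (φ.fiber_eq_of_hom_eq_fiberMap c h w j hj Φ hΦ) ≪≫ m) :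
    ∃ e : (ρ.atFiber c h w j hj Φ hΦ M hM).first.fiber = ρ.first.fiber,
      (ρ.atFiber c h w j hj Φ hΦ M hM).arrow = eqToHom (QVrt.mk_congr e _ _) ≫ ρ.arrow := by
  subst hM
  have e₀ := φ.fiber_eq_of_hom_eq_fiberMap c h w j hj Φ hΦ
  have hj' : cardMap c ρ.second.idx = j := by rw [← ρ.second_idx, hj]
  have hc : (ρ.first.hom ≫ ρ.second.hom) ≫ c = ρ.first.hom ≫ ρ.second.hom ≫ c :=
    Category.assoc _ _ _
  let N := ρ.atFiber c h w j hj Φ hΦ _ rfl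
  have e₁ : N.second.fiber = ρ.second.fiber := ρ.second.atFiber_fiber c _ rfl j hj'
  have hN : N.composite.hom = fiberMap ρ.composite.hom c (ρ.first.hom ≫ ρ.second.hom ≫ c) hc j :=
    (OperadicCategory.fiberMap_comp ρ.first.hom ρ.second.hom _ _ _ _ _ _ _).symm
  have e₂ : N.composite.fiber = ρ.composite.fiber :=
    ρ.composite.fiber_eq_of_hom_eq_fiberMap c _ hc j hj' N.composite hN
  have k₁ : Φ.fiberHom N.composite N.iso.hom N.iso_composite =
      eqToHom e₀ ≫ φ.fiberHom ρ.composite ρ.iso.hom ρ.iso_composite ≫ eqToHom e₂.symm :=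
    φ.fiberHom_of_fiberMap ρ.composite ρ.iso.hom ρ.iso_composite c h _ w hc _ j hj' Φ N.composite hΦ
      hN _ rfl _ _ _
  have k₂ : (N.first.induced N.second N.joint).hom =
      eqToHom e₂ ≫ (ρ.first.induced ρ.second ρ.joint).hom ≫ eqToHom e₁.symm := by
    rw [Elementary.induced_hom, Elementary.induced_hom]
    exact ρ.composite.fiberHom_of_fiberMap ρ.second ρ.first.hom rfl c _ _ hc rfl rfl j hj'
      N.composite N.second hN rfl _ rfl _ _ _
  let t : ElementarySquare (N.first.induced N.second N.joint)
      (ρ.first.induced ρ.second ρ.joint) := ⟨eqToIso e₂, eqToIso e₁, by rw [k₂]; simp⟩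
  have ht : t.trans ρ.square = N.square := by
    refine ElementarySquare.ext ?_ ?_
    · ext
      change eqToHom e₂ ≫ (φ.fiberHomIso ρ.composite ρ.iso ρ.iso_composite).inv ≫ m.hom =
        (Φ.fiberHomIso N.composite N.iso N.iso_composite).inv ≫ eqToHom e₀ ≫ m.hom
      rw [Iso.eq_inv_comp, Elementary.fiberHomIso_hom, k₁, ← Elementary.fiberHomIso_hom]
      simp only [Category.assoc, eqToHom_trans_assoc, eqToHom_refl, Category.id_comp,
        Iso.hom_inv_id_assoc]
    · rfl
  have e₃ : N.first.fiber = ρ.first.fiber := ρ.first.atFiber_fiber _ _ _ _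
    (by rw [cardMap_comp_apply, ρ.joint, hj'])
  refine ⟨e₃, ?_⟩
  obtain ⟨e₄, h₄⟩ := t.fiberClass_eq_eqToHom e₂ e₁ rfl rfl
  change N.arrow = _
  unfold arrow
  rw [← ht, ElementarySquare.fiberClass_trans, h₄]
  simp

end Refinement

/-- The restriction of a refinement to the local terminal fiber of the bottom isomorphism of a
square. -/
noncomputable def Refinement.left {T S T' S' G₀ G₁ : O} {φ : Elementary T S} {φ' : Elementary T' S'}
    {m : φ.fiber ≅ G₀} {γ : Elementary G₀ G₁} (ρ : Refinement φ m γ) (q : ElementarySquare φ φ') :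
    Refinement q.left (eqToIso q.left_fiber ≪≫ m) γ :=
  ρ.atFiber q.bot.hom _ rfl φ'.idx q.cardMap_idx q.left rfl _ rfl

lemma inv_comp_comp_eq {C : Type*} [Category C] {A M N X Y Z : C} (r : M ≅ A) {n : M ⟶ N}
    {f : N ⟶ X} (s : X ≅ Y) {u : A ⟶ Z} {t : N ⟶ Z} {v : Z ⟶ Y} (h : n ≫ t = r.hom ≫ u)
    (h' : f ≫ s.hom = t ≫ v) : (r.inv ≫ n) ≫ f = (u ≫ v) ≫ s.inv := by
  rw [Iso.eq_comp_inv, Category.assoc, Category.assoc, Iso.inv_comp_eq, h', ← Category.assoc, h,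
    Category.assoc]

/-- A refinement is carried along a square whose bottom isomorphism need not be a quasibijection, so
the nontrivial fiber may change to a virtually isomorphic one. For this reason the new refinement
realizes the restriction `(ρ.left q).first` rather than `γ`. This is the geometric input of the
inductive step of equivariance. -/
lemma Refinement.exists_transport {T S T' S' G₀ G₁ : O} {φ : Elementary T S}
    {φ' : Elementary T' S'} {m : φ.fiber ≅ G₀} {γ : Elementary G₀ G₁} (ρ : Refinement φ m γ)
    (q : ElementarySquare φ φ') :
    ∃ (ρ' : Refinement φ' (q.right.symm ≪≫ (ρ.left q).iso) (ρ.left q).first)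
      (q₀ : ElementarySquare ρ.first ρ'.first) (q₁ : ElementarySquare ρ.second ρ'.second)
      (e : (ρ.left q).first.fiber = ρ.first.fiber) (e' : q₁.mid = (ρ.left q).obj₁),
      q₁.bot = q.bot ∧ φ'.idx = ρ'.second.idx ∧ q₀.bot = q₁.top ∧
      ρ.iso ≪≫ q₀.top = q.top ≪≫ ρ'.iso ∧ ρ'.label = q₁.right.symm ≪≫ eqToIso e' ∧
      q₀.fiberClass ≫ ρ'.arrow = eqToHom (QVrt.mk_congr e.symm _ _) := by
  -- The second morphism is transported along `q.bot`, and the first along the isomorphism this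
  -- creates on the middle object.
  obtain ⟨T₁, φ₂, ⟨t₁, b, w₁⟩, hb⟩ := ρ.second.exists_square q.bot
  obtain rfl : b = q.bot := hb
  obtain ⟨T₀, φ₁, ⟨t₀, b, w₀⟩, hb⟩ := ρ.first.exists_square t₁
  obtain rfl : b = t₁ := hb
  have wi : ((q.top.symm ≪≫ ρ.iso ≪≫ t₀).hom ≫ φ₁.hom) ≫ φ₂.hom = φ'.hom := by
    simp only [Iso.trans_hom, Iso.symm_hom, Category.assoc]
    rw [Iso.inv_comp_eq, ← q.w, ← reassoc_of% w₀, ← w₁, ← ρ.w]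
    simp
  have hidx := φ'.idx_eq φ₂ _ wi
  obtain ⟨g, hg, k, ht, hp⟩ := φ₂
  obtain rfl : φ'.idx = k := hidx
  let φ₂ : Elementary T₁ S' := ⟨g, hg, φ'.idx, ht, hp⟩
  let q₁ : ElementarySquare ρ.second φ₂ := ⟨b, q.bot, w₁⟩
  let q₀ : ElementarySquare ρ.first φ₁ := ⟨t₀, b, w₀⟩
  have hj : cardMap g φ₁.idx = φ'.idx := by
    have h₁ : cardMap b.hom ρ.first.idx = φ₁.idx := q₀.cardMap_idx
    have h₂ : cardMap q.bot.hom ρ.second.idx = φ'.idx := q₁.cardMap_idx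
    rw [← h₁, ← cardMap_comp_apply, ← w₁, cardMap_comp_apply, ρ.joint, h₂]
  have hj' : cardMap (ρ.second.hom ≫ q.bot.hom) ρ.first.idx = φ'.idx := by
    rw [cardMap_comp_apply, ρ.joint]; exact q₁.cardMap_idx
  let q₂ : ElementarySquare (ρ.left q).first (φ₁.induced φ₂ hj) :=
    q₀.atFiber (ρ.second.hom ≫ q.bot.hom) _ rfl g (φ₁.hom ≫ g) rfl w₁.symm φ'.idx hj' hj
  have W : (q.top.symm ≪≫ ρ.iso ≪≫ t₀).hom ≫ φ₁.hom ≫ g = φ'.hom := by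
    rw [← wi, Category.assoc]
  have WW : (ρ.iso ≪≫ t₀).hom ≫ φ₁.hom ≫ g = φ.hom ≫ q.bot.hom := by
    rw [q.w, ← W]; simp
  have h₃ : (ρ.left q).iso.hom ≫ q₂.top.hom = q.right.hom ≫
      φ'.fiberHom (φ₁.comp φ₂ hj) (q.top.symm ≪≫ ρ.iso ≪≫ t₀).hom W := by
    have h₁ := OperadicCategory.fiberMap_comp ρ.iso.hom t₀.hom (φ.hom ≫ q.bot.hom)
      (ρ.first.hom ≫ ρ.second.hom ≫ q.bot.hom) (φ₁.hom ≫ g) (by rw [← ρ.w]; simp)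
      (by rw [← reassoc_of% w₀]; exact congrArg _ w₁.symm) WW φ'.idx
    have h₂ := OperadicCategory.fiberMap_comp q.top.hom (q.top.symm ≪≫ ρ.iso ≪≫ t₀).hom
      (φ.hom ≫ q.bot.hom) φ'.hom (φ₁.hom ≫ g) q.w.symm W (by rw [Category.assoc, W, q.w]) φ'.idx
    refine h₁.symm.trans (Eq.trans ?_ (h₂.trans ?_))
    · exact (fiberMap_congr (by simp) rfl rfl _ _).trans (eqToHom_conj_self _ _ _)
    · exact congrArg (fun x => q.right.hom ≫ x) (eqToHom_conj_self _ rfl rfl).symm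
  let ρ' : Refinement φ' (q.right.symm ≪≫ (ρ.left q).iso) (ρ.left q).first :=
    ⟨T₀, T₁, q.top.symm ≪≫ ρ.iso ≪≫ t₀, φ₁, φ₂, hj, wi, q₁.right.symm, by
      have h₁ := OperadicCategory.fiberMap_comp (q.top.symm ≪≫ ρ.iso ≪≫ t₀).hom φ₁.hom φ'.hom
        (φ₁.hom ≫ g) g W rfl wi φ'.idx
      have h₂ : φ'.fiberHom φ₂ ((q.top.symm ≪≫ ρ.iso ≪≫ t₀).hom ≫ φ₁.hom) wi =
          φ'.fiberHom (φ₁.comp φ₂ hj) (q.top.symm ≪≫ ρ.iso ≪≫ t₀).hom W ≫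
            (φ₁.induced φ₂ hj).hom := by
        refine (eqToHom_conj_self _ rfl rfl).trans (h₁.trans ?_)
        exact congrArg (fun x => x ≫ fiberMap φ₁.hom g (φ₁.hom ≫ g) rfl φ'.idx)
          (eqToHom_conj_self _ rfl rfl).symm
      rw [h₂]
      exact inv_comp_comp_eq q.right q₁.right h₃ q₂.w⟩
  refine ⟨ρ', q₀, q₁, ρ.first.atFiber_fiber _ _ _ _ hj', rfl, rfl, rfl, rfl, ?_, ?_, ?_⟩
  · change ρ.iso ≪≫ t₀ = q.top ≪≫ q.top.symm ≪≫ ρ.iso ≪≫ t₀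
    simp
  · ext; exact (Category.comp_id _).symm
  -- By this identity of squares the arrow of `ρ'` inverts that of `q₀`, up to equality of fibers.
  · have h : q₂.trans ρ'.square = ElementarySquare.refl _ := by
      refine ElementarySquare.ext ?_ ?_
      · ext
        change q₂.top.hom ≫ (φ'.fiberHomIso ρ'.composite ρ'.iso ρ'.iso_composite).inv ≫
          q.right.inv ≫ (ρ.left q).iso.hom = 𝟙 _
        rw [← cancel_epi (ρ.left q).iso.hom, reassoc_of% h₃]
        change q.right.hom ≫ (φ'.fiberHomIso ρ'.composite ρ'.iso ρ'.iso_composite).hom ≫ _ = _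
        rw [Iso.hom_inv_id_assoc, Iso.hom_inv_id_assoc, Category.comp_id]
      · ext
        exact q₁.right.hom_inv_id
    have h₂ := q₀.atFiber_fiberClass (ρ.second.hom ≫ q.bot.hom) _ rfl g (φ₁.hom ≫ g) rfl w₁.symm
      φ'.idx hj' hj
    have h₄ := congrArg ElementarySquare.fiberClass h
    rw [ElementarySquare.fiberClass_trans, ElementarySquare.fiberClass_refl] at h₄
    have e₁ : (ρ.left q).first.fiber = ρ.first.fiber := ρ.first.atFiber_fiber _ _ _ _ hj'
    have e₂ := φ₁.induced_fiber φ₂ hj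
    have h₅ : (eqToHom (QVrt.mk_congr e₁ (Elementary.fiber_pos _) (Elementary.fiber_pos _)) ≫
        q₀.fiberClass ≫ eqToHom (QVrt.mk_congr e₂ (Elementary.fiber_pos _)
          (Elementary.fiber_pos _))) ≫ ρ'.square.fiberClass = 𝟙 _ :=
      (congrArg (fun x => x ≫ ρ'.square.fiberClass) h₂.symm).trans h₄
    rw [← cancel_epi (eqToHom (QVrt.mk_congr e₁ (Elementary.fiber_pos _)
      (Elementary.fiber_pos _)))]
    refine Eq.trans ?_ (h₅.trans ((eqToHom_trans _ _).trans (eqToHom_refl _ _)).symm)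
    simp only [Category.assoc]
    rfl

end Restriction

/-! ## Refinements compatible with a square of disjoint fibers -/

section Commuting

variable {O : Type u} [Category.{v} O] [GradedOperadicCategory O] [StandingAssumptions O]

/-- Maps into trivial fibers involve no choice and no condition, so only the fiber at `j` has to be
prescribed and checked. -/
lemma lift_hom_at {T S T₀ T₁ : O} (h : T ⟶ S)
    (p : T ⟶ T₀) (f : T₀ ⟶ S) (w : p ≫ f = h)
    (p' : T ⟶ T₁) (f' : T₁ ⟶ S) (w' : p' ≫ f' = h) (hf' : IsOrderPreserving f') (j : Fin (card S))
    (r : fiber f j ⟶ fiber f' j) (hr : fiberMap p f h w j ≫ r = fiberMap p' f' h w' j)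
    (ht : ∀ i, i ≠ j → IsTrivial (fiber f' i)) :
    ∃ (θ : T₀ ⟶ T₁) (wθ : θ ≫ f' = f), p ≫ θ = p' ∧ fiberMap θ f' f wθ j = r := by
  classical
  let q : ∀ i, fiber f i ⟶ fiber f' i := fun i =>
    if h' : i = j then eqToHom (by rw [h']) ≫ r ≫ eqToHom (by rw [h'])
    else (ht i h').isLocalTerminal.from
      (zigzag_of_hom_hom (fiberMap p f h w i) (fiberMap p' f' h w' i))
  obtain ⟨θ, wθ, h₁, h₂⟩ := lift_hom h p f w p' f' w' hf' q (fun i => by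
    by_cases h' : i = j
    · subst h'; simp [q, hr]
    · exact (ht i h').isLocalTerminal.hom_ext _ _)
  exact ⟨θ, wθ, h₁, by rw [h₂]; simp [q]⟩

/-- Over a trivial fiber of the intermediate object, induced maps of fibers agree. -/
lemma fiberMap_eq_of_isTrivial {T S Q R : O} (f : T ⟶ S) (a : S ⟶ Q) (b : T ⟶ Q) (c : Q ⟶ R)
    (g : S ⟶ R) (h : T ⟶ R) (w : f ≫ a = b) (wg : a ≫ c = g) (w' : f ≫ g = h)
    (i : Fin (card R)) (k : Fin (card Q)) (hk : cardMap c k = i) (hc : IsTrivial (fiber c i))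
    (e : fiber b k = fiber h i) (e' : fiber g i = fiber a k) :
    fiberMap f a b w k = eqToHom e ≫ fiberMap f g h w' i ≫ eqToHom e' := by
  have wh : b ≫ c = h := by rw [← w, Category.assoc, wg, w']
  obtain ⟨l, hl⟩ := exists_incl c k hk
  have w'' : fiberMap f g h w' i ≫ fiberMap a c g wg i = fiberMap b c h wh i := by
    rw [← OperadicCategory.fiberMap_comp f a h g c w' wg (by rw [w, wh])]
    exact (fiberMap_congr w rfl rfl _ _).trans (eqToHom_conj_self _ _ _)
  have h₁ := fiberMap_fiberMap_incl f a b c g h w wg wh w' i l k hl w''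
  have h₂ : ∀ {X Y Z : O} (x : X ⟶ Y) (y : Y ⟶ Z) (z : X ⟶ Z) (wz : x ≫ y = z) (hZ : IsTrivial Z)
      (l : Fin (card Z)), fiberMap x y z wz l = eqToHom (fiber_of_isTrivial z hZ l) ≫ x ≫
        eqToHom (fiber_of_isTrivial y hZ l).symm := by
    rintro X Y Z x y z wz ⟨c, rfl⟩ l
    exact OperadicCategory.fiberMap_U _ _ _ _ _
  rw [h₂ _ _ _ w'' hc l] at h₁
  have h₃ := congrArg (fun x => eqToHom (fiber_fiberMap_incl b c h wh hl).symm ≫ x ≫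
    eqToHom (fiber_fiberMap_incl a c g wg hl)) h₁
  simp only [Category.assoc, eqToHom_trans, eqToHom_trans_assoc, eqToHom_refl, Category.id_comp,
    Category.comp_id] at h₃
  exact h₃.symm

lemma Elementary.conj_idx {X Y G₀ G₁ : O} {γ : Elementary G₀ G₁} {e₀ : X = G₀} {e₁ : G₁ = Y}
    {γ' : Elementary X Y} (h : γ'.hom = eqToHom e₀ ≫ γ.hom ≫ eqToHom e₁) :
    γ'.idx = cardMap (eqToHom e₁) γ.idx := by
  subst e₀ e₁
  obtain rfl : γ' = γ := ext_hom (by simpa using h)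
  exact (cardMap_id_apply _ _).symm

lemma eq_of_card_fiber_eq_one {X Y : O} (f : X ⟶ Y) {i : Fin (card Y)} (h : card (fiber f i) = 1)
    {x y : Fin (card X)} (hx : cardMap f x = i) (hy : cardMap f y = i) : x = y := by
  obtain ⟨k, rfl⟩ := exists_incl f x hx
  obtain ⟨l, rfl⟩ := exists_incl f y hy
  have : Subsingleton (Fin (card (fiber f i))) := by rw [h]; infer_instance
  rw [Subsingleton.elim k l]

/-- The diagonal `T ⟶ S` has two nontrivial fibers, that of `φ''` over `ψ'.idx` and that of `φ'`
over `ψ''.idx`, and everything is constructed over `S` by choosing this pair. The object `T₀` has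
`G₀` in the first place and `T₁` has `G₁`, both keeping the second fiber, while `Q₀` and `Q₁` have
`G₀` and `G₁` with the second fiber made terminal. Thus `γ` is realized in `φ''` and `ψ'`
simultaneously, and the original square is cut into one that exchanges `γ` with the fiber of `φ'`
and one whose remaining fiber is `G₁`. The second has smaller grade, which is what the induction for
commutativity needs. -/
lemma DisjointSquare.exists_refinements {T P' P'' S G₀ G₁ : O} {φ' : Elementary T P'}
    {ψ' : Elementary P' S} {φ'' : Elementary T P''} {ψ'' : Elementary P'' S}
    (q : DisjointSquare φ' ψ' φ'' ψ'') (ℓ : φ''.fiber ≅ G₀) (γ : Elementary G₀ G₁)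
    (hG : 1 ≤ grade G₁) :
    ∃ (T₀ T₁ Q₀ Q₁ : O) (τ : T ≅ T₀) (σ : P' ≅ Q₀) (φ₁ : Elementary T₀ T₁) (φ₂ : Elementary T₁ P'')
      (ζ : Elementary Q₀ Q₁) (ω : Elementary Q₁ S) (χ₀ : Elementary T₀ Q₀) (χ₁ : Elementary T₁ Q₁)
      (l : φ₂.fiber ≅ G₁) (l' : ω.fiber ≅ G₁) (h₁ : _) (h₂ : _) (h₃ : _) (h₄ : _) (h₅ : _)
      (h₆ : _) (w : φ'.hom ≫ σ.hom = τ.hom ≫ χ₀.hom),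
      (⟨T₀, T₁, τ, φ₁, φ₂, h₁, h₂, l, h₃⟩ : Refinement φ'' ℓ γ).IsStrict ∧
      (⟨Q₀, Q₁, σ, ζ, ω, h₄, h₅, l', h₆⟩ :
        Refinement ψ' (eqToIso q.symm.fiber_eq_fiber.symm ≪≫ ℓ) γ).IsStrict ∧
      DisjointSquare χ₀ ζ φ₁ χ₁ ∧ DisjointSquare χ₁ ω φ₂ ψ'' ∧
      IsTrivial (fiber σ.hom χ₀.idx) ∧
      ∃ e, (⟨τ, σ, w⟩ : ElementarySquare φ' χ₀).right.hom = eqToHom e := by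
  have hne := q.disjoint
  have w'' := q.w.symm
  have hfib : fiber (φ'.hom ≫ ψ'.hom) ψ'.idx = φ''.fiber := by
    rw [q.w]; exact q.symm.fiber_eq.symm
  -- the objects over `S`
  obtain ⟨T₀, t, f₀, wt, e₀, hf₀, ht, ht'⟩ :=
    exists_lift_at (φ'.hom ≫ ψ'.hom) ψ'.idx (eqToHom hfib ≫ ℓ.hom)
  subst e₀
  simp only [eqToHom_refl, Category.comp_id] at ht
  have hg : ∀ i, grade (fiber (φ'.hom ≫ ψ'.hom) i) = grade (fiber f₀ i) := fun i => by
    by_cases h : i = ψ'.idx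
    · subst h; rw [hfib, grade_of_iso ℓ]
    · obtain ⟨e, -⟩ := ht' i h; rw [e]
  have := isIso_of_grade_fiber_eq _ t f₀ hg
  obtain ⟨T₁, p, f₁, wp, e₁, hf₁, hp, hp'⟩ := exists_lift_at f₀ ψ'.idx γ.hom
  subst e₁
  simp only [eqToHom_refl, Category.comp_id] at hp
  -- Collapsing the fiber over `ψ''.idx` to the chosen local terminal object removes the
  -- contribution of `φ'`.
  obtain ⟨Q₀, c₀, g₀, wc₀, e₀, hg₀, hc₀, hc₀'⟩ :=
    exists_lift_at f₀ ψ''.idx (toTerminal (fiber f₀ ψ''.idx))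
  obtain ⟨Q₁, c₁, g₁, wc₁, e₁, hg₁, hc₁, hc₁'⟩ :=
    exists_lift_at f₁ ψ''.idx (toTerminal (fiber f₁ ψ''.idx))
  -- their fibers
  have hpos : 1 ≤ grade (fiber f₀ ψ''.idx) := by
    rw [← hg, ← q.fiber_eq]; exact φ'.fiber_pos
  have hpos₁ : 1 ≤ grade (fiber f₁ ψ''.idx) := by
    obtain ⟨e, -⟩ := hp' _ hne.symm; rw [← e]; exact hpos
  have tr₀ : ∀ i, i ≠ ψ'.idx → i ≠ ψ''.idx → IsTrivial (fiber f₀ i) := fun i h h' => by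
    obtain ⟨e, -⟩ := ht' i h; rw [← e]; exact q.isTrivial_fiber _ rfl h h'
  have tr₁ : ∀ i, i ≠ ψ'.idx → i ≠ ψ''.idx → IsTrivial (fiber f₁ i) := fun i h h' => by
    obtain ⟨e, -⟩ := hp' i h; rw [← e]; exact tr₀ i h h'
  have trg₀ : ∀ i, i ≠ ψ'.idx → IsTrivial (fiber g₀ i) := fun i h => by
    by_cases h' : i = ψ''.idx
    · subst h'; rw [← e₀]; exact isTrivial_terminalOf _
    · obtain ⟨e, -⟩ := hc₀' i h'; rw [← e]; exact tr₀ i h h'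
  have trg₁ : ∀ i, i ≠ ψ'.idx → IsTrivial (fiber g₁ i) := fun i h => by
    by_cases h' : i = ψ''.idx
    · subst h'; rw [← e₁]; exact isTrivial_terminalOf _
    · obtain ⟨e, -⟩ := hc₁' i h'; rw [← e]; exact tr₁ i h h'
  obtain ⟨k₀, hk₀⟩ := hc₀' _ hne
  obtain ⟨k₁, hk₁⟩ := hc₁' _ hne
  obtain ⟨a', ha'⟩ := q.symm.fiberMap_eq_eqToHom (φ'.hom ≫ ψ'.hom) rfl
  obtain ⟨a'', ha''⟩ := q.fiberMap_eq_eqToHom (φ'.hom ≫ ψ'.hom) w''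
  obtain ⟨b, hb⟩ := ht' _ hne.symm
  obtain ⟨b₁, hb₁⟩ := hp' _ hne.symm
  -- the remaining morphisms over `S`
  have wtc : (t ≫ c₀) ≫ g₀ = φ'.hom ≫ ψ'.hom := by rw [Category.assoc, wc₀, wt]
  obtain ⟨s, ws, hs, hs'⟩ := lift_hom_at (φ'.hom ≫ ψ'.hom) φ'.hom ψ'.hom rfl (t ≫ c₀) g₀ wtc hg₀
    ψ'.idx (eqToHom (a'.symm.trans hfib) ≫ ℓ.hom ≫ eqToHom k₀) (by
      rw [OperadicCategory.fiberMap_comp t c₀ _ f₀ g₀ wt wc₀, ht, hk₀, ha']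
      simp) trg₀
  have wpc : (p ≫ c₁) ≫ g₁ = f₀ := by rw [Category.assoc, wc₁, wp]
  obtain ⟨z, wz, hz, hz'⟩ := lift_hom_at f₀ c₀ g₀ wc₀ (p ≫ c₁) g₁ wpc hg₁
    ψ'.idx (eqToHom k₀.symm ≫ γ.hom ≫ eqToHom k₁) (by
      rw [OperadicCategory.fiberMap_comp p c₁ _ f₁ g₁ wp wc₁, hp, hk₀, hk₁]
      simp) trg₁
  have wtp : (t ≫ p) ≫ f₁ = φ'.hom ≫ ψ'.hom := by rw [Category.assoc, wp, wt]
  obtain ⟨r, wr, hr, hr'⟩ := lift_hom_at (φ'.hom ≫ ψ'.hom) (t ≫ p) f₁ wtp φ''.hom ψ''.hom w''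
    ψ''.orderPreserving ψ''.idx (eqToHom (b₁.symm.trans (b.symm.trans a''))) (by
      rw [OperadicCategory.fiberMap_comp t p _ f₀ f₁ wt wp, hb, hb₁, ha'']
      simp) ψ''.trivial
  have hsiso : IsIso s := isIso_of_grade_fiber_eq ψ'.hom s g₀ fun i => by
    by_cases h : i = ψ'.idx
    · subst h; rw [← k₀, ← grade_of_iso ℓ, ← hfib, a']
    · rw [grade_of_isTrivial (ψ'.trivial i h), grade_of_isTrivial (trg₀ i h)]
  -- the elementary morphisms
  have eqf : ∀ {X Y : O} {f : X ⟶ Y}, (∃ e : X = Y, f = eqToHom e) →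
      IsOrderPreserving f ∧ IsQuasibijection f := fun h => by
    obtain ⟨e, rfl⟩ := h
    exact ⟨isOrderPreserving_eqToHom e, isQuasibijection_eqToHom e⟩
  have trf : ∀ {X Y : O} (f : X ⟶ Y), IsTrivial X → IsTrivial Y →
      IsOrderPreserving f ∧ IsQuasibijection f := fun f hX hY =>
    ⟨isOrderPreserving_of_card_target _ hY.card_eq, isQuasibijection_of_isTrivial f hX hY⟩
  obtain ⟨φ₁, rfl, iφ₁, -⟩ := exists_elementary_of_fiberMap p f₁ f₀ wp hf₁ hf₀ ψ'.idx γ hp.symm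
    fun i h => eqf (hp' i h)
  obtain ⟨χ₀, rfl, iχ₀, -⟩ := exists_elementary_of_fiberMap c₀ g₀ f₀ wc₀ hg₀ hf₀ ψ''.idx
    (.toLocalTerminal (fiberMap c₀ g₀ f₀ wc₀ ψ''.idx) (trg₀ _ hne.symm).isLocalTerminal hpos) rfl
    fun i h => eqf (hc₀' i h)
  obtain ⟨χ₁, rfl, iχ₁, -⟩ := exists_elementary_of_fiberMap c₁ g₁ f₁ wc₁ hg₁ hf₁ ψ''.idx
    (.toLocalTerminal (fiberMap c₁ g₁ f₁ wc₁ ψ''.idx) (trg₁ _ hne.symm).isLocalTerminal hpos₁) rfl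
    fun i h => eqf (hc₁' i h)
  obtain ⟨γ', hγ', -⟩ := γ.exists_conj k₀.symm k₁
  obtain ⟨ζ, rfl, iζ, -⟩ := exists_elementary_of_fiberMap z g₁ g₀ wz hg₁ hg₀ ψ'.idx γ'
    (by rw [hγ', hz']) fun i h => trf _ (trg₀ i h) (trg₁ i h)
  obtain ⟨φ₂, rfl, iφ₂, fφ₂⟩ := exists_elementary_of_fiberMap r ψ''.hom f₁ wr
    ψ''.orderPreserving hf₁
    ψ'.idx (.toLocalTerminal (fiberMap r ψ''.hom f₁ wr ψ'.idx)
      (ψ''.trivial _ hne).isLocalTerminal hG) rfl fun i h => by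
        by_cases h' : i = ψ''.idx
        · subst h'; exact eqf ⟨_, hr'⟩
        · exact trf _ (tr₁ i h h') (ψ''.trivial i h')
  let ω : Elementary Q₁ S := ⟨g₁, hg₁, ψ'.idx, trg₁, by rw [← k₁]; exact hG⟩
  have fφ₂' : φ₂.fiber = fiber f₁ ψ'.idx :=
    fφ₂.trans (fiber_of_isTrivial _ (ψ''.trivial _ hne) _)
  have jφ₂ : cardMap ψ''.hom φ₂.idx = ψ'.idx := by rw [iφ₂]; exact cardMap_incl _ _ _
  have cardψ : card (fiber ψ''.hom ψ'.idx) = 1 := (ψ''.trivial _ hne).card_eq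
  have cardg : card (fiber g₁ ψ''.idx) = 1 := (trg₁ _ hne.symm).card_eq
  have jφ₁ : cardMap f₁ φ₁.idx = ψ'.idx := by rw [iφ₁]; exact cardMap_incl _ _ _
  have jχ₀ : cardMap g₀ χ₀.idx = ψ''.idx := by rw [iχ₀]; exact cardMap_incl _ _ _
  have jχ₁ : cardMap g₁ χ₁.idx = ψ''.idx := by rw [iχ₁]; exact cardMap_incl _ _ _
  have jζ : cardMap g₁ ζ.idx = ψ'.idx := by rw [iζ]; exact cardMap_incl _ _ _
  have jj : cardMap φ₂.hom φ₁.idx = φ₂.idx := eq_of_card_fiber_eq_one ψ''.hom cardψ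
    (by rw [← cardMap_comp_apply, wr, jφ₁]) jφ₂
  -- restrictions to the nontrivial fibers
  have hℓ : fiberMap (t ≫ φ₁.hom) f₁ _ wtp ψ'.idx = (eqToHom hfib ≫ ℓ.hom) ≫ γ.hom := by
    rw [OperadicCategory.fiberMap_comp t φ₁.hom _ f₀ f₁ wt wp, ht, hp]
  have wsz : (s ≫ ζ.hom) ≫ g₁ = ψ'.hom := by rw [Category.assoc, wz, ws]
  have hℓ' : fiberMap (s ≫ ζ.hom) g₁ ψ'.hom wsz ψ'.idx =
      (eqToHom (a'.symm.trans hfib) ≫ ℓ.hom ≫ eqToHom k₀) ≫ eqToHom k₀.symm ≫ γ.hom ≫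
        eqToHom k₁ := by
    rw [OperadicCategory.fiberMap_comp s ζ.hom _ g₀ g₁ ws wz, hs', hz']
  have comm₁ : ℓ.hom ≫ γ.hom = φ''.fiberHom φ₂ (t ≫ φ₁.hom) hr ≫ eqToHom fφ₂' := by
    have h := fiberMap_eq_of_isTrivial (t ≫ φ₁.hom) φ₂.hom φ''.hom ψ''.hom f₁ _ hr wr wtp ψ'.idx
      φ₂.idx jφ₂ (ψ''.trivial _ hne) ((φ''.fiber_eq_of_idx (φ''.idx_eq φ₂ _ hr)).symm.trans
        hfib.symm) fφ₂'.symm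
    rw [hℓ] at h
    have h' := congrArg (fun x => (eqToHom (φ''.fiber_eq_of_idx (φ''.idx_eq φ₂ _ hr)) ≫ x ≫
      eqToHom φ₂.fiber_def) ≫ eqToHom fφ₂') h
    refine Eq.trans ?_ h'.symm
    have aux : ∀ {A B C X Y Z W : O} (f : A ⟶ B) (g : B ⟶ C) (x₁ : A = X) (x₂ : X = Y)
        (x₃ : Y = A) (y₁ : C = Z) (y₂ : Z = W) (y₃ : W = C), f ≫ g = (eqToHom x₁ ≫ (eqToHom x₂ ≫
          ((eqToHom x₃ ≫ f) ≫ g) ≫ eqToHom y₁) ≫ eqToHom y₂) ≫ eqToHom y₃ := by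
      intros; subst_vars; simp
    exact aux _ _ _ _ _ _ _ _
  have comm₂ : (eqToHom q.symm.fiber_eq_fiber.symm ≫ ℓ.hom) ≫ γ.hom =
      ψ'.fiberHom ω (s ≫ ζ.hom) wsz ≫ eqToHom k₁.symm := by
    have h' := congrArg (fun x => (eqToHom ψ'.fiber_def.symm ≫ x ≫ eqToHom ω.fiber_def) ≫
      eqToHom k₁.symm) hℓ'
    refine Eq.trans ?_ h'.symm
    have aux : ∀ {A B C X Y Z W U : O} (f : A ⟶ B) (g : B ⟶ C) (x₀ : X = A) (x₁ : X = Y)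
        (x₂ : Y = A) (x₃ : B = U) (x₄ : U = B) (y₁ : C = Z) (y₂ : Z = W) (y₃ : W = C),
        (eqToHom x₀ ≫ f) ≫ g = (eqToHom x₁ ≫ ((eqToHom x₂ ≫ f ≫ eqToHom x₃) ≫ eqToHom x₄ ≫ g ≫
          eqToHom y₁) ≫ eqToHom y₂) ≫ eqToHom y₃ := by
      intros; subst_vars; simp
    exact aux _ _ _ _ _ _ _ _ _ _
  refine ⟨T₀, T₁, Q₀, Q₁, asIso t, asIso s, φ₁, φ₂, ζ, ω, χ₀, χ₁, eqToIso fφ₂', eqToIso k₁.symm,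
    jj, hr, comm₁, jζ, wsz, comm₂, hs, ?_, ?_, ⟨hz, ?_, ?_, ?_⟩, ⟨?_, ?_, jφ₂, hne⟩, ?_, ?_⟩
  · have ec : fiber (φ₁.comp φ₂ jj).hom (φ₁.comp φ₂ jj).idx = fiber f₀ ψ'.idx :=
      fiber_eq_of_trivial (φ₁.hom ≫ φ₂.hom) ψ''.hom f₀ (by rw [Category.assoc, wr, wp]) φ₂.idx
        ψ'.idx jφ₂ (ψ''.trivial _ hne)
    refine Refinement.isStrict_of _ ec.symm ?_ ⟨fφ₂', rfl⟩
    have w₁ : t ≫ φ₁.hom ≫ φ₂.hom = φ''.hom := by rw [← Category.assoc, hr]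
    have h := fiberMap_eq_of_isTrivial t (φ₁.hom ≫ φ₂.hom) φ''.hom ψ''.hom f₀ _ w₁
      (by rw [Category.assoc, wr, wp]) wt ψ'.idx φ₂.idx jφ₂ (ψ''.trivial _ hne)
      ((φ''.fiber_eq_of_idx (φ''.idx_eq φ₂ _ hr)).symm.trans hfib.symm) ec.symm
    rw [ht] at h
    have h' := congrArg (fun x => eqToHom (φ''.fiber_eq_of_idx (φ''.idx_eq φ₂ _ hr)) ≫ x ≫
      eqToHom (φ₁.comp φ₂ jj).fiber_def) h
    refine h'.trans ?_
    have aux : ∀ {A B X Y Z W : O} (f : A ⟶ B) (x₁ : A = X) (x₂ : X = Y) (x₃ : Y = A)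
        (y₁ : B = Z) (y₂ : Z = W) (y₃ : B = W), eqToHom x₁ ≫ (eqToHom x₂ ≫ (eqToHom x₃ ≫ f) ≫
          eqToHom y₁) ≫ eqToHom y₂ = f ≫ eqToHom y₃ := by
      intros; subst_vars; simp
    exact aux _ _ _ _ _ _ _
  · have ec : fiber (ζ.comp ω jζ).hom (ζ.comp ω jζ).idx = fiber f₀ ψ'.idx :=
      (congrArg (fun x => fiber x ψ'.idx) wz).trans k₀.symm
    refine Refinement.isStrict_of _ ec.symm ?_ ⟨k₁.symm, rfl⟩
    have h : ∀ (g : Q₀ ⟶ S) (hg : g = g₀) (w : s ≫ g = ψ'.hom),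
        fiberMap s g ψ'.hom w ψ'.idx = (eqToHom (a'.symm.trans hfib) ≫ ℓ.hom ≫ eqToHom k₀) ≫
          eqToHom (by rw [hg]) := by
      rintro _ rfl w; rw [hs']; simp
    have h' := congrArg (fun x => eqToHom ψ'.fiber_def.symm ≫ x ≫
      eqToHom (ζ.comp ω jζ).fiber_def) (h (ζ.hom ≫ g₁) wz (by rw [wz, ws]))
    refine h'.trans ?_
    have aux : ∀ {A B X Y Z W U : O} (f : A ⟶ B) (x₁ : X = Y) (x₂ : Y = A) (y₁ : B = Z)
        (y₂ : Z = W) (y₃ : W = U) (x₀ : X = A) (y₀ : B = U), eqToHom x₁ ≫ ((eqToHom x₂ ≫ f ≫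
          eqToHom y₁) ≫ eqToHom y₂) ≫ eqToHom y₃ = (eqToHom x₀ ≫ f) ≫ eqToHom y₀ := by
      intros; subst_vars; simp
    exact aux _ _ _ _ _ _ q.symm.fiber_eq_fiber.symm _
  · exact eq_of_card_fiber_eq_one g₁ cardg (by rw [← cardMap_comp_apply, wz, jχ₀]) jχ₁
  · rw [iφ₁, iζ, Elementary.conj_idx hγ', cardMap_incl_eq _ _ _ wc₁ ψ'.idx _ hk₁]
  · intro h
    exact hne (jζ.symm.trans ((congrArg _ h).trans jχ₁))
  · change χ₁.hom ≫ g₁ = _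
    rw [wc₁, wr]
  · exact jχ₁
  · rw [show fiber (asIso s).hom χ₀.idx = fiber ψ'.hom ψ''.idx from
      fiber_eq_of_trivial s g₀ ψ'.hom ws χ₀.idx ψ''.idx jχ₀ (trg₀ _ hne.symm)]
    exact ψ'.trivial _ hne.symm
  · have e : fiber (t ≫ χ₀.hom) χ₀.idx = fiber (φ'.hom ≫ ψ'.hom) ψ''.idx :=
      fiber_eq_of_trivial (t ≫ χ₀.hom) g₀ _ wtc χ₀.idx ψ''.idx jχ₀ (trg₀ _ hne.symm)
    have e' : χ₀.fiber = fiber f₀ ψ''.idx :=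
      fiber_eq_of_trivial χ₀.hom g₀ f₀ wc₀ χ₀.idx ψ''.idx jχ₀ (trg₀ _ hne.symm)
    have e₂ : fiber (φ'.hom ≫ s) χ₀.idx = fiber (φ'.hom ≫ ψ'.hom) ψ''.idx := by rw [hs, e]
    have h := fiberMap_eq_of_isTrivial t χ₀.hom (φ'.hom ≫ s) g₀ f₀ _ hs.symm wc₀ wt ψ''.idx
      χ₀.idx jχ₀ (trg₀ _ hne.symm) e₂ e'.symm
    rw [hb] at h
    refine ⟨e₂.trans (b.trans e'.symm), h.trans ?_⟩
    exact (congrArg (fun x => eqToHom e₂ ≫ x) (eqToHom_trans b e'.symm)).trans (eqToHom_trans _ _)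

end Commuting

/-! ## Modules over a collection -/

/-- A presheaf on the groupoid of isomorphisms on which a collection acts along the elementary
morphisms, with units at the local terminal objects. -/
structure TowerModule {O : Type u} [Category.{v} O] [GradedOperadicCategory O]
    [StandingAssumptions O] {V : Type u'} [Category.{v'} V] [MonoidalCategory V]
    [SymmetricCategory V] (E : Collection O V) where
  presheaf : IsoPresheaf O V
  act : ∀ {T S : O} (φ : Elementary T S),
    E.obj (op (QVrt.mk φ.fiber φ.fiber_pos)) ⊗ presheaf.val S ⟶ presheaf.val T
  act_pull : ∀ {T S T' S' : O} {φ : Elementary T S} {φ' : Elementary T' S'}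
    (q : ElementarySquare φ φ'),
    act φ' ≫ presheaf.pull q.top = (E.map q.fiberClass.op ⊗ₘ presheaf.pull q.bot) ≫ act φ
  act_comm : ∀ {T P' P'' S : O} {φ' : Elementary T P'} {ψ' : Elementary P' S}
    {φ'' : Elementary T P''} {ψ'' : Elementary P'' S} (q : DisjointSquare φ' ψ' φ'' ψ''),
    (E.obj (op (QVrt.mk φ''.fiber φ''.fiber_pos)) ◁ act ψ'') ≫ act φ'' =
      swapMap (E.map q.cross.hom.op) (E.map q.symm.cross.inv.op) (presheaf.val S) ≫
        (E.obj (op (QVrt.mk φ'.fiber φ'.fiber_pos)) ◁ act ψ') ≫ act φ'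
  unit : ∀ {t : O}, IsLocalTerminal t → (𝟙_ V ⟶ presheaf.val t)
  unit_pull : ∀ {s t : O} (hs : IsLocalTerminal s) (ht : IsLocalTerminal t) (f : s ≅ t),
    unit ht ≫ presheaf.pull f = unit hs

section Modules

variable {O : Type u} [Category.{v} O] [GradedOperadicCategory O] [StandingAssumptions O]
  {V : Type u'} [Category.{v'} V] [MonoidalCategory V] [SymmetricCategory V] {E : Collection O V}

lemma Elementary.mk_fiber_toLocalTerminal {T t : O} (f : T ⟶ t) (ht : IsLocalTerminal t)
    (hT : 1 ≤ grade T) :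
    VirtualClass.mk T hT = VirtualClass.mk (toLocalTerminal f ht hT).fiber
      (toLocalTerminal f ht hT).fiber_pos :=
  (VirtualClass.sound _ _ ⟨t, ht, f, _, rfl⟩).symm

lemma ElementarySquare.fiberClass_toLocalTerminal {T t T' t' : O} {f : T ⟶ t}
    {ht : IsLocalTerminal t} {hT : 1 ≤ grade T} {f' : T' ⟶ t'} {ht' : IsLocalTerminal t'}
    {hT' : 1 ≤ grade T'}
    (q : ElementarySquare (.toLocalTerminal f ht hT) (.toLocalTerminal f' ht' hT')) :
    q.fiberClass = QVrt.hom q.top (Elementary.mk_fiber_toLocalTerminal f ht hT)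
      (Elementary.mk_fiber_toLocalTerminal f' ht' hT') :=
  (QVrt.hom_fiberIso ht' q.top f' (f ≫ q.bot.hom) q.w.symm _ _ _ _ _).symm

lemma IsLocalTerminal.exists_iso {T t t' : O} (ht : IsLocalTerminal t) (ht' : IsLocalTerminal t')
    (f : T ⟶ t) (f' : T ⟶ t') : Nonempty (t ≅ t') :=
  ⟨⟨ht'.from (zigzag_of_hom_hom f f'), ht.from (zigzag_of_hom_hom f' f), ht.hom_ext _ _,
    ht'.hom_ext _ _⟩⟩

namespace TowerModule

variable (P : TowerModule E)

/-- The values of a module. -/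
abbrev val (T : O) : V := P.presheaf.val T

/-- The action of isomorphisms on a module. -/
abbrev pull {T S : O} (f : T ≅ S) : P.val S ⟶ P.val T := P.presheaf.pull f

/-- The map from the generators, computed at a map to a local terminal object. -/
def genAt {T t : O} (f : T ⟶ t) (ht : IsLocalTerminal t) (hT : 1 ≤ grade T) :
    E.obj (op (QVrt.mk T hT)) ⟶ P.val T :=
  E.map (QVrt.hom (Iso.refl T) (Elementary.mk_fiber_toLocalTerminal f ht hT) rfl).op ≫
    (ρ_ _).inv ≫ (_ ◁ P.unit ht) ≫ P.act (.toLocalTerminal f ht hT)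

/-- The map from the generators. -/
noncomputable def gen {T : O} (hT : 1 ≤ grade T) : E.obj (op (QVrt.mk T hT)) ⟶ P.val T :=
  P.genAt (toTerminal T) (isTrivial_terminalOf T).isLocalTerminal hT

/-- The isomorphism `σ` is the top of a square over an isomorphism of the local terminal targets, so
the claim is equivariance of the action together with invariance of the units. Taking `σ` to be an
identity shows that the choice of target is immaterial. -/
lemma genAt_pull {T t T' t' : O} (f : T ⟶ t) (ht : IsLocalTerminal t) (hT : 1 ≤ grade T)
    (f' : T' ⟶ t') (ht' : IsLocalTerminal t') (hT' : 1 ≤ grade T') (σ : T ≅ T') :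
    P.genAt f' ht' hT' ≫ P.pull σ = E.map (QVrt.hom σ rfl rfl).op ≫ P.genAt f ht hT := by
  obtain ⟨b⟩ := ht.exists_iso ht' f (σ.hom ≫ f')
  let q : ElementarySquare (.toLocalTerminal f ht hT) (.toLocalTerminal f' ht' hT') :=
    ⟨σ, b, ht'.hom_ext _ _⟩
  have h := P.act_pull q
  unfold genAt
  simp only [Category.assoc]
  rw [h, ← Category.assoc (_ ◁ _), whiskerLeft_comp_tensorHom, P.unit_pull ht ht' b,
    MonoidalCategory.tensorHom_def, Category.assoc, ← rightUnitor_inv_naturality_assoc,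
    ← E.map_comp_assoc, ← E.map_comp_assoc, ← op_comp, ← op_comp, q.fiberClass_toLocalTerminal,
    QVrt.hom_trans, QVrt.hom_trans]
  simp [q]

lemma genAt_eq_gen {T t : O} (f : T ⟶ t) (ht : IsLocalTerminal t) (hT : 1 ≤ grade T) :
    P.genAt f ht hT = P.gen hT := by
  have := P.genAt_pull (toTerminal T) (isTrivial_terminalOf T).isLocalTerminal hT f ht hT
    (Iso.refl T)
  rw [QVrt.hom_refl, op_id, E.map_id, Category.id_comp] at this
  rw [gen, ← this]
  exact ((congrArg _ (P.presheaf.pull_refl T)).trans (Category.comp_id _)).symm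

lemma gen_pull {T T' : O} (hT : 1 ≤ grade T) (hT' : 1 ≤ grade T') (σ : T ≅ T') :
    P.gen hT' ≫ P.pull σ = E.map (QVrt.hom σ rfl rfl).op ≫ P.gen hT :=
  P.genAt_pull _ _ hT _ _ hT' σ

end TowerModule

namespace Tower

/-- The composite of the actions along a tower. -/
noncomputable def ev (P : TowerModule E) : ∀ {T : O} (A : Tower T), A.tensor E ⟶ P.val T
  | _, .last _ h => P.gen h
  | _, .cons φ r => (_ ◁ r.ev P) ≫ P.act φ

lemma Hom.map_ev (P : TowerModule E) : ∀ {T T' : O} {A : Tower T} {B : Tower T'} {σ : T ≅ T'}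
    (f : Hom A B σ), f.map E ≫ A.ev P = B.ev P ≫ P.pull σ
  | _, _, _, _, _, .last h h' σ => (P.gen_pull h h' σ).symm
  | _, _, _, _, _, .cons (φ' := φ) (φ'' := φ') (r' := r) (r'' := r') (σ := σ) (ρ := ρ) w f => by
      have ih := Hom.map_ev P f
      have h := P.act_pull (φ := φ) (φ' := φ') ⟨σ, ρ, w⟩
      change (E.map _ ⊗ₘ f.map E) ≫ (_ ◁ r.ev P) ≫ P.act φ = ((_ ◁ r'.ev P) ≫ P.act φ') ≫ P.pull σ
      rw [Category.assoc]
      refine Eq.trans ?_ (congrArg (fun x => (_ ◁ r'.ev P) ≫ x) h).symm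
      rw [← Category.assoc, tensorHom_comp_whiskerLeft, ih, ← Category.assoc,
        whiskerLeft_comp_tensorHom]

lemma Swap.map_ev (P : TowerModule E) : ∀ {T : O} {A B : Tower T} (s : Swap A B),
    s.map E ≫ A.ev P = B.ev P
  | _, _, _, .here (φ' := φ') (ψ' := ψ') (φ'' := φ'') (ψ'' := ψ'') q r => by
      have h := P.act_comm q
      change swapMap _ _ _ ≫ (_ ◁ ((_ ◁ r.ev P) ≫ P.act ψ')) ≫ P.act φ' =
        (_ ◁ ((_ ◁ r.ev P) ≫ P.act ψ'')) ≫ P.act φ''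
      have h' := swapMap_natural (E.map q.cross.hom.op) (E.map q.symm.cross.inv.op)
        (E.map q.cross.hom.op) (E.map q.symm.cross.inv.op) (𝟙 _) (𝟙 _) (𝟙 _) (𝟙 _) (r.ev P)
        (by simp) (by simp)
      simp only [id_tensorHom] at h'
      rw [whiskerLeft_comp, whiskerLeft_comp, Category.assoc, Category.assoc, h, reassoc_of% h']
  | _, _, _, .there (A := A) (B := B) φ s => by
      have ih := Swap.map_ev P s
      change (_ ◁ s.map E) ≫ (_ ◁ A.ev P) ≫ P.act φ = (_ ◁ B.ev P) ≫ P.act φ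
      rw [← ih, whiskerLeft_comp, Category.assoc]

end Tower

namespace LabelledTower

/-- Arrows of a presented category are words in the generators, so being a cocone need be tested on
generators only. The relations play no role here. -/
lemma eval_comp_of_gen {X : O} {Z : V} (g : ∀ a : LabelledTower X, a.tower.tensor E ⟶ Z)
    (hg : ∀ {a b : LabelledTower X} (γ : Gen a b), γ.map E ≫ g a = g b)
    {a b : LabelledTower X} (p : Word Gen a b) :
    (p.eval (C := Vᵒᵖ) (fun a : LabelledTower X => op (a.tower.tensor E))
      (fun g => (g.map E).op)).unop ≫ g a = g b := by
  induction p with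
  | gen γ => exact hg γ
  | id a => exact Category.id_comp _
  | comp p q hp hq => simp only [Word.eval, unop_comp, Category.assoc, hp, hq]

lemma whiskerLeft_eval_comp_of_gen {X : O} {Y Z : V}
    (g : ∀ a : LabelledTower X, Y ⊗ a.tower.tensor E ⟶ Z)
    (hg : ∀ {a b : LabelledTower X} (γ : Gen a b), (Y ◁ γ.map E) ≫ g a = g b)
    {a b : LabelledTower X} (p : Word Gen a b) :
    (Y ◁ (p.eval (C := Vᵒᵖ) (fun a : LabelledTower X => op (a.tower.tensor E))
      (fun g => (g.map E).op)).unop) ≫ g a = g b := by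
  induction p with
  | gen γ => exact hg γ
  | id a => exact (congrArg (· ≫ _) (whiskerLeft_id _ _)).trans (Category.id_comp _)
  | comp p q hp hq => simp only [Word.eval, unop_comp, whiskerLeft_comp, Category.assoc, hp, hq]

/-- A natural transformation from the diagram of labelled towers is determined by a family
compatible with the generating morphisms. -/
noncomputable def natTrans {X : O} {Z : V} (g : ∀ a : LabelledTower X, a.tower.tensor E ⟶ Z)
    (hg : ∀ {a b : LabelledTower X} (γ : Gen a b), γ.map E ≫ g a = g b) :
    towerDiagram E X ⟶ (Functor.const (LTw X)ᵒᵖ).obj Z where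
  app a := g a.unop.as
  naturality := by
    rintro ⟨⟨b⟩⟩ ⟨⟨a⟩⟩ ⟨⟨p⟩⟩
    refine Eq.trans ?_ (Category.comp_id _).symm
    exact eval_comp_of_gen g hg p

/-- The composite of the actions along a labelled tower. -/
noncomputable def leg (P : TowerModule E) {X : O} (a : LabelledTower X) :
    a.tower.tensor E ⟶ P.val X := a.tower.ev P ≫ P.pull a.label

/-- The two axioms of a module match the two types of generators: `act_pull` handles isomorphisms of
towers, and `act_comm` handles interchanges. -/
lemma Gen.map_leg (P : TowerModule E) {X : O} {a b : LabelledTower X} (γ : Gen a b) :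
    γ.map E ≫ a.leg P = b.leg P := by
  cases γ with
  | first σ w f =>
    have h := f.map_ev P
    change f.map E ≫ a.tower.ev P ≫ P.pull a.label = b.tower.ev P ≫ P.pull b.label
    rw [reassoc_of% h, ← w]
    exact congrArg _ (P.presheaf.pull_trans _ _).symm
  | second ℓ s =>
    have h := s.map_ev P
    change s.map E ≫ Tower.ev P _ ≫ P.pull ℓ = Tower.ev P _ ≫ P.pull ℓ
    rw [reassoc_of% h]

end LabelledTower

namespace TowerModule

/-- The cocone of the values of labelled towers. -/
noncomputable def cocone (P : TowerModule E) (X : O) : Cocone (towerDiagram E X) :=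
  Cocone.mk _ (LabelledTower.natTrans (fun a => a.leg P) fun γ => γ.map_leg P)

/-- A module is free if its values are the colimits over the labelled towers. -/
structure IsFree (P : TowerModule E) : Prop where
  isColimit : ∀ X : O, 1 ≤ grade X → Nonempty (IsColimit (P.cocone X))
  isIso_unit : ∀ {t : O} (ht : IsLocalTerminal t), IsIso (P.unit ht)

end TowerModule

end Modules

/-! ## Free modules -/

section Descent

variable {O : Type u} [Category.{v} O] [GradedOperadicCategory O] [StandingAssumptions O]
  {V : Type u'} [Category.{v'} V] [MonoidalCategory V] [SymmetricCategory V] {E : Collection O V}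

namespace TowerModule

namespace IsFree

variable {P : TowerModule E} (hP : P.IsFree) {X : O} (hX : 1 ≤ grade X)
include hP hX

lemma exists_desc {Z : V} (g : ∀ a : LabelledTower X, a.tower.tensor E ⟶ Z)
    (hg : ∀ {a b : LabelledTower X} (γ : LabelledTower.Gen a b), γ.map E ≫ g a = g b) :
    ∃ d : P.val X ⟶ Z, ∀ a : LabelledTower X, a.leg P ≫ d = g a := by
  obtain ⟨h⟩ := hP.isColimit X hX
  exact ⟨h.desc (Cocone.mk Z (LabelledTower.natTrans g hg)), fun a => h.fac _ (op ⟨a⟩)⟩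

lemma hom_ext {Z : V} {d d' : P.val X ⟶ Z}
    (h : ∀ a : LabelledTower X, a.leg P ≫ d = a.leg P ≫ d') : d = d' := by
  obtain ⟨hc⟩ := hP.isColimit X hX
  exact hc.hom_ext fun a => h a.unop.as

variable [∀ A : V, PreservesColimitsOfSize.{max u v, max u v} (tensorLeft A)]

/-- Tensoring preserves the colimit, so maps may be defined and compared on towers in one tensor
factor. The versions for the other side follow by the symmetry. -/
lemma exists_desc_whiskerLeft (Y : V) {Z : V}
    (g : ∀ a : LabelledTower X, Y ⊗ a.tower.tensor E ⟶ Z)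
    (hg : ∀ {a b : LabelledTower X} (γ : LabelledTower.Gen a b), (Y ◁ γ.map E) ≫ g a = g b) :
    ∃ d : Y ⊗ P.val X ⟶ Z, ∀ a : LabelledTower X, (Y ◁ a.leg P) ≫ d = g a := by
  obtain ⟨h⟩ := hP.isColimit X hX
  have h' := isColimitOfPreserves (tensorLeft Y) h
  let c : Cocone (towerDiagram E X ⋙ tensorLeft Y) := Cocone.mk Z
    { app := fun a => g a.unop.as
      naturality := by
        rintro ⟨⟨b⟩⟩ ⟨⟨a⟩⟩ ⟨⟨p⟩⟩
        refine Eq.trans ?_ (Category.comp_id _).symm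
        change (Y ◁ (p.eval (C := Vᵒᵖ) (fun a : LabelledTower X => op (a.tower.tensor E))
          (fun g => (g.map E).op)).unop) ≫ g a = g b
        exact LabelledTower.whiskerLeft_eval_comp_of_gen g hg p }
  exact ⟨h'.desc c, fun a => h'.fac c (op ⟨a⟩)⟩

lemma hom_ext_whiskerLeft {Y Z : V} {d d' : Y ⊗ P.val X ⟶ Z}
    (h : ∀ a : LabelledTower X, (Y ◁ a.leg P) ≫ d = (Y ◁ a.leg P) ≫ d') : d = d' := by
  obtain ⟨hc⟩ := hP.isColimit X hX
  exact (isColimitOfPreserves (tensorLeft Y) hc).hom_ext fun a => h a.unop.as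

lemma exists_desc_whiskerRight (Y : V) {Z : V}
    (g : ∀ a : LabelledTower X, a.tower.tensor E ⊗ Y ⟶ Z)
    (hg : ∀ {a b : LabelledTower X} (γ : LabelledTower.Gen a b), (γ.map E ▷ Y) ≫ g a = g b) :
    ∃ d : P.val X ⊗ Y ⟶ Z, ∀ a : LabelledTower X, (a.leg P ▷ Y) ≫ d = g a := by
  obtain ⟨d, hd⟩ := hP.exists_desc_whiskerLeft hX Y (fun a => (β_ Y _).hom ≫ g a) fun γ => by
    rw [BraidedCategory.braiding_naturality_right_assoc, hg γ]
  refine ⟨(β_ _ _).hom ≫ d, fun a => ?_⟩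
  rw [BraidedCategory.braiding_naturality_left_assoc, hd, SymmetricCategory.symmetry_assoc]

lemma hom_ext_whiskerRight {Y Z : V} {d d' : P.val X ⊗ Y ⟶ Z}
    (h : ∀ a : LabelledTower X, (a.leg P ▷ Y) ≫ d = (a.leg P ▷ Y) ≫ d') : d = d' := by
  rw [← cancel_epi (β_ Y (P.val X)).hom]
  refine hP.hom_ext_whiskerLeft hX fun a => ?_
  rw [BraidedCategory.braiding_naturality_right_assoc, h,
    BraidedCategory.braiding_naturality_right_assoc]

end IsFree

end TowerModule

end Descent

/-! ## Insertion of towers into fibers -/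

section Insertion

variable {O : Type u} [Category.{v} O] [GradedOperadicCategory O] [StandingAssumptions O]
  {V : Type u'} [Category.{v'} V] [MonoidalCategory V] [SymmetricCategory V] {E : Collection O V}

lemma Tower.pos : ∀ {T : O}, Tower T → 1 ≤ grade T
  | _, .last _ h => h
  | _, .cons φ _ => φ.one_le_grade

/-- Over an identity the intermediate fiber of the diagonal is that of `φ` itself, so no virtual
isomorphism intervenes. -/
lemma ElementarySquare.fiberClass_eq_hom {T S T' : O} {φ : Elementary T S} {φ' : Elementary T' S}
    (q : ElementarySquare φ φ') (hb : q.bot = Iso.refl S) (w : q.top.hom ≫ φ'.hom = φ.hom) :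
    q.fiberClass = QVrt.hom (hT := φ.fiber_pos) (hS := φ'.fiber_pos)
      (φ.fiberHomIso φ' q.top w) rfl rfl := by
  obtain ⟨σ, b, w'⟩ := q
  obtain rfl : b = Iso.refl S := hb
  have aux : ∀ (h : T ⟶ S) (hh : h = φ.hom) (w'' : σ.hom ≫ φ'.hom = h),
      fiberMap σ.hom φ'.hom h w'' φ'.idx =
        eqToHom (by rw [hh]) ≫ fiberMap σ.hom φ'.hom φ.hom w φ'.idx := by
    rintro _ rfl w; simp
  have e : OperadicData.fiber (φ.hom ≫ (Iso.refl S).hom) φ'.idx = φ.fiber := by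
    rw [Iso.refl_hom, Category.comp_id, φ.fiber_eq_of_idx (φ.idx_eq φ' _ w)]
  refine QVrt.hom_congr _ (φ.fiberHomIso φ' σ w) e rfl ?_ _ _ rfl rfl
  refine (aux _ (Category.comp_id _) w'.symm).trans ?_
  simp only [Elementary.fiberHomIso_hom, Elementary.fiberHom, eqToHom_refl, Category.comp_id,
    eqToHom_trans_assoc]
  exact congrArg (eqToHom _ ≫ ·) (Category.comp_id _).symm

namespace TowerModule

variable (P : TowerModule E)

/-- The composite of the action of the first morphism of a refinement with a given map. -/
noncomputable def insertStep {T S G₀ G₁ : O} {φ : Elementary T S} {m : φ.fiber ≅ G₀}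
    {γ : Elementary G₀ G₁} (ρ : Refinement φ m γ) {A B : V} (g : A ⊗ B ⟶ P.val ρ.obj₁) :
    (E.obj (op (QVrt.mk γ.fiber γ.fiber_pos)) ⊗ A) ⊗ B ⟶ P.val T :=
  (α_ _ _ _).hom ≫ (E.map ρ.arrow.op ⊗ₘ g) ≫ P.act ρ.first ≫ P.pull ρ.iso

/-- One statement serves three purposes: independence of the chosen refinement, compatibility with
morphisms of towers, and the change of labels in `act_circ`. In each case the comparison square `s`
comes from `Refinement.exists_square`. -/
lemma insertStep_natural {T S G₀ G₁ T' S' G₀' G₁' : O} {φ : Elementary T S} {m : φ.fiber ≅ G₀}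
    {γ : Elementary G₀ G₁} {φ' : Elementary T' S'} {m' : φ'.fiber ≅ G₀'} {γ' : Elementary G₀' G₁'}
    (ρ : Refinement φ m γ) (ρ' : Refinement φ' m' γ') (s : ElementarySquare ρ.first ρ'.first)
    {σ : T ≅ T'} (hσ : ρ.iso ≪≫ s.top = σ ≪≫ ρ'.iso)
    (x : QVrt.mk γ.fiber γ.fiber_pos ⟶ QVrt.mk γ'.fiber γ'.fiber_pos)
    (hx : ρ.arrow ≫ x = s.fiberClass ≫ ρ'.arrow) {A B A' B' : V} {g : A ⊗ B ⟶ P.val ρ.obj₁}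
    {g' : A' ⊗ B' ⟶ P.val ρ'.obj₁} (a : A' ⟶ A) (b : B' ⟶ B)
    (h : (a ⊗ₘ b) ≫ g = g' ≫ P.pull s.bot) :
    ((E.map x.op ⊗ₘ a) ⊗ₘ b) ≫ P.insertStep ρ g = P.insertStep ρ' g' ≫ P.pull σ := by
  have h₁ : P.pull ρ'.iso ≫ P.pull σ = P.pull s.top ≫ P.pull ρ.iso := by
    rw [← P.presheaf.pull_trans, ← P.presheaf.pull_trans, hσ]
  have h₂ := P.act_pull s
  have h₃ : E.map x.op ≫ E.map ρ.arrow.op = E.map ρ'.arrow.op ≫ E.map s.fiberClass.op := by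
    rw [← E.map_comp, ← E.map_comp, ← op_comp, ← op_comp, hx]
  unfold insertStep
  simp only [Category.assoc]
  rw [h₁, reassoc_of% h₂, associator_naturality_assoc]
  congr 1
  rw [MonoidalCategory.tensorHom_comp_tensorHom_assoc,
    MonoidalCategory.tensorHom_comp_tensorHom_assoc, h, h₃]

end TowerModule

namespace Tower

variable (P : TowerModule E)

/-- The insertion of a tower into the nontrivial fiber of an elementary morphism. -/
noncomputable def insert : ∀ {G : O} (A : Tower G) {T S : O} (φ : Elementary T S)
    (_ : φ.fiber ≅ G), A.tensor E ⊗ P.val S ⟶ P.val T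
  | _, .last _ h, _, _, φ, m =>
      (E.map (QVrt.hom (hT := φ.fiber_pos) (hS := h) m rfl rfl).op ▷ _) ≫ P.act φ
  | _, .cons γ r, _, _, φ, m =>
      -- The refinement is an arbitrary choice, and `insert_cons` removes the dependence on it.
      P.insertStep (exists_refinement φ m γ r.pos).some
        (r.insert (exists_refinement φ m γ r.pos).some.second
          (exists_refinement φ m γ r.pos).some.label)

/-- At each stage the refinements chosen for the two towers are compared by
`Refinement.exists_square`. The comparison is itself an isomorphism over `S` compatible with the
labels, so the induction continues with the rest of the towers. -/
lemma Hom.map_insert : ∀ {G G' : O} {A : Tower G} {A' : Tower G'} {κ : G ≅ G'} (f : Hom A A' κ)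
    {T T' S : O} (φ : Elementary T S) (φ' : Elementary T' S) (m : φ.fiber ≅ G)
    (m' : φ'.fiber ≅ G') (σ : T ≅ T') (w : σ.hom ≫ φ'.hom = φ.hom)
    (_ : m.hom ≫ κ.hom = φ.fiberHom φ' σ.hom w ≫ m'.hom),
    (f.map E ▷ P.val S) ≫ A.insert P φ m = A'.insert P φ' m' ≫ P.pull σ
  | _, _, _, _, _, .last h h' κ, _, _, S, φ, φ', m, m', σ, w, hm => by
      have h₁ := P.act_pull (φ := φ) (φ' := φ') ⟨σ, Iso.refl S, by rw [w]; exact Category.comp_id _⟩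
      have h₂ := ElementarySquare.fiberClass_eq_hom (φ := φ) (φ' := φ')
        ⟨σ, Iso.refl S, by rw [w]; exact Category.comp_id _⟩ rfl w
      have h₃ : P.presheaf.pull (Iso.refl S) = 𝟙 _ := P.presheaf.pull_refl S
      have h₄ : E.map (QVrt.hom (hT := h) (hS := h') κ rfl rfl).op ≫
          E.map (QVrt.hom (hT := φ.fiber_pos) (hS := h) m rfl rfl).op =
          E.map (QVrt.hom (hT := φ'.fiber_pos) (hS := h') m' rfl rfl).op ≫
            E.map (QVrt.hom (hT := φ.fiber_pos) (hS := φ'.fiber_pos) (φ.fiberHomIso φ' σ w)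
              rfl rfl).op := by
        rw [← E.map_comp, ← E.map_comp, ← op_comp, ← op_comp, QVrt.hom_trans, QVrt.hom_trans]
        congr 3
        ext
        exact hm
      change (E.map (QVrt.hom κ rfl rfl).op ▷ _) ≫ (E.map (QVrt.hom m rfl rfl).op ▷ _) ≫ P.act φ =
        ((E.map (QVrt.hom m' rfl rfl).op ▷ _) ≫ P.act φ') ≫ P.pull σ
      rw [Category.assoc]
      refine Eq.trans ?_ (congrArg (fun x => (E.map (QVrt.hom m' rfl rfl).op ▷ _) ≫ x) h₁).symm
      rw [h₂, ← comp_whiskerRight_assoc, h₄, comp_whiskerRight_assoc]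
      change _ = _ ≫ (_ ⊗ₘ P.presheaf.pull (Iso.refl S)) ≫ _
      rw [h₃, tensorHom_id]
  | _, _, _, _, _, .cons (φ' := γ) (φ'' := γ') (r' := r) (r'' := r') (σ := κ) (ρ := κ') w' f,
      _, _, S, φ, φ', m, m', σ, w, hm => by
      obtain ⟨s, ws, h₁, h₂, h₃⟩ := Refinement.exists_square
        (exists_refinement φ m γ r.pos).some (exists_refinement φ' m' γ' r'.pos).some σ w
        ⟨κ, κ', w'⟩ hm
      have ih := Hom.map_insert f (exists_refinement φ m γ r.pos).some.second
        (exists_refinement φ' m' γ' r'.pos).some.second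
        (exists_refinement φ m γ r.pos).some.label
        (exists_refinement φ' m' γ' r'.pos).some.label s.bot ws h₂
      have h₄ := P.insertStep_natural _ _ s (σ := σ) (by rw [h₁]; simp) _ h₃ (f.map E) (𝟙 (P.val S))
        ((congrArg (· ≫ _) (tensorHom_id _ _)).trans ih)
      rw [tensorHom_id] at h₄
      exact h₄

/-- Any two refinements of the same data are isomorphic, and `map_insert` for the identity of the
remaining tower absorbs the isomorphism. Later proofs may thus use whichever refinement is
convenient. -/
lemma insert_cons {G₀ G₁ T S : O} (γ : Elementary G₀ G₁) (r : Tower G₁) (φ : Elementary T S)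
    (m : φ.fiber ≅ G₀) (ρ : Refinement φ m γ) :
    (Tower.cons γ r).insert P φ m = P.insertStep ρ (r.insert P ρ.second ρ.label) := by
  have w : (Iso.refl T).hom ≫ φ.hom = φ.hom := Category.id_comp _
  have hw : φ.fiberHom φ (Iso.refl T).hom w = 𝟙 _ := φ.fiberHom_id w
  obtain ⟨s, ws, h₁, h₂, h₃⟩ := Refinement.exists_square
    (exists_refinement φ m γ r.pos).some ρ (Iso.refl T) w (ElementarySquare.refl γ)
    (by rw [hw]; simp)
  have ih := (Hom.id r).map_insert P _ ρ.second _ ρ.label s.bot ws h₂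
  have h₄ := P.insertStep_natural _ ρ s (σ := Iso.refl T) (by rw [h₁]; simp) _ h₃
    ((Hom.id r).map E) (𝟙 (P.val S)) ((congrArg (· ≫ _) (tensorHom_id _ _)).trans ih)
  rw [ElementarySquare.fiberClass_refl, op_id, E.map_id, Hom.map_id, id_tensorHom_id,
    id_tensorHom_id, Category.id_comp] at h₄
  exact h₄.trans ((congrArg _ (P.presheaf.pull_refl T)).trans (Category.comp_id _))

end Tower

end Insertion

/-! ### Compatibility of insertion with interchanges -/

section SwapInsertion

variable {O : Type u} [Category.{v} O] [GradedOperadicCategory O] [StandingAssumptions O]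
  {V : Type u'} [Category.{v'} V] [MonoidalCategory V] [SymmetricCategory V] {E : Collection O V}

lemma swapMap_whiskerRight {A B C D : V} (x : B ⟶ C) (y : A ⟶ D) (R S : V) :
    (swapMap x y R ▷ S) ≫ (α_ _ _ _).hom ≫ (C ◁ (α_ _ _ _).hom) =
      (α_ _ _ _).hom ≫ (A ◁ (α_ _ _ _).hom) ≫ swapMap x y (R ⊗ S) := by
  unfold swapMap
  monoidal

lemma swapMap_insert {A B C D A₀ B₀ C₀ D₀ R S Q : V} {x : B ⟶ C} {y : A ⟶ D} {x₀ : B₀ ⟶ C₀}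
    {y₀ : A₀ ⟶ D₀} {a : A ⟶ A₀} {b : B ⟶ B₀} {c : C ⟶ C₀} {d : D ⟶ D₀} (k : R ⊗ S ⟶ Q)
    (h : b ≫ x₀ = x ≫ c) (h' : a ≫ y₀ = y ≫ d) :
    (α_ _ _ _).hom ≫ (a ⊗ₘ ((α_ _ _ _).hom ≫ (b ⊗ₘ k))) ≫ swapMap x₀ y₀ Q =
      (swapMap x y R ▷ S) ≫ (α_ _ _ _).hom ≫ (c ⊗ₘ ((α_ _ _ _).hom ≫ (d ⊗ₘ k))) := by
  rw [← whiskerLeft_comp_tensorHom, ← whiskerLeft_comp_tensorHom, Category.assoc,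
    swapMap_natural x y x₀ y₀ a b c d k h h', reassoc_of% swapMap_whiskerRight]

lemma TowerModule.insertStep_comp (P : TowerModule E) {T S G₀ G₁ : O} {φ : Elementary T S}
    {m : φ.fiber ≅ G₀} {γ : Elementary G₀ G₁} (ρ : Refinement φ m γ) {A B A' B' : V}
    (g : A ⊗ B ⟶ P.val ρ.obj₁) (a : A' ⟶ A) (b : B' ⟶ B) :
    ((E.obj (op (QVrt.mk γ.fiber γ.fiber_pos)) ◁ a) ⊗ₘ b) ≫ P.insertStep ρ g =
      P.insertStep ρ ((a ⊗ₘ b) ≫ g) := by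
  unfold insertStep
  rw [← id_tensorHom, associator_naturality_assoc, MonoidalCategory.tensorHom_comp_tensorHom_assoc,
    Category.id_comp]

namespace Tower

variable (P : TowerModule E)

/-- For an interchange at the top, both orders are realized by strict refinements that themselves
form a square with disjoint fibers. Strictness turns all identifications of fibers into equalities,
and the claim becomes commutativity of the action for that square. An interchange further down is
passed through one refinement. -/
lemma Swap.map_insert : ∀ {G : O} {A B : Tower G} (s : Swap A B) {T S : O} (φ : Elementary T S)
    (m : φ.fiber ≅ G), (s.map E ▷ P.val S) ≫ A.insert P φ m = B.insert P φ m
  | _, _, _, .here (φ' := α') (ψ' := β') (φ'' := α'') (ψ'' := β'') q r, T, S, φ, m => by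
      obtain ⟨T₀, T₁', T₁'', T₂, τ, φ', ψ', φ'', ψ'', ξ', ξ'', χ, l', l'', l, h₁, h₂, h₃, h₄, h₅,
        h₆, h₇, h₈, h₉, h₁₀, h₁₁, h₁₂, i₁, i₂, i₃, i₄, q₀⟩ :=
        exists_disjoint_refinements φ m q r.pos
      rw [insert_cons P α' _ φ m ⟨T₀, T₁', τ, φ', ξ', h₁, h₂, l', h₃⟩,
        insert_cons P β' r ξ' l' ⟨T₁', T₂, Iso.refl _, ψ', χ, h₇, h₈, l, h₉⟩,
        insert_cons P α'' _ φ m ⟨T₀, T₁'', τ, φ'', ξ'', h₄, h₅, l'', h₆⟩,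
        insert_cons P β'' r ξ'' l'' ⟨T₁'', T₂, Iso.refl _, ψ'', χ, h₁₀, h₁₁, l, h₁₂⟩]
      have hq := P.act_comm q₀
      have h : E.map (QVrt.mk_congr i₄.fiber_eq _ _ |> eqToHom).op ≫ E.map q₀.cross.hom.op =
          E.map q.cross.hom.op ≫ E.map (QVrt.mk_congr i₁.fiber_eq _ _ |> eqToHom).op := by
        rw [← E.map_comp, ← E.map_comp, ← op_comp, ← op_comp, q.cross_hom_eq_eqToHom,
          q₀.cross_hom_eq_eqToHom, eqToHom_trans, eqToHom_trans]
      have h' : E.map (QVrt.mk_congr i₂.fiber_eq _ _ |> eqToHom).op ≫ E.map q₀.symm.cross.inv.op =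
          E.map q.symm.cross.inv.op ≫ E.map (QVrt.mk_congr i₃.fiber_eq _ _ |> eqToHom).op := by
        rw [← E.map_comp, ← E.map_comp, ← op_comp, ← op_comp, q.symm.cross_inv_eq_eqToHom,
          q₀.symm.cross_inv_eq_eqToHom, eqToHom_trans, eqToHom_trans]
      have h'' := swapMap_insert (r.insert P χ l) h h'
      have hr : ∀ X, P.presheaf.pull (Iso.refl X) = 𝟙 _ := P.presheaf.pull_refl
      unfold TowerModule.insertStep TowerModule.pull
      rw [i₁.arrow_eq, i₂.arrow_eq, i₃.arrow_eq, i₄.arrow_eq]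
      change (swapMap _ _ _ ▷ _) ≫ (α_ _ _ _).hom ≫ (_ ⊗ₘ ((α_ _ _ _).hom ≫ _ ≫ P.act ψ' ≫
        P.presheaf.pull (Iso.refl _))) ≫ P.act φ' ≫ P.presheaf.pull τ = (α_ _ _ _).hom ≫
        (_ ⊗ₘ ((α_ _ _ _).hom ≫ _ ≫ P.act ψ'' ≫ P.presheaf.pull (Iso.refl _))) ≫
          P.act φ'' ≫ P.presheaf.pull τ
      rw [hr, hr, Category.comp_id, Category.comp_id]
      have h₀ : ∀ {A B C D : V} (f : A ⟶ B) (g : C ⟶ D) {H : V} (k : D ⟶ H),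
          f ⊗ₘ (g ≫ k) = (f ⊗ₘ g) ≫ (B ◁ k) := by
        intros; rw [tensorHom_comp_whiskerLeft]
      rw [← Category.assoc _ _ (P.act ψ'), ← Category.assoc _ _ (P.act ψ''), h₀ _ _ (P.act ψ'),
        h₀ _ _ (P.act ψ''), Category.assoc, Category.assoc, reassoc_of% hq, reassoc_of% h'']
  | _, _, _, .there (A := A) (B := B) γ s, T, S, φ, m => by
      obtain ⟨ρ⟩ := exists_refinement φ m γ A.pos
      have ih := Swap.map_insert s ρ.second ρ.label
      rw [insert_cons P γ A φ m ρ, insert_cons P γ B φ m ρ, ← ih, ← tensorHom_id, ← tensorHom_id]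
      exact P.insertStep_comp ρ _ _ _

end Tower

lemma LabelledTower.Gen.map_insert (P : TowerModule E) {T S : O} (φ : Elementary T S)
    {a b : LabelledTower φ.fiber} (γ : Gen a b) :
    (γ.map E ▷ P.val S) ≫ a.tower.insert P φ a.label = b.tower.insert P φ b.label := by
  cases γ with
  | first σ w f =>
    have h := f.map_insert P φ φ a.label b.label (Iso.refl T) (Category.id_comp _) (by
      rw [← w]
      exact (Category.id_comp _).symm.trans (congrArg (· ≫ _) (φ.fiberHom_id _)).symm)
    exact h.trans ((congrArg _ (P.presheaf.pull_refl T)).trans (Category.comp_id _))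
  | second ℓ s => exact s.map_insert P φ ℓ

end SwapInsertion

/-! ### The circle product of a free module -/

section Circ

variable {O : Type u} [Category.{v} O] [GradedOperadicCategory O] [StandingAssumptions O]
  {V : Type u'} [Category.{v'} V] [MonoidalCategory V] [SymmetricCategory V] {E : Collection O V}
  [∀ A : V, PreservesColimitsOfSize.{max u v, max u v} (tensorLeft A)]

instance ElementarySquare.isIso_fiberClass {T S T' S' : O} {φ : Elementary T S}
    {φ' : Elementary T' S'} (q : ElementarySquare φ φ') : IsIso q.fiberClass :=
  ⟨q.inverse.fiberClass, q.fiberClass_comp_inverse, q.fiberClass_inverse_comp⟩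

namespace TowerModule.IsFree

variable {P : TowerModule E} (hP : P.IsFree)
include hP

/-- A tower either has one term, and then contributes a generator, or begins with an elementary `γ`,
and then contributes to the image of the action of `γ`. This is the case distinction of all
inductions on the grade of a fiber. -/
lemma hom_ext_cases {Y Z : V} {G : O} (hG : 1 ≤ grade G) {d d' : P.val G ⊗ Y ⟶ Z}
    (h : (P.gen hG ▷ Y) ≫ d = (P.gen hG ▷ Y) ≫ d')
    (h' : ∀ {G₀ G₁ : O} (ℓ : G ≅ G₀) (γ : Elementary G₀ G₁), 1 ≤ grade G₁ →
      ((P.act γ ≫ P.pull ℓ) ▷ Y) ≫ d = ((P.act γ ≫ P.pull ℓ) ▷ Y) ≫ d') : d = d' := by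
  refine hP.hom_ext_whiskerRight hG ?_
  rintro ⟨G₀, ℓ, A⟩
  cases A with
  | last _ hG₀ =>
    change ((P.gen hG₀ ≫ P.pull ℓ) ▷ Y) ≫ d = ((P.gen hG₀ ≫ P.pull ℓ) ▷ Y) ≫ d'
    rw [P.gen_pull hG hG₀, comp_whiskerRight_assoc, comp_whiskerRight_assoc, h]
  | cons γ r =>
    change ((((_ ◁ r.ev P) ≫ P.act γ) ≫ P.pull ℓ) ▷ Y) ≫ d =
      ((((_ ◁ r.ev P) ≫ P.act γ) ≫ P.pull ℓ) ▷ Y) ≫ d'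
    rw [Category.assoc, comp_whiskerRight_assoc, h' ℓ γ r.pos, ← comp_whiskerRight_assoc]

lemma hom_ext_whiskerLeft_whiskerRight {G : O} (hG : 1 ≤ grade G) {Y X Z : V}
    {d d' : (Y ⊗ P.val G) ⊗ X ⟶ Z}
    (h : ∀ a : LabelledTower G, ((Y ◁ a.leg P) ▷ X) ≫ d = ((Y ◁ a.leg P) ▷ X) ≫ d') :
    d = d' := by
  rw [← cancel_epi ((β_ _ _).hom ▷ X), ← cancel_epi (α_ _ _ _).inv]
  refine hP.hom_ext_whiskerRight hG fun a => ?_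
  have k : (a.leg P ▷ Y) ▷ X ≫ (β_ _ _).hom ▷ X = (β_ _ _).hom ▷ X ≫ (Y ◁ a.leg P) ▷ X := by
    rw [← comp_whiskerRight, ← comp_whiskerRight, BraidedCategory.braiding_naturality_left]
  rw [associator_inv_naturality_left_assoc, associator_inv_naturality_left_assoc, reassoc_of% k,
    reassoc_of% k, h]

/-- The circle product of a free module. -/
noncomputable def circ {T S : O} (φ : Elementary T S) : P.val φ.fiber ⊗ P.val S ⟶ P.val T :=
  (hP.exists_desc_whiskerRight φ.fiber_pos (P.val S) (fun a => a.tower.insert P φ a.label)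
    fun γ => γ.map_insert P φ).choose

lemma leg_circ {T S : O} (φ : Elementary T S) (a : LabelledTower φ.fiber) :
    (a.leg P ▷ P.val S) ≫ hP.circ φ = a.tower.insert P φ a.label :=
  (hP.exists_desc_whiskerRight φ.fiber_pos (P.val S) (fun a => a.tower.insert P φ a.label)
    fun γ => γ.map_insert P φ).choose_spec a

/-- A generator is the tower with one term, whose insertion is by definition the action of `φ`. -/
lemma gen_circ {T S : O} (φ : Elementary T S) :
    (P.gen φ.fiber_pos ▷ P.val S) ≫ hP.circ φ = P.act φ := by
  have h := hP.leg_circ φ ⟨φ.fiber, Iso.refl _, .last _ φ.fiber_pos⟩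
  change ((P.gen φ.fiber_pos ≫ P.presheaf.pull (Iso.refl _)) ▷ _) ≫ hP.circ φ =
    (E.map (QVrt.hom (Iso.refl _) rfl rfl).op ▷ _) ≫ P.act φ at h
  rw [P.presheaf.pull_refl, Category.comp_id, QVrt.hom_refl] at h
  rw [h]
  exact (congrArg (fun x => (x ▷ _) ≫ _) (E.map_id _)).trans
    ((congrArg (· ≫ _) (id_whiskerRight _ _)).trans (Category.id_comp _))

/-- This is the recursion for the circle product. On a tower beginning with `γ` it is the definition
of insertion, once `insert_cons` permits the given refinement. Together with `gen_circ` it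
determines the product, and towers are not needed afterwards in proving the operad axioms. -/
lemma act_circ {T S G₀ G₁ : O} {φ : Elementary T S} {m : φ.fiber ≅ G₀} {γ : Elementary G₀ G₁}
    (ρ : Refinement φ m γ) (hG : 1 ≤ grade G₁) :
    ((P.act γ ≫ P.pull m) ▷ P.val S) ≫ hP.circ φ =
      P.insertStep ρ ((P.pull ρ.label ▷ P.val S) ≫ hP.circ ρ.second) := by
  refine hP.hom_ext_whiskerLeft_whiskerRight hG fun a => ?_
  obtain ⟨base, ℓ, A⟩ := a
  -- To put `γ` in front of a labelled tower under `G₁`, it is first moved along the label. The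
  -- result is the tower `cons γ₀ A` with label `m ≪≫ q.top`, to which `leg_circ` applies.
  obtain ⟨B₀, γ₀, q, rfl⟩ := γ.exists_square ℓ
  obtain ⟨ρ₀⟩ := exists_refinement φ (m ≪≫ q.top) γ₀ A.pos
  have w : (Iso.refl T).hom ≫ φ.hom = φ.hom := Category.id_comp _
  have hw : φ.fiberHom φ (Iso.refl T).hom w = 𝟙 _ := φ.fiberHom_id w
  obtain ⟨s, ws, h₁, h₂, h₃⟩ := ρ.exists_square ρ₀ (Iso.refl T) w q
    (by rw [hw, Category.id_comp]; rfl)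
  have e₁ : (E.map q.fiberClass.op ▷ _) ≫ (_ ◁ LabelledTower.leg P ⟨base, q.bot, A⟩) ≫ P.act γ ≫
      P.pull m = LabelledTower.leg P ⟨B₀, m ≪≫ q.top, .cons γ₀ A⟩ := by
    change (E.map q.fiberClass.op ▷ _) ≫ (_ ◁ (A.ev P ≫ P.presheaf.pull q.bot)) ≫ P.act γ ≫
      P.presheaf.pull m = ((_ ◁ A.ev P) ≫ P.act γ₀) ≫ P.presheaf.pull (m ≪≫ q.top)
    rw [P.presheaf.pull_trans, Category.assoc, reassoc_of% P.act_pull q,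
      ← MonoidalCategory.tensorHom_def_assoc, whiskerLeft_comp_tensorHom_assoc]
  have e₂ : (LabelledTower.leg P ⟨base, q.bot, A⟩ ⊗ₘ 𝟙 _) ≫ (P.pull ρ.label ▷ P.val S) ≫
      hP.circ ρ.second = A.insert P ρ₀.second ρ₀.label ≫ P.pull s.bot := by
    have e₃ : LabelledTower.leg P ⟨base, q.bot, A⟩ ≫ P.pull ρ.label =
        LabelledTower.leg P ⟨base, ρ.label ≪≫ q.bot, A⟩ :=
      (Category.assoc _ _ _).trans (congrArg _ (P.presheaf.pull_trans _ _).symm)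
    rw [tensorHom_id, ← comp_whiskerRight_assoc, e₃, hP.leg_circ]
    have e₄ := (Tower.Hom.id A).map_insert P ρ.second ρ₀.second (ρ.label ≪≫ q.bot) ρ₀.label s.bot ws
      ((Category.comp_id _).trans h₂)
    rw [Tower.Hom.map_id, id_whiskerRight, Category.id_comp] at e₄
    exact e₄
  have e₅ := P.insertStep_natural ρ ρ₀ s (σ := Iso.refl T) (by rw [h₁]; simp) q.fiberClass h₃ _ _ e₂
  have e₆ : P.insertStep ρ₀ (A.insert P ρ₀.second ρ₀.label) ≫ P.pull (Iso.refl T) =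
      P.insertStep ρ₀ (A.insert P ρ₀.second ρ₀.label) :=
    (congrArg _ (P.presheaf.pull_refl T)).trans (Category.comp_id _)
  rw [e₆, ← Tower.insert_cons] at e₅
  have e₇ := hP.leg_circ φ ⟨B₀, m ≪≫ q.top, .cons γ₀ A⟩
  rw [← e₁] at e₇
  rw [← cancel_epi ((E.map q.fiberClass.op ▷ _) ▷ _), ← comp_whiskerRight_assoc,
    ← comp_whiskerRight_assoc, Category.assoc]
  refine e₇.trans (e₅.symm.trans ?_)
  rw [tensorHom_id, MonoidalCategory.tensorHom_def, comp_whiskerRight_assoc]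

end TowerModule.IsFree

end Circ

/-! ### Elementary morphisms to local terminal objects -/

section TrivialFiberHom

variable {O : Type u} [Category.{v} O] [GradedOperadicCategory O]

lemma Elementary.fiber_eq_of_isTrivial {T t : O} (φ : Elementary T t) (ht : IsTrivial t) :
    φ.fiber = T := fiber_of_isTrivial φ.hom ht φ.idx

/-- The nontrivial fiber contributes at least 1 to the grade of the source. The inductions on grades
rest on this inequality. -/
lemma Elementary.grade_lt {T S : O} (φ : Elementary T S) : grade S < grade T := by
  have h := grade_eq φ.hom
  have h' : grade (OperadicData.fiber φ.hom φ.idx) ≤ ∑ i, grade (OperadicData.fiber φ.hom i) :=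
    Finset.single_le_sum (f := fun i => grade (OperadicData.fiber φ.hom i))
      (fun _ _ => Nat.zero_le _) (Finset.mem_univ φ.idx)
  have := φ.grade_pos
  omega

lemma Elementary.fiberHom_of_isTrivial {T T' t : O} (φ : Elementary T t) (φ' : Elementary T' t)
    (ht : IsTrivial t) (p : T ⟶ T') (w : p ≫ φ'.hom = φ.hom) :
    φ.fiberHom φ' p w = eqToHom (φ.fiber_eq_of_isTrivial ht) ≫ p ≫
      eqToHom (φ'.fiber_eq_of_isTrivial ht).symm := by
  obtain ⟨c, rfl⟩ := ht
  unfold Elementary.fiberHom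
  rw [OperadicCategory.fiberMap_U]
  simp only [Category.assoc, eqToHom_trans, eqToHom_trans_assoc]

lemma Elementary.eq_toLocalTerminal {T t : O} (φ : Elementary T t) (ht : IsLocalTerminal t) :
    φ = .toLocalTerminal φ.hom ht φ.one_le_grade :=
  Elementary.ext_hom rfl

lemma Elementary.mk_fiber {T t : O} (φ : Elementary T t) (ht : IsLocalTerminal t) :
    VirtualClass.mk T φ.one_le_grade = VirtualClass.mk φ.fiber φ.fiber_pos :=
  (VirtualClass.sound _ _ ⟨t, ht, φ.hom, _, rfl⟩).symm

end TrivialFiberHom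

/-! ### Multiplication by units -/

section Theta

lemma insert_pentagon {V : Type u'} [Category.{v'} V] [MonoidalCategory V]
    {E₀ E₁ E₂ G W R Y Z : V} (a : E₀ ⟶ E₁) (b : E₁ ⟶ E₂) (x : G ⊗ W ⟶ Y)
    (k : Y ⊗ R ⟶ Z) :
    (α_ _ _ _).inv ≫ (((α_ _ _ _).hom ≫ (a ⊗ₘ x)) ▷ R) ≫ (α_ _ _ _).hom ≫ (b ⊗ₘ k) =
      (α_ _ _ _).hom ≫ ((a ≫ b) ⊗ₘ ((α_ _ _ _).inv ≫ (x ▷ R) ≫ k)) := by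
  have h : ((a ⊗ₘ x) ▷ R) ≫ (α_ _ _ _).hom ≫ (b ⊗ₘ k) =
      (((a ≫ b) ⊗ₘ x) ▷ R) ≫ (α_ _ _ _).hom ≫ (_ ◁ k) := by
    rw [MonoidalCategory.tensorHom_def b k, ← associator_naturality_left_assoc,
      ← comp_whiskerRight_assoc, tensorHom_comp_whiskerRight]
  rw [comp_whiskerRight_assoc, h]
  simp only [MonoidalCategory.tensorHom_def]
  monoidal

variable {O : Type u} [Category.{v} O] [GradedOperadicCategory O] [StandingAssumptions O]

/-- Over a chosen local terminal object the fiber functor is the domain functor, so `γ`, followed by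
the map to `t`, already is a refinement. -/
lemma Elementary.exists_trivial_refinement {T t G₀ G₁ : O} (φ : Elementary T t) (ht : IsTrivial t)
    (m : φ.fiber ≅ G₀) (γ : Elementary G₀ G₁) (hG : 1 ≤ grade G₁) :
    ∃ (ψ : Elementary G₁ t) (h₁ : _) (h₂ : _) (h₃ : _),
      (⟨G₀, G₁, eqToIso (φ.fiber_eq_of_isTrivial ht).symm ≪≫ m, γ, ψ, h₁, h₂,
        eqToIso (ψ.fiber_eq_of_isTrivial ht), h₃⟩ : Refinement φ m γ).IsStrict := by
  have hl := ht.isLocalTerminal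
  have hs : Subsingleton (Fin (card t)) := by rw [hl.card_eq]; infer_instance
  let f₀ : G₀ ⟶ t := m.inv ≫ eqToHom (φ.fiber_eq_of_isTrivial ht) ≫ φ.hom
  let ψ : Elementary G₁ t := .toLocalTerminal (hl.from (zigzag_of_hom_hom γ.hom f₀)) hl hG
  refine ⟨ψ, Subsingleton.elim _ _, hl.hom_ext _ _, ?_, ?_⟩
  · rw [φ.fiberHom_of_isTrivial ψ ht]
    simp only [Iso.trans_hom, eqToIso.hom, Category.assoc, eqToHom_trans_assoc, eqToHom_refl,
      Category.id_comp, eqToHom_trans, Category.comp_id]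
  · refine Refinement.isStrict_of _ (Elementary.fiber_eq_of_isTrivial _ ht).symm ?_
      ⟨ψ.fiber_eq_of_isTrivial ht, rfl⟩
    refine (φ.fiberHom_of_isTrivial _ ht _ _).trans ?_
    simp

variable  {V : Type u'} [Category.{v'} V] [MonoidalCategory V] [SymmetricCategory V]
  {E : Collection O V} [∀ A : V, PreservesColimitsOfSize.{max u v, max u v} (tensorLeft A)]

namespace TowerModule.IsFree

variable {P : TowerModule E} (hP : P.IsFree)
include hP

lemma hom_ext_cases_of_val {Z : V} {G : O} (hG : 1 ≤ grade G) {d d' : P.val G ⟶ Z}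
    (h : P.gen hG ≫ d = P.gen hG ≫ d')
    (h' : ∀ {G₀ G₁ : O} (ℓ : G ≅ G₀) (γ : Elementary G₀ G₁), 1 ≤ grade G₁ →
      (P.act γ ≫ P.pull ℓ) ≫ d = (P.act γ ≫ P.pull ℓ) ≫ d') : d = d' := by
  rw [← cancel_epi (ρ_ _).hom, ← rightUnitor_naturality, ← rightUnitor_naturality]
  refine congrArg (· ≫ _) (hP.hom_ext_cases hG ?_ fun ℓ γ hγ => ?_)
  · rw [← comp_whiskerRight, h, comp_whiskerRight]
  · rw [← comp_whiskerRight, h' ℓ γ hγ, comp_whiskerRight]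

/-- Multiplication by the unit at a local terminal object. -/
noncomputable def theta {T t : O} (φ : Elementary T t) (ht : IsLocalTerminal t) :
    P.val φ.fiber ⟶ P.val T :=
  (ρ_ _).inv ≫ (_ ◁ P.unit ht) ≫ hP.circ φ

/-- The generator map at `T` was defined by acting on a unit, and it does not depend on the local
terminal target. The equality of virtual classes of `T` and the fiber accounts for the remaining
identification. -/
lemma gen_theta {T t : O} (φ : Elementary T t) (ht : IsLocalTerminal t) :
    P.gen φ.fiber_pos ≫ hP.theta φ ht =
      E.map (eqToHom (congrArg Presented.mk (φ.mk_fiber ht))).op ≫ P.gen φ.one_le_grade := by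
  rw [theta, rightUnitor_inv_naturality_assoc, ← whisker_exchange_assoc, hP.gen_circ]
  obtain ⟨f, hT, rfl⟩ : ∃ f hT, φ = .toLocalTerminal f ht hT := ⟨_, _, φ.eq_toLocalTerminal ht⟩
  rw [← P.genAt_eq_gen f ht hT]
  have h : QVrt.hom (hT := hT) (hS := hT) (Iso.refl T)
      (Elementary.mk_fiber_toLocalTerminal f ht hT) rfl =
      eqToHom (congrArg Presented.mk (Elementary.mk_fiber_toLocalTerminal f ht hT).symm) :=
    QVrt.hom_eqToIso rfl _ _ _ _ _
  unfold genAt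
  rw [h, ← E.map_comp_assoc, ← op_comp, eqToHom_trans]
  exact ((congrArg (· ≫ _) (E.map_id _)).trans (Category.id_comp _)).symm

/-- In the recursion `act_circ` the unit in the right factor passes to the second morphism of the
refinement. -/
lemma act_theta {T t G₀ G₁ : O} {φ : Elementary T t} (ht : IsLocalTerminal t) {m : φ.fiber ≅ G₀}
    {γ : Elementary G₀ G₁} (ρ : Refinement φ m γ) (hG : 1 ≤ grade G₁) :
    (P.act γ ≫ P.pull m) ≫ hP.theta φ ht =
      (E.map ρ.arrow.op ⊗ₘ (P.pull ρ.label ≫ hP.theta ρ.second ht)) ≫ P.act ρ.first ≫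
        P.pull ρ.iso := by
  rw [theta, rightUnitor_inv_naturality_assoc, ← whisker_exchange_assoc, hP.act_circ ρ hG]
  unfold insertStep theta
  have : ∀ {A B C D : V} (x : A ⟶ C) (y : B ⊗ P.val t ⟶ D),
      (ρ_ (A ⊗ B)).inv ≫ ((A ⊗ B) ◁ P.unit ht) ≫ (α_ _ _ _).hom ≫ (x ⊗ₘ y) =
        x ⊗ₘ ((ρ_ B).inv ≫ (B ◁ P.unit ht) ≫ y) := by
    intros
    simp only [MonoidalCategory.tensorHom_def']
    monoidal
  rw [reassoc_of% this, whisker_exchange_assoc, ← rightUnitor_inv_naturality_assoc]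

/-- By induction on the grade of `T`: the refinement of `exists_trivial_refinement` is strict, so
the recursion returns the action of `γ` followed by multiplication with a unit at an object of
smaller grade. For chosen local terminal objects unitality thus holds before any strictification. -/
lemma theta_of_isTrivial {T t : O} (φ : Elementary T t) (ht : IsTrivial t) :
    hP.theta φ ht.isLocalTerminal =
      P.pull (eqToIso (φ.fiber_eq_of_isTrivial ht).symm) := by
  obtain ⟨n, hn⟩ : ∃ n, grade T ≤ n := ⟨_, le_rfl⟩
  induction n generalizing T with
  | zero => exact absurd φ.one_le_grade (by omega)
  | succ n ih =>
    refine hP.hom_ext_cases_of_val φ.fiber_pos ?_ fun m γ hγ => ?_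
    · rw [gen_theta, P.gen_pull φ.one_le_grade φ.fiber_pos]
      congr 3
      exact (QVrt.hom_eqToIso _ _ _ _ _ _).symm
    · obtain ⟨ψ, h₁, h₂, h₃, hρ⟩ := φ.exists_trivial_refinement ht m γ hγ
      rw [hP.act_theta ht.isLocalTerminal ⟨_, _, _, _, ψ, h₁, h₂, _, h₃⟩ hγ, hρ.arrow_eq, ih ψ
        (by have := γ.grade_lt; have := grade_of_iso m; have := φ.fiber_eq_of_isTrivial ht
            simp_all; omega)]
      have h : P.pull (eqToIso (ψ.fiber_eq_of_isTrivial ht)) ≫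
          P.pull (eqToIso (ψ.fiber_eq_of_isTrivial ht).symm) = 𝟙 _ := by
        rw [← P.presheaf.pull_trans, eqToIso_trans]; exact P.presheaf.pull_refl _
      rw [h, Category.assoc]
      refine Eq.trans ?_ (congrArg (P.act γ ≫ ·) (P.presheaf.pull_trans _ _))
      exact (congrArg (· ≫ _) ((congrArg (· ⊗ₘ _) (E.map_id _)).trans
        (id_tensorHom_id _ _))).trans (Category.id_comp _)

end TowerModule.IsFree

end Theta

/-! ## Associativity -/

section Assoc

variable {O : Type u} [Category.{v} O] [GradedOperadicCategory O] [StandingAssumptions O]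

/-- A composite of elementary morphisms with joint fibers is a refinement of the induced map. -/
lemma Elementary.exists_refinement_comp {T S R : O} (φ : Elementary T S) (ψ : Elementary S R)
    (h : cardMap ψ.hom φ.idx = ψ.idx) :
    ∃ h₁ h₂ h₃, (⟨T, S, Iso.refl T, φ, ψ, h₁, h₂, Iso.refl _, h₃⟩ :
      Refinement (φ.comp ψ h) (Iso.refl _) (φ.induced ψ h)).IsStrict := by
  refine ⟨h, (congrArg (· ≫ ψ.hom) (Category.id_comp _)), ?_, ?_⟩
  · refine (Category.id_comp _).trans (Eq.trans ?_ (Category.comp_id _).symm)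
    refine (φ.induced_hom ψ h).trans ?_
    exact (φ.comp ψ h).fiberHom_congr ψ (Category.id_comp _).symm _ _
  · refine Refinement.isStrict_of _ rfl ?_ ⟨rfl, rfl⟩
    exact ((φ.comp ψ h).fiberHom_id _).trans (Category.comp_id _).symm

namespace Refinement

variable {T S R G₀ G₁ : O} {φ : Elementary T S} {m : φ.fiber ≅ G₀} {γ : Elementary G₀ G₁}

/-- The isomorphism of fibers of composites induced by a refinement of the first morphism. -/
noncomputable def compIso (ρ : Refinement φ m γ) (ψ : Elementary S R)
    (h : cardMap ψ.hom φ.idx = ψ.idx) (h' : cardMap ψ.hom ρ.second.idx = ψ.idx)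
    (h'' : cardMap (ρ.second.comp ψ h').hom ρ.first.idx = (ρ.second.comp ψ h').idx) :
    (φ.comp ψ h).fiber ≅ (ρ.first.comp (ρ.second.comp ψ h') h'').fiber :=
  fiberIso ρ.iso (ρ.first.hom ≫ ρ.second.hom ≫ ψ.hom) (φ.hom ≫ ψ.hom)
    (by rw [← ρ.w]; simp) ψ.idx

/-- The restriction of `ρ` to the fibers of `ψ` is a refinement of the induced morphism with the
same arrow. It is rewritten here in terms of `induced`, as the associativity axiom requires. -/
lemma exists_induced (ρ : Refinement φ m γ) (ψ : Elementary S R)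
    (h : cardMap ψ.hom φ.idx = ψ.idx) (h' : cardMap ψ.hom ρ.second.idx = ψ.idx)
    (h'' : cardMap (ρ.second.comp ψ h').hom ρ.first.idx = (ρ.second.comp ψ h').idx) :
    ∃ h₁ h₂ h₃ e,
      (⟨_, _, ρ.compIso ψ h h' h'', ρ.first.induced (ρ.second.comp ψ h') h'',
        ρ.second.induced ψ h', h₁, h₂, eqToIso (ρ.second.induced_fiber ψ h').symm ≪≫ ρ.label, h₃⟩ :
        Refinement (φ.induced ψ h) (eqToIso (φ.induced_fiber ψ h).symm ≪≫ m) γ).arrow =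
        eqToHom (QVrt.mk_congr e _ _) ≫ ρ.arrow := by
  let ρ₁ := ρ.atFiber ψ.hom (φ.hom ≫ ψ.hom) rfl ψ.idx h (φ.induced ψ h) rfl
    (eqToIso (φ.induced_fiber ψ h).symm ≪≫ m) rfl
  -- The morphisms produced by `induced` and `atFiber` have the same underlying maps, and elementary
  -- morphisms are determined by these.
  have key : ∀ (Φ₁ : Elementary ρ₁.obj₀ ρ₁.obj₁) (Φ₂ : Elementary ρ₁.obj₁ ψ.fiber)
      (_ : Φ₁ = ρ₁.first) (_ : Φ₂ = ρ₁.second) (e₂ : Φ₂.fiber = ρ.second.fiber),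
      ∃ h₁ h₂ h₃ e, (⟨_, _, ρ₁.iso, Φ₁, Φ₂, h₁, h₂, eqToIso e₂ ≪≫ ρ.label, h₃⟩ :
        Refinement (φ.induced ψ h) (eqToIso (φ.induced_fiber ψ h).symm ≪≫ m) γ).arrow =
        eqToHom (QVrt.mk_congr e _ _) ≫ ρ.arrow := by
    rintro _ _ rfl rfl e₂
    exact ⟨ρ₁.joint, ρ₁.w, ρ₁.comm, ρ.arrow_atFiber ψ.hom (φ.hom ≫ ψ.hom) rfl ψ.idx h
      (φ.induced ψ h) rfl _ rfl⟩
  exact key _ _ (Elementary.ext_hom rfl) (Elementary.ext_hom rfl) _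

/-- Regrouping the three morphisms `ρ.first`, `ρ.second`, `ψ` as `ρ.first` followed by a composite
gives a strict refinement of `φ.comp ψ h`. -/
lemma exists_comp (ρ : Refinement φ m γ) (ψ : Elementary S R)
    (h : cardMap ψ.hom φ.idx = ψ.idx) (h' : cardMap ψ.hom ρ.second.idx = ψ.idx)
    (h'' : cardMap (ρ.second.comp ψ h').hom ρ.first.idx = (ρ.second.comp ψ h').idx) :
    ∃ h₁ h₂ h₃, (⟨_, _, ρ.iso, ρ.first, ρ.second.comp ψ h', h₁, h₂, Iso.refl _, h₃⟩ :
      Refinement (φ.comp ψ h) (ρ.compIso ψ h h' h'')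
        (ρ.first.induced (ρ.second.comp ψ h') h'')).IsStrict := by
  have w : (ρ.iso.hom ≫ ρ.first.hom) ≫ (ρ.second.comp ψ h').hom = (φ.comp ψ h).hom := by
    refine Eq.trans ?_ (φ.comp_hom ψ h)
    rw [← ρ.w, Category.assoc, Category.assoc, Category.assoc]
    rfl
  refine ⟨h'', w, ?_, ?_⟩
  · refine Eq.trans ?_ ((Category.comp_id _).trans ((Category.id_comp _).trans
      (Category.comp_id _))).symm
    exact (OperadicCategory.fiberMap_comp ρ.iso.hom ρ.first.hom _ _ _ _ _ _ _).symm
  · refine Refinement.isStrict_of _ rfl ?_ ⟨rfl, rfl⟩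
    exact ((Category.id_comp _).trans (Category.comp_id _)).trans (Category.comp_id _).symm

end Refinement

variable {V : Type u'} [Category.{v'} V] [MonoidalCategory V] [SymmetricCategory V]
  {E : Collection O V} [∀ A : V, PreservesColimitsOfSize.{max u v, max u v} (tensorLeft A)]

namespace TowerModule.IsFree

variable {P : TowerModule E} (hP : P.IsFree)
include hP

lemma act_circ_of_strict {T S G₀ G₁ : O} {φ : Elementary T S} {m : φ.fiber ≅ G₀}
    {γ : Elementary G₀ G₁} {ρ : Refinement φ m γ} (hρ : ρ.IsStrict) (hG : 1 ≤ grade G₁) :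
    ((P.act γ ≫ P.pull m) ▷ P.val S) ≫ hP.circ φ =
      (α_ _ _ _).hom ≫ (E.map (eqToHom (QVrt.mk_congr hρ.fiber_eq _ _)).op ⊗ₘ
        ((P.pull ρ.label ▷ P.val S) ≫ hP.circ ρ.second)) ≫ P.act ρ.first ≫ P.pull ρ.iso := by
  rw [hP.act_circ ρ hG, insertStep, hρ.arrow_eq]

/-- Induction on the grade of the fiber of `φ`. On generators, `φ` and `ψ` themselves refine their
composite, and the claim is `act_circ` for this refinement. On an element decomposed by `γ`, one
refinement of `φ` yields refinements of the induced morphism and of the composite, and the induction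
hypothesis applies to its second morphism followed by `ψ`. -/
lemma circ_assoc {T S R : O} (φ : Elementary T S) (ψ : Elementary S R)
    (h : cardMap ψ.hom φ.idx = ψ.idx) :
    (P.val φ.fiber ◁ hP.circ ψ) ≫ hP.circ φ =
      (α_ _ _ _).inv ≫ (((P.pull (eqToIso (φ.induced_fiber ψ h).symm) ▷ _) ≫
        hP.circ (φ.induced ψ h)) ▷ P.val R) ≫ hP.circ (φ.comp ψ h) := by
  obtain ⟨n, hn⟩ : ∃ n, grade φ.fiber ≤ n := ⟨_, le_rfl⟩
  induction n generalizing T S with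
  | zero => exact absurd φ.fiber_pos (by omega)
  | succ n ih =>
    refine hP.hom_ext_cases φ.fiber_pos ?_ fun m γ hγ => ?_
    · obtain ⟨h₁, h₂, h₃, hρ⟩ := φ.exists_refinement_comp ψ h
      have k := hP.act_circ_of_strict hρ ψ.fiber_pos
      have hr : ∀ X, P.pull (Iso.refl X) = 𝟙 _ := P.presheaf.pull_refl
      have k' : (P.act (φ.induced ψ h) ▷ P.val R) ≫ hP.circ (φ.comp ψ h) = (α_ _ _ _).hom ≫
          (E.map (eqToHom (QVrt.mk_congr hρ.fiber_eq _ _)).op ⊗ₘ hP.circ ψ) ≫ P.act φ := by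
        refine Eq.trans ?_ (k.trans ?_)
        · rw [hr, Category.comp_id]
        · change _ ≫ (_ ⊗ₘ ((P.pull (Iso.refl ψ.fiber) ▷ P.val R) ≫ hP.circ ψ)) ≫ P.act φ ≫
            P.pull (Iso.refl T) = _
          rw [hr, hr, Category.comp_id, id_whiskerRight, Category.id_comp]
      have e : E.map (QVrt.hom (hT := (φ.induced ψ h).fiber_pos) (hS := φ.fiber_pos)
          (eqToIso (φ.induced_fiber ψ h).symm) rfl rfl).op ≫
          E.map (eqToHom (QVrt.mk_congr hρ.fiber_eq φ.fiber_pos (φ.induced ψ h).fiber_pos)).op =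
          𝟙 _ := by
        rw [QVrt.hom_eqToIso _ _ _ _ _ (QVrt.mk_congr (φ.induced_fiber ψ h).symm _ _),
          ← E.map_comp, ← op_comp, eqToHom_trans]
        exact E.map_id _
      have k'' : P.gen φ.fiber_pos ▷ P.val ψ.fiber ≫
          P.pull (eqToIso (φ.induced_fiber ψ h).symm) ▷ P.val ψ.fiber ≫ hP.circ (φ.induced ψ h) =
          (E.map (QVrt.hom (eqToIso (φ.induced_fiber ψ h).symm) rfl rfl).op ▷ _) ≫
            P.act (φ.induced ψ h) := by
        rw [← comp_whiskerRight_assoc, P.gen_pull (φ.induced ψ h).fiber_pos φ.fiber_pos,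
          comp_whiskerRight_assoc, hP.gen_circ]
      rw [← whisker_exchange_assoc, hP.gen_circ, associator_inv_naturality_left_assoc,
        ← comp_whiskerRight_assoc, k'', comp_whiskerRight_assoc, k',
        associator_naturality_left_assoc, whiskerRight_comp_tensorHom_assoc, e, id_tensorHom,
        Iso.inv_hom_id_assoc]
    · obtain ⟨ρ⟩ := exists_refinement φ m γ hγ
      have h' : cardMap ψ.hom ρ.second.idx = ψ.idx := by rw [← ρ.second_idx, h]
      have h'' : cardMap (ρ.second.comp ψ h').hom ρ.first.idx = (ρ.second.comp ψ h').idx := by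
        refine (cardMap_comp_apply _ _ _).trans ?_
        rw [ρ.joint, h']; rfl
      obtain ⟨a₁, a₂, a₃, e, he⟩ := ρ.exists_induced ψ h h' h''
      obtain ⟨b₁, b₂, b₃, hs⟩ := ρ.exists_comp ψ h h' h''
      have ih' := ih ρ.second ψ h' (by
        rw [grade_of_iso ρ.label]
        have := γ.grade_lt
        have := grade_of_iso m
        omega)
      have k₁ := hP.act_circ ρ hγ
      have k₂ := hP.act_circ ⟨_, _, ρ.compIso ψ h h' h'', ρ.first.induced (ρ.second.comp ψ h') h'',
        ρ.second.induced ψ h', a₁, a₂, eqToIso (ρ.second.induced_fiber ψ h').symm ≪≫ ρ.label, a₃⟩ hγ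
      have k₃ := hP.act_circ_of_strict hs (ρ.second.comp ψ h').fiber_pos
      have hr : ∀ X, P.pull (Iso.refl X) = 𝟙 _ := P.presheaf.pull_refl
      have k₄ : ((P.act γ ≫ P.pull m) ▷ P.val ψ.fiber) ≫
          (P.pull (eqToIso (φ.induced_fiber ψ h).symm) ▷ P.val ψ.fiber) ≫
            hP.circ (φ.induced ψ h) = (α_ _ _ _).hom ≫
          (E.map (eqToHom (QVrt.mk_congr e _ _) ≫ ρ.arrow).op ⊗ₘ
            ((P.pull ρ.label ▷ _) ≫ (P.pull (eqToIso (ρ.second.induced_fiber ψ h').symm) ▷ _) ≫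
              hP.circ (ρ.second.induced ψ h'))) ≫
            P.act (ρ.first.induced (ρ.second.comp ψ h') h'') ≫ P.pull (ρ.compIso ψ h h' h'') := by
        rw [← comp_whiskerRight_assoc, Category.assoc, ← P.presheaf.pull_trans,
          ← comp_whiskerRight_assoc (P.pull ρ.label), ← P.presheaf.pull_trans]
        rw [insertStep, he] at k₂
        exact k₂
      have k₅ : ((P.act (ρ.first.induced (ρ.second.comp ψ h') h'') ≫
          P.pull (ρ.compIso ψ h h' h'')) ▷ P.val R) ≫ hP.circ (φ.comp ψ h) = (α_ _ _ _).hom ≫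
          (E.map (eqToHom (QVrt.mk_congr hs.fiber_eq _ _)).op ⊗ₘ hP.circ (ρ.second.comp ψ h')) ≫
            P.act ρ.first ≫ P.pull ρ.iso := by
        refine k₃.trans ?_
        change _ ≫ (_ ⊗ₘ ((P.pull (Iso.refl _) ▷ P.val R) ≫ hP.circ (ρ.second.comp ψ h'))) ≫ _ = _
        rw [hr, id_whiskerRight, Category.id_comp]
      have e₁ : (E.map (eqToHom (QVrt.mk_congr e _ _) ≫ ρ.arrow).op) ≫
          E.map (eqToHom (QVrt.mk_congr hs.fiber_eq ρ.first.fiber_pos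
            (ρ.first.induced (ρ.second.comp ψ h') h'').fiber_pos)).op = E.map ρ.arrow.op := by
        rw [← E.map_comp, ← op_comp, eqToHom_trans_assoc]
        exact congrArg (fun x => E.map (Quiver.Hom.op x)) (Category.id_comp _)
      rw [associator_inv_naturality_left_assoc, ← comp_whiskerRight_assoc, k₄,
        ← whisker_exchange_assoc, k₁, ← Category.assoc (α_ _ _ _).hom,
        comp_whiskerRight_assoc, k₅, reassoc_of% insert_pentagon, e₁]
      have k₆ := P.insertStep_comp ρ ((P.pull ρ.label ▷ P.val S) ≫ hP.circ ρ.second) (𝟙 _)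
        (hP.circ ψ)
      rw [whiskerLeft_id, id_tensorHom] at k₆
      rw [k₆, insertStep, id_tensorHom, whisker_exchange_assoc, ih']
      rw [associator_inv_naturality_left_assoc,
        ← comp_whiskerRight_assoc (P.pull ρ.label ▷ P.val ψ.fiber)]

end TowerModule.IsFree

end Assoc

/-! ### Equivariance over arbitrary isomorphisms -/

section Equivariance

variable {O : Type u} [Category.{v} O] [GradedOperadicCategory O] [StandingAssumptions O]
  {V : Type u'} [Category.{v'} V] [MonoidalCategory V] [SymmetricCategory V]
  {E : Collection O V} [∀ A : V, PreservesColimitsOfSize.{max u v, max u v} (tensorLeft A)]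

namespace TowerModule

lemma pull_trans (P : TowerModule E) {T S R : O} (f : T ≅ S) (g : S ≅ R) :
    P.pull (f ≪≫ g) = P.pull g ≫ P.pull f := P.presheaf.pull_trans f g

lemma pull_refl (P : TowerModule E) (T : O) : P.pull (Iso.refl T) = 𝟙 _ := P.presheaf.pull_refl T

end TowerModule

namespace TowerModule.IsFree

variable {P : TowerModule E} (hP : P.IsFree)
include hP

lemma theta_congr {X Y t s F : O} (Φ : Elementary X t) (Ψ : Elementary Y s)
    (ht : IsLocalTerminal t) (hs : IsLocalTerminal s) (e : Y = X) (e' : t = s)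
    (a : Φ.fiber = F) (b : Ψ.fiber = F) :
    P.pull (eqToIso a) ≫ hP.theta Φ ht ≫ P.pull (eqToIso e) =
      P.pull (eqToIso b) ≫ hP.theta Ψ hs := by
  subst e e'
  obtain rfl : Φ = Ψ := Elementary.ext_hom (ht.hom_ext _ _)
  refine congrArg (P.pull (eqToIso a) ≫ ·) ?_
  exact (congrArg (hP.theta Φ ht ≫ ·) (P.presheaf.pull_refl _)).trans (Category.comp_id _)

/-- The map between the values at the nontrivial fibers induced by a square. -/
noncomputable def transfer {T S T' S' : O} {φ : Elementary T S} {φ' : Elementary T' S'}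
    (q : ElementarySquare φ φ') : P.val φ.fiber ⟶ P.val φ'.fiber :=
  P.pull (eqToIso q.left_fiber) ≫ hP.theta q.left (isLocalTerminal_fiber_iso q.bot φ'.idx) ≫
    P.pull q.right.symm

/-- On generators the transfer undoes the action of the arrow of `QVrt(e)` given by the square,
because `theta` preserves generators. -/
lemma gen_transfer {T S T' S' : O} {φ : Elementary T S} {φ' : Elementary T' S'}
    (q : ElementarySquare φ φ') :
    E.map q.fiberClass.op ≫ P.gen φ.fiber_pos ≫ hP.transfer q = P.gen φ'.fiber_pos := by
  unfold transfer
  have h₁ := P.gen_pull q.left.fiber_pos φ.fiber_pos (eqToIso q.left_fiber)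
  have h₂ := hP.gen_theta q.left (isLocalTerminal_fiber_iso q.bot φ'.idx)
  have h₃ := P.gen_pull φ'.fiber_pos q.one_le_grade_mid q.right.symm
  rw [reassoc_of% h₁, reassoc_of% h₂]
  refine (congrArg (fun x => _ ≫ _ ≫ _ ≫ x) h₃).trans ?_
  rw [← E.map_comp_assoc, ← E.map_comp_assoc, ← E.map_comp_assoc, ← op_comp, ← op_comp, ← op_comp]
  have h : QVrt.hom q.right.symm rfl rfl ≫ eqToHom (congrArg Presented.mk
      (q.left.mk_fiber (isLocalTerminal_fiber_iso q.bot φ'.idx))) ≫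
      QVrt.hom (eqToIso q.left_fiber) rfl rfl ≫ q.fiberClass =
        𝟙 (QVrt.mk φ'.fiber φ'.fiber_pos) := by
    rw [QVrt.hom_eqToIso q.left_fiber _ _ _ _ (QVrt.mk_congr q.left_fiber _ _), eqToHom_trans_assoc]
    unfold ElementarySquare.fiberClass
    rw [QVrt.eqToHom_comp_hom q.right _ _ rfl rfl, QVrt.hom_trans,
      Iso.symm_self_id, QVrt.hom_refl]
  refine (congrArg (fun x => E.map (Quiver.Hom.op x) ≫ P.gen φ'.fiber_pos) h).trans ?_
  exact (congrArg (· ≫ _) (E.map_id _)).trans (Category.id_comp _)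

/-- Induction on the grade of the fiber of `φ`. The generator case is equivariance of the action.
Otherwise a refinement of `φ` is transported along `q`: its first morphisms form a square, handled
by `act_pull`, and its second morphisms form a square of smaller fiber grade, handled by the
induction hypothesis. -/
lemma circ_equivariant {T S T' S' : O} {φ : Elementary T S} {φ' : Elementary T' S'}
    (q : ElementarySquare φ φ') :
    (hP.transfer q ▷ P.val S') ≫ hP.circ φ' ≫ P.pull q.top =
      (P.val φ.fiber ◁ P.pull q.bot) ≫ hP.circ φ := by
  obtain ⟨n, hn⟩ : ∃ n, grade φ.fiber ≤ n := ⟨_, le_rfl⟩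
  induction n generalizing T S T' S' with
  | zero => exact absurd φ.fiber_pos (by omega)
  | succ n ih =>
    refine hP.hom_ext_cases φ.fiber_pos ?_ fun {G₀ G₁} m γ hγ => ?_
    · rw [← cancel_epi (E.map q.fiberClass.op ▷ _), ← comp_whiskerRight_assoc,
        ← comp_whiskerRight_assoc, Category.assoc, hP.gen_transfer, reassoc_of% hP.gen_circ φ',
        ← whisker_exchange_assoc, hP.gen_circ φ, P.act_pull q, MonoidalCategory.tensorHom_def,
        Category.assoc]
    · obtain ⟨ρ⟩ := exists_refinement φ m γ hγ
      obtain ⟨ρ', q₀, q₁, e, e', h₁, h₂, h₃, h₄, h₅, h₆⟩ := ρ.exists_transport q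
      obtain ⟨e₁, he₁⟩ : ∃ e₁ : (ρ.left q).first.fiber = ρ.first.fiber,
          (ρ.left q).arrow = eqToHom (QVrt.mk_congr e₁ _ _) ≫ ρ.arrow :=
        ρ.arrow_atFiber q.bot.hom _ rfl φ'.idx q.cardMap_idx q.left rfl _ rfl
      have e₂ : (ρ.left q).second.fiber = ρ.second.fiber :=
        ρ.second.atFiber_fiber q.bot.hom _ rfl φ'.idx (by rw [← ρ.second_idx, q.cardMap_idx])
      have hl : P.pull (ρ.left q).label = P.pull ρ.label ≫ P.pull (eqToIso e₂) :=
        P.pull_trans _ _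
      have ht := isLocalTerminal_fiber_iso q.bot φ'.idx
      have k₁ := hP.theta_congr (ρ.left q).second q₁.left ht
        (isLocalTerminal_fiber_iso q₁.bot ρ'.second.idx) e' (by
          have : ∀ b i, b = q.bot → i = φ'.idx → OperadicData.fiber q.bot.hom φ'.idx =
              OperadicData.fiber b.hom i := by rintro _ _ rfl rfl; rfl
          exact this _ _ h₁ h₂.symm) e₂ q₁.left_fiber
      have k₂ : (P.act γ ≫ P.pull m) ≫ hP.transfer q =
          (E.map (ρ.left q).arrow.op ⊗ₘ (P.pull (ρ.left q).label ≫ hP.theta (ρ.left q).second ht)) ≫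
            P.act (ρ.left q).first ≫ P.pull (q.right.symm ≪≫ (ρ.left q).iso) := by
        have k := hP.act_theta ht (ρ.left q) hγ
        rw [P.pull_trans, Category.assoc] at k
        unfold transfer
        rw [Category.assoc, reassoc_of% k, P.pull_trans]
      have hg : grade (ρ.left q).obj₁ = grade G₁ := by
        rw [← grade_of_iso ρ.label, ← e₂]
        exact (grade_fiber_localTerminal (ρ.left q).second.hom ht _).symm
      have k₃ := hP.act_circ ρ' (by rw [hg]; exact hγ)
      have ih' := ih q₁ (by
        rw [grade_of_iso ρ.label]
        have := γ.grade_lt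
        have := grade_of_iso m
        omega)
      have k₄ : P.pull ρ'.iso ≫ P.pull q.top = P.pull q₀.top ≫ P.pull ρ.iso := by
        rw [← P.pull_trans, ← P.pull_trans, h₄]
      have k₅ : E.map (ρ.left q).arrow.op ≫ E.map ρ'.arrow.op ≫ E.map q₀.fiberClass.op =
          E.map ρ.arrow.op := by
        rw [← E.map_comp, ← E.map_comp, ← op_comp, ← op_comp, h₆, he₁, eqToHom_trans_assoc]
        exact congrArg (fun x => E.map (Quiver.Hom.op x)) (Category.id_comp _)
      have k₆ : (((P.pull (ρ.left q).label ≫ hP.theta (ρ.left q).second ht) ≫ P.pull ρ'.label) ▷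
          P.val S') ≫ hP.circ ρ'.second ≫ P.pull q₀.bot =
          (_ ◁ P.pull q.bot) ≫ (P.pull ρ.label ▷ P.val S) ≫ hP.circ ρ.second := by
        rw [h₃, h₅, P.pull_trans, hl, Category.assoc, Category.assoc, reassoc_of% k₁,
          comp_whiskerRight_assoc]
        refine (congrArg ((P.pull ρ.label ▷ P.val S') ≫ ·) ih').trans ?_
        rw [h₁, whisker_exchange_assoc]
      have k₇ := P.insertStep_comp ρ ((P.pull ρ.label ▷ P.val S) ≫ hP.circ ρ.second) (𝟙 _)
        (P.pull q.bot)
      rw [whiskerLeft_id, id_tensorHom, id_tensorHom, ← k₆] at k₇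
      rw [← whisker_exchange_assoc, hP.act_circ ρ hγ, k₇, ← comp_whiskerRight_assoc, k₂,
        comp_whiskerRight_assoc, reassoc_of% k₃]
      unfold insertStep
      simp only [Category.assoc]
      rw [k₄, reassoc_of% P.act_pull q₀]
      have k₈ : ∀ {A A' A'' A''' B B' B'' C C' : V} (a : A ⟶ A') (a' : A' ⟶ A'') (a'' : A'' ⟶ A''')
          (b : B ⟶ B') (b' : B' ⟶ B'') (c : B'' ⊗ P.val S' ⟶ C) (d : C ⟶ C'),
          ((a ⊗ₘ b) ▷ P.val S') ≫ (α_ _ _ _).hom ≫ (a' ⊗ₘ ((b' ▷ P.val S') ≫ c)) ≫ (a'' ⊗ₘ d) =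
            (α_ _ _ _).hom ≫ ((a ≫ a' ≫ a'') ⊗ₘ (((b ≫ b') ▷ P.val S') ≫ c ≫ d)) := by
        intros
        rw [← tensorHom_id, associator_naturality_assoc, MonoidalCategory.tensorHom_comp_tensorHom,
          MonoidalCategory.tensorHom_comp_tensorHom, tensorHom_id, comp_whiskerRight_assoc]
        simp only [Category.assoc]
      rw [reassoc_of% k₈, k₅]
      simp only [Category.assoc]

end TowerModule.IsFree

end Equivariance

/-! ### Coherence of exchanges of tensor factors -/

section SwapAssoc

variable {V : Type u'} [Category.{v'} V] [MonoidalCategory V] [SymmetricCategory V]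

lemma swapMap_eq {A B C D : V} (x : B ⟶ C) (y : A ⟶ D) (R : V) :
    swapMap x y R = swapMap (𝟙 B) (𝟙 A) R ≫ (x ⊗ₘ (y ▷ R)) := by
  have h := swapMap_natural (𝟙 B) (𝟙 A) x y (𝟙 A) (𝟙 B) x y (𝟙 R) (by simp) (by simp)
  rw [id_tensorHom_id, id_tensorHom_id, Category.id_comp, tensorHom_id] at h
  exact h

lemma whiskerRight_swapMap {A A' B C D : V} (x : B ⟶ C) (y : A' ⟶ D) (a : A ⟶ A') (R : V) :
    (a ▷ (B ⊗ R)) ≫ swapMap x y R = swapMap x (a ≫ y) R := by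
  have h := swapMap_natural x (a ≫ y) x y a (𝟙 B) (𝟙 C) (𝟙 D) (𝟙 R) (by simp) (by simp)
  rw [id_tensorHom_id, id_tensorHom_id, id_tensorHom_id, Category.comp_id, tensorHom_id] at h
  exact h

lemma swapMap_whiskerLeft {A B C D D' : V} (x : B ⟶ C) (y : A ⟶ D) (a : D ⟶ D') (R : V) :
    swapMap x y R ≫ (C ◁ (a ▷ R)) = swapMap x (y ≫ a) R := by
  have h := swapMap_natural x y x (y ≫ a) (𝟙 A) (𝟙 B) (𝟙 C) a (𝟙 R) (by simp) (by simp)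
  rw [id_tensorHom_id, id_tensorHom_id, Category.id_comp, tensorHom_id, id_tensorHom] at h
  exact h.symm

lemma swapMap_assoc (A G B R : V) :
    (α_ A G (B ⊗ R)).hom ≫ (A ◁ swapMap (𝟙 B) (𝟙 G) R) ≫ swapMap (𝟙 B) (𝟙 A) (G ⊗ R) =
      swapMap (𝟙 B) (𝟙 (A ⊗ G)) R ≫ (B ◁ (α_ A G R).hom) := by
  have h := BraidedCategory.braiding_tensor_left_hom A G B
  simp only [swapMap, id_tensorHom_id, Category.comp_id, h]
  monoidal

/-- Moving `B` past `G` and then past `A` equals moving it past `A ⊗ G`, with arbitrary maps in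
between. This is the coherence used when a commutation is performed in two steps. -/
lemma swapMap_interchange {A A₁ A₂ G G₁ G₂ B B₁ B₂ B₃ R Q : V} (c : A ⟶ A₁) (l : G ⟶ G₁)
    (y₁ : B ⟶ B₁) (p : G₁ ⟶ G₂) (w : G₂ ⊗ R ⟶ Q) (y₂ : B₁ ⟶ B₂) (e : A₁ ⟶ A₂) (y₃ : B₂ ⟶ B₃) :
    (α_ A G (B ⊗ R)).hom ≫ (c ⊗ₘ ((l ▷ _) ≫ swapMap y₁ p R ≫ (B₁ ◁ w))) ≫ swapMap y₂ e Q ≫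
      (y₃ ▷ _) =
      swapMap (y₁ ≫ y₂ ≫ y₃) (𝟙 _) R ≫
        (B₃ ◁ ((α_ A G R).hom ≫ ((c ≫ e) ⊗ₘ (((l ≫ p) ▷ R) ≫ w)))) := by
  have h₁ : (l ▷ _) ≫ swapMap y₁ p R ≫ (B₁ ◁ w) =
      swapMap (𝟙 B) (𝟙 G) R ≫ (y₁ ⊗ₘ (((l ≫ p) ▷ R) ≫ w)) := by
    rw [reassoc_of% whiskerRight_swapMap, swapMap_eq, Category.assoc, tensorHom_comp_whiskerLeft]
  have h₂ : swapMap y₂ e Q ≫ (y₃ ▷ _) = swapMap (y₂ ≫ y₃) e Q := by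
    rw [swapMap_eq, Category.assoc, tensorHom_comp_whiskerRight, ← swapMap_eq]
  have h₃ : (c ⊗ₘ (y₁ ⊗ₘ (((l ≫ p) ▷ R) ≫ w))) ≫ swapMap (y₂ ≫ y₃) e Q =
      swapMap (𝟙 B) (𝟙 A) (G ⊗ R) ≫ ((y₁ ≫ y₂ ≫ y₃) ⊗ₘ ((c ≫ e) ⊗ₘ (((l ≫ p) ▷ R) ≫ w))) :=
    swapMap_natural _ _ _ _ _ _ _ _ _ (by simp) (by simp)
  rw [h₁, h₂, ← whiskerLeft_comp_tensorHom, Category.assoc, h₃, reassoc_of% swapMap_assoc,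
    swapMap_eq (y₁ ≫ y₂ ≫ y₃), Category.assoc, id_whiskerRight, tensorHom_comp_whiskerLeft,
    whiskerLeft_comp_tensorHom, Category.id_comp]

end SwapAssoc

/-! ### The induction for commutativity -/

section Commutativity

variable {O : Type u} [Category.{v} O] [GradedOperadicCategory O] [StandingAssumptions O]
  {V : Type u'} [Category.{v'} V] [MonoidalCategory V] [SymmetricCategory V]
  {E : Collection O V} [∀ A : V, PreservesColimitsOfSize.{max u v, max u v} (tensorLeft A)]

/-- The identification of the values of a family at equal objects. -/
def castPos (Y : ∀ X : O, 1 ≤ grade X → V) {X X' : O} (h : X = X') (hX : 1 ≤ grade X)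
    (hX' : 1 ≤ grade X') : Y X' hX' ⟶ Y X hX :=
  eqToHom (by subst h; rfl)

lemma castPos_trans (Y : ∀ X : O, 1 ≤ grade X → V) {X X' X'' : O} (h : X = X') (h' : X' = X'')
    (hX : 1 ≤ grade X) (hX' : 1 ≤ grade X') (hX'' : 1 ≤ grade X'') :
    castPos Y h' hX' hX'' ≫ castPos Y h hX hX' = castPos Y (h.trans h') hX hX'' := by
  subst h h'; simp [castPos]

namespace TowerModule.IsFree

variable {P : TowerModule E} (hP : P.IsFree)
include hP

/-- Commutativity of the circle products with a family of operations which commutes with the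
action of the generators. -/
lemma circ_comm_of_act_comm (Y : ∀ X : O, 1 ≤ grade X → V)
    (y : ∀ {T S : O} (φ : Elementary T S), Y φ.fiber φ.fiber_pos ⊗ P.val S ⟶ P.val T)
    (h₁ : ∀ {T P' P'' S : O} {φ' : Elementary T P'} {ψ' : Elementary P' S}
      {φ'' : Elementary T P''} {ψ'' : Elementary P'' S} (q : DisjointSquare φ' ψ' φ'' ψ''),
      (E.obj (op (QVrt.mk φ''.fiber φ''.fiber_pos)) ◁ y ψ'') ≫ P.act φ'' =
        swapMap (castPos Y q.fiber_eq_fiber φ'.fiber_pos ψ''.fiber_pos)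
          (E.map (eqToHom (QVrt.mk_congr q.symm.fiber_eq_fiber.symm _ _)).op) (P.val S) ≫
          (Y φ'.fiber φ'.fiber_pos ◁ P.act ψ') ≫ y φ')
    (h₂ : ∀ {T S T' S' : O} {φ : Elementary T S} {φ' : Elementary T' S'}
      (q : ElementarySquare φ φ'), IsTrivial (OperadicData.fiber q.bot.hom φ'.idx) →
      ∀ (e : φ.fiber = φ'.fiber), (∃ e, q.right.hom = eqToHom e) →
      y φ' ≫ P.pull q.top = (castPos Y e φ.fiber_pos φ'.fiber_pos ⊗ₘ P.pull q.bot) ≫ y φ)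
    {T P' P'' S : O} {φ' : Elementary T P'} {ψ' : Elementary P' S}
    {φ'' : Elementary T P''} {ψ'' : Elementary P'' S} (q : DisjointSquare φ' ψ' φ'' ψ'') :
    (P.val φ''.fiber ◁ y ψ'') ≫ hP.circ φ'' =
      swapMap (castPos Y q.fiber_eq_fiber φ'.fiber_pos ψ''.fiber_pos)
        (P.pull (eqToIso q.symm.fiber_eq_fiber.symm)) (P.val S) ≫
        (Y φ'.fiber φ'.fiber_pos ◁ hP.circ ψ') ≫ y φ' := by
  obtain ⟨n, hn⟩ : ∃ n, grade φ''.fiber ≤ n := ⟨_, le_rfl⟩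
  induction n generalizing T P' P'' S with
  | zero => exact absurd φ''.fiber_pos (by omega)
  | succ n ih =>
    refine hP.hom_ext_cases φ''.fiber_pos ?_ fun {G₀ G₁} ℓ γ hγ => ?_
    -- On generators the circle product is the action, so this case is the hypothesis `h₁`.
    · rw [← whisker_exchange_assoc, hP.gen_circ, h₁ q, reassoc_of% whiskerRight_swapMap,
        P.gen_pull ψ'.fiber_pos φ''.fiber_pos, ← hP.gen_circ ψ', whiskerLeft_comp_assoc,
        reassoc_of% swapMap_whiskerLeft,
        QVrt.hom_eqToIso _ _ _ _ _ (QVrt.mk_congr q.symm.fiber_eq_fiber.symm _ _)]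
    -- The square is cut along `γ`. The square `q₂` has smaller fiber and is covered by the
    -- induction hypothesis, `q₁` involves only the action of a generator and is covered by `h₁`,
    -- and `h₂` returns from `χ₀` to `φ'`.
    · obtain ⟨T₀, T₁, Q₀, Q₁, τ, σ, φ₁, φ₂, ζ, ω, χ₀, χ₁, l, l', a₁, a₂, a₃, a₄, a₅, a₆, w, hρ, hρ',
        q₁, q₂, ht, hr⟩ := q.exists_refinements ℓ γ hγ
      have ih' := ih q₂ (by
        have := γ.grade_lt
        have := grade_of_iso l
        have := grade_of_iso ℓ
        omega)
      have f₁ : φ₁.fiber = γ.fiber := hρ.fiber_eq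
      have f₂ : ζ.fiber = γ.fiber := hρ'.fiber_eq
      have k₁ : ((P.act γ ≫ P.pull ℓ) ▷ P.val P'') ≫ hP.circ φ'' = (α_ _ _ _).hom ≫
          (E.map (eqToHom (QVrt.mk_congr f₁ φ₁.fiber_pos γ.fiber_pos)).op ⊗ₘ
            ((P.pull l ▷ P.val P'') ≫
            hP.circ φ₂)) ≫ P.act φ₁ ≫ P.pull τ := hP.act_circ_of_strict hρ hγ
      have k₂ := hP.act_circ_of_strict hρ' hγ
      have e : φ'.fiber = χ₀.fiber := by
        rw [q.fiber_eq_fiber, ← q₂.fiber_eq_fiber, ← q₁.symm.symm.fiber_eq_fiber]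
      have k₃ : y χ₀ ≫ P.pull τ = (castPos Y e φ'.fiber_pos χ₀.fiber_pos ⊗ₘ P.pull σ) ≫ y φ' :=
        h₂ ⟨τ, σ, w⟩ ht e hr
      have k₄ := h₁ q₁
      have k₅ : P.pull l ≫ P.pull (eqToIso q₂.symm.fiber_eq_fiber.symm) = P.pull l' := by
        obtain ⟨e₁, he₁⟩ := hρ.label
        obtain ⟨e₂, he₂⟩ := hρ'.label
        have he₁' : l.hom = eqToHom e₁ := he₁
        have he₂' : l'.hom = eqToHom e₂ := he₂
        rw [← P.pull_trans]
        refine congrArg (fun x => P.presheaf.pull x) (Iso.ext ?_)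
        rw [Iso.trans_hom, eqToIso.hom, he₁', he₂', eqToHom_trans]
      have k₆ : ((P.act γ ≫ P.pull ℓ) ▷ (Y ψ''.fiber ψ''.fiber_pos ⊗ P.val S)) ≫
          (P.val φ''.fiber ◁ y ψ'') ≫ hP.circ φ'' = (α_ _ _ _).hom ≫
          (E.map (eqToHom (QVrt.mk_congr f₁ φ₁.fiber_pos γ.fiber_pos)).op ⊗ₘ ((P.pull l ▷ _) ≫
            swapMap (castPos Y q₂.fiber_eq_fiber χ₁.fiber_pos ψ''.fiber_pos)
              (P.pull (eqToIso q₂.symm.fiber_eq_fiber.symm)) (P.val S) ≫ (_ ◁ hP.circ ω))) ≫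
          swapMap (castPos Y q₁.fiber_eq_fiber χ₀.fiber_pos χ₁.fiber_pos)
            (E.map (eqToHom (QVrt.mk_congr q₁.symm.fiber_eq_fiber.symm ζ.fiber_pos
              φ₁.fiber_pos)).op) (P.val Q₁) ≫
          (castPos Y e φ'.fiber_pos χ₀.fiber_pos ▷ _) ≫
          (_ ◁ (P.act ζ ≫ P.pull σ)) ≫ y φ' := by
        have k : (P.val G₁ ◁ y ψ'') ≫ (P.pull l ▷ P.val P'') ≫ hP.circ φ₂ = ((P.pull l ▷ _) ≫
            swapMap (castPos Y q₂.fiber_eq_fiber χ₁.fiber_pos ψ''.fiber_pos)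
              (P.pull (eqToIso q₂.symm.fiber_eq_fiber.symm)) (P.val S) ≫
              (Y χ₁.fiber χ₁.fiber_pos ◁ hP.circ ω)) ≫ y χ₁ := by
          rw [whisker_exchange_assoc, ih']
          simp only [Category.assoc]
        rw [← whisker_exchange_assoc, k₁, associator_naturality_right_assoc,
          whiskerLeft_comp_tensorHom_assoc, k, ← tensorHom_comp_whiskerLeft, Category.assoc,
          reassoc_of% k₄, k₃, MonoidalCategory.tensorHom_def (castPos _ _ _ _), Category.assoc,
          whisker_exchange_assoc, whiskerLeft_comp_assoc]
      have k₇ : ((P.act γ ≫ P.pull (eqToIso q.symm.fiber_eq_fiber.symm ≪≫ ℓ)) ▷ P.val S) ≫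
          hP.circ ψ' = ((α_ _ _ _).hom ≫
            (E.map (eqToHom (QVrt.mk_congr f₂ ζ.fiber_pos γ.fiber_pos)).op ⊗ₘ
            ((P.pull l' ▷ _) ≫ hP.circ ω))) ≫ P.act ζ ≫ P.pull σ := by
        simp only [Category.assoc]; exact k₂
      have k₈ : E.map (eqToHom (QVrt.mk_congr f₁ φ₁.fiber_pos γ.fiber_pos)).op ≫
          E.map (eqToHom (QVrt.mk_congr q₁.symm.fiber_eq_fiber.symm ζ.fiber_pos φ₁.fiber_pos)).op =
          E.map (eqToHom (QVrt.mk_congr f₂ ζ.fiber_pos γ.fiber_pos)).op := by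
        rw [← E.map_comp, ← op_comp, eqToHom_trans]
      rw [k₆, reassoc_of% swapMap_interchange, k₅, k₈, castPos_trans, castPos_trans,
        reassoc_of% whiskerRight_swapMap, Category.assoc, ← P.pull_trans,
        ← Category.id_comp (P.act γ ≫ _), ← swapMap_whiskerLeft, Category.assoc,
        ← whiskerLeft_comp_assoc, ← whiskerLeft_comp_assoc, k₇]

end TowerModule.IsFree

end Commutativity

lemma swapMap_swapMap_of_comp_eq_id {V : Type u'} [Category.{v'} V] [MonoidalCategory V]
    [SymmetricCategory V] {A B C D : V} (x : B ⟶ C) (y : A ⟶ D) (x' : C ⟶ B)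
    (y' : D ⟶ A) (h : x ≫ x' = 𝟙 _) (k : y ≫ y' = 𝟙 _) (R : V) :
    swapMap x y R ≫ swapMap y' x' R = 𝟙 _ := by
  have h₁ : ((β_ A B).hom ≫ (x ⊗ₘ y)) ≫ (β_ C D).hom ≫ (y' ⊗ₘ x') = 𝟙 _ := by
    rw [Category.assoc, BraidedCategory.braiding_naturality_assoc,
      MonoidalCategory.tensorHom_comp_tensorHom, h, k]
    simp
  simp only [swapMap, Category.assoc, Iso.hom_inv_id_assoc]
  rw [← comp_whiskerRight_assoc, h₁]
  simp

/-! ### Commutativity and quasibijection equivariance of the circle product -/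

section Instances

variable {O : Type u} [Category.{v} O] [GradedOperadicCategory O] [StandingAssumptions O]
  {V : Type u'} [Category.{v'} V] [MonoidalCategory V] [SymmetricCategory V]
  {E : Collection O V} [∀ A : V, PreservesColimitsOfSize.{max u v, max u v} (tensorLeft A)]

lemma castPos_collection (E : Collection O V) {X X' : O} (h : X = X') (hX : 1 ≤ grade X)
    (hX' : 1 ≤ grade X') :
    castPos (fun X hX => E.obj (op (QVrt.mk X hX))) h hX hX' =
      E.map (eqToHom (QVrt.mk_congr h hX hX')).op := by
  subst h; simp [castPos]

lemma castPos_presheaf (P : IsoPresheaf O V) {X X' : O} (h : X = X') (hX : 1 ≤ grade X)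
    (hX' : 1 ≤ grade X') : castPos (fun X _ => P.val X) h hX hX' = P.pull (eqToIso h) := by
  subst h; exact (P.pull_refl X).symm

lemma ElementarySquare.fiberClass_eq_of_right {T S T' S' : O} {φ : Elementary T S}
    {φ' : Elementary T' S'} (q : ElementarySquare φ φ') (e : φ.fiber = φ'.fiber)
    (h : ∃ e, q.right.hom = eqToHom e) : q.fiberClass = eqToHom (QVrt.mk_congr e _ _) := by
  obtain ⟨e', h⟩ := h
  have h' : q.right = eqToIso e' := Iso.ext h
  unfold fiberClass
  rw [h']
  exact QVrt.hom_eqToIso _ _ _ _ _ _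

namespace TowerModule

variable {P : TowerModule E}

lemma act_comm' {T P' P'' S : O} {φ' : Elementary T P'} {ψ' : Elementary P' S}
    {φ'' : Elementary T P''} {ψ'' : Elementary P'' S} (q : DisjointSquare φ' ψ' φ'' ψ'') :
    (E.obj (op (QVrt.mk φ''.fiber φ''.fiber_pos)) ◁ P.act ψ'') ≫ P.act φ'' =
      swapMap (castPos (fun X hX => E.obj (op (QVrt.mk X hX))) q.fiber_eq_fiber φ'.fiber_pos
        ψ''.fiber_pos) (E.map (eqToHom (QVrt.mk_congr q.symm.fiber_eq_fiber.symm _ _)).op)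
        (P.val S) ≫ (E.obj (op (QVrt.mk φ'.fiber φ'.fiber_pos)) ◁ P.act ψ') ≫ P.act φ' := by
  rw [P.act_comm q, q.cross_hom_eq_eqToHom, q.symm.cross_inv_eq_eqToHom, castPos_collection]

namespace IsFree

variable (hP : P.IsFree)
include hP

/-- The first use of `circ_comm_of_act_comm`, with the action of generators as the family of
operations: its hypotheses are the axioms of a module. -/
lemma circ_act_comm {T P' P'' S : O} {φ' : Elementary T P'} {ψ' : Elementary P' S}
    {φ'' : Elementary T P''} {ψ'' : Elementary P'' S} (q : DisjointSquare φ' ψ' φ'' ψ'') :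
    (P.val φ''.fiber ◁ P.act ψ'') ≫ hP.circ φ'' =
      swapMap (E.map (eqToHom (QVrt.mk_congr q.fiber_eq_fiber φ'.fiber_pos ψ''.fiber_pos)).op)
        (P.pull (eqToIso q.symm.fiber_eq_fiber.symm)) (P.val S) ≫
        (E.obj (op (QVrt.mk φ'.fiber φ'.fiber_pos)) ◁ hP.circ ψ') ≫ P.act φ' := by
  have h := hP.circ_comm_of_act_comm (fun X hX => E.obj (op (QVrt.mk X hX))) (fun φ => P.act φ)
    (fun q => act_comm' q) (fun q ht e hr => by
      rw [P.act_pull q, q.fiberClass_eq_of_right e hr, castPos_collection]) q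
  rw [castPos_collection] at h
  exact h

lemma transfer_of_isTrivial {T S T' S' : O} {φ : Elementary T S} {φ' : Elementary T' S'}
    (q : ElementarySquare φ φ') (ht : IsTrivial (OperadicData.fiber q.bot.hom φ'.idx))
    (e : q.mid = φ.fiber) : hP.transfer q = P.pull (q.right.symm ≪≫ eqToIso e) := by
  unfold transfer
  rw [P.pull_trans]
  have h := hP.theta_of_isTrivial q.left ht
  rw [reassoc_of% h, ← Category.assoc, ← P.pull_trans]
  refine congrArg (fun x => P.presheaf.pull x ≫ P.pull q.right.symm) (Iso.ext ?_)
  have k : ∀ {X Y Z : O} (a : X = Y) (b : Y = Z) (c : X = Z),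
      (eqToIso a ≪≫ eqToIso b).hom = (eqToIso c).hom := fun a b c => eqToHom_trans a b
  exact k _ q.left_fiber _

/-- If the relevant fiber of the bottom isomorphism is trivial, `theta` is an identity and the
transfer is inverse to the isomorphism of fibers. It can then be moved to the other side of
`circ_equivariant`. -/
lemma circ_pull_of_isTrivial {T S T' S' : O} {φ : Elementary T S} {φ' : Elementary T' S'}
    (q : ElementarySquare φ φ') (ht : IsTrivial (OperadicData.fiber q.bot.hom φ'.idx))
    (e : φ.fiber = q.mid) : hP.circ φ' ≫ P.pull q.top =
      (P.pull (eqToIso e ≪≫ q.right) ⊗ₘ P.pull q.bot) ≫ hP.circ φ := by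
  have h := hP.circ_equivariant q
  have h' : P.pull (eqToIso e ≪≫ q.right) ≫ hP.transfer q = 𝟙 _ := by
    rw [hP.transfer_of_isTrivial q ht e.symm, ← P.pull_trans, ← P.pull_refl]
    refine congrArg (fun x => P.presheaf.pull x) (Iso.ext ?_)
    simp
  rw [MonoidalCategory.tensorHom_def, Category.assoc, ← h, ← comp_whiskerRight_assoc, h',
    id_whiskerRight, Category.id_comp]

lemma circ_equivariant_of_isQuasibijection {T S T' S' : O} {φ : Elementary T S}
    {φ' : Elementary T' S'} (q : ElementarySquare φ φ') (hq : IsQuasibijection q.bot.hom) :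
    hP.circ φ' ≫ P.pull q.top =
      (P.pull (q.fiberIsoOfQuasibijection hq) ⊗ₘ P.pull q.bot) ≫ hP.circ φ :=
  hP.circ_pull_of_isTrivial q (hq _) _

/-- The second use of `circ_comm_of_act_comm`, now with the circle product as the family of
operations. Its first hypothesis is the previously established commutation with the action. -/
lemma circ_comm {T P' P'' S : O} {φ' : Elementary T P'} {ψ' : Elementary P' S}
    {φ'' : Elementary T P''} {ψ'' : Elementary P'' S} (q : DisjointSquare φ' ψ' φ'' ψ'') :
    (P.val φ''.fiber ◁ hP.circ ψ'') ≫ hP.circ φ'' =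
      swapMap (P.pull q.fiberIso) (P.pull q.symm.fiberIso.symm) (P.val S) ≫
        (P.val φ'.fiber ◁ hP.circ ψ') ≫ hP.circ φ' := by
  have h₁ : ∀ {T P' P'' S : O} {φ' : Elementary T P'} {ψ' : Elementary P' S}
      {φ'' : Elementary T P''} {ψ'' : Elementary P'' S} (q : DisjointSquare φ' ψ' φ'' ψ''),
      (E.obj (op (QVrt.mk φ''.fiber φ''.fiber_pos)) ◁ hP.circ ψ'') ≫ P.act φ'' =
        swapMap (castPos (fun X _ => P.val X) q.fiber_eq_fiber φ'.fiber_pos ψ''.fiber_pos)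
          (E.map (eqToHom (QVrt.mk_congr q.symm.fiber_eq_fiber.symm _ _)).op) (P.val S) ≫
          (P.val φ'.fiber ◁ P.act ψ') ≫ hP.circ φ' := by
    intro T P' P'' S φ' ψ' φ'' ψ'' q
    -- The exchange is invertible, so the commutation of product and action for the reflected square
    -- can be read backwards.
    rw [hP.circ_act_comm q.symm, ← Category.assoc, swapMap_swapMap_of_comp_eq_id, Category.id_comp]
    · rw [castPos_presheaf, ← P.pull_trans, ← P.pull_refl]
      refine congrArg (fun x => P.presheaf.pull x) (Iso.ext ?_)
      exact eqToHom_trans q.fiber_eq_fiber.symm q.fiber_eq_fiber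
    · rw [← E.map_comp, ← op_comp, eqToHom_trans]
      exact E.map_id _
  have h₂ : ∀ {T S T' S' : O} {φ : Elementary T S} {φ' : Elementary T' S'}
      (q : ElementarySquare φ φ'), IsTrivial (OperadicData.fiber q.bot.hom φ'.idx) →
      ∀ (e : φ.fiber = φ'.fiber), (∃ e, q.right.hom = eqToHom e) →
      hP.circ φ' ≫ P.pull q.top =
        (castPos (fun X _ => P.val X) e φ.fiber_pos φ'.fiber_pos ⊗ₘ P.pull q.bot) ≫ hP.circ φ := by
    intro T S T' S' φ φ' q ht e ⟨e', hr⟩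
    rw [hP.circ_pull_of_isTrivial q ht (e.trans e'.symm), castPos_presheaf]
    refine congrArg (fun x => (P.presheaf.pull x ⊗ₘ P.pull q.bot) ≫ hP.circ φ) (Iso.ext ?_)
    rw [Iso.trans_hom, hr]
    exact eqToHom_trans (e.trans e'.symm) e'
  have h := hP.circ_comm_of_act_comm (fun X _ => P.val X) (fun φ => hP.circ φ) h₁ h₂ q
  rw [castPos_presheaf] at h
  rw [h, q.fiberIso_eq, q.symm.fiberIso_eq]
  rfl

end IsFree

end TowerModule

end Instances

/-! ## The free module -/

section FreeModule

variable {O : Type u} [Category.{v} O] [GradedOperadicCategory O] [StandingAssumptions O]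
  {V : Type u'} [Category.{v'} V] [MonoidalCategory V] [SymmetricCategory V]
  [HasColimitsOfSize.{max u v, max u v} V] (E : Collection O V)

lemma LabelledTower.pos {X : O} (a : LabelledTower X) : 1 ≤ grade X := by
  rw [grade_of_iso a.label]; exact a.tower.pos

/-- The colimit of the values of the labelled towers, extended by the unit in grade `0`. -/
noncomputable def freeVal (X : O) : V :=
  if 1 ≤ grade X then colimit (towerDiagram E X) else 𝟙_ V

lemma freeVal_of_pos {X : O} (h : 1 ≤ grade X) : freeVal E X = colimit (towerDiagram E X) :=
  if_pos h

lemma freeVal_of_grade_eq_zero {X : O} (h : grade X = 0) : freeVal E X = 𝟙_ V :=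
  if_neg (by omega)

/-- The cocone of the colimit over the labelled towers. -/
noncomputable def freeInj {X : O} (a : LabelledTower X) : a.tower.tensor E ⟶ freeVal E X :=
  colimit.ι (towerDiagram E X) (op ⟨a⟩) ≫ eqToHom (freeVal_of_pos E a.pos).symm

lemma freeInj_gen {X : O} {a b : LabelledTower X} (γ : LabelledTower.Gen a b) :
    γ.map E ≫ freeInj E a = freeInj E b := by
  have h := colimit.w (towerDiagram E X)
    (Presented.homMk (LabelledTower.Rel (X := X)) (.gen γ)).op
  exact (Category.assoc _ _ _).symm.trans (congrArg (· ≫ eqToHom _) h)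

lemma freeInj_congr {X T : O} {ℓ ℓ' : X ≅ T} (h : ℓ = ℓ') (A : Tower T) :
    freeInj E ⟨T, ℓ, A⟩ = freeInj E ⟨T, ℓ', A⟩ := by rw [h]

lemma freeInj_hom {X T S : O} {ℓ : X ≅ T} {σ : T ≅ S} {A : Tower T} {B : Tower S}
    (f : Tower.Hom A B σ) : f.map E ≫ freeInj E ⟨T, ℓ, A⟩ = freeInj E ⟨S, ℓ ≪≫ σ, B⟩ :=
  freeInj_gen E (.first (a := ⟨T, ℓ, A⟩) (b := ⟨S, ℓ ≪≫ σ, B⟩) σ rfl f)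

lemma free_nonempty_isColimit {X : O} (hX : 1 ≤ grade X) :
    Nonempty (IsColimit (Cocone.mk (freeVal E X)
      (LabelledTower.natTrans (freeInj E) (freeInj_gen E)))) :=
  ⟨(colimit.isColimit (towerDiagram E X)).ofIsoColimit
    (Cocone.ext (eqToIso (freeVal_of_pos E hX).symm) fun _ => rfl)⟩

lemma free_exists_desc {X : O} (hX : 1 ≤ grade X) {Z : V}
    (g : ∀ a : LabelledTower X, a.tower.tensor E ⟶ Z)
    (hg : ∀ {a b : LabelledTower X} (γ : LabelledTower.Gen a b), γ.map E ≫ g a = g b) :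
    ∃ d : freeVal E X ⟶ Z, ∀ a : LabelledTower X, freeInj E a ≫ d = g a := by
  obtain ⟨h⟩ := free_nonempty_isColimit E hX
  exact ⟨h.desc (Cocone.mk Z (LabelledTower.natTrans g hg)), fun a => h.fac _ (op ⟨a⟩)⟩

lemma free_hom_ext {X : O} (hX : 1 ≤ grade X) {Z : V} {d d' : freeVal E X ⟶ Z}
    (h : ∀ a : LabelledTower X, freeInj E a ≫ d = freeInj E a ≫ d') : d = d' := by
  obtain ⟨hc⟩ := free_nonempty_isColimit E hX
  exact hc.hom_ext fun a => h a.unop.as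

/-- In positive grade an isomorphism acts by precomposition with the labels, which commutes with all
morphisms of towers. In grade 0 all values are the unit object and the action is an identity. -/
lemma exists_freePull {X Y : O} (f : X ≅ Y) :
    ∃ d : freeVal E Y ⟶ freeVal E X,
      (∀ a : LabelledTower Y, freeInj E a ≫ d = freeInj E ⟨a.base, f ≪≫ a.label, a.tower⟩) ∧
        ∀ hX : grade X = 0, d = eqToHom ((freeVal_of_grade_eq_zero E ((grade_of_iso f).symm.trans
          hX)).trans (freeVal_of_grade_eq_zero E hX).symm) := by
  by_cases hX : grade X = 0
  · refine ⟨eqToHom ((freeVal_of_grade_eq_zero E ((grade_of_iso f).symm.trans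
          hX)).trans (freeVal_of_grade_eq_zero E hX).symm), fun a => ?_, fun _ => rfl⟩
    have := a.pos
    rw [← grade_of_iso f] at this
    omega
  · obtain ⟨d, hd⟩ := free_exists_desc E (X := Y) (by rw [← grade_of_iso f]; omega)
      (fun a => freeInj E (X := X) ⟨a.base, f ≪≫ a.label, a.tower⟩) (fun {a b} γ => by
        cases γ with
        | first σ w g =>
          refine (freeInj_hom E (ℓ := f ≪≫ a.label) g).trans (freeInj_congr E ?_ _)
          rw [← w, Iso.trans_assoc]
        | second ℓ s => exact freeInj_gen E (.second (f ≪≫ ℓ) s))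
    exact ⟨d, hd, fun h => absurd h hX⟩

/-- The action of an isomorphism. -/
noncomputable def freePull {X Y : O} (f : X ≅ Y) : freeVal E Y ⟶ freeVal E X :=
  (exists_freePull E f).choose

lemma freeInj_freePull {X Y : O} (f : X ≅ Y) (a : LabelledTower Y) :
    freeInj E a ≫ freePull E f = freeInj E ⟨a.base, f ≪≫ a.label, a.tower⟩ :=
  (exists_freePull E f).choose_spec.1 a

lemma freePull_of_grade_eq_zero {X Y : O} (f : X ≅ Y) (hX : grade X = 0) :
    freePull E f = eqToHom ((freeVal_of_grade_eq_zero E ((grade_of_iso f).symm.trans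
      hX)).trans (freeVal_of_grade_eq_zero E hX).symm) :=
  (exists_freePull E f).choose_spec.2 hX

/-- The presheaf underlying the free module. -/
noncomputable def freePresheaf : IsoPresheaf O V where
  obj X := freeVal E X.unop.of
  map f := freePull E f.unop.iso
  map_id X := by
    change freePull E (Iso.refl X.unop.of) = _
    by_cases hX : grade X.unop.of = 0
    · exact freePull_of_grade_eq_zero E _ hX
    · refine free_hom_ext E (by omega) fun a => ?_
      rw [freeInj_freePull, Category.comp_id]
      exact freeInj_congr E (Iso.refl_trans _) _
  map_comp {X Y Z} f g := by
    change freePull E (g.unop.iso ≪≫ f.unop.iso) = freePull E f.unop.iso ≫ freePull E g.unop.iso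
    by_cases hX : grade Z.unop.of = 0
    · rw [freePull_of_grade_eq_zero E _ hX, freePull_of_grade_eq_zero E _ hX,
        freePull_of_grade_eq_zero E _ (by rw [← grade_of_iso g.unop.iso]; exact hX), eqToHom_trans]
    · refine free_hom_ext E (by
        rw [← grade_of_iso f.unop.iso, ← grade_of_iso g.unop.iso]; omega) fun a => ?_
      rw [freeInj_freePull, ← Category.assoc, freeInj_freePull, freeInj_freePull]
      exact freeInj_congr E (Iso.trans_assoc _ _ _) _

/-- The map of the cocone at a tower with at least two terms. -/
noncomputable def freeInjCons {X T S : O} (ℓ : X ≅ T) (φ : Elementary T S) (A : Tower S) :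
    E.obj (op (QVrt.mk φ.fiber φ.fiber_pos)) ⊗ A.tensor E ⟶ freeVal E X :=
  freeInj E ⟨T, ℓ, .cons φ A⟩

/-- The map of the cocone at a tower with one term. -/
noncomputable def freeInjLast {X T : O} (ℓ : X ≅ T) (hT : 1 ≤ grade T) :
    E.obj (op (QVrt.mk T hT)) ⟶ freeVal E X :=
  freeInj E ⟨T, ℓ, .last T hT⟩

lemma freeInjCons_pull {X Y T S : O} (f : X ≅ Y) (ℓ : Y ≅ T) (φ : Elementary T S) (A : Tower S) :
    freeInjCons E ℓ φ A ≫ freePull E f = freeInjCons E (f ≪≫ ℓ) φ A :=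
  freeInj_freePull E f ⟨T, ℓ, .cons φ A⟩

lemma freeInjLast_pull {X Y T : O} (f : X ≅ Y) (ℓ : Y ≅ T) (hT : 1 ≤ grade T) :
    freeInjLast E ℓ hT ≫ freePull E f = freeInjLast E (f ≪≫ ℓ) hT :=
  freeInj_freePull E f ⟨T, ℓ, .last T hT⟩

lemma freeInjLast_hom {X T S : O} (ℓ : X ≅ T) (hT : 1 ≤ grade T) (hS : 1 ≤ grade S) (σ : T ≅ S) :
    E.map (QVrt.hom (hT := hT) (hS := hS) σ rfl rfl).op ≫ freeInjLast E ℓ hT =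
      freeInjLast E (ℓ ≪≫ σ) hS :=
  freeInj_hom E (.last hT hS σ)

lemma freeInjCons_hom {X T S T' S' : O} (ℓ : X ≅ T) {φ : Elementary T S} {φ' : Elementary T' S'}
    (q : ElementarySquare φ φ') {A : Tower S} {B : Tower S'} (f : Tower.Hom A B q.bot) :
    (E.map q.fiberClass.op ⊗ₘ f.map E) ≫ freeInjCons E ℓ φ A =
      freeInjCons E (ℓ ≪≫ q.top) φ' B :=
  freeInj_hom E (.cons q.w f)

lemma freeInjCons_swap {X T S : O} (ℓ : X ≅ T) (φ : Elementary T S) {A B : Tower S}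
    (s : Tower.Swap A B) :
    (_ ◁ s.map E) ≫ freeInjCons E ℓ φ A = freeInjCons E ℓ φ B :=
  freeInj_gen E (.second ℓ (.there φ s))

lemma freeInjCons_disjointSquare {X T P' P'' S : O} (ℓ : X ≅ T) {φ' : Elementary T P'}
    {ψ' : Elementary P' S} {φ'' : Elementary T P''} {ψ'' : Elementary P'' S}
    (q : DisjointSquare φ' ψ' φ'' ψ'') (A : Tower S) :
    swapMap (E.map q.cross.hom.op) (E.map q.symm.cross.inv.op) (A.tensor E) ≫
      freeInjCons E ℓ φ' (.cons ψ' A) = freeInjCons E ℓ φ'' (.cons ψ'' A) :=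
  freeInj_gen E (.second ℓ (.here q A))

variable [∀ A : V, PreservesColimitsOfSize.{max u v, max u v} (tensorLeft A)]

lemma free_exists_desc_whiskerLeft {X : O} (hX : 1 ≤ grade X) (Y : V) {Z : V}
    (g : ∀ a : LabelledTower X, Y ⊗ a.tower.tensor E ⟶ Z)
    (hg : ∀ {a b : LabelledTower X} (γ : LabelledTower.Gen a b), (Y ◁ γ.map E) ≫ g a = g b) :
    ∃ d : Y ⊗ freeVal E X ⟶ Z, ∀ a : LabelledTower X, (Y ◁ freeInj E a) ≫ d = g a := by
  obtain ⟨h⟩ := free_nonempty_isColimit E hX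
  have h' := isColimitOfPreserves (tensorLeft Y) h
  let c : Cocone (towerDiagram E X ⋙ tensorLeft Y) := Cocone.mk Z
    { app := fun a => g a.unop.as
      naturality := by
        rintro ⟨⟨b⟩⟩ ⟨⟨a⟩⟩ ⟨⟨p⟩⟩
        refine Eq.trans ?_ (Category.comp_id _).symm
        change (Y ◁ (p.eval (C := Vᵒᵖ) (fun a : LabelledTower X => op (a.tower.tensor E))
          (fun g => (g.map E).op)).unop) ≫ g a = g b
        exact LabelledTower.whiskerLeft_eval_comp_of_gen g hg p }
  exact ⟨h'.desc c, fun a => h'.fac c (op ⟨a⟩)⟩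

lemma free_hom_ext_whiskerLeft {X : O} (hX : 1 ≤ grade X) {Y Z : V} {d d' : Y ⊗ freeVal E X ⟶ Z}
    (h : ∀ a : LabelledTower X, (Y ◁ freeInj E a) ≫ d = (Y ◁ freeInj E a) ≫ d') : d = d' := by
  obtain ⟨hc⟩ := free_nonempty_isColimit E hX
  exact (isColimitOfPreserves (tensorLeft Y) hc).hom_ext fun a => h a.unop.as

/-- Two transports of `φ` along compatible isomorphisms of its target differ by a square, which is a
first type morphism of the extended towers. In the colimit, putting `φ` in front of a tower is
therefore independent of the transport. -/
lemma freeInj_cons_hom {T S T₀ T₁ S₀ S₁ : O} {φ : Elementary T S} {φ₀ : Elementary T₀ S₀}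
    {φ₁ : Elementary T₁ S₁} (q : ElementarySquare φ φ₀) (q' : ElementarySquare φ φ₁)
    (σ : S₀ ≅ S₁) (hσ : q.bot ≪≫ σ = q'.bot) {A : Tower S₀} {B : Tower S₁} (f : Tower.Hom A B σ) :
    (E.map (inv q.fiberClass).op ⊗ₘ f.map E) ≫ freeInjCons E q.top φ₀ A =
      (E.map (inv q'.fiberClass).op ⊗ₘ 𝟙 _) ≫ freeInjCons E q'.top φ₁ B := by
  have w : φ₀.hom ≫ σ.hom = (q.top.symm ≪≫ q'.top).hom ≫ φ₁.hom := by
    rw [Iso.trans_hom, Category.assoc, ← q'.w, ← hσ, Iso.trans_hom, ← Category.assoc φ.hom, q.w]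
    simp
  let r : ElementarySquare φ₀ φ₁ := ⟨q.top.symm ≪≫ q'.top, σ, w⟩
  have hr : q.trans r = q' := ElementarySquare.ext (by simp [r]) hσ
  have hc : r.fiberClass ≫ inv q'.fiberClass = inv q.fiberClass := by
    rw [IsIso.comp_inv_eq, ← cancel_epi q.fiberClass, IsIso.hom_inv_id_assoc,
      ← ElementarySquare.fiberClass_trans, hr]
  have h := freeInjCons_hom E q.top r f
  rw [show q.top ≪≫ r.top = q'.top by simp [r]] at h
  rw [← h, ← hc, op_comp, E.map_comp, ← Category.assoc,
    MonoidalCategory.tensorHom_comp_tensorHom, Category.id_comp]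

/-- If `S` has positive grade, `φ` is transported along the label of a tower under `S` and put in
front of it. If `S` has grade 0, it is local terminal and the value there is the unit, so a
generator at the fiber gives the one-term tower at `T`, whose virtual class is the same. -/
lemma exists_freeAct {T S : O} (φ : Elementary T S) :
    ∃ d : E.obj (op (QVrt.mk φ.fiber φ.fiber_pos)) ⊗ freeVal E S ⟶ freeVal E T,
      (∀ (a : LabelledTower S) {T₀ : O} (φ₀ : Elementary T₀ a.base) (q : ElementarySquare φ φ₀),
        q.bot = a.label → (E.map q.fiberClass.op ⊗ₘ freeInj E a) ≫ d =
          freeInjCons E q.top φ₀ a.tower) ∧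
      ∀ hS : grade S = 0, d = (_ ◁ eqToHom (freeVal_of_grade_eq_zero E hS)) ≫ (ρ_ _).hom ≫
        E.map (eqToHom (congrArg Presented.mk
          (φ.mk_fiber (isLocalTerminal_of_grade_eq_zero hS)))).op ≫
          freeInjLast E (Iso.refl T) φ.one_le_grade := by
  by_cases hS : grade S = 0
  · refine ⟨(_ ◁ eqToHom (freeVal_of_grade_eq_zero E hS)) ≫ (ρ_ _).hom ≫
        E.map (eqToHom (congrArg Presented.mk
          (φ.mk_fiber (isLocalTerminal_of_grade_eq_zero hS)))).op ≫
          freeInjLast E (Iso.refl T) φ.one_le_grade, fun a => ?_, fun _ => rfl⟩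
    have := a.pos
    omega
  · choose T₀ φ₀ q hq using fun a : LabelledTower S => φ.exists_square a.label
    obtain ⟨d, hd⟩ := free_exists_desc_whiskerLeft E (X := S) (by omega)
      (E.obj (op (QVrt.mk φ.fiber φ.fiber_pos)))
      (fun a => (E.map (inv (q a).fiberClass).op ⊗ₘ 𝟙 _) ≫
        freeInjCons E (q a).top (φ₀ a) a.tower) (fun {a b} γ => by
        rw [← Category.assoc, whiskerLeft_comp_tensorHom, Category.comp_id]
        cases γ with
        | first σ w f => exact freeInj_cons_hom E (q a) (q b) σ (by rw [hq, hq, w]) f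
        | @second R ℓ A B s =>
          have h := freeInj_cons_hom E (q ⟨R, ℓ, A⟩) (q ⟨R, ℓ, B⟩) (Iso.refl R)
            (by rw [hq, hq, Iso.trans_refl]) (Tower.Hom.id B)
          rw [← h, Tower.Hom.map_id]
          rw [← freeInjCons_swap E _ _ s, ← Category.assoc, tensorHom_comp_whiskerLeft,
            Category.id_comp]
          rfl)
    refine ⟨d, fun a T₁ φ₁ q₁ hq₁ => ?_, fun h => absurd h hS⟩
    have h := freeInj_cons_hom E (q a) q₁ (Iso.refl _) (by rw [hq, hq₁, Iso.trans_refl])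
      (Tower.Hom.id a.tower)
    rw [MonoidalCategory.tensorHom_def, Category.assoc, hd]
    rw [Tower.Hom.map_id] at h
    refine (congrArg (_ ≫ ·) h).trans ?_
    rw [← Category.assoc, ← tensorHom_id, MonoidalCategory.tensorHom_comp_tensorHom, ← E.map_comp,
      ← op_comp, IsIso.inv_hom_id, op_id, E.map_id, Category.id_comp, id_tensorHom_id,
      Category.id_comp]

/-- The action of the generators. -/
noncomputable def freeAct {T S : O} (φ : Elementary T S) :
    E.obj (op (QVrt.mk φ.fiber φ.fiber_pos)) ⊗ freeVal E S ⟶ freeVal E T :=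
  (exists_freeAct E φ).choose

lemma freeInj_freeAct {T S : O} {φ : Elementary T S} (a : LabelledTower S) {T₀ : O}
    {φ₀ : Elementary T₀ a.base} (q : ElementarySquare φ φ₀) (hq : q.bot = a.label) :
    (E.map q.fiberClass.op ⊗ₘ freeInj E a) ≫ freeAct E φ =
      freeInjCons E q.top φ₀ a.tower :=
  (exists_freeAct E φ).choose_spec.1 a φ₀ q hq

lemma freeAct_of_grade_eq_zero {T S : O} (φ : Elementary T S) (hS : grade S = 0) :
    freeAct E φ = (_ ◁ eqToHom (freeVal_of_grade_eq_zero E hS)) ≫ (ρ_ _).hom ≫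
      E.map (eqToHom (congrArg Presented.mk
        (φ.mk_fiber (isLocalTerminal_of_grade_eq_zero hS)))).op ≫
        freeInjLast E (Iso.refl T) φ.one_le_grade :=
  (exists_freeAct E φ).choose_spec.2 hS

lemma freeAct_hom_ext {T S : O} (φ : Elementary T S) (hS : 1 ≤ grade S) {Z : V}
    {d d' : E.obj (op (QVrt.mk φ.fiber φ.fiber_pos)) ⊗ freeVal E S ⟶ Z}
    (h : ∀ (a : LabelledTower S) (T₀ : O) (φ₀ : Elementary T₀ a.base)
      (q : ElementarySquare φ φ₀), q.bot = a.label →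
      (E.map q.fiberClass.op ⊗ₘ freeInj E a) ≫ d = (E.map q.fiberClass.op ⊗ₘ freeInj E a) ≫ d') :
    d = d' := by
  refine free_hom_ext_whiskerLeft E hS fun a => ?_
  obtain ⟨T₀, φ₀, q, hq⟩ := φ.exists_square a.label
  have h' := h a T₀ φ₀ q hq
  rw [MonoidalCategory.tensorHom_def, Category.assoc, Category.assoc, cancel_epi] at h'
  exact h'

/-- In positive grade, transporting `φ'` along a label and composing with `q` is a transport of `φ`,
so this is composition of squares. In grade 0 it is a first type morphism of one-term towers. -/
lemma freeAct_pull {T S T' S' : O} {φ : Elementary T S} {φ' : Elementary T' S'}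
    (q : ElementarySquare φ φ') :
    freeAct E φ' ≫ freePull E q.top =
      (E.map q.fiberClass.op ⊗ₘ freePull E q.bot) ≫ freeAct E φ := by
  by_cases hS : grade S' = 0
  · have hS' : grade S = 0 := (grade_of_iso q.bot).trans hS
    have ht := isLocalTerminal_of_grade_eq_zero hS
    have ht' := isLocalTerminal_of_grade_eq_zero hS'
    rw [freeAct_of_grade_eq_zero E φ' hS, freeAct_of_grade_eq_zero E φ hS',
      freePull_of_grade_eq_zero E _ hS']
    simp only [Category.assoc]
    rw [freeInjLast_pull, Iso.trans_refl, ← Iso.refl_trans q.top,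
      ← freeInjLast_hom E _ φ.one_le_grade, ← Category.assoc (_ ⊗ₘ _),
      tensorHom_comp_whiskerLeft, eqToHom_trans, MonoidalCategory.tensorHom_def', Category.assoc,
      rightUnitor_naturality_assoc, ← E.map_comp_assoc, ← E.map_comp_assoc, ← op_comp, ← op_comp]
    have h : ∀ (φ : Elementary T S) (φ' : Elementary T' S') (q : ElementarySquare φ φ')
        (e : QVrt.mk T φ.one_le_grade = QVrt.mk φ.fiber φ.fiber_pos)
        (e' : QVrt.mk T' φ'.one_le_grade = QVrt.mk φ'.fiber φ'.fiber_pos),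
        QVrt.hom q.top rfl rfl ≫ eqToHom e' = eqToHom e ≫ q.fiberClass := by
      intro φ φ' q e e'
      obtain ⟨f, hT, rfl⟩ : ∃ f hT, φ = .toLocalTerminal f ht' hT :=
        ⟨_, _, φ.eq_toLocalTerminal ht'⟩
      obtain ⟨f', hT', rfl⟩ : ∃ f hT, φ' = .toLocalTerminal f ht hT :=
        ⟨_, _, φ'.eq_toLocalTerminal ht⟩
      rw [q.fiberClass_toLocalTerminal, QVrt.eqToHom_comp_hom _ _ _ rfl]
      exact QVrt.hom_comp_eqToHom _ _ _ _ _
    rw [h φ φ' q]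
  · refine freeAct_hom_ext E φ' (by omega) fun a T₀ φ₀ q₀ hq₀ => ?_
    rw [← Category.assoc, freeInj_freeAct E a q₀ hq₀, freeInjCons_pull, ← Category.assoc,
      MonoidalCategory.tensorHom_comp_tensorHom, ← E.map_comp, ← op_comp,
      ← ElementarySquare.fiberClass_trans, freeInj_freePull]
    exact (freeInj_freeAct E ⟨a.base, q.bot ≪≫ a.label, a.tower⟩ (q.trans q₀)
      (by rw [ElementarySquare.trans_bot, hq₀])).symm

/-- The whole square is transported along the label, so that both orders become towers related by an
interchange, that is, by a second type morphism. Naturality of the identifications of fibers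
compares the transported square with the original one. -/
lemma freeAct_comm {T P' P'' S : O} {φ' : Elementary T P'} {ψ' : Elementary P' S}
    {φ'' : Elementary T P''} {ψ'' : Elementary P'' S} (q : DisjointSquare φ' ψ' φ'' ψ'') :
    (E.obj (op (QVrt.mk φ''.fiber φ''.fiber_pos)) ◁ freeAct E ψ'') ≫ freeAct E φ'' =
      swapMap (E.map q.cross.hom.op) (E.map q.symm.cross.inv.op) (freeVal E S) ≫
        (E.obj (op (QVrt.mk φ'.fiber φ'.fiber_pos)) ◁ freeAct E ψ') ≫ freeAct E φ' := by
  -- An object of grade 0 is local terminal and has cardinality one, leaving no room for two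
  -- different positions.
  have hS : 1 ≤ grade S := by
    by_contra hS
    have : Subsingleton (Fin (card S)) := by
      rw [(isLocalTerminal_of_grade_eq_zero (T := S) (by omega)).card_eq]; infer_instance
    exact q.disjoint (Subsingleton.elim _ _)
  rw [← cancel_epi (α_ _ _ _).hom]
  refine free_hom_ext_whiskerLeft E hS fun a => ?_
  obtain ⟨T₀, P₀', P₀'', φ₀', ψ₀', φ₀'', ψ₀'', τ, σ', σ'', q₀, w₁, w₂, w₃, w₄⟩ :=
    q.exists_transport a.label
  let s₁ : ElementarySquare φ' φ₀' := ⟨τ, σ', w₁⟩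
  let t₁ : ElementarySquare ψ' ψ₀' := ⟨σ', a.label, w₂⟩
  let s₂ : ElementarySquare φ'' φ₀'' := ⟨τ, σ'', w₃⟩
  let t₂ : ElementarySquare ψ'' ψ₀'' := ⟨σ'', a.label, w₄⟩
  have key : ∀ {P : O} {φ : Elementary T P} {ψ : Elementary P S} {P₀ : O} {φ₀ : Elementary T₀ P₀}
      {ψ₀ : Elementary P₀ a.base} (s : ElementarySquare φ φ₀) (t : ElementarySquare ψ ψ₀),
      t.bot = a.label → s.bot = t.top →
      (E.map s.fiberClass.op ⊗ₘ (E.map t.fiberClass.op ⊗ₘ freeInj E a)) ≫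
        (_ ◁ freeAct E ψ) ≫ freeAct E φ = freeInjCons E s.top φ₀ (.cons ψ₀ a.tower) := by
    intro P φ ψ P₀ φ₀ ψ₀ s t ht hs
    rw [← Category.assoc, tensorHom_comp_whiskerLeft, freeInj_freeAct E a t ht]
    exact freeInj_freeAct E ⟨P₀, t.top, .cons ψ₀ a.tower⟩ s hs
  have h₁ : q.cross.hom ≫ t₂.fiberClass = s₁.fiberClass ≫ q₀.cross.hom :=
    DisjointSquare.cross_natural q q₀ s₁ t₁ s₂ t₂ rfl rfl rfl
  have h₂ : q.symm.cross.hom ≫ t₁.fiberClass = s₂.fiberClass ≫ q₀.symm.cross.hom :=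
    DisjointSquare.cross_natural q.symm q₀.symm s₂ t₂ s₁ t₁ rfl rfl rfl
  have h₃ : q.symm.cross.inv ≫ s₂.fiberClass = t₁.fiberClass ≫ q₀.symm.cross.inv := by
    rw [Iso.inv_comp_eq, ← Category.assoc, h₂, Category.assoc, Iso.hom_inv_id, Category.comp_id]
  have h₄ := swapMap_natural (E.map q₀.cross.hom.op) (E.map q₀.symm.cross.inv.op)
    (E.map q.cross.hom.op) (E.map q.symm.cross.inv.op) (E.map s₂.fiberClass.op)
    (E.map t₂.fiberClass.op) (E.map s₁.fiberClass.op) (E.map t₁.fiberClass.op) (freeInj E a)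
    (by rw [← E.map_comp, ← E.map_comp, ← op_comp, ← op_comp, h₁])
    (by rw [← E.map_comp, ← E.map_comp, ← op_comp, ← op_comp, h₃])
  have h₅ := key s₂ t₂ rfl rfl
  have h₆ := key s₁ t₁ rfl rfl
  rw [associator_naturality_right_assoc, associator_naturality_right_assoc, cancel_epi,
    ← cancel_epi (E.map s₂.fiberClass.op ⊗ₘ (E.map t₂.fiberClass.op ▷ a.tower.tensor E)),
    ← Category.assoc, tensorHom_comp_whiskerLeft, ← MonoidalCategory.tensorHom_def, h₅,
    ← Category.assoc, tensorHom_comp_whiskerLeft, ← MonoidalCategory.tensorHom_def,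
    reassoc_of% h₄, h₆]
  exact (freeInjCons_disjointSquare E τ q₀ a.tower).symm

/-- The free module on a collection. -/
noncomputable def freeModule : TowerModule E where
  presheaf := freePresheaf E
  act φ := freeAct E φ
  act_pull q := freeAct_pull E q
  act_comm q := freeAct_comm E q
  unit ht := eqToHom (freeVal_of_grade_eq_zero E (grade_of_isLocalTerminal ht)).symm
  unit_pull hs _ f :=
    (congrArg (_ ≫ ·) (freePull_of_grade_eq_zero E f (grade_of_isLocalTerminal hs))).trans
      (eqToHom_trans _ _)

lemma freeAct_unit {T t : O} (φ : Elementary T t) (ht : grade t = 0) :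
    (ρ_ _).inv ≫ (_ ◁ eqToHom (freeVal_of_grade_eq_zero E ht).symm) ≫ freeAct E φ =
      E.map (eqToHom (congrArg Presented.mk
        (φ.mk_fiber (isLocalTerminal_of_grade_eq_zero ht)))).op ≫
        freeInjLast E (Iso.refl T) φ.one_le_grade := by
  rw [freeAct_of_grade_eq_zero E φ ht, ← whiskerLeft_comp_assoc, eqToHom_trans, eqToHom_refl,
    whiskerLeft_id, Category.id_comp, Iso.inv_hom_id_assoc]

lemma freeModule_gen {T : O} (hT : 1 ≤ grade T) :
    (freeModule E).gen hT = freeInjLast E (Iso.refl T) hT := by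
  have ht := isTrivial_terminalOf T
  refine (congrArg (_ ≫ ·) (freeAct_unit E (.toLocalTerminal (toTerminal T) ht.isLocalTerminal hT)
    (grade_of_isTrivial ht))).trans ?_
  rw [← E.map_comp_assoc, ← op_comp, QVrt.eqToHom_comp_hom _ _ _ rfl rfl, QVrt.hom_refl, op_id,
    E.map_id, Category.id_comp]

/-- Acting puts a morphism in front of a tower, so acting along all of `A` rebuilds `A`.
Consequently the cocone of the free module is the colimit cocone. -/
lemma freeModule_ev : ∀ {T : O} (A : Tower T),
    A.ev (freeModule E) = freeInj E ⟨T, Iso.refl T, A⟩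
  | _, .last T hT => freeModule_gen E hT
  | _, .cons (T := T) φ r => by
      have h := freeInj_freeAct E ⟨_, Iso.refl _, r⟩ (ElementarySquare.refl φ) rfl
      rw [ElementarySquare.fiberClass_refl, op_id, E.map_id, id_tensorHom, ← freeModule_ev r] at h
      exact h

lemma freeModule_leg {X : O} (a : LabelledTower X) : a.leg (freeModule E) = freeInj E a := by
  unfold LabelledTower.leg
  rw [freeModule_ev]
  exact (freeInj_freePull E a.label ⟨a.base, Iso.refl _, a.tower⟩).trans
    (freeInj_congr E (Iso.trans_refl _) _)

lemma freeModule_isFree : (freeModule E).IsFree where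
  isColimit X hX := by
    obtain ⟨h⟩ := free_nonempty_isColimit E hX
    exact ⟨h.ofIsoColimit (Cocone.ext (Iso.refl _) fun a =>
      (Category.comp_id _).trans (freeModule_leg E a.unop.as).symm)⟩
  isIso_unit ht := inferInstanceAs (IsIso (eqToHom (freeVal_of_grade_eq_zero E
    (grade_of_isLocalTerminal ht)).symm))

end FreeModule

/-! ### Virtual isomorphism as an equivalence relation -/

section VirtualIsomorphisms

variable {O : Type u} [Category.{v} O] [GradedOperadicCategory O] [StandingAssumptions O]

lemma Elementary.fiber_congr {X Y t s : O} (Φ : Elementary X t) (Ψ : Elementary Y s)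
    (ht : IsLocalTerminal t) (e : X = Y) (e' : t = s) : Φ.fiber = Ψ.fiber := by
  subst e e'
  rw [Elementary.ext_hom (φ := Φ) (ψ := Ψ) (ht.hom_ext _ _)]

/-- The right isomorphism is the map of fibers induced by an identity. It is stated through
`eqToHom` because the diagonal equals `φ'` only propositionally. -/
lemma ElementarySquare.right_eq_of_top_eq_refl {T S S' : O} {φ : Elementary T S}
    {φ' : Elementary T S'} (q : ElementarySquare φ φ') (h : q.top = Iso.refl T) :
    ∃ e, q.right.hom = eqToHom e := by
  obtain ⟨σ, b, w⟩ := q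
  obtain rfl : σ = Iso.refl T := h
  have aux : ∀ (h : T ⟶ S') (w : 𝟙 T ≫ φ'.hom = h),
      ∃ e, fiberMap (𝟙 T) φ'.hom h w φ'.idx = eqToHom e := by
    intro h w
    obtain rfl : h = φ'.hom := by rw [← w, Category.id_comp]
    exact ⟨rfl, OperadicCategory.fiberMap_id _ _ _⟩
  exact aux _ w.symm

/-- The square with identical top between two maps to local terminal objects. -/
lemma Elementary.exists_square_refl {T t s : O} (φ : Elementary T t) (ψ : Elementary T s)
    (ht : IsLocalTerminal t) (hs : IsLocalTerminal s) :
    ∃ q : ElementarySquare φ ψ, q.top = Iso.refl T := by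
  obtain ⟨b⟩ := ht.exists_iso hs φ.hom ψ.hom
  exact ⟨⟨Iso.refl T, b, hs.hom_ext _ _⟩, rfl⟩

lemma Virtual.exists_elementary {F T : O} (hT : 1 ≤ grade T) (h : Virtual F T) :
    ∃ (t : O) (_ : IsLocalTerminal t) (φ : Elementary T t), φ.fiber = F := by
  obtain ⟨t, ht, f, i, rfl⟩ := h
  exact ⟨t, ht, .toLocalTerminal f ht hT, (fiber_eq_toLocalTerminal ht f i hT).symm⟩

lemma Elementary.virtual {T t : O} (φ : Elementary T t) (ht : IsLocalTerminal t) :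
    Virtual φ.fiber T := ⟨t, ht, φ.hom, φ.idx, rfl⟩

/-- The map to the chosen local terminal object. -/
noncomputable def Elementary.terminal {T : O} (hT : 1 ≤ grade T) : Elementary T (terminalOf T) :=
  .toLocalTerminal (toTerminal T) (isTrivial_terminalOf T).isLocalTerminal hT

lemma Elementary.terminal_fiber {T : O} (hT : 1 ≤ grade T) : (terminal hT).fiber = T :=
  (terminal hT).fiber_eq_of_isTrivial (isTrivial_terminalOf T)

lemma Virtual.refl {T : O} (hT : 1 ≤ grade T) : Virtual T T := by
  have h := (Elementary.terminal hT).virtual (isTrivial_terminalOf T).isLocalTerminal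
  rwa [Elementary.terminal_fiber] at h

/-- Comparing the map `φ` to a local terminal object with the map to the chosen one gives a square
whose left edge is a map from the fiber of `φ` to a local terminal object. Its fiber is the fiber
over the chosen object, which is `T`. -/
lemma Virtual.symm {F T : O} (hT : 1 ≤ grade T) (h : Virtual F T) : Virtual T F := by
  obtain ⟨t, ht, φ, rfl⟩ := h.exists_elementary hT
  obtain ⟨q, hq⟩ := (Elementary.terminal hT).exists_square_refl φ
    (isTrivial_terminalOf T).isLocalTerminal ht
  obtain ⟨e, -⟩ := q.right_eq_of_top_eq_refl hq
  have h := q.left.virtual (isLocalTerminal_fiber_iso q.bot φ.idx)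
  rwa [q.left_fiber, Elementary.terminal_fiber, e] at h

/-- The maps to local terminal objects compose along their fibers. -/
lemma Elementary.exists_comp_fiber {X t s : O} (φ : Elementary X t) (ht : IsLocalTerminal t)
    (ψ : Elementary φ.fiber s) (hs : IsLocalTerminal s) :
    ∃ (r : O) (_ : IsLocalTerminal r) (ξ : Elementary X r) (q : ElementarySquare ξ φ),
      q.top = Iso.refl X ∧ OperadicData.fiber q.bot.hom φ.idx = s := by
  -- Replacing the fiber of `φ` by `s` yields an object `r` over `t`. Its grade is that of `s`,
  -- namely 0, so it is local terminal.
  obtain ⟨r, p, f, w, e, -, -, -⟩ := exists_lift_at φ.hom φ.idx (G := s) ψ.hom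
  have hr : grade r = 0 := by
    rw [← grade_fiber_localTerminal f ht φ.idx, ← e, grade_of_isLocalTerminal hs]
  have hr' := isLocalTerminal_of_grade_eq_zero hr
  have := StandingAssumptions.isIso_of_grade f (by rw [hr, grade_of_isLocalTerminal ht])
  exact ⟨r, hr', .toLocalTerminal p hr' φ.one_le_grade, ⟨Iso.refl X, asIso f, by
    simpa [Elementary.toLocalTerminal] using w⟩, rfl, e.symm⟩

lemma Virtual.trans {R F T : O} (hF : 1 ≤ grade F) (hT : 1 ≤ grade T) (h : Virtual R F)
    (h' : Virtual F T) : Virtual R T := by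
  obtain ⟨t, ht, φ, rfl⟩ := h'.exists_elementary hT
  obtain ⟨s, hs, ψ, rfl⟩ := h.exists_elementary hF
  obtain ⟨r, hr, ξ, q, hq, e⟩ := φ.exists_comp_fiber ht ψ hs
  obtain ⟨e', -⟩ := q.right_eq_of_top_eq_refl hq
  have h := ξ.virtual hr
  rwa [← q.left_fiber, q.left.fiber_congr ψ (isLocalTerminal_fiber_iso q.bot φ.idx) e' e] at h

/-- Virtual morphisms already form an equivalence relation, so equality of classes is witnessed by a
single map to a local terminal object. -/
lemma virtual_of_mk_eq {F T : O} (hF : 1 ≤ grade F) (hT : 1 ≤ grade T)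
    (h : VirtualClass.mk F hF = VirtualClass.mk T hT) : Virtual F T := by
  have he : Equivalence fun F T : {T : O // 1 ≤ grade T} => Virtual F.1 T.1 :=
    ⟨fun T => Virtual.refl T.2, fun {F T} h => Virtual.symm T.2 h,
      fun {R F T} h h' => Virtual.trans F.2 T.2 h h'⟩
  exact he.eqvGen_iff.mp (Quot.eqvGen_exact h)

/-- The map to a local terminal object with a given fiber is unique. -/
lemma Elementary.target_eq_of_fiber_eq {T t s : O} (φ : Elementary T t) (ψ : Elementary T s)
    (ht : IsLocalTerminal t) (hs : IsLocalTerminal s) (h : φ.fiber = ψ.fiber) : t = s := by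
  obtain ⟨q, hq⟩ := φ.exists_square_refl ψ ht hs
  obtain ⟨e, -⟩ := q.right_eq_of_top_eq_refl hq
  -- The map `q.left` to this local terminal object has a fiber equal to its own source, since both
  -- fibers agree. The unique fiber axiom applies, and the bottom isomorphism becomes an order
  -- preserving quasibijection, hence an identity.
  have ht' : IsTrivial (OperadicData.fiber q.bot.hom ψ.idx) :=
    StandingAssumptions.unique_fiber q.left.hom q.left.idx (isLocalTerminal_fiber_iso q.bot ψ.idx)
      ((q.left_fiber.trans h).trans e.symm)
  have hc := hs.card_eq
  have : Subsingleton (Fin (card s)) := by rw [hc]; infer_instance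
  exact (eq_of_quasibijection q.bot.hom (isOrderPreserving_of_card_target _ hc) fun i => by
    rwa [Subsingleton.elim i ψ.idx]).choose

/-- A representative of the virtual isomorphism class of an object. -/
noncomputable def VirtualClass.rep (A : VirtualClass O) : O := (Quot.out A).1

lemma VirtualClass.rep_pos (A : VirtualClass O) : 1 ≤ grade A.rep := (Quot.out A).2

lemma VirtualClass.mk_rep (A : VirtualClass O) : VirtualClass.mk A.rep A.rep_pos = A :=
  Quot.out_eq A

lemma VirtualClass.exists_elementary_rep {T : O} (hT : 1 ≤ grade T) :
    ∃ (t : O) (_ : IsLocalTerminal t) (φ : Elementary T t),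
      φ.fiber = (VirtualClass.mk T hT).rep :=
  (virtual_of_mk_eq (VirtualClass.rep_pos _) hT (VirtualClass.mk_rep _)).exists_elementary hT

end VirtualIsomorphisms

/-! ### Invertibility of unit multiplications and comparison with representatives -/

section Strictification

variable {O : Type u} [Category.{v} O] [GradedOperadicCategory O] [StandingAssumptions O]
  {V : Type u'} [Category.{v'} V] [MonoidalCategory V] [SymmetricCategory V]
  {E : Collection O V} [∀ A : V, PreservesColimitsOfSize.{max u v, max u v} (tensorLeft A)]

instance TowerModule.isIso_pull (P : TowerModule E) {X Y : O} (f : X ≅ Y) : IsIso (P.pull f) :=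
  ⟨P.pull f.symm, by rw [← P.pull_trans, Iso.symm_self_id, P.pull_refl],
    by rw [← P.pull_trans, Iso.self_symm_id, P.pull_refl]⟩

namespace TowerModule.IsFree

variable {P : TowerModule E} (hP : P.IsFree)
include hP

/-- This is equivariance of the circle product evaluated at the units. -/
lemma transfer_theta {T t T' t' : O} {φ : Elementary T t} {φ' : Elementary T' t'}
    (q : ElementarySquare φ φ') (ht : IsLocalTerminal t) (ht' : IsLocalTerminal t') :
    hP.transfer q ≫ hP.theta φ' ht' ≫ P.pull q.top = hP.theta φ ht := by
  have h := hP.circ_equivariant q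
  unfold theta
  simp only [Category.assoc]
  rw [rightUnitor_inv_naturality_assoc, ← whisker_exchange_assoc, h, ← whiskerLeft_comp_assoc,
    P.unit_pull ht ht']

lemma transfer_eq {T t s S : O} {φ : Elementary T S} {ξ : Elementary T t}
    (q : ElementarySquare ξ φ) (hq : q.top = Iso.refl T)
    (ψ : Elementary φ.fiber s) (hs : IsLocalTerminal s)
    (e : OperadicData.fiber q.bot.hom φ.idx = s) (e' : ξ.fiber = ψ.fiber) :
    hP.transfer q = P.pull (eqToIso e'.symm) ≫ hP.theta ψ hs := by
  obtain ⟨e₁, h₁⟩ := q.right_eq_of_top_eq_refl hq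
  have h := hP.theta_congr ψ q.left hs (isLocalTerminal_fiber_iso q.bot φ.idx) e₁ e.symm e'.symm
    q.left_fiber
  have h₂ : q.right = eqToIso e₁ := Iso.ext h₁
  have h₃ : P.pull (eqToIso e₁) ≫ P.pull q.right.symm = 𝟙 _ := by
    rw [h₂, ← P.pull_trans, Iso.symm_self_id, P.pull_refl]
  unfold transfer
  rw [← reassoc_of% h]
  exact (congrArg (fun x => _ ≫ _ ≫ x) h₃).trans (congrArg (_ ≫ ·) (Category.comp_id _))

/-- Multiplications by units compose. -/
lemma exists_theta_comp {X t s : O} (φ : Elementary X t) (ht : IsLocalTerminal t)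
    (ψ : Elementary φ.fiber s) (hs : IsLocalTerminal s) :
    ∃ (r : O) (hr : IsLocalTerminal r) (ξ : Elementary X r) (e : ψ.fiber = ξ.fiber),
      P.pull (eqToIso e) ≫ hP.theta ψ hs ≫ hP.theta φ ht = hP.theta ξ hr := by
  obtain ⟨r, hr, ξ, q, hq, e⟩ := φ.exists_comp_fiber ht ψ hs
  obtain ⟨e₁, -⟩ := q.right_eq_of_top_eq_refl hq
  have e' : ξ.fiber = ψ.fiber := by
    rw [← q.left_fiber, q.left.fiber_congr ψ (isLocalTerminal_fiber_iso q.bot φ.idx) e₁ e]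
  have h := hP.transfer_theta q hr ht
  rw [hP.transfer_eq q hq ψ hs e e', hq, P.pull_refl, Category.comp_id, Category.assoc] at h
  exact ⟨r, hr, ξ, e'.symm, h⟩

/-- Virtual isomorphism is symmetric, so some `ψ` leads from the fiber back to `T`. The composite
multiplication belongs to a map out of `T` with fiber `T`, whose target is trivial by the unique
fiber axiom, and there `theta` is known to be invertible. -/
lemma exists_theta_section {T t : O} (φ : Elementary T t) (ht : IsLocalTerminal t) :
    ∃ (s : O) (hs : IsLocalTerminal s) (ψ : Elementary φ.fiber s),
      IsIso (hP.theta ψ hs ≫ hP.theta φ ht) := by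
  obtain ⟨s, hs, ψ, hψ⟩ := (Virtual.symm φ.one_le_grade (φ.virtual ht)).exists_elementary
    φ.fiber_pos
  obtain ⟨r, hr, ξ, e, h⟩ := hP.exists_theta_comp φ ht ψ hs
  refine ⟨s, hs, ψ, ?_⟩
  have hr' : IsTrivial r := StandingAssumptions.unique_fiber ξ.hom ξ.idx hr (e.symm.trans hψ)
  have : IsIso (P.pull (eqToIso e) ≫ hP.theta ψ hs ≫ hP.theta φ ht) := by
    rw [h, hP.theta_of_isTrivial ξ hr']
    infer_instance
  exact IsIso.of_isIso_comp_left (P.pull (eqToIso e)) _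

/-- By `exists_theta_section` applied to `φ` and then to `ψ`, the map `theta` of `ψ` is both a split
monomorphism and a split epimorphism. It is thus invertible, and so is that of `φ`. -/
lemma isIso_theta {T t : O} (φ : Elementary T t) (ht : IsLocalTerminal t) :
    IsIso (hP.theta φ ht) := by
  obtain ⟨s, hs, ψ, h⟩ := hP.exists_theta_section φ ht
  obtain ⟨r, hr, χ, h'⟩ := hP.exists_theta_section ψ hs
  have : IsIso (hP.theta ψ hs) := by
    have h₁ : hP.theta ψ hs ≫ hP.theta φ ht ≫ inv (hP.theta ψ hs ≫ hP.theta φ ht) = 𝟙 _ := by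
      rw [← Category.assoc, IsIso.hom_inv_id]
    have h₂ : (inv (hP.theta χ hr ≫ hP.theta ψ hs) ≫ hP.theta χ hr) ≫ hP.theta ψ hs = 𝟙 _ := by
      rw [Category.assoc, IsIso.inv_hom_id]
    have h₃ := (Category.comp_id _).symm.trans ((congrArg (_ ≫ ·) h₁.symm).trans
      ((Category.assoc _ _ _).symm.trans ((congrArg (· ≫ _) h₂).trans (Category.id_comp _))))
    exact ⟨_, h₁, by rw [← h₃]; exact h₂⟩
  exact IsIso.of_isIso_comp_left (hP.theta ψ hs) _

/-- The value at an object of positive grade is isomorphic to that at the representative of its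
virtual isomorphism class. -/
lemma exists_repIso {X : O} (hX : 1 ≤ grade X) :
    ∃ c : P.val (VirtualClass.mk X hX).rep ≅ P.val X,
      ∀ (t : O) (ht : IsLocalTerminal t) (φ : Elementary X t)
        (e : φ.fiber = (VirtualClass.mk X hX).rep),
        c.hom = P.pull (eqToIso e) ≫ hP.theta φ ht := by
  obtain ⟨t, ht, φ, e⟩ := VirtualClass.exists_elementary_rep hX
  have := hP.isIso_theta φ ht
  -- A map from `X` to a local terminal object is determined by its fiber, so every choice with the
  -- representative as fiber gives the same isomorphism.
  refine ⟨asIso (P.pull (eqToIso e) ≫ hP.theta φ ht), fun s hs ψ e' => ?_⟩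
  rw [asIso_hom, ← hP.theta_congr φ ψ ht hs rfl
    (φ.target_eq_of_fiber_eq ψ ht hs (e.trans e'.symm)) e e', eqToIso_refl, P.pull_refl,
    Category.comp_id]

/-- The comparison with the value at the representative. -/
noncomputable def repIso {X : O} (hX : 1 ≤ grade X) :
    P.val (VirtualClass.mk X hX).rep ≅ P.val X := (hP.exists_repIso hX).choose

lemma repIso_hom {X t : O} (hX : 1 ≤ grade X) (ht : IsLocalTerminal t) (φ : Elementary X t)
    (e : φ.fiber = (VirtualClass.mk X hX).rep) :
    (hP.repIso hX).hom = P.pull (eqToIso e) ≫ hP.theta φ ht :=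
  (hP.exists_repIso hX).choose_spec t ht φ e

/-- The multiplications compose, and `X` and the fiber have the same representative. Relative to the
comparison isomorphisms `theta` is therefore an identity, which is what makes the strictification
strict. -/
lemma repIso_theta {X t : O} (φ : Elementary X t) (ht : IsLocalTerminal t)
    (e : P.val (VirtualClass.mk X φ.one_le_grade).rep =
      P.val (VirtualClass.mk φ.fiber φ.fiber_pos).rep) :
    (hP.repIso φ.fiber_pos).hom ≫ hP.theta φ ht =
      eqToHom e.symm ≫ (hP.repIso φ.one_le_grade).hom := by
  obtain ⟨s, hs, ψ, e₁⟩ := VirtualClass.exists_elementary_rep φ.fiber_pos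
  obtain ⟨r, hr, ξ, e₂, h⟩ := hP.exists_theta_comp φ ht ψ hs
  have e₃ : ξ.fiber = (VirtualClass.mk X φ.one_le_grade).rep := by
    rw [φ.mk_fiber ht, ← e₂, e₁]
  have k : eqToHom e.symm ≫ P.pull (eqToIso e₃) ≫ P.pull (eqToIso e₂) = P.pull (eqToIso e₁) := by
    simp only [TowerModule.pull, IsoPresheaf.pull_eqToIso, eqToHom_trans]
  rw [hP.repIso_hom _ hs ψ e₁, hP.repIso_hom _ hr ξ e₃, ← h, ← k]
  simp only [Category.assoc]

end TowerModule.IsFree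

end Strictification

/-! ### Coherence between the two orders of the factors -/

section Coherence

variable {V : Type u'} [Category.{v'} V] [MonoidalCategory V] [SymmetricCategory V]

/-- A form of the Yang–Baxter equation. It reconciles the convention with the fiber as left factor,
natural for towers, with that of the operad axioms, where the fiber is on the right. -/
lemma braiding_assoc (A B C : V) :
    ((β_ A B).hom ▷ C) ≫ (β_ (B ⊗ A) C).hom ≫ (α_ C B A).inv =
      (α_ A B C).hom ≫ (A ◁ (β_ B C).hom) ≫ (β_ A (C ⊗ B)).hom := by
  have h := BraidedCategory.yang_baxter A B C
  rw [BraidedCategory.braiding_tensor_left_hom, BraidedCategory.braiding_tensor_right_hom]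
  simp only [Category.assoc, Iso.hom_inv_id, Category.comp_id] at h ⊢
  rw [← cancel_epi (α_ A B C).inv, ← cancel_mono (α_ C B A).hom]
  simp only [Category.assoc, Iso.inv_hom_id, Category.comp_id, Iso.inv_hom_id_assoc]
  exact h

/-- The symmetry reversing three factors. -/
def reverse (A B C : V) : A ⊗ (B ⊗ C) ⟶ C ⊗ (B ⊗ A) :=
  (α_ A B C).inv ≫ ((β_ A B).hom ▷ C) ≫ (β_ (B ⊗ A) C).hom

lemma reverse_natural (A : V) {B C B' C' : V} (b : B ⟶ B') (c : C ⟶ C') :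
    (A ◁ (b ⊗ₘ c)) ≫ reverse A B' C' = reverse A B C ≫ (c ⊗ₘ (b ▷ A)) := by
  simp only [reverse, Category.assoc]
  have h : (A ◁ (b ⊗ₘ c)) ≫ (α_ A B' C').inv = (α_ A B C).inv ≫ ((A ◁ b) ⊗ₘ c) := by
    rw [← id_tensorHom, associator_inv_naturality, id_tensorHom]
  rw [reassoc_of% h, tensorHom_comp_whiskerRight_assoc, BraidedCategory.braiding_naturality_right,
    ← BraidedCategory.braiding_naturality, ← whiskerRight_comp_tensorHom_assoc]

lemma reverse_swapMap {A B C D G : V} (x : B ⟶ D) (y : C ⟶ G) :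
    reverse A B C ≫ swapMap x y A =
      (A ◁ ((β_ B C).hom ≫ (y ⊗ₘ x))) ≫ reverse A G D := by
  have h : reverse A B C ≫ swapMap (𝟙 B) (𝟙 C) A = (A ◁ (β_ B C).hom) ≫ reverse A C B := by
    have hr : ∀ X Y Z : V, reverse X Y Z =
        (X ◁ (β_ Y Z).hom) ≫ (β_ X (Z ⊗ Y)).hom ≫ (α_ Z Y X).hom := fun X Y Z => by
      rw [reverse, ← cancel_mono (α_ Z Y X).inv]
      simp only [Category.assoc, Iso.hom_inv_id, Category.comp_id]
      rw [braiding_assoc, Iso.inv_hom_id_assoc]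
    rw [hr, hr, swapMap, id_tensorHom_id, Category.comp_id, Category.assoc, Category.assoc,
      Iso.hom_inv_id_assoc, ← BraidedCategory.braiding_naturality_right_assoc]
  rw [swapMap_eq, whiskerLeft_comp, Category.assoc, reverse_natural, reassoc_of% h]

lemma reverse_whiskerLeft {A B C D : V} (c : B ⊗ A ⟶ D) :
    (α_ A B C).inv ≫ (((β_ A B).hom ≫ c) ▷ C) ≫ (β_ D C).hom = reverse A B C ≫ (C ◁ c) := by
  rw [comp_whiskerRight, Category.assoc, BraidedCategory.braiding_naturality_left, reverse]
  simp only [Category.assoc]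

lemma reverse_whiskerLeft_assoc {A B C D Z : V} (c : B ⊗ A ⟶ D) (z : C ⊗ D ⟶ Z) :
    (α_ A B C).inv ≫ (((β_ A B).hom ≫ c) ▷ C) ≫ (β_ D C).hom ≫ z =
      reverse A B C ≫ (C ◁ c) ≫ z := by
  simpa only [Category.assoc] using congrArg (· ≫ z) (reverse_whiskerLeft c)

end Coherence

lemma IsoPresheaf.cast_eq_pull {O : Type u} [Category.{v} O] {V : Type u'} [Category.{v'} V]
    (P : IsoPresheaf O V) {T S : O} (h : T = S) : P.cast h = P.pull (eqToIso h.symm) := by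
  rw [P.pull_eqToIso]; rfl

/-! ## The operad of a free module -/

section Operads

variable {O : Type u} [Category.{v} O] [GradedOperadicCategory O] [StandingAssumptions O]
  {V : Type u'} [Category.{v'} V] [MonoidalCategory V] [SymmetricCategory V]
  {E : Collection O V} [∀ A : V, PreservesColimitsOfSize.{max u v, max u v} (tensorLeft A)]

namespace TowerModule.IsFree

variable {P : TowerModule E} (hP : P.IsFree)

/-- The Markl operad of a free module. -/
noncomputable def operad : MarklOperad O V where
  presheaf := P.presheaf
  circ φ := (β_ _ _).hom ≫ hP.circ φ
  assoc {T S R} φ ψ h := by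
    have k := hP.circ_assoc φ ψ h
    rw [comp_whiskerRight, Category.assoc, BraidedCategory.braiding_naturality_left_assoc, k,
      ← Category.assoc (_ ▷ _), ← Category.assoc]
    have k' := braiding_assoc (P.val R) (P.val ψ.fiber) (P.val φ.fiber)
    simp only [Category.assoc] at k' ⊢
    rw [reassoc_of% k', ← BraidedCategory.braiding_naturality_right_assoc, ← whiskerLeft_comp_assoc,
      P.presheaf.cast_eq_pull]
    refine congrArg (fun x => _ ≫ (P.val R ◁ x) ≫ _) ?_
    rw [BraidedCategory.braiding_naturality_right_assoc]
  comm φ' ψ' φ'' ψ'' q := by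
    rw [reverse_whiskerLeft_assoc, reverse_whiskerLeft_assoc, hP.circ_comm q, ← Category.assoc,
      reverse_swapMap, Category.assoc]
  equivariant φ' φ'' q hq := by
    rw [Category.assoc, hP.circ_equivariant_of_isQuasibijection q hq,
      BraidedCategory.braiding_naturality_assoc]

end TowerModule.IsFree

end Operads

/-! ## Transport and strictification -/

section Transport

variable {O : Type u} [Category.{v} O] [GradedOperadicCategory O] [StandingAssumptions O]
  {V : Type u'} [Category.{v'} V] [MonoidalCategory V] [SymmetricCategory V]

namespace MarklOperad

variable (N : MarklOperad O V)

/-- A presheaf with given values isomorphic to those of a presheaf. -/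
def _root_.OpCat.IsoPresheaf.transport (N : IsoPresheaf O V) {W : O → V}
    (c : ∀ X, W X ≅ N.val X) : IsoPresheaf O V where
  obj X := W X.unop.of
  map {X Y} f := (c X.unop.of).hom ≫ N.map f ≫ (c Y.unop.of).inv
  map_id X := by
    rw [N.map_id]
    exact ((c X.unop.of).hom ≫= Category.id_comp (c X.unop.of).inv).trans
      (c X.unop.of).hom_inv_id
  map_comp {X Y Z} f g := by
    rw [N.map_comp]
    have h : ∀ {A B C A' B' C' : V} (a : A ≅ A') (b : B ≅ B') (c : C ≅ C') (f : A' ⟶ B')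
        (g : B' ⟶ C'), a.hom ≫ (f ≫ g) ≫ c.inv = (a.hom ≫ f ≫ b.inv) ≫ b.hom ≫ g ≫ c.inv := by
      intros; simp
    exact h _ _ _ _ _

lemma _root_.OpCat.IsoPresheaf.transport_pull_hom (N : IsoPresheaf O V) {W : O → V}
    (c : ∀ X, W X ≅ N.val X) {T S : O} (f : T ≅ S) :
    (N.transport c).pull f ≫ (c T).hom = (c S).hom ≫ N.pull f :=
  (Category.assoc _ _ _).trans ((c S).hom ≫= ((Category.assoc _ _ _).trans
    ((_ ≫= (c T).inv_hom_id).trans (Category.comp_id _))))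

variable {Q : IsoPresheaf O V} (c : ∀ X, Q.val X ≅ N.val X)

/-- The circle product of a transported operad. -/
def transportCirc {T S : O} (φ : Elementary T S) : Q.val S ⊗ Q.val φ.fiber ⟶ Q.val T :=
  ((c S).hom ⊗ₘ (c φ.fiber).hom) ≫ N.circ φ ≫ (c T).inv

lemma transportCirc_hom {T S : O} (φ : Elementary T S) :
    N.transportCirc c φ ≫ (c T).hom = ((c S).hom ⊗ₘ (c φ.fiber).hom) ≫ N.circ φ := by
  simp [transportCirc]

lemma transportCirc_hom_assoc {T S : O} (φ : Elementary T S) {Z : V} (z : N.val T ⟶ Z) :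
    N.transportCirc c φ ≫ (c T).hom ≫ z =
      ((c S).hom ⊗ₘ (c φ.fiber).hom) ≫ N.circ φ ≫ z := by
  rw [← Category.assoc, transportCirc_hom, Category.assoc]

/-- An operad with given values isomorphic to those of an operad. -/
def transport (hc : ∀ {T S : O} (f : T ≅ S), Q.pull f ≫ (c T).hom = (c S).hom ≫ N.pull f) :
    MarklOperad O V where
  presheaf := Q
  circ φ := N.transportCirc c φ
  assoc {T S R} φ ψ h := by
    have hc' : Q.cast (φ.induced_fiber ψ h) ≫ (c _).hom =
        (c _).hom ≫ N.presheaf.cast (φ.induced_fiber ψ h) := by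
      rw [IsoPresheaf.cast_eq_pull, hc, IsoPresheaf.cast_eq_pull]
    rw [← cancel_mono (c T).hom]
    simp only [Category.assoc]
    rw [transportCirc_hom, transportCirc_hom]
    have h₁ : (N.transportCirc c ψ ▷ Q.val φ.fiber) ≫ ((c S).hom ⊗ₘ (c φ.fiber).hom) =
        (((c R).hom ⊗ₘ (c ψ.fiber).hom) ⊗ₘ (c φ.fiber).hom) ≫ (N.circ ψ ▷ _) := by
      rw [whiskerRight_comp_tensorHom, transportCirc_hom, tensorHom_comp_whiskerRight]
    have h₂ : (Q.val R ◁ ((Q.val ψ.fiber ◁ Q.cast (φ.induced_fiber ψ h)) ≫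
          N.transportCirc c (φ.induced ψ h))) ≫ ((c R).hom ⊗ₘ (c (φ.comp ψ h).fiber).hom) =
        ((c R).hom ⊗ₘ ((c ψ.fiber).hom ⊗ₘ (c φ.fiber).hom)) ≫
          (N.val R ◁ ((N.val ψ.fiber ◁ N.presheaf.cast (φ.induced_fiber ψ h)) ≫
            N.circ (φ.induced ψ h))) := by
      rw [whiskerLeft_comp_tensorHom, tensorHom_comp_whiskerLeft]
      refine congrArg (_ ⊗ₘ ·) ?_
      rw [Category.assoc]
      refine (_ ≫= N.transportCirc_hom c _).trans ?_
      rw [← Category.assoc, ← Category.assoc, whiskerLeft_comp_tensorHom,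
        tensorHom_comp_whiskerLeft]
      exact congrArg (fun x => (_ ⊗ₘ x) ≫ _) hc'
    rw [reassoc_of% h₁, N.assoc φ ψ h, associator_naturality_assoc, reassoc_of% h₂]
  comm {T P' P'' S} φ' ψ' φ'' ψ'' q := by
    rw [← cancel_mono (c T).hom]
    simp only [Category.assoc]
    rw [transportCirc_hom, transportCirc_hom]
    have h₁ : ∀ {R : O} (φ : Elementary T R) (ψ : Elementary R S),
        (N.transportCirc c ψ ▷ Q.val φ.fiber) ≫ ((c R).hom ⊗ₘ (c φ.fiber).hom) =
        (((c S).hom ⊗ₘ (c ψ.fiber).hom) ⊗ₘ (c φ.fiber).hom) ≫ (N.circ ψ ▷ _) := fun φ ψ => by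
      rw [whiskerRight_comp_tensorHom, transportCirc_hom, tensorHom_comp_whiskerRight]
    have h₂ : ((β_ (Q.val ψ''.fiber) (Q.val φ''.fiber)).hom ≫
        (Q.pull q.symm.fiberIso.symm ⊗ₘ
          Q.pull q.fiberIso)) ≫ ((c ψ'.fiber).hom ⊗ₘ (c φ'.fiber).hom) =
        ((c ψ''.fiber).hom ⊗ₘ (c φ''.fiber).hom) ≫
          (β_ (N.val ψ''.fiber) (N.val φ''.fiber)).hom ≫
            (N.pull q.symm.fiberIso.symm ⊗ₘ N.pull q.fiberIso) := by
      rw [BraidedCategory.braiding_naturality_assoc, MonoidalCategory.tensorHom_comp_tensorHom,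
        ← hc, ← hc, Category.assoc]
      exact _ ≫= MonoidalCategory.tensorHom_comp_tensorHom _ _ _ _
    have h₃ := h₁ φ'' ψ''
    have h₄ := h₁ φ' ψ'
    rw [reassoc_of% h₃, reassoc_of% h₄, ← associator_inv_naturality_assoc,
      N.comm φ' ψ' φ'' ψ'' q, ← associator_inv_naturality_assoc,
      ← Category.assoc, tensorHom_comp_whiskerLeft, ← h₂, ← whiskerLeft_comp_tensorHom,
      Category.assoc]
  equivariant {T' S' T'' S''} φ' φ'' q hq := by
    rw [← cancel_mono (c T').hom]
    simp only [Category.assoc]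
    rw [hc, transportCirc_hom_assoc, transportCirc_hom,
      N.equivariant φ' φ'' q hq, ← Category.assoc, ← Category.assoc,
      MonoidalCategory.tensorHom_comp_tensorHom]
    refine congrArg (· ≫ _) (Eq.trans ?_ (MonoidalCategory.tensorHom_comp_tensorHom _ _ _ _).symm)
    rw [hc, hc]

lemma transport_theta (hc : ∀ {T S : O} (f : T ≅ S), Q.pull f ≫ (c T).hom = (c S).hom ≫ N.pull f)
    {T t : O} (eta : 𝟙_ V ⟶ N.val t) (f : T ⟶ t) (ht : IsLocalTerminal t)
    (hT : 1 ≤ grade T) :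
    (N.transport c hc).theta (eta ≫ (c t).inv) f ht hT =
      (c _).hom ≫ N.theta eta f ht hT ≫ (c T).inv := by
  change (λ_ _).inv ≫ ((eta ≫ (c t).inv) ▷ _) ≫ N.transportCirc c _ = _
  rw [← cancel_mono (c T).hom]
  simp only [Category.assoc, Iso.inv_hom_id, Category.comp_id]
  rw [transportCirc_hom, ← Category.assoc (_ ▷ _), whiskerRight_comp_tensorHom, Category.assoc,
    Iso.inv_hom_id, Category.comp_id, MonoidalCategory.tensorHom_def', Category.assoc,
    ← leftUnitor_inv_naturality_assoc]
  rfl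

end MarklOperad

end Transport

/-! ### The strictified operad -/

section StrictOperad

variable {O : Type u} [Category.{v} O] [GradedOperadicCategory O] [StandingAssumptions O]
  {V : Type u'} [Category.{v'} V] [MonoidalCategory V] [SymmetricCategory V]
  {E : Collection O V} [∀ A : V, PreservesColimitsOfSize.{max u v, max u v} (tensorLeft A)]

/-- The values of the strictification: those at the representatives, and the unit in grade `0`. -/
noncomputable def TowerModule.strictVal (P : TowerModule E) (X : O) : V :=
  if h : 1 ≤ grade X then P.val (VirtualClass.mk X h).rep else 𝟙_ V

lemma TowerModule.strictVal_of_pos (P : TowerModule E) {X : O} (h : 1 ≤ grade X) :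
    P.strictVal X = P.val (VirtualClass.mk X h).rep := dif_pos h

lemma TowerModule.strictVal_of_grade_eq_zero (P : TowerModule E) {X : O} (h : grade X = 0) :
    P.strictVal X = 𝟙_ V := dif_neg (by omega)

namespace TowerModule.IsFree

variable {P : TowerModule E} (hP : P.IsFree)

lemma exists_strictIso (X : O) : ∃ c : P.strictVal X ≅ P.val X,
    (∀ h : 1 ≤ grade X, c = eqToIso (P.strictVal_of_pos h) ≪≫ hP.repIso h) ∧
      ∀ h : IsLocalTerminal X, c.hom =
        eqToHom (P.strictVal_of_grade_eq_zero (grade_of_isLocalTerminal h)) ≫ P.unit h := by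
  by_cases h : 1 ≤ grade X
  · exact ⟨eqToIso (P.strictVal_of_pos h) ≪≫ hP.repIso h, fun _ => rfl,
      fun h' => absurd (grade_of_isLocalTerminal h') (by omega)⟩
  · have h' := isLocalTerminal_of_grade_eq_zero (T := X) (by omega)
    have := hP.isIso_unit h'
    exact ⟨eqToIso (P.strictVal_of_grade_eq_zero (grade_of_isLocalTerminal h')) ≪≫
      asIso (P.unit h'), fun h'' => absurd h'' h, fun _ => rfl⟩

/-- The comparison of the strictification with the module. -/
noncomputable def strictIso (X : O) : P.strictVal X ≅ P.val X := (hP.exists_strictIso X).choose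

lemma strictIso_of_pos {X : O} (h : 1 ≤ grade X) :
    hP.strictIso X = eqToIso (P.strictVal_of_pos h) ≪≫ hP.repIso h :=
  (hP.exists_strictIso X).choose_spec.1 h

lemma strictIso_hom_of_isLocalTerminal {X : O} (h : IsLocalTerminal X) : (hP.strictIso X).hom =
    eqToHom (P.strictVal_of_grade_eq_zero (grade_of_isLocalTerminal h)) ≫ P.unit h :=
  (hP.exists_strictIso X).choose_spec.2 h

/-- The presheaf of the strictification. -/
noncomputable def strictPresheaf : IsoPresheaf O V := P.presheaf.transport hP.strictIso

/-- The comparison of presheaves. -/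
noncomputable def compare (X : O) : hP.strictPresheaf.val X ≅ P.val X := hP.strictIso X

lemma strictPresheaf_pull_hom {T S : O} (f : T ≅ S) :
    hP.strictPresheaf.pull f ≫ (hP.compare T).hom = (hP.compare S).hom ≫ P.pull f :=
  P.presheaf.transport_pull_hom hP.strictIso f

lemma operad_theta {T t : O} (f : T ⟶ t) (ht : IsLocalTerminal t) (hT : 1 ≤ grade T) :
    hP.operad.theta (P.unit ht) f ht hT = hP.theta (.toLocalTerminal f ht hT) ht := by
  change (λ_ _).inv ≫ (P.unit ht ▷ _) ≫ (β_ _ _).hom ≫ hP.circ _ = _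
  rw [BraidedCategory.braiding_naturality_left_assoc, ← Category.assoc, leftUnitor_inv_braiding]
  rfl

/-- The Markl operad underlying the strictification. -/
noncomputable def strictMarklOperad : MarklOperad O V :=
  hP.operad.transport hP.compare hP.strictPresheaf_pull_hom

lemma strictMarklOperad_theta {T t : O} (f : T ⟶ t) (ht : IsLocalTerminal t) (hT : 1 ≤ grade T) :
    (hP.strictMarklOperad.theta (P.unit ht ≫ (hP.compare t).inv) f ht hT :
      hP.strictPresheaf.val _ ⟶ hP.strictPresheaf.val _) =
      (hP.compare _).hom ≫ hP.theta (.toLocalTerminal f ht hT) ht ≫ (hP.compare T).inv := by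
  rw [← hP.operad_theta f ht hT]
  exact hP.operad.transport_theta hP.compare hP.strictPresheaf_pull_hom _ f ht hT

/-- Virtually isomorphic objects have the same representative, so the two values are equal, and
`repIso_theta` says that the multiplication is the resulting identity. -/
lemma strictMarklOperad_strict {T t : O} (f : T ⟶ t) (ht : IsLocalTerminal t)
    (hT : 1 ≤ grade T) :
    ∃ h : hP.strictMarklOperad.val (Elementary.toLocalTerminal f ht hT).fiber =
        hP.strictMarklOperad.val T,
      hP.strictMarklOperad.theta (P.unit ht ≫ (hP.compare t).inv) f ht hT = eqToHom h := by
  have e : ∀ φ : Elementary T t, P.val (VirtualClass.mk T φ.one_le_grade).rep =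
      P.val (VirtualClass.mk φ.fiber φ.fiber_pos).rep := fun φ => by rw [φ.mk_fiber ht]
  have h : ∀ φ : Elementary T t, (hP.strictIso φ.fiber).hom ≫ hP.theta φ ht =
      eqToHom (((P.strictVal_of_pos φ.fiber_pos).trans (e φ).symm).trans
        (P.strictVal_of_pos hT).symm) ≫ (hP.strictIso T).hom := fun φ => by
    rw [hP.strictIso_of_pos φ.fiber_pos, hP.strictIso_of_pos hT, Iso.trans_hom, Iso.trans_hom,
      Category.assoc, hP.repIso_theta φ ht (e φ)]
    simp only [eqToIso.hom, eqToHom_trans_assoc]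
  refine ⟨_, (hP.strictMarklOperad_theta f ht hT).trans ((Category.assoc _ _ _).symm.trans
    ((Iso.comp_inv_eq _).mpr (h _)))⟩

lemma unit_compare_pull {s t : O} (hs : IsLocalTerminal s) (ht : IsLocalTerminal t) (f : s ≅ t) :
    (P.unit ht ≫ (hP.compare t).inv) ≫ hP.strictPresheaf.pull f =
      P.unit hs ≫ (hP.compare s).inv := by
  rw [← cancel_mono (hP.compare s).hom]
  simp only [Category.assoc]
  rw [hP.strictPresheaf_pull_hom f, Iso.inv_hom_id_assoc, Iso.inv_hom_id, Category.comp_id]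
  exact P.unit_pull hs ht f

lemma transportCirc_equivariant {T S T' S' : O} {φ : Elementary T S} {φ' : Elementary T' S'}
    (q : ElementarySquare φ φ') :
    (hP.strictPresheaf.val S' ◁ ((hP.compare φ.fiber).hom ≫ hP.transfer q ≫
      (hP.compare φ'.fiber).inv)) ≫ hP.operad.transportCirc hP.compare φ' ≫
        hP.strictPresheaf.pull q.top =
      (hP.strictPresheaf.pull q.bot ▷ hP.strictPresheaf.val φ.fiber) ≫
        hP.operad.transportCirc hP.compare φ := by
  have h₀ : ∀ {T S : O} (φ : Elementary T S), hP.operad.transportCirc hP.compare φ ≫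
      (hP.compare T).hom = ((hP.compare S).hom ⊗ₘ (hP.compare φ.fiber).hom) ≫ (β_ _ _).hom ≫
        hP.circ φ := fun φ => hP.operad.transportCirc_hom hP.compare φ
  have h₁ := hP.circ_equivariant q
  rw [← cancel_mono (hP.compare T).hom]
  simp only [Category.assoc]
  rw [hP.strictPresheaf_pull_hom, h₀ φ, reassoc_of% h₀ φ', ← Category.assoc (_ ◁ _),
    ← Category.assoc (_ ▷ _), whiskerLeft_comp_tensorHom, whiskerRight_comp_tensorHom,
    hP.strictPresheaf_pull_hom, Category.assoc, Category.assoc, Iso.inv_hom_id, Category.comp_id,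
    BraidedCategory.braiding_naturality_assoc, BraidedCategory.braiding_naturality_assoc,
    ← tensorHom_comp_whiskerRight, ← tensorHom_comp_whiskerLeft, Category.assoc, Category.assoc, h₁]

/-- The strictification of the operad of a free module. -/
noncomputable def strictOperad : ConnectedMarklOperad O V where
  toMarklOperad := hP.strictMarklOperad
  eta {t} ht := P.unit ht ≫ (hP.compare t).inv
  eta_natural hs ht f := hP.unit_compare_pull hs ht f
  unital c f hT := by
    obtain ⟨h, e⟩ := hP.strictMarklOperad_strict f (OperadicCategory.U_localTerminal c) hT
    exact e
  equivariant_iso {T' S' T'' S''} φ' φ'' q := by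
    refine Eq.trans ?_ (hP.transportCirc_equivariant q)
    have h : hP.strictPresheaf.cast q.left_fiber.symm ≫
        ((hP.compare q.left.fiber).hom ≫ hP.theta q.left (isLocalTerminal_fiber_iso q.bot φ''.idx) ≫
          (hP.compare q.mid).inv) ≫ hP.strictPresheaf.pull q.right.symm =
        (hP.compare φ'.fiber).hom ≫ hP.transfer q ≫ (hP.compare φ''.fiber).inv := by
      rw [IsoPresheaf.cast_eq_pull, ← cancel_mono (hP.compare φ''.fiber).hom]
      simp only [Category.assoc]
      rw [hP.strictPresheaf_pull_hom, Iso.inv_hom_id_assoc, Iso.inv_hom_id, Category.comp_id,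
        ← Category.assoc, hP.strictPresheaf_pull_hom, Category.assoc]
      rfl
    refine congrArg (fun x => (hP.strictPresheaf.val S'' ◁ x) ≫ _) (Eq.trans ?_ h)
    exact congrArg (fun x => hP.strictPresheaf.cast q.left_fiber.symm ≫ x ≫
      hP.strictPresheaf.pull q.right.symm) (hP.strictMarklOperad_theta q.left.hom
        (isLocalTerminal_fiber_iso q.bot φ''.idx) q.one_le_grade_mid)
  strict f ht hT := hP.strictMarklOperad_strict f ht hT
  isIso_eta {t} ht := by
    have := hP.isIso_unit ht
    exact inferInstanceAs (IsIso (P.unit ht ≫ (hP.compare t).inv))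

lemma strictOperad_eta {t : O} (ht : IsLocalTerminal t) : hP.strictOperad.eta ht =
    eqToHom (P.strictVal_of_grade_eq_zero (grade_of_isLocalTerminal ht)).symm := by
  change P.unit ht ≫ (hP.strictIso t).inv = _
  rw [Iso.comp_inv_eq, hP.strictIso_hom_of_isLocalTerminal ht, eqToHom_trans_assoc, eqToHom_refl,
    Category.id_comp]

end TowerModule.IsFree

end StrictOperad

/-! ## Operads as modules -/

section OperadModule

variable {O : Type u} [Category.{v} O] [GradedOperadicCategory O] [StandingAssumptions O]
  {V : Type u'} [Category.{v'} V] [MonoidalCategory V] [SymmetricCategory V]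

namespace TowerModule

/-- The restriction of a module along a map of collections. -/
def restrict {E E' : Collection O V} (P : TowerModule E') (y : E ⟶ E') :
    TowerModule E where
  presheaf := P.presheaf
  act φ := (y.app _ ▷ _) ≫ P.act φ
  act_pull q := by
    rw [Category.assoc, P.act_pull q, whiskerRight_comp_tensorHom_assoc,
      tensorHom_comp_whiskerRight_assoc, y.naturality]
  act_comm {T P' P'' S} φ' ψ' φ'' ψ'' q := by
    have h := P.act_comm q
    have h' := swapMap_natural (E.map q.cross.hom.op) (E.map q.symm.cross.inv.op)
      (E'.map q.cross.hom.op) (E'.map q.symm.cross.inv.op) (y.app _) (y.app _) (y.app _) (y.app _)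
      (𝟙 (P.presheaf.val S)) (y.naturality _).symm (y.naturality _).symm
    simp only [tensorHom_id] at h'
    simp only [whiskerLeft_comp, Category.assoc]
    rw [whisker_exchange_assoc, whisker_exchange_assoc, h,
      ← whisker_exchange_assoc, ← MonoidalCategory.tensorHom_def'_assoc, reassoc_of% h',
      MonoidalCategory.tensorHom_def'_assoc, whisker_exchange_assoc, whisker_exchange_assoc,
      whisker_exchange_assoc]
  unit := P.unit
  unit_pull := P.unit_pull

end TowerModule

namespace ConnectedMarklOperad

variable (M : ConnectedMarklOperad O V)

/-- The action of an arrow between classes, on the values at representatives. -/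
def classPull {T S : O} {hT : 1 ≤ grade T} {hS : 1 ≤ grade S} (x : QVrt.mk T hT ⟶ QVrt.mk S hS) :
    M.val S ⟶ M.val T := M.toCollection.map x.op

lemma classPull_hom {T S : O} {hT : 1 ≤ grade T} {hS : 1 ≤ grade S} (f : T ≅ S) :
    M.classPull (QVrt.hom (hT := hT) (hS := hS) f rfl rfl) = M.pull f :=
  M.genMap_mk hT hS f

lemma classPull_comp {T S R : O} {hT : 1 ≤ grade T} {hS : 1 ≤ grade S} {hR : 1 ≤ grade R}
    (x : QVrt.mk T hT ⟶ QVrt.mk S hS) (z : QVrt.mk S hS ⟶ QVrt.mk R hR) :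
    M.classPull (x ≫ z) = M.classPull z ≫ M.classPull x :=
  M.toCollection.map_comp z.op x.op

lemma classPull_eqToHom {T S : O} {hT : 1 ≤ grade T} {hS : 1 ≤ grade S} (h : T = S) :
    M.classPull (eqToHom (QVrt.mk_congr h hT hS)) = M.pull (eqToIso h) := by
  subst h
  exact (M.toCollection.map_id _).trans (M.presheaf.pull_refl T).symm

/-- In the axiom `equivariant_iso` the multiplication `theta` is an identity by strictness, so the
map applied to the fiber factor is inverse to the action of `q.fiberClass`. Cancelling it gives
equivariance in the form of the module axiom `act_pull`. -/
lemma circ_pull {T S T' S' : O} {φ : Elementary T S} {φ' : Elementary T' S'}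
    (q : ElementarySquare φ φ') :
    M.circ φ' ≫ M.pull q.top = (M.pull q.bot ⊗ₘ M.classPull q.fiberClass) ≫ M.circ φ := by
  have h := M.equivariant_iso φ φ' q
  obtain ⟨a, ha⟩ := M.strict q.left.hom (isLocalTerminal_fiber_iso q.bot φ'.idx) q.one_le_grade_mid
  have k : M.classPull q.fiberClass ≫
      (M.presheaf.cast q.left_fiber.symm ≫
        M.theta (M.eta (isLocalTerminal_fiber_iso q.bot φ'.idx)) q.left.hom
          (isLocalTerminal_fiber_iso q.bot φ'.idx) q.one_le_grade_mid ≫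
        M.pull q.right.symm) = 𝟙 _ := by
    rw [ha]
    have e : ∀ {A A' B C D : V} (h₀ : A = A') (f : A' ⟶ B) (h₁ : B = C) (h₂ : C = D) (h₃ : D = B)
        (g : B ⟶ A) (_ : eqToHom h₀ ≫ f ≫ g = 𝟙 _),
        (eqToHom h₀ ≫ f ≫ eqToHom h₁) ≫ eqToHom h₂ ≫ eqToHom h₃ ≫ g = 𝟙 _ := by
      rintro A A' B C D rfl f rfl rfl _ g hg
      simpa using hg
    exact e _ _ _ _ _ _ ((Category.id_comp _).trans ((M.presheaf.pull_trans _ _).symm.trans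
      ((congrArg _ q.right.symm_self_id).trans (M.presheaf.pull_refl _))))
  rw [MonoidalCategory.tensorHom_def', Category.assoc, ← h, ← whiskerLeft_comp_assoc, k,
    whiskerLeft_id, Category.id_comp]

/-- The circle product, with the fiber as the left factor. -/
def leftCirc {T S : O} (φ : Elementary T S) : M.val φ.fiber ⊗ M.val S ⟶ M.val T :=
  (β_ _ _).hom ≫ M.circ φ

lemma leftCirc_pull {T S T' S' : O} {φ : Elementary T S} {φ' : Elementary T' S'}
    (q : ElementarySquare φ φ') :
    M.leftCirc φ' ≫ M.pull q.top =
      (M.classPull q.fiberClass ⊗ₘ M.pull q.bot) ≫ M.leftCirc φ := by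
  rw [leftCirc, leftCirc, Category.assoc, M.circ_pull q, BraidedCategory.braiding_naturality_assoc]

lemma circ_eq_leftCirc {T S : O} (φ : Elementary T S) :
    M.circ φ = (β_ _ _).hom ≫ M.leftCirc φ := by
  rw [leftCirc, SymmetricCategory.symmetry_assoc]

/-- Precomposition with the invertible map `reverse` turns the axiom `comm`, with fibers on the
right, into the exchange of the first two factors. -/
lemma leftCirc_comm {T P' P'' S : O} {φ' : Elementary T P'} {ψ' : Elementary P' S}
    {φ'' : Elementary T P''} {ψ'' : Elementary P'' S} (q : DisjointSquare φ' ψ' φ'' ψ'') :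
    (M.val φ''.fiber ◁ M.leftCirc ψ'') ≫ M.leftCirc φ'' =
      swapMap (M.classPull q.cross.hom) (M.classPull q.symm.cross.inv) (M.val S) ≫
        (M.val φ'.fiber ◁ M.leftCirc ψ') ≫ M.leftCirc φ' := by
  have h := M.comm φ' ψ' φ'' ψ'' q
  have hr : IsIso (reverse (M.val S) (M.val ψ''.fiber) (M.val φ''.fiber)) := by
    unfold reverse; infer_instance
  have h₁ : M.classPull q.cross.hom = M.pull q.fiberIso := M.classPull_hom q.fiberIso
  have h₂ : M.classPull q.symm.cross.inv = M.pull q.symm.fiberIso.symm :=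
    M.classPull_hom q.symm.fiberIso.symm
  simp only [M.circ_eq_leftCirc] at h
  rw [reverse_whiskerLeft_assoc, reverse_whiskerLeft_assoc, ← Category.assoc (_ ◁ _),
    ← reverse_swapMap, Category.assoc, cancel_epi] at h
  rw [h₁, h₂, h]

/-- An operad as a module over its underlying collection. -/
def module : TowerModule M.toCollection where
  presheaf := M.presheaf
  act φ := M.leftCirc φ
  act_pull q := M.leftCirc_pull q
  act_comm q := M.leftCirc_comm q
  unit := M.eta
  unit_pull := M.eta_natural

end ConnectedMarklOperad

end OperadModule

/-! ## Morphisms of modules -/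

section ModuleHom

variable {O : Type u} [Category.{v} O] [GradedOperadicCategory O] [StandingAssumptions O]
  {V : Type u'} [Category.{v'} V] [MonoidalCategory V] [SymmetricCategory V] {E : Collection O V}

/-- A morphism of modules. -/
structure TowerModule.Hom (P N : TowerModule E) where
  hom : ∀ T : O, P.val T ⟶ N.val T
  pull_hom : ∀ {T S : O} (f : T ≅ S), P.pull f ≫ hom T = hom S ≫ N.pull f
  act_hom : ∀ {T S : O} (φ : Elementary T S), P.act φ ≫ hom T = (_ ◁ hom S) ≫ N.act φ
  unit_hom : ∀ {t : O} (ht : IsLocalTerminal t), P.unit ht ≫ hom t = N.unit ht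

namespace TowerModule.Hom

variable {P N : TowerModule E} (F : Hom P N)

lemma genAt_hom {T t : O} (f : T ⟶ t) (ht : IsLocalTerminal t) (hT : 1 ≤ grade T) :
    P.genAt f ht hT ≫ F.hom T = N.genAt f ht hT := by
  unfold genAt
  simp only [Category.assoc]
  rw [F.act_hom, ← whiskerLeft_comp_assoc, F.unit_hom]

lemma gen_hom {T : O} (hT : 1 ≤ grade T) : P.gen hT ≫ F.hom T = N.gen hT := F.genAt_hom _ _ _

lemma ev_hom : ∀ {T : O} (A : Tower T), A.ev P ≫ F.hom T = A.ev N
  | _, .last _ h => F.gen_hom h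
  | _, .cons φ r => by
      change ((_ ◁ r.ev P) ≫ P.act φ) ≫ F.hom _ = (_ ◁ r.ev N) ≫ N.act φ
      rw [Category.assoc, F.act_hom, ← whiskerLeft_comp_assoc, ev_hom r]

lemma leg_hom {X : O} (a : LabelledTower X) : a.leg P ≫ F.hom X = a.leg N := by
  unfold LabelledTower.leg
  rw [Category.assoc, F.pull_hom, ← Category.assoc, F.ev_hom]

end TowerModule.Hom

lemma LabelledTower.leg_trans (P : TowerModule E) {X Y : O} (f : X ≅ Y) (a : LabelledTower Y) :
    leg P ⟨a.base, f ≪≫ a.label, a.tower⟩ = a.leg P ≫ P.pull f :=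
  (congrArg _ (P.presheaf.pull_trans _ _)).trans (Category.assoc _ _ _).symm

lemma LabelledTower.leg_cons (P : TowerModule E) {T S T₀ S₀ : O} {φ : Elementary T S}
    {φ₀ : Elementary T₀ S₀} (q : ElementarySquare φ φ₀) (A : Tower S₀) :
    leg P ⟨T₀, q.top, .cons φ₀ A⟩ =
      (E.map q.fiberClass.op ▷ _) ≫ (_ ◁ leg P ⟨S₀, q.bot, A⟩) ≫ P.act φ := by
  change ((_ ◁ A.ev P) ≫ P.act φ₀) ≫ P.pull q.top =
    (E.map q.fiberClass.op ▷ _) ≫ (_ ◁ (A.ev P ≫ P.pull q.bot)) ≫ P.act φ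
  rw [Category.assoc, P.act_pull q, whiskerLeft_comp_tensorHom_assoc,
    MonoidalCategory.tensorHom_def_assoc]

namespace TowerModule.IsFree

variable {P : TowerModule E} (hP : P.IsFree)
include hP

/-- In positive grade the colimit property provides the map, in grade 0 the invertible unit does. In
each case one of the two conditions is void. -/
lemma exists_component (N : TowerModule E) (X : O) : ∃ d : P.val X ⟶ N.val X,
    (∀ a : LabelledTower X, a.leg P ≫ d = a.leg N) ∧
      ∀ h : IsLocalTerminal X, P.unit h ≫ d = N.unit h := by
  by_cases hX : 1 ≤ grade X
  · obtain ⟨d, hd⟩ := hP.exists_desc hX (fun a => a.leg N) fun γ => γ.map_leg N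
    exact ⟨d, hd, fun h => absurd (grade_of_isLocalTerminal h) (by omega)⟩
  · have ht := isLocalTerminal_of_grade_eq_zero (T := X) (by omega)
    have := hP.isIso_unit ht
    refine ⟨inv (P.unit ht) ≫ N.unit ht, fun a => ?_, fun _ => IsIso.hom_inv_id_assoc _ _⟩
    exact absurd a.tower.pos (by rw [← grade_of_iso a.label]; omega)

section

variable {N : TowerModule E} {T S : O} {d : P.val T ⟶ N.val T} {d' : P.val S ⟶ N.val S}
  (hd : ∀ a : LabelledTower T, a.leg P ≫ d = a.leg N)
  (hd' : ∀ a : LabelledTower S, a.leg P ≫ d' = a.leg N)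
include hd hd'

lemma pull_comp_of_leg (f : T ≅ S) (hu : ∀ h : IsLocalTerminal T, P.unit h ≫ d = N.unit h)
    (hu' : ∀ h : IsLocalTerminal S, P.unit h ≫ d' = N.unit h) :
    P.pull f ≫ d = d' ≫ N.pull f := by
  by_cases hS : 1 ≤ grade S
  · refine hP.hom_ext hS fun a => ?_
    rw [reassoc_of% hd', ← LabelledTower.leg_trans, ← Category.assoc, ← LabelledTower.leg_trans, hd]
  · have hs := isLocalTerminal_of_grade_eq_zero (T := S) (by omega)
    have ht := isLocalTerminal_of_grade_eq_zero (T := T) (by rw [grade_of_iso f]; omega)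
    have := hP.isIso_unit hs
    rw [← cancel_epi (P.unit hs), reassoc_of% hu', N.unit_pull ht hs f, ← Category.assoc,
      P.unit_pull ht hs f, hu]

/-- In positive grade this is tested on towers under `S` extended by `φ`. In grade 0 it is tested on
the unit, where it becomes compatibility with the one-term tower at `T`. -/
lemma act_comp_of_leg (φ : Elementary T S)
    (hu' : ∀ h : IsLocalTerminal S, P.unit h ≫ d' = N.unit h)
    [∀ A : V, PreservesColimitsOfSize.{max u v, max u v} (tensorLeft A)] :
    P.act φ ≫ d = (_ ◁ d') ≫ N.act φ := by
  by_cases hS : 1 ≤ grade S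
  · refine hP.hom_ext_whiskerLeft hS fun a => ?_
    obtain ⟨S₀, ℓ, A⟩ := a
    obtain ⟨T₀, φ₀, q, rfl⟩ := φ.exists_square ℓ
    rw [← cancel_epi (E.map q.fiberClass.op ▷ _)]
    have h := hd ⟨T₀, q.top, .cons φ₀ A⟩
    have h' := hd' ⟨S₀, q.bot, A⟩
    rw [LabelledTower.leg_cons, LabelledTower.leg_cons, ← h', whiskerLeft_comp_assoc] at h
    exact ((Category.assoc _ _ _).trans (_ ≫= Category.assoc _ _ _)).symm.trans h
  · have hs := isLocalTerminal_of_grade_eq_zero (T := S) (by omega)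
    have := hP.isIso_unit hs
    obtain ⟨f, hT, rfl⟩ : ∃ f hT, φ = .toLocalTerminal f hs hT :=
      ⟨_, _, φ.eq_toLocalTerminal hs⟩
    have h := hd ⟨T, Iso.refl T, .last T hT⟩
    have k : ∀ Q : TowerModule E, LabelledTower.leg Q ⟨T, Iso.refl T, .last T hT⟩ =
        Q.genAt f hs hT := fun Q => by
      rw [Q.genAt_eq_gen]
      exact (congrArg _ (Q.presheaf.pull_refl T)).trans (Category.comp_id _)
    rw [k, k] at h
    have : IsIso (E.map (QVrt.hom (hT := hT) (hS := hT) (Iso.refl T)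
        (Elementary.mk_fiber_toLocalTerminal f hs hT) rfl).op) :=
      inferInstanceAs (IsIso (E.mapIso (QVrt.iso (hT := hT) (hS := hT) (Iso.refl T)
        (Elementary.mk_fiber_toLocalTerminal f hs hT) rfl).op).hom)
    rw [← cancel_epi (_ ◁ P.unit hs), ← whiskerLeft_comp_assoc, hu', ← cancel_epi (ρ_ _).inv,
      ← cancel_epi (E.map (QVrt.hom (hT := hT) (hS := hT) (Iso.refl T)
        (Elementary.mk_fiber_toLocalTerminal f hs hT) rfl).op)]
    exact ((Category.assoc _ _ _).trans (_ ≫= (Category.assoc _ _ _).trans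
      (_ ≫= Category.assoc _ _ _))).symm.trans h

end

/-- The morphism from a free module to a module. -/
noncomputable def lift [∀ A : V, PreservesColimitsOfSize.{max u v, max u v} (tensorLeft A)]
    (N : TowerModule E) : Hom P N where
  hom X := (hP.exists_component N X).choose
  pull_hom {T S} f := by
    obtain ⟨h₁, h₂⟩ := (hP.exists_component N T).choose_spec
    obtain ⟨h₃, h₄⟩ := (hP.exists_component N S).choose_spec
    exact hP.pull_comp_of_leg h₁ h₃ f h₂ h₄
  act_hom {T S} φ := by
    obtain ⟨h₁, h₂⟩ := (hP.exists_component N T).choose_spec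
    obtain ⟨h₃, h₄⟩ := (hP.exists_component N S).choose_spec
    exact hP.act_comp_of_leg h₁ h₃ φ h₄
  unit_hom {t} ht := (hP.exists_component N t).choose_spec.2 ht

lemma hom_eq {N : TowerModule E} (F G : Hom P N) (X : O) : F.hom X = G.hom X := by
  by_cases hX : 1 ≤ grade X
  · refine hP.hom_ext hX fun a => ?_
    rw [F.leg_hom, G.leg_hom]
  · have ht := isLocalTerminal_of_grade_eq_zero (T := X) (by omega)
    have := hP.isIso_unit ht
    rw [← cancel_epi (P.unit ht), F.unit_hom, G.unit_hom]

end TowerModule.IsFree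

end ModuleHom

/-! ### Refinements and towers in an arbitrary operad -/

section OperadHom

variable {O : Type u} [Category.{v} O] [GradedOperadicCategory O] [StandingAssumptions O]
  {V : Type u'} [Category.{v'} V] [MonoidalCategory V] [SymmetricCategory V]

namespace ConnectedMarklOperad

variable (M : ConnectedMarklOperad O V)

lemma leftCirc_assoc {T S R : O} (φ : Elementary T S) (ψ : Elementary S R)
    (h : cardMap ψ.hom φ.idx = ψ.idx) :
    (M.val φ.fiber ◁ M.leftCirc ψ) ≫ M.leftCirc φ =
      (α_ _ _ _).inv ≫ (((M.presheaf.cast (φ.induced_fiber ψ h) ▷ _) ≫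
        M.leftCirc (φ.induced ψ h)) ▷ M.val R) ≫ M.leftCirc (φ.comp ψ h) := by
  have k := M.assoc φ ψ h
  simp only [M.circ_eq_leftCirc] at k
  have k' := braiding_assoc (M.val R) (M.val ψ.fiber) (M.val φ.fiber)
  rw [comp_whiskerRight, Category.assoc, BraidedCategory.braiding_naturality_left_assoc,
    BraidedCategory.braiding_naturality_right_assoc (M.val ψ.fiber)
      (M.presheaf.cast (φ.induced_fiber ψ h)), whiskerLeft_comp, Category.assoc,
    BraidedCategory.braiding_naturality_right_assoc (M.val R), ← reassoc_of% k', cancel_epi,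
    cancel_epi] at k
  exact k

lemma leftCirc_iso {T T' S : O} (φ : Elementary T S) (φ' : Elementary T' S) (σ : T ≅ T')
    (w : σ.hom ≫ φ'.hom = φ.hom) :
    (M.pull (φ.fiberHomIso φ' σ w) ▷ M.val S) ≫ M.leftCirc φ = M.leftCirc φ' ≫ M.pull σ := by
  let q : ElementarySquare φ φ' := ⟨σ, Iso.refl S, by rw [w]; exact Category.comp_id _⟩
  have h := M.leftCirc_pull q
  rw [q.fiberClass_eq_hom rfl w, M.classPull_hom] at h
  have hr : M.pull q.bot = 𝟙 _ := M.presheaf.pull_refl S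
  rw [hr, tensorHom_id] at h
  exact h.symm

/-- The counterpart of the recursion `act_circ` in any operad. Equivariance along `ρ.square`
replaces `γ` by the morphism induced on fibers, and associativity for `ρ.first` and `ρ.second` does
the rest. -/
lemma leftCirc_refinement {T S G₀ G₁ : O} {φ : Elementary T S} {m : φ.fiber ≅ G₀}
    {γ : Elementary G₀ G₁} (ρ : Refinement φ m γ) :
    ((M.leftCirc γ ≫ M.pull m) ▷ M.val S) ≫ M.leftCirc φ =
      (α_ _ _ _).hom ≫ (M.classPull ρ.arrow ⊗ₘ ((M.pull ρ.label ▷ _) ≫ M.leftCirc ρ.second)) ≫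
        M.leftCirc ρ.first ≫ M.pull ρ.iso := by
  have h₁ : M.pull m = M.pull ρ.square.top ≫
      M.pull (φ.fiberHomIso ρ.composite ρ.iso ρ.iso_composite) := by
    refine Eq.trans (congrArg M.presheaf.pull ?_) (M.presheaf.pull_trans _ _)
    exact (Iso.self_symm_id_assoc _ _).symm
  have h₂ : M.pull ρ.square.bot = M.pull ρ.label := rfl
  have h₃ := M.leftCirc_assoc ρ.first ρ.second ρ.joint
  have h₄ : M.classPull ρ.arrow = M.classPull ρ.square.fiberClass ≫
      M.presheaf.cast (ρ.first.induced_fiber ρ.second ρ.joint).symm := by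
    refine (M.classPull_comp _ _).trans (_ ≫= ?_)
    rw [M.classPull_eqToHom (ρ.first.induced_fiber ρ.second ρ.joint), M.presheaf.cast_eq_pull]
  have h₅ : M.presheaf.cast (ρ.first.induced_fiber ρ.second ρ.joint).symm ≫
      M.presheaf.cast (ρ.first.induced_fiber ρ.second ρ.joint) = 𝟙 _ := by
    simp [IsoPresheaf.cast]
  rw [h₁, ← Category.assoc, M.leftCirc_pull ρ.square, h₂, comp_whiskerRight_assoc,
    M.leftCirc_iso, h₄]
  have h₆ : (M.classPull ρ.square.fiberClass ≫ M.presheaf.cast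
      (ρ.first.induced_fiber ρ.second ρ.joint).symm) ⊗ₘ
      ((M.pull ρ.label ▷ M.val S) ≫ M.leftCirc ρ.second) =
      (M.classPull ρ.square.fiberClass ⊗ₘ (M.pull ρ.label ▷ M.val S)) ≫
        (M.presheaf.cast (ρ.first.induced_fiber ρ.second ρ.joint).symm ▷ _) ≫
          (_ ◁ M.leftCirc ρ.second) := by
    rw [← MonoidalCategory.tensorHom_def, MonoidalCategory.tensorHom_comp_tensorHom]
  rw [h₆, Category.assoc, Category.assoc, reassoc_of% h₃,
    associator_inv_naturality_left_assoc, ← comp_whiskerRight_assoc, ← comp_whiskerRight_assoc, h₅,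
    id_whiskerRight, Category.id_comp, ← tensorHom_id (M.pull ρ.label),
    ← associator_naturality_assoc,
    Iso.hom_inv_id_assoc, tensorHom_id, comp_whiskerRight_assoc]

variable {E : Collection O V}

/-- The value of a map of collections at a representative. -/
def generator (y : E ⟶ (forget O V).obj M) {T : O} (hT : 1 ≤ grade T) :
    E.obj (op (QVrt.mk T hT)) ⟶ M.val T := y.app (op (QVrt.mk T hT))

/-- By strictness `theta` is an identity, and the arrow between the classes of `T` and of the fiber
comes from an identity isomorphism. The claim is naturality of `y` for that arrow. -/
lemma generator_theta (y : E ⟶ (forget O V).obj M) {T t : O} (f : T ⟶ t) (ht : IsLocalTerminal t)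
    (hT : 1 ≤ grade T) :
    E.map (QVrt.hom (Iso.refl T) (Elementary.mk_fiber_toLocalTerminal f ht hT) rfl).op ≫
      M.generator y (Elementary.toLocalTerminal f ht hT).fiber_pos ≫ M.theta (M.eta ht) f ht hT =
        M.generator y hT := by
  obtain ⟨a, ha⟩ := M.strict f ht hT
  rw [ha]
  have h := y.naturality (QVrt.hom (hT := hT) (hS := hT) (Iso.refl T)
    (Elementary.mk_fiber_toLocalTerminal f ht hT) rfl).op
  have e : ∀ {A B C D : V} (x : A ⟶ B) (z : B ⟶ C) (z' : A ⟶ D) (p : D ⟶ D) (h₀ : D = D)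
      (h₁ : D = C) (h₂ : C = D) (_ : p = 𝟙 _) (_ : x ≫ z = z' ≫ eqToHom h₀ ≫ p ≫ eqToHom h₁),
      x ≫ z ≫ eqToHom h₂ = z' := by
    rintro A B C D x z z' p h₀ rfl h₂ rfl h
    simpa using h
  exact e _ _ _ _ _ _ _ (M.presheaf.pull_refl T) h

lemma module_gen (y : E ⟶ (forget O V).obj M) {T : O} (hT : 1 ≤ grade T) :
    (M.module.restrict y).gen hT = M.generator y hT := by
  rw [← M.generator_theta y (toTerminal T) (isTrivial_terminalOf T).isLocalTerminal hT]
  refine _ ≫= ?_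
  change (ρ_ _).inv ≫ (_ ◁ M.eta _) ≫ (M.generator y _ ▷ _) ≫ (β_ _ _).hom ≫ M.circ _ =
    M.generator y _ ≫ (λ_ _).inv ≫ (M.eta _ ▷ _) ≫ M.circ _
  rw [whisker_exchange_assoc, ← rightUnitor_inv_naturality_assoc,
    BraidedCategory.braiding_naturality_right_assoc, ← rightUnitor_inv_braiding_assoc]

lemma ev_module (y : E ⟶ (forget O V).obj M) : ∀ {T : O} (A : Tower T),
    A.ev (M.module.restrict y) = A.eval y
  | _, .last _ h => M.module_gen y h
  | _, .cons (S := S) φ r => by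
      have ih := ev_module y r
      change (_ ◁ (r.ev (M.module.restrict y) : _ ⟶ M.val S)) ≫ (M.generator y φ.fiber_pos ▷ _) ≫
        (β_ (M.val φ.fiber) (M.val S)).hom ≫
        M.circ φ = (M.generator y φ.fiber_pos ⊗ₘ r.eval y) ≫ (β_ (M.val φ.fiber) (M.val S)).hom ≫
          M.circ φ
      rw [ih, MonoidalCategory.tensorHom_def']
      exact (Category.assoc _ _ _).symm

lemma leg_module (y : E ⟶ (forget O V).obj M) {X : O} (a : LabelledTower X) :
    a.leg (M.module.restrict y) = a.eval y :=
  congrArg (· ≫ M.pull a.label) (M.ev_module y a.tower)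

lemma leftCirc_hom {M N : ConnectedMarklOperad O V} (G : N ⟶ M) {T S : O} (φ : Elementary T S) :
    N.leftCirc φ ≫ Hom.hom G T =
      (Hom.hom G φ.fiber ⊗ₘ Hom.hom G S) ≫
        M.leftCirc φ := by
  have h := Hom.circ_hom G φ
  rw [leftCirc, leftCirc, Category.assoc, h,
    BraidedCategory.braiding_naturality_assoc]

lemma generator_hom {M N : ConnectedMarklOperad O V} (G : N ⟶ M)
    (y : E ⟶ (forget O V).obj N) {T : O} (hT : 1 ≤ grade T) :
    M.generator (y ≫ (forget O V).map G) hT =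
      N.generator y hT ≫ Hom.hom G T := rfl

end ConnectedMarklOperad

end OperadHom

/-! ### Module morphisms preserve circle products -/

section CircHom

variable {O : Type u} [Category.{v} O] [GradedOperadicCategory O] [StandingAssumptions O]
  {V : Type u'} [Category.{v'} V] [MonoidalCategory V] [SymmetricCategory V]
  {E : Collection O V} [∀ A : V, PreservesColimitsOfSize.{max u v, max u v} (tensorLeft A)]

namespace TowerModule.IsFree

variable {P : TowerModule E} (hP : P.IsFree) {M : ConnectedMarklOperad O V}
  {y : E ⟶ (ConnectedMarklOperad.forget O V).obj M} (d : ∀ T : O, P.val T ⟶ M.val T)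
include hP

/-- The circle product is determined by its restriction to generators and the recursion `act_circ`,
and `M` satisfies the same recursion by `leftCirc_refinement`. Induction on the grade of the fiber
compares the two. -/
lemma circ_comp (hp : ∀ {T S : O} (f : T ≅ S), P.pull f ≫ d T = d S ≫ M.pull f)
    (hg : ∀ {T : O} (hT : 1 ≤ grade T), P.gen hT ≫ d T = M.generator y hT)
    (ha : ∀ {T S : O} (φ : Elementary T S),
      P.act φ ≫ d T = (M.generator y φ.fiber_pos ⊗ₘ d S) ≫ M.leftCirc φ)
    {T S : O} (φ : Elementary T S) :
    hP.circ φ ≫ d T = (d φ.fiber ⊗ₘ d S) ≫ M.leftCirc φ := by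
  obtain ⟨n, hn⟩ : ∃ n, grade φ.fiber ≤ n := ⟨_, le_rfl⟩
  induction n generalizing T S with
  | zero => exact absurd φ.fiber_pos (by omega)
  | succ n ih =>
    refine hP.hom_ext_cases φ.fiber_pos ?_ fun m γ hγ => ?_
    · rw [← Category.assoc, hP.gen_circ, ha, whiskerRight_comp_tensorHom_assoc, hg]
    · obtain ⟨ρ⟩ := exists_refinement φ m γ hγ
      have ih' := ih ρ.second (by
        rw [grade_of_iso ρ.label]
        have := γ.grade_lt
        have := grade_of_iso m
        omega)
      have h₁ : E.map ρ.arrow.op ≫ M.generator y ρ.first.fiber_pos =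
          M.generator y γ.fiber_pos ≫ M.classPull ρ.arrow := y.naturality _
      have h₂ := M.leftCirc_refinement ρ
      rw [← Category.assoc, hP.act_circ ρ hγ, insertStep, Category.assoc, Category.assoc,
        Category.assoc, hp, reassoc_of% ha]
      rw [MonoidalCategory.tensorHom_comp_tensorHom_assoc, h₁, Category.assoc, ih',
        whiskerRight_comp_tensorHom_assoc, hp, whiskerRight_comp_tensorHom_assoc, Category.assoc,
        hp, reassoc_of% ha]
      have k : ((M.generator y γ.fiber_pos ⊗ₘ d _) ⊗ₘ d S) ≫
          ((M.leftCirc γ ≫ M.pull m) ▷ M.val S) =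
          ((M.generator y γ.fiber_pos ⊗ₘ d _) ≫ M.leftCirc γ ≫ M.pull m) ⊗ₘ d S := by
        rw [tensorHom_comp_whiskerRight]
      rw [← k, Category.assoc, h₂, associator_naturality_assoc,
        MonoidalCategory.tensorHom_comp_tensorHom_assoc, tensorHom_comp_whiskerRight_assoc]

end TowerModule.IsFree

end CircHom

/-! ### Maps of collections from their values on objects -/

section Unit

variable {O : Type u} [Category.{v} O] [GradedOperadicCategory O] [StandingAssumptions O]
  {V : Type u'} [Category.{v'} V] [MonoidalCategory V] [SymmetricCategory V]
  {E : Collection O V}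

namespace ConnectedMarklOperad

variable (M : ConnectedMarklOperad O V)
  (g : ∀ {T : O} (hT : 1 ≤ grade T), E.obj (op (QVrt.mk T hT)) ⟶ M.val T)

/-- A family indexed by objects must agree on virtually isomorphic ones to descend to classes. As
`theta` is an identity in `M`, compatibility with `theta` says precisely this. -/
lemma heq_of_theta (h : ∀ {T t : O} (f : T ⟶ t) (ht : IsLocalTerminal t) (hT : 1 ≤ grade T),
      g (Elementary.toLocalTerminal f ht hT).fiber_pos ≫ M.theta (M.eta ht) f ht hT =
        eqToHom (by rw [QVrt.mk, ← Elementary.mk_fiber_toLocalTerminal f ht hT]) ≫ g hT)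
    {F T : O} (hF : 1 ≤ grade F) (hT : 1 ≤ grade T) (hv : Virtual F T) : HEq (g hF) (g hT) := by
  obtain ⟨t, ht, f, i, rfl⟩ := hv
  obtain ⟨a, ha⟩ := M.strict f ht hT
  have k := h f ht hT
  rw [ha] at k
  have e := fiber_eq_toLocalTerminal ht f i hT
  have k' : HEq (g hF) (g (Elementary.toLocalTerminal f ht hT).fiber_pos) := by
    revert hF
    rw [e]
    intro hF
    rfl
  refine k'.trans ?_
  have aux : ∀ {A B C D : V} (x : A ⟶ B) (z : C ⟶ D) (p : B = D) (q : A = C)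
      (_ : x ≫ eqToHom p = eqToHom q ≫ z), HEq x z := by
    rintro A B C D x z rfl rfl h
    simpa using h
  exact aux _ _ _ _ k

/-- The value at a class of a map given at representatives. -/
def classGenerator (h : ∀ {T t : O} (f : T ⟶ t) (ht : IsLocalTerminal t) (hT : 1 ≤ grade T),
      g (Elementary.toLocalTerminal f ht hT).fiber_pos ≫ M.theta (M.eta ht) f ht hT =
        eqToHom (by rw [QVrt.mk, ← Elementary.mk_fiber_toLocalTerminal f ht hT]) ≫ g hT)
    (B : VirtualClass O) : E.obj (op ⟨B⟩) ⟶ M.classVal B :=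
  Quot.hrecOn (motive := fun B => E.obj (op ⟨B⟩) ⟶ M.classVal B) B
    (fun T => g T.2) fun F T hv => M.heq_of_theta g h F.2 T.2 hv

lemma map_classGenerator (h : ∀ {T t : O} (f : T ⟶ t) (ht : IsLocalTerminal t) (hT : 1 ≤ grade T),
      g (Elementary.toLocalTerminal f ht hT).fiber_pos ≫ M.theta (M.eta ht) f ht hT =
        eqToHom (by rw [QVrt.mk, ← Elementary.mk_fiber_toLocalTerminal f ht hT]) ≫ g hT)
    (h' : ∀ {T S : O} (hT : 1 ≤ grade T) (hS : 1 ≤ grade S) (f : T ≅ S),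
      E.map (QVrt.hom f rfl rfl).op ≫ g hT = g hS ≫ M.pull f)
    {A B : VirtualClass O} (p : Word VirtualGen A B) :
    E.map (Presented.homMk (VirtualRel (O := O)) p).op ≫ M.classGenerator g h A =
      M.classGenerator g h B ≫
        (p.eval (C := Vᵒᵖ) (fun A => op (M.classVal A)) (fun g => (M.genMap g).op)).unop := by
  induction p with
  | gen x =>
    obtain ⟨T, S, hT, hS, f, rfl, rfl⟩ := x
    refine (h' hT hS f).trans (_ ≫= (M.genMap_mk hT hS f).symm)
  | id A =>
    exact (congrArg (· ≫ _) (E.map_id _)).trans ((Category.id_comp _).trans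
      (Category.comp_id _).symm)
  | comp p q hp hq =>
    refine (congrArg (· ≫ _)
      (E.map_comp (Presented.homMk _ q).op (Presented.homMk _ p).op)).trans ?_
    rw [Category.assoc, hp, reassoc_of% hq]
    rfl

/-- The map of collections with given values at representatives. -/
def ofGenerators (h : ∀ {T t : O} (f : T ⟶ t) (ht : IsLocalTerminal t) (hT : 1 ≤ grade T),
      g (Elementary.toLocalTerminal f ht hT).fiber_pos ≫ M.theta (M.eta ht) f ht hT =
        eqToHom (by rw [QVrt.mk, ← Elementary.mk_fiber_toLocalTerminal f ht hT]) ≫ g hT)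
    (h' : ∀ {T S : O} (hT : 1 ≤ grade T) (hS : 1 ≤ grade S) (f : T ≅ S),
      E.map (QVrt.hom f rfl rfl).op ≫ g hT = g hS ≫ M.pull f) :
    E ⟶ (forget O V).obj M where
  app A := M.classGenerator g h A.unop.as
  naturality := by
    rintro ⟨⟨B⟩⟩ ⟨⟨A⟩⟩ ⟨⟨p⟩⟩
    exact M.map_classGenerator g h h' p

end ConnectedMarklOperad

end Unit

/-! ## The universal property -/

section Universal

variable {O : Type u} [Category.{v} O] [GradedOperadicCategory O] [StandingAssumptions O]
  {V : Type u'} [Category.{v'} V] [MonoidalCategory V] [SymmetricCategory V]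
  {E : Collection O V} [∀ A : V, PreservesColimitsOfSize.{max u v, max u v} (tensorLeft A)]

namespace TowerModule.IsFree

variable {P : TowerModule E} (hP : P.IsFree)

/-- The comparison of the values of the strictification with those of the module. -/
noncomputable def toModule (X : O) : hP.strictOperad.val X ≅ P.val X := hP.compare X

lemma pull_toModule_hom {T S : O} (f : T ≅ S) :
    hP.strictOperad.pull f ≫ (hP.toModule T).hom = (hP.toModule S).hom ≫ P.pull f :=
  hP.strictPresheaf_pull_hom f

lemma pull_toModule_inv {T S : O} (f : T ≅ S) :
    P.pull f ≫ (hP.toModule T).inv = (hP.toModule S).inv ≫ hP.strictOperad.pull f := by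
  rw [Iso.eq_inv_comp, ← Category.assoc, Iso.comp_inv_eq, hP.pull_toModule_hom]

lemma strictOperad_circ {T S : O} (φ : Elementary T S) :
    hP.strictOperad.circ φ ≫ (hP.toModule T).hom =
      ((hP.toModule S).hom ⊗ₘ (hP.toModule φ.fiber).hom) ≫ (β_ _ _).hom ≫ hP.circ φ :=
  hP.operad.transportCirc_hom hP.compare φ

lemma strictOperad_leftCirc {T S : O} (φ : Elementary T S) :
    hP.strictOperad.leftCirc φ =
      ((hP.toModule φ.fiber).hom ⊗ₘ (hP.toModule S).hom) ≫ hP.circ φ ≫ (hP.toModule T).inv := by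
  rw [ConnectedMarklOperad.leftCirc, ← Category.assoc, Iso.eq_comp_inv, Category.assoc,
    hP.strictOperad_circ, ← BraidedCategory.braiding_naturality_assoc,
    SymmetricCategory.symmetry_assoc]

lemma eta_toModule {t : O} (ht : IsLocalTerminal t) :
    hP.strictOperad.eta ht = P.unit ht ≫ (hP.toModule t).inv := rfl

lemma strictOperad_theta {T t : O} (f : T ⟶ t) (ht : IsLocalTerminal t) (hT : 1 ≤ grade T) :
    hP.strictOperad.theta (hP.strictOperad.eta ht) f ht hT =
      (hP.toModule _).hom ≫ hP.theta (.toLocalTerminal f ht hT) ht ≫ (hP.toModule T).inv :=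
  hP.strictMarklOperad_theta f ht hT

lemma gen_strictOperad_theta {T t : O} (f : T ⟶ t) (ht : IsLocalTerminal t) (hT : 1 ≤ grade T) :
    (P.gen (Elementary.toLocalTerminal f ht hT).fiber_pos ≫ (hP.toModule _).inv) ≫
        hP.strictOperad.theta (hP.strictOperad.eta ht) f ht hT =
      eqToHom (by rw [QVrt.mk, ← Elementary.mk_fiber_toLocalTerminal f ht hT]) ≫
        P.gen hT ≫ (hP.toModule T).inv := by
  rw [hP.strictOperad_theta, Category.assoc, Iso.inv_hom_id_assoc, ← Category.assoc, hP.gen_theta,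
    eqToHom_op, eqToHom_map, Category.assoc]

/-- The inclusion of the generators. -/
noncomputable def inclusion : E ⟶ (ConnectedMarklOperad.forget O V).obj hP.strictOperad :=
  hP.strictOperad.ofGenerators (fun {T} hT => P.gen hT ≫ (hP.toModule T).inv)
    (fun f ht hT => hP.gen_strictOperad_theta f ht hT) fun {T S} hT hS f => by
      rw [← Category.assoc, ← P.gen_pull hT hS f, Category.assoc, hP.pull_toModule_inv,
        Category.assoc]

lemma generator_inclusion {T : O} (hT : 1 ≤ grade T) :
    hP.strictOperad.generator hP.inclusion hT = P.gen hT ≫ (hP.toModule T).inv := rfl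

lemma act_toModule {T S : O} (φ : Elementary T S) :
    P.act φ ≫ (hP.toModule T).inv =
      (hP.strictOperad.generator hP.inclusion φ.fiber_pos ⊗ₘ (hP.toModule S).inv) ≫
        hP.strictOperad.leftCirc φ := by
  rw [hP.strictOperad_leftCirc, hP.generator_inclusion,
    MonoidalCategory.tensorHom_comp_tensorHom_assoc, Category.assoc, Iso.inv_hom_id,
    Iso.inv_hom_id, Category.comp_id, tensorHom_id, ← Category.assoc, hP.gen_circ]

section

variable {M : ConnectedMarklOperad O V}

/-- The module morphism given by a morphism from the strictification. -/
noncomputable def toModuleHom (G : hP.strictOperad ⟶ M)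
    {y : E ⟶ (ConnectedMarklOperad.forget O V).obj M}
    (hy : hP.inclusion ≫ (ConnectedMarklOperad.forget O V).map G = y) :
    Hom P (M.module.restrict y) where
  hom T := (hP.toModule T).inv ≫ ConnectedMarklOperad.Hom.hom G T
  pull_hom {T S} f := by
    change P.pull f ≫ (hP.toModule T).inv ≫ ConnectedMarklOperad.Hom.hom G T =
      ((hP.toModule S).inv ≫ ConnectedMarklOperad.Hom.hom G S) ≫ M.pull f
    have h := ConnectedMarklOperad.Hom.pull_hom G f
    rw [← Category.assoc, hP.pull_toModule_inv, Category.assoc, Category.assoc, h]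
  act_hom {T S} φ := by
    subst hy
    change P.act φ ≫ (hP.toModule T).inv ≫ ConnectedMarklOperad.Hom.hom G T =
      (_ ◁ ((hP.toModule S).inv ≫ ConnectedMarklOperad.Hom.hom G S)) ≫
        (M.generator (hP.inclusion ≫ (ConnectedMarklOperad.forget O V).map G) φ.fiber_pos ▷ _) ≫
          M.leftCirc φ
    rw [← Category.assoc, hP.act_toModule, ConnectedMarklOperad.generator_hom, Category.assoc,
      ConnectedMarklOperad.leftCirc_hom,
      MonoidalCategory.tensorHom_comp_tensorHom_assoc, MonoidalCategory.tensorHom_def',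
      Category.assoc]
  unit_hom {t} ht := by
    change P.unit ht ≫ (hP.toModule t).inv ≫ ConnectedMarklOperad.Hom.hom G t = M.eta ht
    have h := ConnectedMarklOperad.Hom.eta_hom G ht
    rw [← Category.assoc, ← hP.eta_toModule, h]

variable (y : E ⟶ (ConnectedMarklOperad.forget O V).obj M)

/-- The components of the module morphism to an operad given by a map from the generators. -/
noncomputable def component (T : O) : P.val T ⟶ M.val T := (hP.lift (M.module.restrict y)).hom T

lemma component_pull {T S : O} (f : T ≅ S) :
    P.pull f ≫ hP.component y T = hP.component y S ≫ M.pull f :=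
  (hP.lift (M.module.restrict y)).pull_hom f

lemma gen_component {T : O} (hT : 1 ≤ grade T) :
    P.gen hT ≫ hP.component y T = M.generator y hT :=
  ((hP.lift (M.module.restrict y)).gen_hom hT).trans (M.module_gen y hT)

lemma circ_component {T S : O} (φ : Elementary T S) :
    hP.circ φ ≫ hP.component y T =
      (hP.component y φ.fiber ⊗ₘ hP.component y S) ≫ M.leftCirc φ :=
  hP.circ_comp _ (hP.component_pull y) (hP.gen_component y) (fun φ => by
    rw [MonoidalCategory.tensorHom_def', Category.assoc]
    exact (hP.lift (M.module.restrict y)).act_hom φ) φ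

lemma unit_component {t : O} (ht : IsLocalTerminal t) :
    P.unit ht ≫ hP.component y t = M.eta ht :=
  (hP.lift (M.module.restrict y)).unit_hom ht

/-- The operad morphism given by a map from the generators. -/
noncomputable def desc : hP.strictOperad ⟶ M where
  hom T := (hP.toModule T).hom ≫ hP.component y T
  pull_hom {T S} f := by
    rw [← Category.assoc, hP.pull_toModule_hom, Category.assoc, hP.component_pull,
      Category.assoc]
  circ_hom {T S} φ := by
    rw [← Category.assoc, hP.strictOperad_circ, Category.assoc, Category.assoc, hP.circ_component,
      ← MonoidalCategory.tensorHom_comp_tensorHom_assoc, M.circ_eq_leftCirc,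
      BraidedCategory.braiding_naturality_assoc, BraidedCategory.braiding_naturality_assoc,
      BraidedCategory.braiding_naturality_assoc]
  eta_hom {t} ht := by
    rw [hP.eta_toModule, Category.assoc, Iso.inv_hom_id_assoc, hP.unit_component]

lemma inclusion_desc :
    hP.inclusion ≫ (ConnectedMarklOperad.forget O V).map (hP.desc y) = y := by
  ext ⟨⟨⟨T, hT⟩⟩⟩
  have h : (P.gen hT ≫ (hP.toModule T).inv) ≫ (hP.toModule T).hom ≫ hP.component y T =
      M.generator y hT := by
    rw [Category.assoc, Iso.inv_hom_id_assoc, hP.gen_component]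
  exact h

/-- An operad morphism is recovered from the module morphism it induces on `P`, and a free module
has only one morphism to a given module. -/
lemma hom_ext_strictOperad {G G' : hP.strictOperad ⟶ M}
    (h : hP.inclusion ≫ (ConnectedMarklOperad.forget O V).map G =
      hP.inclusion ≫ (ConnectedMarklOperad.forget O V).map G') : G = G' := by
  refine ConnectedMarklOperad.Hom.ext (funext fun T => ?_)
  have k := hP.hom_eq (hP.toModuleHom G h) (hP.toModuleHom G' rfl) T
  exact (cancel_epi (hP.toModule T).inv).mp k

end

/-- The identity of the operad induces a module morphism out of `P`, and module morphisms respect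
evaluation of towers. The colimit cocone is thereby identified with the iterated circle products of
generators. -/
lemma eval_inclusion {X : O} (a : LabelledTower X) :
    a.eval hP.inclusion = a.leg P ≫ (hP.toModule X).inv := by
  have h := (hP.toModuleHom (𝟙 hP.strictOperad) (y := hP.inclusion) (by
    rw [CategoryTheory.Functor.map_id, Category.comp_id])).leg_hom a
  rw [hP.strictOperad.leg_module] at h
  exact h.symm.trans (_ ≫= Category.comp_id _)

end TowerModule.IsFree

end Universal

/-! ## The free operad -/

section FreeOperad

variable (O : Type u) [Category.{v} O] [GradedOperadicCategory O] [StandingAssumptions O]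
  (V : Type u') [Category.{v'} V] [MonoidalCategory V] [SymmetricCategory V]
  [HasColimitsOfSize.{max u v, max u v} V]
  [∀ A : V, PreservesColimitsOfSize.{max u v, max u v} (tensorLeft A)]

/-- Operad morphisms from the free operad are maps from the generators. -/
noncomputable def freeHomEquiv (E : Collection O V) (M : ConnectedMarklOperad O V) :
    ((freeModule_isFree E).strictOperad ⟶ M) ≃
      (E ⟶ (ConnectedMarklOperad.forget O V).obj M) where
  toFun G := (freeModule_isFree E).inclusion ≫ (ConnectedMarklOperad.forget O V).map G
  invFun y := (freeModule_isFree E).desc y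
  left_inv _ := (freeModule_isFree E).hom_ext_strictOperad ((freeModule_isFree E).inclusion_desc _)
  right_inv y := (freeModule_isFree E).inclusion_desc y

/-- The free operad functor. -/
noncomputable def freeOperad : Collection O V ⥤ ConnectedMarklOperad O V :=
  Adjunction.leftAdjointOfEquiv (G := ConnectedMarklOperad.forget O V) (freeHomEquiv O V)
    fun E _ _ g h => by
      change _ ≫ (ConnectedMarklOperad.forget O V).map (h ≫ g) = _
      rw [Functor.map_comp, ← Category.assoc]
      rfl

/-- The free operad functor is left adjoint to the forgetful functor. -/
noncomputable def freeOperadAdjunction : freeOperad O V ⊣ ConnectedMarklOperad.forget O V :=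
  Adjunction.adjunctionOfEquivLeft _ _

variable {O V}

lemma freeOperadAdjunction_unit (E : Collection O V) :
    (freeOperadAdjunction O V).unit.app E = (freeModule_isFree E).inclusion := by
  have h : (freeOperadAdjunction O V).unit.app E = freeHomEquiv O V E _ (𝟙 _) :=
    Adjunction.adjunctionOfEquivLeft_unit_app _ _ _
  refine h.trans ?_
  exact (_ ≫= (ConnectedMarklOperad.forget O V).map_id _).trans (Category.comp_id _)

lemma free_isColimit (E : Collection O V) {X : O} (hX : 1 ≤ grade X) :
    ∃ ι : towerDiagram E X ⟶ (Functor.const (LTw X)ᵒᵖ).obj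
        ((freeModule_isFree E).strictOperad.val X),
      (∀ a : (LTw X)ᵒᵖ, ι.app a = a.unop.as.eval (freeModule_isFree E).inclusion) ∧
        Nonempty (IsColimit (Cocone.mk _ ι)) := by
  obtain ⟨h⟩ := (freeModule_isFree E).isColimit X hX
  refine ⟨((freeModule E).cocone X).ι ≫
    (Functor.const _).map ((freeModule_isFree E).toModule X).inv, fun a => ?_, ⟨?_⟩⟩
  · exact ((freeModule_isFree E).eval_inclusion a.unop.as).symm
  · exact h.ofIsoColimit (Cocone.ext ((freeModule_isFree E).toModule X).symm fun a => rfl)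

end FreeOperad

end OpCat

/-! ### The theorem on free operads -/

theorem theorem9p8 {O : Type u} [Category.{v} O] [GradedOperadicCategory O]
    [StandingAssumptions O] {V : Type u'} [Category.{v'} V] [MonoidalCategory V]
    [SymmetricCategory V] [HasColimitsOfSize.{max u v, max u v} V]
    [∀ A : V, PreservesColimitsOfSize.{max u v, max u v} (tensorLeft A)] :
    ∃ (F : Collection O V ⥤ ConnectedMarklOperad O V)
      (adj : F ⊣ ConnectedMarklOperad.forget O V),
      ∀ E : Collection O V,
        (∀ X : O, 1 ≤ GradedOperadicCategory.grade X →
          ∃ ι : towerDiagram E X ⟶ (Functor.const (LTw X)ᵒᵖ).obj ((F.obj E).val X),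
            (∀ a : (LTw X)ᵒᵖ, ι.app a = a.unop.as.eval (adj.unit.app E)) ∧
              Nonempty (IsColimit (Cocone.mk _ ι))) ∧
        (∀ X : O, GradedOperadicCategory.grade X = 0 →
          ∃ h : 𝟙_ V = (F.obj E).val X,
            ∀ hX : IsLocalTerminal X, (F.obj E).eta hX = eqToHom h) ∧
        ∀ (M : ConnectedMarklOperad O V) (y : E ⟶ (ConnectedMarklOperad.forget O V).obj M),
          ∃! yhat : F.obj E ⟶ M,
            adj.unit.app E ≫ (ConnectedMarklOperad.forget O V).map yhat = y := by
  refine ⟨freeOperad O V, freeOperadAdjunction O V, fun E => ⟨fun X hX => ?_, fun X hX => ?_,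
    fun M y => ?_⟩⟩
  · rw [freeOperadAdjunction_unit]
    exact free_isColimit E hX
  -- In grade 0 the strictified value is by definition the unit object, and the comparison
  -- isomorphism was chosen there as the module unit, so that `eta` becomes the identity.
  · exact ⟨((freeModule E).strictVal_of_grade_eq_zero hX).symm, fun hX' =>
      (freeModule_isFree E).strictOperad_eta hX'⟩
  · rw [freeOperadAdjunction_unit]
    exact ⟨(freeModule_isFree E).desc y, (freeModule_isFree E).inclusion_desc y, fun G hG =>
      (freeModule_isFree E).hom_ext_strictOperad
        (hG.trans ((freeModule_isFree E).inclusion_desc y).symm)⟩
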